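/- Let $X$ be a (Hausdorff) complex manifold of pure dimension $2n$ and $\Pi$ a holomorphic Poisson structure on $X$ that is log-symplectic: every point lies in a holomorphic chart $(x_1,\dots,x_{2n})$ and has a set $S\subseteq\{1,\dots,2n\}$ such that $\Pi^n=u\prod_{j\in S}x_j\cdot\partial_{x_1}\wedge\dots\wedge\partial_{x_{2n}}$ with $u$ nowhere zero. So $D=[\Pi^n]$ is a reduced divisor with local normal crossings, whose local branches are $\{x_j=0\}$, $j\in S$. Let $\Omega^\bullet(\log D)$ be the log de Rham complex, and let $\Theta^\bullet(\log D)$ be the log Mahr de Poisson (MdP) complex, with terms $\Theta^j(\log D)=\Omega^{2n-j}(\log D)$ and differential $\Theta^j(\log D)\to\Theta^{j+1}(\log D)$ equal to $\delta_{n-j}$, where $$\delta_i=i\,d\,\iota_\Pi-(i-1)\,\iota_\Pi\,d\quad\text{on }\Omega^{n+i}(\log D)$$ and $\iota_\Pi$ is contraction with $\Pi$. (All terms outside degrees $0,\dots,2n$ are zero.) For $i\ge 0$ let $X_i$ be the space of pairs consisting of a point $p\in X$ and a set of $i$ distinct local branches of $D$ at $p$; it is the normalization of the $i$-fold locus of $D$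 (and $X_0=X$). Let $\nu_i:X_i\to X$ be the natural map, and let $\varepsilon_i$ be the rank-one local system on $X_i$ of orientations of these sets of branches: its sections are the locally constant $\mathbb C$-valued functions on ordered $i$-tuples of distinct branches that are multiplied by the sign of the permutation under reordering. 1. $\Theta^\bullet(\log D)$ and $\Omega^\bullet(\log D)$ are complexes. 2. There is an isomorphism of complexes of sheaves of $\mathbb C$-vector spaces $\pi:\Theta^\bullet(\log D)\to\Omega^\bullet(\log D)$ which for every $m\ge0$ is $$\iota_{\Pi^m}=\iota_\Pi^m:\ \Theta^{n-m}(\log D)=\Omega^{n+m}(\log D)\to\Omega^{n-m}(\log D)$$ in degree $n-m$, and is the inverse of $\iota_{\Pi^m}:\Omega^{n+m}(\log D)\to\Omega^{n-m}(\log D)$ in degree $n+m$, as a map $\Theta^{n+m}(\log D)=\Omega^{n-m}(\log D)\to\Omega^{n+m}(\log D)$. 3. For every $i\ge0$ the cohomology sheaf satisfies $\mathcal H^i(\Theta^\bullet(\log D))\simeq\nu_{i*}\varepsilon_i$. 4. If $D$ has simple normal crossings (there is a family of closed subsets of $X$ whose germs at each point $p$ are, for the members through $p$ and without repetition, the local branches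 of $D$ at $p$), then $\mathcal H^i(\Theta^\bullet(\log D))\simeq\nu_{i*}\mathbb C_{X_i}$ for every $i\ge0$. 5. Call $\Pi$ P-normal if every point has holomorphic coordinates $x_1,\dots,x_n,y_1,\dots,y_n$ and a set $K\subseteq\{1,\dots,n\}$ with $$\Pi=\sum_{i\in K}x_i\,\partial_{x_i}\wedge\partial_{y_i}+\sum_{i\notin K}\partial_{x_i}\wedge\partial_{y_i}.$$ If $\Pi$ is P-normal, then $\mathcal H^i(\Theta^\bullet(\log D))=0$ for all $i>n$. 6. Let $V\subseteq X$ be the domain of a coordinate system as in 5, with its set $K$ (whether or not $\Pi$ is P-normal elsewhere). Put $d_i=\mathrm{dlog}(x_i)\wedge dy_i$ for $i\in K$ and $d_i=dx_i\wedge dy_i$ for $i\notin K$. For $J\subseteq K$ let $I=\{1,\dots,n\}\setminus J$, $d_I=\bigwedge_{i\in I}d_i$ and $\mathrm{dlog}(x)_J=\bigwedge_{j\in J}\mathrm{dlog}(x_j)$ (indices increasing). Then for each $i\geq 0$ and each $J\subseteq K$ with $|J|=i$, the form $d_I\wedge\mathrm{dlog}(x)_J$ is a cocycle in $\Theta^i(\log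 D)(V)$. At every $q\in V$, the classes of these forms with $x_j(q)=0$ for all $j\in J$ form a $\mathbb C$-basis of the stalk $\mathcal H^i(\Theta^\bullet(\log D))_q$, and the classes of the other ones vanish in that stalk. -/

import Mathlib

open CategoryTheory TopologicalSpace Topology Filter Opposite
open scoped Manifold ContDiff

noncomputable section

set_option linter.unusedSectionVars false

namespace LogSymp

/-! ### Multilinear algebra on the model space -/

/-- The model space `ℂ²ⁿ`. -/
abbrev E (n : ℕ) : Type := EuclideanSpace ℂ (Fin (n + n))

/-- Complex covectors. -/
abbrev Cov (n : ℕ) : Type := E n →L[ℂ] ℂ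

/-- (Possibly inhomogeneous) exterior forms: the component of index `q` is an alternating
`q`-linear form. -/
def Ext (n : ℕ) : Type := (q : ℕ) → (E n) [⋀^Fin q]→L[ℂ] ℂ

instance (n : ℕ) : AddCommGroup (Ext n) :=
  inferInstanceAs (AddCommGroup ((q : ℕ) → (E n) [⋀^Fin q]→L[ℂ] ℂ))

instance (n : ℕ) : Module ℂ (Ext n) :=
  inferInstanceAs (Module ℂ ((q : ℕ) → (E n) [⋀^Fin q]→L[ℂ] ℂ))

@[simp] theorem Ext.add_apply {n : ℕ} (a b : Ext n) (q : ℕ) : (a + b) q = a q + b q := rfl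

@[simp] theorem Ext.smul_apply {n : ℕ} (c : ℂ) (a : Ext n) (q : ℕ) : (c • a) q = c • a q := rfl

@[simp] theorem Ext.zero_apply {n : ℕ} (q : ℕ) : (0 : Ext n) q = 0 := rfl

/-- The standard basis of `ℂ²ⁿ`. -/
def stdVec {n : ℕ} (i : Fin (n + n)) : E n := EuclideanSpace.single i 1

/-- The dual basis. -/
def stdCov {n : ℕ} (i : Fin (n + n)) : Cov n := EuclideanSpace.proj i

/-- Bivectors, as alternating bilinear forms on covectors. -/
abbrev Bivec (n : ℕ) : Type := (Cov n) [⋀^Fin 2]→ₗ[ℂ] ℂ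

/-- Interior multiplication by a bivector: if `B = ∑_{i<j} Bⁱʲ eᵢ ∧ eⱼ`, then
`ι_B w = ∑_{i<j} Bⁱʲ w(eᵢ, eⱼ, …)`. It lowers the degree by two. -/
def contract {n : ℕ} (B : Bivec n) (w : Ext n) : Ext n := fun q =>
  (1 / 2 : ℂ) • ∑ i, ∑ j, B ![stdCov i, stdCov j] •
    ((w (q + 2)).curryLeft (stdVec i)).curryLeft (stdVec j)

/-- Exterior multiplication `a ∧ w` by a covector, on the left. -/
def wedge {n : ℕ} (a : Cov n) (w : Ext n) : Ext n
  | 0 => 0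
  | q + 1 => ContinuousAlternatingMap.alternatizeUncurryFin (a.smulRight (w q))

/-- The unit of the exterior algebra. -/
def extOne {n : ℕ} : Ext n
  | 0 => ContinuousAlternatingMap.constOfIsEmpty ℂ (E n) (Fin 0) 1
  | _ + 1 => 0

/-- The product `a₁ ∧ a₂ ∧ ⋯` of a list of covectors. -/
def wedgeList {n : ℕ} (l : List (Cov n)) : Ext n := l.foldr wedge extOne

/-! ### Differential forms on a complex manifold of dimension `2n` -/

section Manifold

variable {n : ℕ} {X : Type} [TopologicalSpace X] [ChartedSpace (E n) X]

/-- The differential of a function, as a covector in the tangent space at `x`. -/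
def dF (f : X → ℂ) (x : X) : Cov n := mfderiv 𝓘(ℂ, E n) 𝓘(ℂ, ℂ) f x

/-- The derivative of a coordinate system. -/
def tan (φ : OpenPartialHomeomorph X (E n)) (x : X) : E n →L[ℂ] E n :=
  mfderiv 𝓘(ℂ, E n) 𝓘(ℂ, E n) φ x

/-- The derivative of the inverse of a coordinate system. -/
def tanSymm (φ : OpenPartialHomeomorph X (E n)) (y : E n) : E n →L[ℂ] E n :=
  mfderiv 𝓘(ℂ, E n) 𝓘(ℂ, E n) φ.symm y

/-- The coordinate functions of a coordinate system. -/
def coord (φ : OpenPartialHomeomorph X (E n)) (i : Fin (n + n)) (x : X) : ℂ := φ x i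

/-- A differential form on `X` (a set-theoretic section of the exterior algebra of the cotangent
bundle). -/
def Forms (n : ℕ) (X : Type) : Type := X → Ext n

instance : AddCommGroup (Forms n X) := inferInstanceAs (AddCommGroup (X → Ext n))

instance : Module ℂ (Forms n X) := inferInstanceAs (Module ℂ (X → Ext n))

@[simp] theorem Forms.add_apply (a b : Forms n X) (x : X) : (a + b) x = a x + b x := rfl

@[simp] theorem Forms.sub_apply (a b : Forms n X) (x : X) : (a - b) x = a x - b x := rfl

@[simp] theorem Forms.smul_apply (c : ℂ) (a : Forms n X) (x : X) : (c • a) x = c • a x := rfl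

@[simp] theorem Forms.zero_apply (x : X) : (0 : Forms n X) x = 0 := rfl

/-- The expression in coordinates `φ` of the degree `q` component of a differential form. -/
def rep (φ : OpenPartialHomeomorph X (E n)) (q : ℕ) (w : Forms n X) :
    E n → (E n) [⋀^Fin q]→L[ℂ] ℂ :=
  fun y => (w (φ.symm y) q).compContinuousLinearMap (tanSymm φ y)

/-- Exterior derivative, computed at `x` in the preferred chart at `x`. -/
def dExt (w : Forms n X) : Forms n X := fun x q =>
  match q with
  | 0 => 0
  | q + 1 => (extDeriv (rep (chartAt (E n) x) q w) (chartAt (E n) x x)).compContinuousLinearMap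
      (tan (chartAt (E n) x) x)

/-- The form is holomorphic on the open set `W`. -/
def HolOn (W : Opens X) (w : Forms n X) : Prop :=
  ∀ x ∈ W, ∀ q, DifferentiableAt ℂ (rep (chartAt (E n) x) q w) (chartAt (E n) x x)

open Classical in
/-- Extension by zero of the restriction of a form to an open set. -/
def restr (W : Opens X) : Forms n X →ₗ[ℂ] Forms n X where
  toFun w := fun x => if x ∈ W then w x else 0
  map_add' a b := by
    funext x
    change (if x ∈ W then a x + b x else 0) =
      (if x ∈ W then a x else 0) + (if x ∈ W then b x else 0)
    split_ifs
    · rfl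
    · exact (add_zero (0 : Ext n)).symm
  map_smul' c a := by
    funext x
    change (if x ∈ W then c • a x else 0) = c • (if x ∈ W then a x else 0)
    split_ifs
    · rfl
    · exact (smul_zero (A := Ext n) c).symm

theorem restr_mem {W : Opens X} (w : Forms n X) {x : X} (hx : x ∈ W) : restr W w x = w x :=
  if_pos hx

theorem restr_notMem {W : Opens X} (w : Forms n X) {x : X} (hx : x ∉ W) : restr W w x = 0 :=
  if_neg hx

variable (n X) in
/-- A holomorphic Poisson structure: a holomorphic bivector field `Π` such that
`{f, g} = ⟨Π, df ∧ dg⟩` satisfies the Jacobi identity on local holomorphic functions. -/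
structure Poisson where
  biv : X → Bivec n
  holo : ∀ (V : Opens X) (f g : X → ℂ), MDifferentiableOn 𝓘(ℂ, E n) 𝓘(ℂ, ℂ) f V →
    MDifferentiableOn 𝓘(ℂ, E n) 𝓘(ℂ, ℂ) g V →
    MDifferentiableOn 𝓘(ℂ, E n) 𝓘(ℂ, ℂ) (fun x => biv x ![dF f x, dF g x]) V
  jacobi : ∀ (V : Opens X) (f g h : X → ℂ), MDifferentiableOn 𝓘(ℂ, E n) 𝓘(ℂ, ℂ) f V →
    MDifferentiableOn 𝓘(ℂ, E n) 𝓘(ℂ, ℂ) g V → MDifferentiableOn 𝓘(ℂ, E n) 𝓘(ℂ, ℂ) h V →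
    ∀ x ∈ V, biv x ![dF f x, dF (fun y => biv y ![dF g y, dF h y]) x]
      + biv x ![dF g x, dF (fun y => biv y ![dF h y, dF f y]) x]
      + biv x ![dF h x, dF (fun y => biv y ![dF f y, dF g y]) x] = 0

variable (P : Poisson n X)

/-- Interior multiplication `ι_Π`. -/
def iota (w : Forms n X) : Forms n X := fun x => contract (P.biv x) (w x)

/-- The Mahr de Poisson differential `δ_i = i d ι_Π - (i - 1) ι_Π d`, to be applied to forms of
degree `n + i`. -/
def mdp (i : ℤ) (w : Forms n X) : Forms n X :=
  (i : ℂ) • dExt (iota P w) - ((i : ℂ) - 1) • iota P (dExt w)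

/-- The form `dx₁ ∧ ⋯ ∧ dx₂ₙ` of a coordinate system. -/
def coordVol (φ : OpenPartialHomeomorph X (E n)) : Forms n X := fun x =>
  wedgeList ((List.finRange (n + n)).map fun i => dF (coord φ i) x)

/-- The coefficient `⟨Πⁿ, dx₁ ∧ ⋯ ∧ dx₂ₙ⟩` of the section `Πⁿ` of `∧²ⁿ T_X`. -/
def topCoeff (φ : OpenPartialHomeomorph X (E n)) (x : X) : ℂ :=
  ((iota P)^[n] (coordVol φ)) x 0 ![]

/-- The complement of the degeneracy divisor `D = [Πⁿ]`: the locus where `Πⁿ ≠ 0`. (That locus is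
open since `Π` is holomorphic, so that taking the interior changes nothing.) -/
def symplLocus : Opens X :=
  ⟨interior {x | topCoeff P (chartAt (E n) x) x ≠ 0}, isOpen_interior⟩

/-- A holomorphic coordinate system adapted to `D = [Πⁿ]`: on its domain the coefficient of `Πⁿ` is
an invertible holomorphic function times the product of the coordinates `x_j`, `j ∈ S`. -/
def IsAdapted (φ : OpenPartialHomeomorph X (E n)) (S : Finset (Fin (n + n))) : Prop :=
  φ ∈ IsManifold.maximalAtlas 𝓘(ℂ, E n) ω X ∧
  ∃ u : X → ℂ, MDifferentiableOn 𝓘(ℂ, E n) 𝓘(ℂ, ℂ) u φ.source ∧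
    ∀ x ∈ φ.source, u x ≠ 0 ∧ topCoeff P φ x = u x * ∏ j ∈ S, coord φ j x

/-- `Π` is log-symplectic: its degeneracy divisor `[Πⁿ]` has local normal crossings. -/
def IsLogSymplectic : Prop :=
  ∀ p : X, ∃ φ S, p ∈ φ.source ∧ IsAdapted P φ S

/-! ### Linearity and locality of the operators -/

theorem sum_dual_basis {n : ℕ} {M : Type*} [AddCommGroup M] [Module ℂ M]
    (f : Cov n →ₗ[ℂ] E n →ₗ[ℂ] M) (A A' : E n →L[ℂ] E n) (h : ∀ v, A (A' v) = v) :
    ∑ i, f ((stdCov i).comp A') (A (stdVec i)) = ∑ i, f (stdCov i) (stdVec i) := by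
  have hv : ∀ v : E n, v = ∑ i, (stdCov i v) • stdVec i := by
    intro v
    ext k
    simp [stdCov, stdVec, Finset.sum_apply, Pi.single_apply]
  have hc : ∀ i, (stdCov i).comp A' = ∑ k, (stdCov i (A' (stdVec k))) • stdCov (n := n) k := by
    intro i
    ext v
    conv_lhs => rw [hv v]
    simp [map_sum, mul_comm]
  calc ∑ i, f ((stdCov i).comp A') (A (stdVec i))
      = ∑ i, ∑ k, f (stdCov k) (A ((stdCov i (A' (stdVec k))) • stdVec i)) := by
        refine Finset.sum_congr rfl fun i _ => ?_
        rw [hc i]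
        simp
    _ = ∑ k, f (stdCov k) (A (∑ i, (stdCov i (A' (stdVec k))) • stdVec i)) := by
        rw [Finset.sum_comm]
        simp
    _ = ∑ i, f (stdCov i) (stdVec i) := by
        refine Finset.sum_congr rfl fun k _ => ?_
        rw [← hv, h]

theorem contract_comp {n : ℕ} (B : Bivec n) (w : Ext n) (q : ℕ) (A A' : E n →L[ℂ] E n)
    (h : ∀ v, A (A' v) = v) :
    (contract B w q).compContinuousLinearMap A = (1 / 2 : ℂ) • ∑ i, ∑ j,
      B ![(stdCov i).comp A', (stdCov j).comp A'] •
        ((((w (q + 2)).compContinuousLinearMap A).curryLeft (stdVec i)).curryLeft (stdVec j)) := by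
  ext v
  have key : ∀ (f : Cov n →ₗ[ℂ] Cov n →ₗ[ℂ] ℂ) (g : E n →ₗ[ℂ] E n →ₗ[ℂ] ℂ),
      ∑ i, ∑ j, f (stdCov i) (stdCov j) * g (stdVec i) (stdVec j) =
        ∑ i, ∑ j, f ((stdCov i).comp A') ((stdCov j).comp A') *
          g (A (stdVec i)) (A (stdVec j)) := by
    intro f g
    have h1 : ∀ (a : Cov n) (e : E n), ∑ j, f a (stdCov j) * g e (stdVec j) =
        ∑ j, f a ((stdCov j).comp A') * g e (A (stdVec j)) := by
      intro a e
      have := sum_dual_basis (LinearMap.mk₂ ℂ (fun b e' => f a b * g e e')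
        (by intros; simp [add_mul]) (by intros; simp [mul_assoc])
        (by intros; simp [mul_add]) (by intros; simp [mul_left_comm])) A A' h
      simpa using this.symm
    have h2 := sum_dual_basis (LinearMap.mk₂ ℂ
      (fun a e => ∑ j, f a ((stdCov j).comp A') * g e (A (stdVec j)))
        (by intros; simp [add_mul, Finset.sum_add_distrib])
        (by intros; simp [mul_assoc, Finset.mul_sum])
        (by intros; simp [mul_add, Finset.sum_add_distrib])
        (by intros; simp [mul_left_comm, Finset.mul_sum])) A A' h
    simp only [LinearMap.mk₂_apply] at h2
    rw [h2]
    exact Finset.sum_congr rfl fun i _ => h1 _ _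
  have u0 : ∀ a b c : Cov n, Function.update ![a, b] 0 c = ![c, b] := fun a b c => by
    funext t
    fin_cases t <;> rfl
  have u1 : ∀ a b c : Cov n, Function.update ![a, b] 1 c = ![a, c] := fun a b c => by
    funext t
    fin_cases t <;> rfl
  let f : Cov n →ₗ[ℂ] Cov n →ₗ[ℂ] ℂ := LinearMap.mk₂ ℂ (fun a b => B ![a, b])
    (fun a a' b => by simpa only [u0] using B.map_update_add ![a, b] 0 a a')
    (fun c a b => by simpa only [u0] using B.map_update_smul ![a, b] 0 c a)
    (fun a b b' => by simpa only [u1] using B.map_update_add ![a, b] 1 b b')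
    (fun c a b => by simpa only [u1] using B.map_update_smul ![a, b] 1 c b)
  let g : E n →ₗ[ℂ] E n →ₗ[ℂ] ℂ := LinearMap.mk₂ ℂ
    (fun a b => (((w (q + 2)).curryLeft a).curryLeft b) (A ∘ v))
    (by intros; simp) (by intros; simp) (by intros; simp) (by intros; simp)
  have hk := key f g
  simp only [f, g, LinearMap.mk₂_apply] at hk
  have hcomp : ∀ a b : E n, (((w (q + 2)).compContinuousLinearMap A).curryLeft a).curryLeft b v =
      (((w (q + 2)).curryLeft (A a)).curryLeft (A b)) (A ∘ v) := by
    intro a b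
    simp only [ContinuousAlternatingMap.curryLeft_apply_apply,
      ContinuousAlternatingMap.compContinuousLinearMap_apply]
    congr 1
    funext t
    refine Fin.cases rfl (fun t => ?_) t
    refine Fin.cases rfl (fun t => ?_) t
    rfl
  simp only [contract, ContinuousAlternatingMap.compContinuousLinearMap_apply,
    ContinuousAlternatingMap.smul_apply, ContinuousAlternatingMap.sum_apply, smul_eq_mul, hcomp]
  congr 1

theorem contract_add {n : ℕ} (B : Bivec n) (w w' : Ext n) :
    contract B (w + w') = contract B w + contract B w' := by
  funext q
  simp [contract, Finset.sum_add_distrib, smul_add]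

theorem contract_smul {n : ℕ} (B : Bivec n) (c : ℂ) (w : Ext n) :
    contract B (c • w) = c • contract B w := by
  funext q
  simp [contract, Finset.smul_sum, smul_comm c]

theorem iota_add (w w' : Forms n X) : iota P (w + w') = iota P w + iota P w' :=
  funext fun _ => contract_add _ _ _

theorem iota_smul (c : ℂ) (w : Forms n X) : iota P (c • w) = c • iota P w :=
  funext fun _ => contract_smul _ _ _

theorem rep_add (φ : OpenPartialHomeomorph X (E n)) (q : ℕ) (w w' : Forms n X) :
    rep φ q (w + w') = rep φ q w + rep φ q w' := rfl

theorem rep_smul (φ : OpenPartialHomeomorph X (E n)) (q : ℕ) (c : ℂ) (w : Forms n X) :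
    rep φ q (c • w) = c • rep φ q w := rfl

theorem HolOn.add {W : Opens X} {w w' : Forms n X} (h : HolOn W w) (h' : HolOn W w') :
    HolOn W (w + w') := fun x hx q => by
  rw [rep_add]; exact (h x hx q).add (h' x hx q)

theorem HolOn.smul {W : Opens X} {w : Forms n X} (c : ℂ) (h : HolOn W w) :
    HolOn W (c • w) := fun x hx q => by
  rw [rep_smul]; exact (h x hx q).const_smul c

theorem rep_congr {W : Opens X} {w w' : Forms n X} (h : ∀ x ∈ W, w x = w' x) {x : X} (hx : x ∈ W)
    (q : ℕ) : rep (chartAt (E n) x) q w =ᶠ[𝓝 (chartAt (E n) x x)] rep (chartAt (E n) x) q w' := by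
  have hc : ContinuousAt (chartAt (E n) x).symm (chartAt (E n) x x) :=
    (chartAt (E n) x).continuousAt_symm (mem_chart_target _ x)
  have : ∀ᶠ y in 𝓝 (chartAt (E n) x x), (chartAt (E n) x).symm y ∈ W := by
    refine hc.eventually (W.isOpen.mem_nhds ?_)
    simpa using hx
  filter_upwards [this] with y hy
  simp only [rep, h _ hy]

theorem HolOn.congr {W : Opens X} {w w' : Forms n X} (h : ∀ x ∈ W, w x = w' x) (hw : HolOn W w) :
    HolOn W w' := fun x hx q =>
  (hw x hx q).congr_of_eventuallyEq (rep_congr h hx q).symm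

theorem dExt_congr {W : Opens X} {w w' : Forms n X} (h : ∀ x ∈ W, w x = w' x) {x : X}
    (hx : x ∈ W) : dExt w x = dExt w' x := by
  funext q
  cases q with
  | zero => rfl
  | succ q => simp only [dExt, (rep_congr h hx q).extDeriv_eq]

theorem dExt_add {W : Opens X} {w w' : Forms n X} (hw : HolOn W w) (hw' : HolOn W w') {x : X}
    (hx : x ∈ W) : dExt (w + w') x = dExt w x + dExt w' x := by
  funext q
  cases q with
  | zero => simp [dExt]
  | succ q =>
    simp only [dExt, rep_add, extDeriv_add (hw x hx q) (hw' x hx q)]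
    rfl

theorem dExt_smul (c : ℂ) (w : Forms n X) : dExt (c • w) = c • dExt w := by
  funext x q
  cases q with
  | zero => exact (smul_zero (A := (E n) [⋀^Fin 0]→L[ℂ] ℂ) c).symm
  | succ q =>
    simp only [dExt, rep_smul, Forms.smul_apply, extDeriv_smul]
    rfl

theorem mdp_congr {W : Opens X} {w w' : Forms n X} (h : ∀ x ∈ W, w x = w' x) (i : ℤ) {x : X}
    (hx : x ∈ W) : mdp P i w x = mdp P i w' x := by
  have h1 : ∀ x ∈ W, iota P w x = iota P w' x := fun x hx => by simp only [iota, h x hx]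
  have h2 : iota P (dExt w) x = iota P (dExt w') x := by simp only [iota, dExt_congr h hx]
  simp only [mdp, Forms.sub_apply, Forms.smul_apply, dExt_congr h1 hx, h2]

theorem mdp_smul (i : ℤ) (c : ℂ) (w : Forms n X) : mdp P i (c • w) = c • mdp P i w := by
  simp only [mdp, iota_smul, dExt_smul]
  module

variable [IsManifold 𝓘(ℂ, E n) ω X]

theorem HolOn.iota {W : Opens X} {w : Forms n X} (hw : HolOn W w) : HolOn W (iota P w) := by
  intro x hx q
  set φ := chartAt (E n) x with hφ
  have : IsManifold 𝓘(ℂ, E n) 1 X := IsManifold.of_le (n := ω) le_top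
  have hmd : φ.MDifferentiable 𝓘(ℂ, E n) 𝓘(ℂ, E n) := mdifferentiable_chart x
  set c : Fin (n + n) → Fin (n + n) → X → ℂ :=
    fun i j z => P.biv z ![dF (coord φ i) z, dF (coord φ j) z] with hc
  have hcoord : ∀ i, MDifferentiableOn 𝓘(ℂ, E n) 𝓘(ℂ, ℂ) (coord φ i) φ.source := fun i z hz =>
    (((EuclideanSpace.proj i : E n →L[ℂ] ℂ).mdifferentiableAt).comp z
      (hmd.mdifferentiableAt hz)).mdifferentiableWithinAt
  have hdF : ∀ i, ∀ z ∈ φ.source, dF (coord φ i) z = (stdCov i).comp (tan φ z) := by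
    intro i z hz
    have := mfderiv_comp z ((EuclideanSpace.proj i : E n →L[ℂ] ℂ).mdifferentiableAt)
      (hmd.mdifferentiableAt hz)
    rw [ContinuousLinearMap.mfderiv_eq] at this
    exact this
  have hcd : ∀ i j, DifferentiableAt ℂ (fun y => c i j (φ.symm y)) (φ x) := by
    intro i j
    have h1 := P.holo ⟨φ.source, φ.open_source⟩ _ _ (hcoord i) (hcoord j)
    have h2 : MDifferentiableAt 𝓘(ℂ, E n) 𝓘(ℂ, ℂ) (c i j) (φ.symm (φ x)) :=
      (h1 _ (by simp [hφ])).mdifferentiableAt (φ.open_source.mem_nhds (by simp [hφ]))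
    exact mdifferentiableAt_iff_differentiableAt.1
      (h2.comp (φ x) (hmd.mdifferentiableAt_symm (mem_chart_target _ x)))
  have hev : rep φ q (LogSymp.iota P w) =ᶠ[𝓝 (φ x)] fun y => (1 / 2 : ℂ) • ∑ i, ∑ j,
      c i j (φ.symm y) • (((rep φ (q + 2) w y).curryLeft (stdVec i)).curryLeft (stdVec j)) := by
    filter_upwards [φ.open_target.mem_nhds (mem_chart_target _ x)] with y hy
    have hA : ∀ v, tanSymm φ y (tan φ (φ.symm y) v) = v := by
      intro v
      have := hmd.symm_comp_deriv (φ.map_target hy)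
      rw [φ.right_inv hy] at this
      exact DFunLike.congr_fun this v
    have := contract_comp (P.biv (φ.symm y)) (w (φ.symm y)) q (tanSymm φ y) (tan φ (φ.symm y)) hA
    simp only [hc, hdF _ _ (φ.map_target hy)]
    exact this
  refine DifferentiableAt.congr_of_eventuallyEq ?_ hev
  refine DifferentiableAt.fun_const_smul ?_ _
  refine DifferentiableAt.fun_sum fun i _ => DifferentiableAt.fun_sum fun j _ => ?_
  refine (hcd i j).smul ?_
  have hcur : ∀ (k : ℕ) (F : E n → (E n) [⋀^Fin (k + 1)]→L[ℂ] ℂ) (e y : E n),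
      DifferentiableAt ℂ F y → DifferentiableAt ℂ (fun y => (F y).curryLeft e) y :=
    fun k F e y hF =>
      ((ContinuousLinearMap.apply ℂ ((E n) [⋀^Fin k]→L[ℂ] ℂ) e).comp
        (ContinuousAlternatingMap.curryLeftLI (𝕜 := ℂ) (E := E n) (F := ℂ)
          (n := k)).toContinuousLinearMap).differentiableAt.comp y hF
  exact hcur _ _ _ _ (hcur _ _ _ _ (hw x hx (q + 2)))

theorem mdp_add {W : Opens X} {w w' : Forms n X} (hw : HolOn W w) (hw' : HolOn W w') (i : ℤ) {x : X}
    (hx : x ∈ W) : mdp P i (w + w') x = mdp P i w x + mdp P i w' x := by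
  have h1 := dExt_add (hw.iota P) (hw'.iota P) hx
  have h2 : LogSymp.iota P (dExt (w + w')) x
      = LogSymp.iota P (dExt w) x + LogSymp.iota P (dExt w') x := by
    simp only [LogSymp.iota, dExt_add hw hw' hx, contract_add]
  simp only [mdp, iota_add, Forms.sub_apply, Forms.smul_apply, h1, h2]
  module

/-! ### Logarithmic forms -/

/-- The local frame `x_j ∂_j` (`j ∈ S`), `∂_j` (`j ∉ S`) of the logarithmic tangent sheaf. -/
def logVec (φ : OpenPartialHomeomorph X (E n)) (S : Finset (Fin (n + n))) (j : Fin (n + n))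
    (x : X) : E n :=
  (if j ∈ S then coord φ j x else 1) • tanSymm φ (φ x) (stdVec j)

/-- The germ at `p` of the form `w`, holomorphic off `D`, is a logarithmic form: in adapted
coordinates, its coefficients with respect to the wedge products of `dx_j / x_j` (`j ∈ S`) and
`dx_j` (`j ∉ S`) extend to holomorphic functions near `p`. -/
def IsLogAt (w : Forms n X) (p : X) : Prop :=
  ∀ φ S, p ∈ φ.source → IsAdapted P φ S → ∀ (q : ℕ) (K : Fin q → Fin (n + n)),
    ∃ g : X → ℂ, (∀ᶠ x in 𝓝 p, MDifferentiableAt 𝓘(ℂ, E n) 𝓘(ℂ, ℂ) g x) ∧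
      ∀ᶠ x in 𝓝 p, x ∈ symplLocus P → w x q (fun a => logVec φ S (K a) x) = g x

theorem IsLogAt.congr {w w' : Forms n X} {p : X}
    (h : ∀ᶠ x in 𝓝 p, x ∈ symplLocus P → w x = w' x) (hw : IsLogAt P w p) : IsLogAt P w' p := by
  intro φ S hp hS q K
  obtain ⟨g, hg, hg'⟩ := hw φ S hp hS q K
  refine ⟨g, hg, ?_⟩
  filter_upwards [h, hg'] with x h1 h2 hx
  rw [← h1 hx, h2 hx]

/-- The sections over `V` of `Ω^r(log D)`, for `r : ℤ` (zero for `r < 0`). Such a section is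
a meromorphic form; it is represented by its restriction to `V ∖ D`, extended by zero. -/
def logForms (V : Opens X) (r : ℤ) : Submodule ℂ (Forms n X) where
  carrier := {w | (∀ x, ∀ q : ℕ, (q : ℤ) ≠ r → w x q = 0) ∧
    (∀ x, x ∉ V ⊓ symplLocus P → w x = 0) ∧
    HolOn (V ⊓ symplLocus P) w ∧ ∀ p ∈ V, IsLogAt P w p}
  zero_mem' := by
    refine ⟨fun _ _ _ => rfl, fun _ _ => rfl, fun x _ q => ?_, fun p _ φ S _ _ q K => ?_⟩
    · exact differentiableAt_const (0 : (E n) [⋀^Fin q]→L[ℂ] ℂ)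
    · exact ⟨fun _ => 0, Eventually.of_forall fun _ => mdifferentiableAt_const,
        Eventually.of_forall fun _ _ => rfl⟩
  add_mem' := by
    rintro a b ⟨a1, a2, a3, a4⟩ ⟨b1, b2, b3, b4⟩
    refine ⟨fun x q h => ?_, fun x h => ?_, a3.add b3, fun p hp φ S hs hS q K => ?_⟩
    · simp [a1 x q h, b1 x q h]
    · simp [a2 x h, b2 x h]
    · obtain ⟨g, hg, hg'⟩ := a4 p hp φ S hs hS q K
      obtain ⟨f, hf, hf'⟩ := b4 p hp φ S hs hS q K
      refine ⟨fun x => g x + f x, ?_, ?_⟩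
      · filter_upwards [hg, hf] with x h1 h2 using h1.add h2
      · filter_upwards [hg', hf'] with x h1 h2 hx
        rw [← h1 hx, ← h2 hx]
        rfl
  smul_mem' := by
    rintro c a ⟨a1, a2, a3, a4⟩
    refine ⟨fun x q h => ?_, fun x h => ?_, a3.smul c, fun p hp φ S hs hS q K => ?_⟩
    · simp only [Forms.smul_apply, Ext.smul_apply, a1 x q h]
      exact smul_zero (A := (E n) [⋀^Fin q]→L[ℂ] ℂ) c
    · simp only [Forms.smul_apply, a2 x h]
      exact smul_zero (A := Ext n) c
    · obtain ⟨g, hg, hg'⟩ := a4 p hp φ S hs hS q K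
      refine ⟨fun x => c * g x, ?_, ?_⟩
      · filter_upwards [hg] with x h1 using mdifferentiableAt_const.mul h1
      · filter_upwards [hg'] with x h1 hx
        rw [← h1 hx]
        rfl

theorem restr_mem_logForms {V V' : Opens X} (h : V' ≤ V) {r : ℤ} {w : Forms n X}
    (hw : w ∈ logForms P V r) : restr (V' ⊓ symplLocus P) w ∈ logForms P V' r := by
  obtain ⟨h1, h2, h3, h4⟩ := hw
  refine ⟨fun x q hq => ?_, fun x hx => restr_notMem w hx, ?_, fun p hp => ?_⟩
  · by_cases hx : x ∈ V' ⊓ symplLocus P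
    · rw [restr_mem w hx, h1 x q hq]
    · rw [restr_notMem w hx]; rfl
  · refine HolOn.congr (fun x hx => (restr_mem w hx).symm) ?_
    exact fun x hx q => h3 x ⟨h hx.1, hx.2⟩ q
  · refine IsLogAt.congr P ?_ (h4 p (h hp))
    filter_upwards [V'.isOpen.mem_nhds hp] with x hx hx'
    exact (restr_mem (W := V' ⊓ symplLocus P) w ⟨hx, hx'⟩).symm

/-- Restriction of logarithmic forms. -/
def resLog {V V' : Opens X} (h : V' ≤ V) (r : ℤ) : logForms P V r →ₗ[ℂ] logForms P V' r :=
  (restr (V' ⊓ symplLocus P)).restrict fun _ hw => restr_mem_logForms P h hw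

/-- The term `Θ^j(log D) = Ω^{2n-j}(log D)` of the log MdP complex. -/
abbrev Theta (V : Opens X) (j : ℤ) : Submodule ℂ (Forms n X) := logForms P V (2 * n - j)

/-- The exterior derivative on forms on `V ∖ D`. -/
def deRhamOn (V : Opens X) (w : Forms n X) : Forms n X := restr (V ⊓ symplLocus P) (dExt w)

/-- The differential `Θ^j(log D) → Θ^{j+1}(log D)`, i.e. `δ_{n-j}`, on forms on `V ∖ D`. -/
def mdpOn (V : Opens X) (j : ℤ) (w : Forms n X) : Forms n X :=
  restr (V ⊓ symplLocus P) (mdp P (n - j) w)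

/-- The differential of the log MdP complex on sections over `V`. -/
def delta (V : Opens X) (j : ℤ) : Theta P V j →ₗ[ℂ] Forms n X where
  toFun w := mdpOn P V j w
  map_add' a b := by
    funext x
    by_cases hx : x ∈ V ⊓ symplLocus P
    · simp only [mdpOn, Forms.add_apply, restr_mem _ hx]
      exact mdp_add P a.2.2.2.1 b.2.2.2.1 _ hx
    · simp [mdpOn, restr_notMem _ hx]
  map_smul' c a := by
    simp only [mdpOn, Submodule.coe_smul, mdp_smul, map_smul, RingHom.id_apply]

theorem delta_res {V V' : Opens X} (h : V' ≤ V) (j : ℤ) (w : Theta P V j) :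
    delta P V' j (resLog P h _ w) = restr (V' ⊓ symplLocus P) (delta P V j w) := by
  funext x
  by_cases hx : x ∈ V' ⊓ symplLocus P
  · have hx' : x ∈ V ⊓ symplLocus P := ⟨h hx.1, hx.2⟩
    simp only [delta, LinearMap.coe_mk, AddHom.coe_mk, mdpOn, restr_mem _ hx, restr_mem _ hx']
    exact mdp_congr P (fun y hy => restr_mem _ hy) _ hx
  · simp [delta, mdpOn, restr_notMem _ hx]

/-! ### The cohomology sheaves of the log MdP complex -/

/-- Cocycles of `Θ^•(log D)` over `V`. -/
def cocycles (V : Opens X) (j : ℤ) : Submodule ℂ (Theta P V j) := LinearMap.ker (delta P V j)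

/-- Coboundaries of `Θ^•(log D)` over `V`, as a subspace of the cocycles. -/
def coboundaries (V : Opens X) (j : ℤ) : Submodule ℂ (cocycles P V j) :=
  (LinearMap.range (delta P V (j - 1))).comap
    ((Theta P V j).subtype ∘ₗ (cocycles P V j).subtype)

/-- Restriction of cocycles. -/
def resCocycles {V V' : Opens X} (h : V' ≤ V) (j : ℤ) : cocycles P V j →ₗ[ℂ] cocycles P V' j :=
  (resLog P h _).restrict fun w hw => by
    have : delta P V j w = 0 := hw
    change delta P V' j (resLog P h _ w) = 0
    rw [delta_res, this, map_zero]

theorem resCocycles_coe {V V' : Opens X} (h : V' ≤ V) (j : ℤ) (w : cocycles P V j) :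
    ((resCocycles P h j w : Theta P V' j) : Forms n X) = restr (V' ⊓ symplLocus P) w.1.1 := rfl

theorem coboundaries_le {V V' : Opens X} (h : V' ≤ V) (j : ℤ) :
    coboundaries P V j ≤ (coboundaries P V' j).comap (resCocycles P h j) := by
  rintro w ⟨v, hv⟩
  exact ⟨resLog P h _ v, by rw [delta_res, hv]; rfl⟩

/-- The presheaf `V ↦ H^j(Θ^•(log D)(V))`. -/
def cohPresheaf (j : ℤ) : TopCat.Presheaf (ModuleCat.{0} ℂ) (TopCat.of X) where
  obj V := ModuleCat.of ℂ (cocycles P V.unop j ⧸ coboundaries P V.unop j)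
  map {V V'} f := ModuleCat.ofHom
    (Submodule.mapQ _ _ (resCocycles P f.unop.le j) (coboundaries_le P f.unop.le j))
  map_id V := by
    ext w
    refine congrArg (Submodule.Quotient.mk (p := coboundaries P V.unop j)) ?_
    apply Subtype.ext
    apply Subtype.ext
    rw [resCocycles_coe]
    funext x
    by_cases hx : x ∈ V.unop ⊓ symplLocus P
    · exact restr_mem _ hx
    · rw [restr_notMem _ hx]
      exact (w.1.2.2.1 x hx).symm
  map_comp {V V' V''} f g := by
    ext w
    refine congrArg (Submodule.Quotient.mk (p := coboundaries P V''.unop j)) ?_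
    apply Subtype.ext
    apply Subtype.ext
    rw [resCocycles_coe, resCocycles_coe, resCocycles_coe]
    funext x
    by_cases hx : x ∈ V''.unop ⊓ symplLocus P
    · have hx' : x ∈ V'.unop ⊓ symplLocus P := ⟨g.unop.le hx.1, hx.2⟩
      rw [restr_mem _ hx, restr_mem _ hx, restr_mem _ hx']
    · rw [restr_notMem _ hx, restr_notMem _ hx]

/-- The cohomology sheaf `ℋ^j(Θ^•(log D))`. -/
def cohSheaf (j : ℤ) : TopCat.Sheaf (ModuleCat.{0} ℂ) (TopCat.of X) :=
  (presheafToSheaf (Opens.grothendieckTopology (TopCat.of X)) (ModuleCat.{0} ℂ)).obj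
    (cohPresheaf P j)

/-- The section over `V` of `ℋ^j(Θ^•(log D))` defined by a cocycle. -/
def cohClass (V : Opens X) (j : ℤ) (w : cocycles P V j) :
    (cohSheaf P j).presheaf.obj (op V) :=
  ((toSheafify (Opens.grothendieckTopology (TopCat.of X)) (cohPresheaf P j)).app (op V)).hom
    (Submodule.Quotient.mk w)

/-- Its germ at a point `x` of `V`. -/
def cohGerm (V : Opens X) (x : X) (hx : x ∈ V) (j : ℤ) (w : cocycles P V j) :
    (cohSheaf P j).presheaf.stalk x :=
  ((cohSheaf P j).presheaf.germ V x hx).hom (cohClass P V j w)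

/-! ### The multiplicity loci `X_i` and the sheaves `ν_{i*} ℂ` -/

/-- The local branches of `D` at `p`: germs at `p` of the hypersurfaces `x_j = 0`, `j ∈ S`, through
`p`, in adapted coordinates at `p`. -/
def IsBranch (p : X) (b : Germ (𝓝 p) Prop) : Prop :=
  ∃ φ S, p ∈ φ.source ∧ IsAdapted P φ S ∧ ∃ j ∈ S, coord φ j p = 0 ∧
    b = ((fun x => coord φ j x = 0 : X → Prop) : Germ (𝓝 p) Prop)

/-- Points of `X` together with an ordered `i`-tuple of distinct local branches of `D`. -/
def OrdLocus (i : ℕ) : Type :=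
  {z : Σ p : X, (Fin i → Germ (𝓝 p) Prop) //
    Function.Injective z.2 ∧ ∀ a, IsBranch P z.1 (z.2 a)}

/-- The underlying point of `X`. -/
def OrdLocus.pt {i : ℕ} (z : OrdLocus P i) : X := z.1.1

/-- Reordering the branches. -/
def OrdLocus.perm {i : ℕ} (s : Equiv.Perm (Fin i)) (z : OrdLocus P i) : OrdLocus P i :=
  ⟨⟨z.1.1, z.1.2 ∘ s⟩, z.2.1.comp s.injective, fun a => z.2.2 (s a)⟩

/-- The lift to `OrdLocus` of the stratum `x_{J 1} = ⋯ = x_{J i} = 0` of a coordinate domain. -/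
def plaque {i : ℕ} (φ : OpenPartialHomeomorph X (E n)) (J : Fin i → Fin (n + n)) :
    Set (OrdLocus P i) :=
  {z | z.1.1 ∈ φ.source ∧ ∀ a, coord φ (J a) z.1.1 = 0 ∧
    z.1.2 a = ((fun x => coord φ (J a) x = 0 : X → Prop) : Germ (𝓝 z.1.1) Prop)}

/-- The coarsest topology for which the map to `X` is continuous and the lifts of the strata of
adapted coordinate systems are open. These lifts are thus homeomorphic to the strata. -/
instance (i : ℕ) : TopologicalSpace (OrdLocus P i) :=
  TopologicalSpace.induced (OrdLocus.pt P) inferInstance ⊓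
    TopologicalSpace.generateFrom
      {A | ∃ φ S, IsAdapted P φ S ∧ ∃ J : Fin i → Fin (n + n), (∀ a, J a ∈ S) ∧ A = plaque P φ J}

theorem OrdLocus.continuous_pt (i : ℕ) : Continuous (OrdLocus.pt P (i := i)) :=
  continuous_iff_le_induced.2 inf_le_left

/-- Two tuples of branches differ by a reordering. -/
instance OrdLocus.setoid (i : ℕ) : Setoid (OrdLocus P i) where
  r z z' := ∃ s, z' = OrdLocus.perm P s z
  iseqv :=
    { refl := fun _ => ⟨1, rfl⟩
      symm := by
        rintro z _ ⟨s, rfl⟩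
        refine ⟨s⁻¹, Subtype.ext (Sigma.ext rfl (heq_of_eq ?_))⟩
        funext a
        simp [OrdLocus.perm]
      trans := by
        rintro z _ _ ⟨s, rfl⟩ ⟨t, rfl⟩
        exact ⟨s * t, rfl⟩ }

/-- The normalization `X_i` of the `i`-fold locus of `D`: points of `X` together with a set of
`i` distinct local branches of `D`. (`X_0 = X`.) -/
def MultLocus (i : ℕ) : Type := Quotient (OrdLocus.setoid P i)

instance (i : ℕ) : TopologicalSpace (MultLocus P i) :=
  inferInstanceAs (TopologicalSpace (Quotient (OrdLocus.setoid P i)))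

/-- The map `ν_i : X_i → X`. -/
def nu (i : ℕ) : MultLocus P i → X :=
  Quotient.lift (OrdLocus.pt P) (by rintro z _ ⟨s, rfl⟩; rfl)

theorem continuous_nu (i : ℕ) : Continuous (nu P i) :=
  Continuous.quotient_lift (OrdLocus.continuous_pt P i) _

/-- The inclusion `f⁻¹ V' → f⁻¹ V`. -/
def preimageIncl {Y : Type} [TopologicalSpace Y] (f : Y → X) {V V' : Opens X} (h : V' ≤ V) :
    C(f ⁻¹' (V' : Set X), f ⁻¹' (V : Set X)) :=
  ⟨Set.inclusion (Set.preimage_mono h), continuous_inclusion (Set.preimage_mono h)⟩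

/-- The sheaf `ν_{i*} ℂ_{X_i}`: its sections over `V` are the locally constant functions on
`ν_i⁻¹ V`. -/
def nuConst (i : ℕ) : TopCat.Presheaf (ModuleCat.{0} ℂ) (TopCat.of X) where
  obj V := ModuleCat.of ℂ (LocallyConstant (nu P i ⁻¹' (V.unop : Set X)) ℂ)
  map f := ModuleCat.ofHom (LocallyConstant.comapₗ ℂ (preimageIncl (nu P i) f.unop.le))

/-- Locally constant functions on ordered `i`-tuples of branches over `V` that change by the
sign under reorderings. -/
def altConst (i : ℕ) (V : Opens X) :
    Submodule ℂ (LocallyConstant (OrdLocus.pt P (i := i) ⁻¹' (V : Set X)) ℂ) where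
  carrier := {f | ∀ (s : Equiv.Perm (Fin i)) (z : OrdLocus P i) (hz : OrdLocus.pt P z ∈ V),
    f ⟨OrdLocus.perm P s z, hz⟩ = ((Equiv.Perm.sign s : ℤ) : ℂ) * f ⟨z, hz⟩}
  zero_mem' := fun s z hz => by simp
  add_mem' := fun {f g} hf hg s z hz => by
    simp only [LocallyConstant.coe_add, Pi.add_apply, hf s z hz, hg s z hz, mul_add]
  smul_mem' := fun c f hf s z hz => by
    simp only [LocallyConstant.coe_smul, Pi.smul_apply, smul_eq_mul, hf s z hz, mul_left_comm]

/-- The sheaf `ν_{i*} ε_i`, where `ε_i` is the rank one local system of orientations of the sets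
of `i` branches on `X_i` (the twist of `ℂ_{X_i}` by the sign character of the monodromy of
the branches). -/
def nuOrient (i : ℕ) : TopCat.Presheaf (ModuleCat.{0} ℂ) (TopCat.of X) where
  obj V := ModuleCat.of ℂ (altConst P i V.unop)
  map f := ModuleCat.ofHom
    ((LocallyConstant.comapₗ ℂ (preimageIncl (OrdLocus.pt P (i := i)) f.unop.le)).restrict
      fun _ hg s z hz => hg s z (f.unop.le hz))

/-- `D` has simple normal crossings: there is a family of closed subsets of `X` (the components
of `D`) such that at each point the germs of those through the point are, without repetition,
the local branches of `D`. -/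
def IsSimpleNC : Prop :=
  ∃ C : Set (Set X), (∀ Z ∈ C, IsClosed Z) ∧ ∀ p : X,
    Set.BijOn (fun Z : Set X => ((fun x => x ∈ Z : X → Prop) : Germ (𝓝 p) Prop))
      {Z | Z ∈ C ∧ p ∈ Z} {b | IsBranch P p b}

/-! ### P-normal structures -/

/-- The coordinate `x_i`, `i < n`, among `x_1, …, x_n, y_1, …, y_n`. -/
def xIdx (i : Fin n) : Fin (n + n) := Fin.castAdd n i

/-- The coordinate `y_i`, `i < n`, among `x_1, …, x_n, y_1, …, y_n`. -/
def yIdx (i : Fin n) : Fin (n + n) := Fin.natAdd n i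

/-- Normal coordinates:
`Π = ∑_{i ∈ K} x_i ∂_{x_i} ∧ ∂_{y_i} + ∑_{i ∉ K} ∂_{x_i} ∧ ∂_{y_i}`. -/
def IsNormal (φ : OpenPartialHomeomorph X (E n)) (K : Finset (Fin n)) : Prop :=
  φ ∈ IsManifold.maximalAtlas 𝓘(ℂ, E n) ω X ∧ ∀ x ∈ φ.source, ∀ i j : Fin n,
    P.biv x ![dF (coord φ (xIdx i)) x, dF (coord φ (xIdx j)) x] = 0 ∧
    P.biv x ![dF (coord φ (yIdx i)) x, dF (coord φ (yIdx j)) x] = 0 ∧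
    P.biv x ![dF (coord φ (xIdx i)) x, dF (coord φ (yIdx j)) x] =
      if i = j then (if i ∈ K then coord φ (xIdx i) x else 1) else 0

/-- `Π` is P-normal: normal coordinates exist near every point. -/
def IsPNormal : Prop := ∀ p : X, ∃ φ K, p ∈ φ.source ∧ IsNormal P φ K

/-- `dlog x_i` for `i ∈ K` and `dx_i` for `i ∉ K`. -/
def xCov (φ : OpenPartialHomeomorph X (E n)) (K : Finset (Fin n)) (i : Fin n) (x : X) : Cov n :=
  if i ∈ K then (coord φ (xIdx i) x)⁻¹ • dF (coord φ (xIdx i)) x else dF (coord φ (xIdx i)) x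

/-- The form `d_I ∧ dlog(x)_J`, where `I` is the complement of `J` in `{1, …, n}`,
`d_I = ∧_{i ∈ I} d_i`, `d_i = dlog(x_i) ∧ dy_i` for `i ∈ K` and `d_i = dx_i ∧ dy_i`
for `i ∉ K`. -/
def normalForm (φ : OpenPartialHomeomorph X (E n)) (K J : Finset (Fin n)) : Forms n X := fun x =>
  wedgeList
    ((((List.finRange n).filter (· ∉ J)).flatMap fun i =>
        [xCov φ K i x, dF (coord φ (yIdx i)) x]) ++
      ((List.finRange n).filter (· ∈ J)).map fun j => xCov φ K j x)

end Manifold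

end LogSymp

end

open LogSymp

/-!
Write `ι` for contraction with `Π`.

**The isomorphism with the log de Rham complex.** On the exterior algebra of a `2n`-dimensional
vector space, the powers of contraction with a nondegenerate bivector satisfy a Lefschetz theorem:
`ι^m` is bijective from degree `n + m` to degree `n - m` (`contractM_pow_injective`,
`contractM_pow_surjective`). It follows from the commutator of `ι^{k+1}` with `α ∧`, which is
`(k + 1) ι_{Π^♯ α} ι^k`, by descending induction on the degree. The Jacobi identity says that the
double commutator `[ι, [ι, d]]` vanishes (`iota_iota_dExt`). By induction this gives
`ι^k δ_{k+1} = d ι^{k+1}` and `ι^{m+1} d = δ_{-m} ι^m` (`iota_iterate_mdp`,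
`iota_iterate_dExt_eq_mdp`), so that the operators `ι^m` and their inverses intertwine the operators
`δ_i` with `d`; in particular `δ` squares to zero because `d` does.

For this to make sense on logarithmic forms, `Π` has to be a logarithmic bivector that is
nondegenerate as such, so that `ι` preserves logarithmic forms and has holomorphic inverses in
logarithmic frames (`IsAdapted.exists_log_matrix`, `exists_holExt_contractM_pow_eq`). Indeed,
Hamiltonian vector fields multiply the coefficient of `Πⁿ` by functions
(`exists_sum_amat_mul_fderiv`); hence the coefficients of `Π` vanish on the hyperplanes `x_j = 0` as
required, and after division by the coordinates the top power is the unit `u`. Adapted charts are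
compared in `IsAdapted.exists_frame_change`: the change of logarithmic frame is holomorphic, since
coordinates that define the same branch differ by a unit, and at a point it identifies the vectors
`x_j ∂_{x_j}` belonging to the same branch.

**The cohomology sheaves.** The rest concerns the log de Rham complex. In a logarithmic frame on a
ball, a closed form is the sum of an exact form and a constant form in the `dlog x_j`
(`exists_extdLog_primitive`): the coordinates are eliminated one at a time by integration along them.
The coefficients of the constant form are the residues of the closed form, which are its values on
the vectors `x_j ∂_{x_j}` at the points of the strata. They are defined for ordered tuples of
branches, are alternating and, for closed forms, locally constant; they vanish for exact forms. So
they define a morphism from the presheaf of cohomology groups to `ν_{i*} ε_i`, which is locally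
injective and locally surjective by the decomposition above. Hence the sheafification is
`ν_{i*} ε_i` (`exists_cohSheaf_iso`). If the crossings are simple, a linear order on the components
orders the branches at each point consistently and trivializes `ε_i` (`nonempty_iso_nuConst`).

**Normal coordinates.** In the logarithmic frame of normal coordinates, `Π` is the constant bivector
`∑ ∂_{x_i} ∧ ∂_{y_i}`, the chart is adapted to the divisor `∏_{i ∈ K} x_i = 0`
(`IsNormal.isAdapted`), and at most `n` branches meet, whence the vanishing above degree `n`
(`isZero_cohSheaf`). The isomorphism with the log de Rham complex takes `d_I ∧ dlog(x)_J` to a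
nonzero multiple of `dlog(x)_J` (`contractM_darboux_pow_normalList`). This form is closed, and its
residues are nonzero exactly along the set `J` of branches. Since a germ of a cohomology class is
determined by its residues at the point (`cohGerm_eq_zero_iff`), these classes form a basis of the
stalk (`linearIndependent_cohGerm`, `span_cohGerm_eq_top`).
-/

noncomputable section

set_option linter.unusedSectionVars false

namespace LogSymp

/-! ### Exterior algebra with interior products -/

section Algebra

variable {n : ℕ}

/-- The component of degree `q` of a form. -/
def Ext.comp (q : ℕ) : Ext n →ₗ[ℂ] (E n) [⋀^Fin q]→L[ℂ] ℂ where
  toFun w := w q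
  map_add' _ _ := rfl
  map_smul' _ _ := rfl

theorem Ext.sum_apply {ι : Type*} (s : Finset ι) (f : ι → Ext n) (q : ℕ) :
    (∑ i ∈ s, f i) q = ∑ i ∈ s, f i q := map_sum (Ext.comp q) f s

theorem alt_smul_zero {q : ℕ} (c : ℂ) : c • (0 : (E n) [⋀^Fin q]→L[ℂ] ℂ) = 0 :=
  smul_zero (A := (E n) [⋀^Fin q]→L[ℂ] ℂ) c

theorem Ext.smul_apply_eq_zero {c : ℂ} {w : Ext n} {q : ℕ} (h : w q = 0) : (c • w) q = 0 :=
  (congrArg (c • ·) h).trans (alt_smul_zero c)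

theorem Ext.neg_apply (w : Ext n) (q : ℕ) : (-w) q = -w q := rfl

theorem Ext.sub_apply (w w' : Ext n) (q : ℕ) : (w - w') q = w q - w' q := rfl

/-- Interior multiplication by a vector, which is inserted as the first argument. -/
def ctr : E n →ₗ[ℂ] Ext n →ₗ[ℂ] Ext n :=
  LinearMap.mk₂ ℂ (fun v w q => (w (q + 1)).curryLeft v)
    (fun v v' w => by funext q; exact map_add _ _ _)
    (fun c v w => by funext q; exact map_smul _ _ _)
    (fun v w w' => by funext q; ext u; rfl)
    (fun c v w => by funext q; ext u; rfl)

theorem ctr_apply (v : E n) (w : Ext n) (q : ℕ) : ctr v w q = (w (q + 1)).curryLeft v := rfl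

/-- Exterior multiplication by a covector, as a bilinear map. -/
def wdg : Cov n →ₗ[ℂ] Ext n →ₗ[ℂ] Ext n :=
  LinearMap.mk₂ ℂ wedge
    (fun a b w => by
      funext q
      cases q with
      | zero => exact (add_zero _).symm
      | succ q =>
        ext u
        simp [wedge, ContinuousAlternatingMap.alternatizeUncurryFin_apply, add_mul,
          Finset.sum_add_distrib])
    (fun c a w => by
      funext q
      cases q with
      | zero => exact (alt_smul_zero c).symm
      | succ q =>
        ext u
        simp [wedge, ContinuousAlternatingMap.alternatizeUncurryFin_apply, Finset.mul_sum,
          mul_left_comm, mul_assoc])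
    (fun a w w' => by
      funext q
      cases q with
      | zero => exact (add_zero _).symm
      | succ q =>
        rw [Ext.add_apply]
        simp only [wedge, Ext.add_apply]
        ext u
        simp [ContinuousAlternatingMap.alternatizeUncurryFin_apply, Finset.sum_add_distrib])
    (fun c a w => by
      funext q
      cases q with
      | zero => exact (alt_smul_zero c).symm
      | succ q =>
        rw [Ext.smul_apply]
        simp only [wedge, Ext.smul_apply]
        ext u
        simp [ContinuousAlternatingMap.alternatizeUncurryFin_apply, Finset.mul_sum,
          mul_left_comm])

theorem wdg_zero_apply (a : Cov n) (w : Ext n) : wdg a w 0 = 0 := rfl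

theorem wdg_succ_apply (a : Cov n) (w : Ext n) (q : ℕ) :
    wdg a w (q + 1) = ContinuousAlternatingMap.alternatizeUncurryFin (a.smulRight (w q)) := rfl

theorem Ext.ext_ctr {w w' : Ext n} (q : ℕ) (h : ∀ v, ctr v w q = ctr v w' q) :
    w (q + 1) = w' (q + 1) := by
  ext u
  have := congrArg (fun f => f (fun i => u i.succ)) (h (u 0))
  simp only [ctr_apply, ContinuousAlternatingMap.curryLeft_apply_apply] at this
  convert this using 2 <;> exact (Fin.cons_self_tail u).symm

/-- The Clifford relation. -/
theorem ctr_wdg (v : E n) (a : Cov n) (w : Ext n) :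
    ctr v (wdg a w) = a v • w - wdg a (ctr v w) := by
  funext q
  rw [ctr_apply, wdg_succ_apply, Ext.sub_apply, Ext.smul_apply]
  ext u
  rw [ContinuousAlternatingMap.curryLeft_apply_apply,
    ContinuousAlternatingMap.alternatizeUncurryFin_apply, Fin.sum_univ_succ]
  cases q with
  | zero =>
    simp only [wdg_zero_apply]
    simp
  | succ q =>
    rw [wdg_succ_apply, ContinuousAlternatingMap.sub_apply,
      ContinuousAlternatingMap.alternatizeUncurryFin_apply, sub_eq_add_neg,
      ← Finset.sum_neg_distrib]
    congr 1
    · simp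
    · refine Finset.sum_congr rfl fun i _ => ?_
      simp only [ContinuousLinearMap.smulRight_apply, ContinuousAlternatingMap.smul_apply, ctr_apply,
        ContinuousAlternatingMap.curryLeft_apply_apply, Matrix.cons_val_succ, Fin.val_succ, pow_succ,
        smul_eq_mul]
      have : i.succ.removeNth (Matrix.vecCons v u) = Matrix.vecCons v (i.removeNth u) := by
        funext j
        refine Fin.cases ?_ (fun j => ?_) j
        · simp [Fin.removeNth]
        · simp [Fin.removeNth, Fin.succ_succAbove_succ]
      rw [this]
      simp

theorem ctr_ctr (v u : E n) (w : Ext n) : ctr v (ctr u w) = -ctr u (ctr v w) := by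
  funext q
  rw [Ext.neg_apply]
  ext x
  simp only [ctr_apply, ContinuousAlternatingMap.curryLeft_apply_apply,
    ContinuousAlternatingMap.neg_apply]
  have := (w (q + 1 + 1)).toAlternatingMap.map_swap (Matrix.vecCons u (Matrix.vecCons v x))
    (i := 0) (j := 1) (by simp)
  have h2 : (Matrix.vecCons u (Matrix.vecCons v x)) ∘ Equiv.swap 0 1
      = Matrix.vecCons v (Matrix.vecCons u x) := by
    funext t
    refine Fin.cases (by simp) (fun t => ?_) t
    refine Fin.cases (by simp) (fun t => ?_) t
    rw [Function.comp_apply, Equiv.swap_apply_of_ne_of_ne] <;> simp [Fin.ext_iff]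
  rw [h2] at this
  rw [eq_neg_iff_add_eq_zero]
  have h3 := congrArg (· + (w (q + 1 + 1)) (Matrix.vecCons v (Matrix.vecCons u x))) this
  simp at h3
  linear_combination h3

theorem wdg_wdg (a b : Cov n) (w : Ext n) : wdg a (wdg b w) = -wdg b (wdg a w) := by
  have key : ∀ q, ∀ w : Ext n, wdg a (wdg b w) q = (-wdg b (wdg a w)) q := by
    intro q
    induction q with
    | zero => intro w; simp [wdg_zero_apply, Ext.neg_apply]
    | succ q ih =>
      intro w
      refine Ext.ext_ctr q fun v => ?_
      have := ih (ctr v w)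
      simp only [map_neg, ctr_wdg, map_sub, map_smul, Ext.neg_apply, Ext.sub_apply,
        Ext.smul_apply] at this ⊢
      rw [this]
      abel
  funext q
  exact key q w

theorem ctr_self (v : E n) (w : Ext n) : ctr v (ctr v w) = 0 := by
  have h := ctr_ctr v v w
  rwa [eq_neg_iff_add_eq_zero, ← two_smul ℂ, smul_eq_zero_iff_right (two_ne_zero)] at h

theorem sum_stdCov (v : E n) : ∑ i, stdCov i v • stdVec i = v := by
  ext k
  simp [stdCov, stdVec, Pi.single_apply]

theorem stdCov_stdVec (i j : Fin (n + n)) :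
    stdCov (n := n) i (stdVec j) = if i = j then 1 else 0 := by
  simp [stdCov, stdVec]

/-- Euler's identity for the number operator. -/
theorem sum_wdg_ctr (w : Ext n) (q : ℕ) :
    (∑ k, wdg (stdCov k) (ctr (stdVec k) w)) q = (q : ℂ) • w q := by
  induction q generalizing w with
  | zero =>
    simp only [Ext.sum_apply, wdg_zero_apply, Finset.sum_const_zero, Nat.cast_zero]
    exact (zero_smul ℂ (w 0)).symm
  | succ q ih =>
    have : ∀ v, ctr v (∑ k, wdg (stdCov k) (ctr (stdVec k) w))
        = ctr v w + ∑ k, wdg (stdCov k) (ctr (stdVec k) (ctr v w)) := by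
      intro v
      have hs : ∑ k, stdCov k v • ctr (stdVec k) w = ctr v w := by
        conv_rhs => rw [← sum_stdCov v]
        simp [LinearMap.sum_apply]
      simp only [map_sum, ctr_wdg, ctr_ctr v, map_neg, sub_neg_eq_add]
      rw [Finset.sum_add_distrib, hs]
    have h2 : (((q + 1 : ℕ) : ℂ) • w) (q + 1) = ((q + 1 : ℕ) : ℂ) • w (q + 1) := rfl
    rw [← h2]
    refine Ext.ext_ctr q fun v => ?_
    rw [this, Ext.add_apply, ih, map_smul, Ext.smul_apply]
    push_cast
    module

/-- The form is homogeneous of degree `r`. -/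
def Homog (r : ℤ) (w : Ext n) : Prop := ∀ q : ℕ, (q : ℤ) ≠ r → w q = 0

theorem Homog.wdg {r : ℤ} {w : Ext n} (h : Homog r w) (a : Cov n) : Homog (r + 1) (wdg a w) := by
  intro q hq
  cases q with
  | zero => rfl
  | succ q =>
    rw [wdg_succ_apply, h q (by push_cast at hq; omega)]
    ext u
    simp [ContinuousAlternatingMap.alternatizeUncurryFin_apply]

theorem Homog.ctr {r : ℤ} {w : Ext n} (h : Homog r w) (v : E n) : Homog (r - 1) (ctr v w) := by
  intro q hq
  rw [ctr_apply, h (q + 1) (by push_cast; omega)]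
  ext u
  simp

theorem Homog.add {r : ℤ} {w w' : Ext n} (h : Homog r w) (h' : Homog r w') : Homog r (w + w') :=
  fun q hq => by rw [Ext.add_apply, h q hq, h' q hq, add_zero]

theorem Homog.smul {r : ℤ} {w : Ext n} (c : ℂ) (h : Homog r w) : Homog r (c • w) :=
  fun q hq => Ext.smul_apply_eq_zero (h q hq)

theorem Homog.sub {r : ℤ} {w w' : Ext n} (h : Homog r w) (h' : Homog r w') : Homog r (w - w') :=
  fun q hq => by rw [Ext.sub_apply, h q hq, h' q hq, sub_zero]

theorem Homog.zero (r : ℤ) : Homog r (0 : Ext n) := fun _ _ => rfl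

theorem Homog.sum {ι : Type*} {r : ℤ} (s : Finset ι) {f : ι → Ext n} (h : ∀ i ∈ s, Homog r (f i)) :
    Homog r (∑ i ∈ s, f i) := fun q hq => by
  rw [Ext.sum_apply]
  exact Finset.sum_eq_zero fun i hi => h i hi q hq

theorem Homog.eq_zero_of_neg {r : ℤ} {w : Ext n} (h : Homog r w) (hr : r < 0) : w = 0 :=
  funext fun q => h q (by omega)

theorem ext_eq_zero_of_lt {q : ℕ} (hq : n + n < q) (f : (E n) [⋀^Fin q]→L[ℂ] ℂ) : f = 0 := by
  apply ContinuousAlternatingMap.toAlternatingMap_injective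
  refine (EuclideanSpace.basisFun (Fin (n + n)) ℂ).toBasis.ext_alternating fun v hv => ?_
  have := Fintype.card_le_of_injective v hv
  simp at this
  omega

theorem Homog.eq_zero_of_lt {r : ℤ} {w : Ext n} (h : Homog r w) (hr : (n + n : ℤ) < r) : w = 0 := by
  funext q
  by_cases hq : (q : ℤ) = r
  · exact ext_eq_zero_of_lt (by omega) _
  · exact h q hq

theorem Homog.wdg_ctr {r : ℤ} {w : Ext n} (h : Homog r w) :
    ∑ k, LogSymp.wdg (stdCov k) (LogSymp.ctr (stdVec k) w) = (r : ℂ) • w := by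
  funext q
  rw [sum_wdg_ctr, Ext.smul_apply]
  by_cases hq : (q : ℤ) = r
  · rw [← hq]; simp
  · rw [h q hq]
    exact (alt_smul_zero _).trans (alt_smul_zero _).symm

theorem Homog.ctr_wdg {r : ℤ} {w : Ext n} (h : Homog r w) :
    ∑ k, LogSymp.ctr (stdVec k) (LogSymp.wdg (stdCov k) w) = ((n + n : ℂ) - r) • w := by
  simp only [LogSymp.ctr_wdg, Finset.sum_sub_distrib, h.wdg_ctr, stdCov_stdVec]
  rw [sub_smul]
  congr 1
  simp [← Nat.cast_smul_eq_nsmul ℂ]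

/-! ### Contraction with a bivector -/

/-- Contraction with the bivector `½ ∑ aᵢⱼ eᵢ ∧ eⱼ`. -/
def contractM (a : Fin (n + n) → Fin (n + n) → ℂ) : Ext n →ₗ[ℂ] Ext n :=
  (1 / 2 : ℂ) • ∑ i, ∑ j, a i j • (ctr (stdVec j) ∘ₗ ctr (stdVec i))

theorem contractM_apply (a : Fin (n + n) → Fin (n + n) → ℂ) (w : Ext n) :
    contractM a w = (1 / 2 : ℂ) • ∑ i, ∑ j, a i j • ctr (stdVec j) (ctr (stdVec i) w) := by
  simp [contractM, LinearMap.sum_apply]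

theorem contract_eq_contractM (B : Bivec n) (w : Ext n) :
    contract B w = contractM (fun i j => B ![stdCov i, stdCov j]) w := by
  rw [contractM_apply]
  funext q
  simp only [contract, Ext.smul_apply, Ext.sum_apply, ctr_apply]

theorem Homog.contractM {r : ℤ} {w : Ext n} (h : Homog r w) (a : Fin (n + n) → Fin (n + n) → ℂ) :
    Homog (r - 2) (contractM a w) := by
  rw [contractM_apply]
  refine Homog.smul _ (Homog.sum _ fun i _ => Homog.sum _ fun j _ => Homog.smul _ ?_)
  have := (h.ctr (stdVec i)).ctr (stdVec j)
  rwa [show r - 1 - 1 = r - 2 by ring] at this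

theorem Homog.contractM_pow {r : ℤ} {w : Ext n} (h : Homog r w)
    (a : Fin (n + n) → Fin (n + n) → ℂ) (m : ℕ) :
    Homog (r - 2 * m) ((LogSymp.contractM a ^ m) w) := by
  induction m with
  | zero => simpa using h
  | succ m ih =>
    rw [pow_succ', Module.End.mul_apply]
    have := ih.contractM a
    rwa [show r - 2 * (m : ℤ) - 2 = r - 2 * ((m + 1 : ℕ) : ℤ) by push_cast; ring] at this

theorem contractM_ctr (a : Fin (n + n) → Fin (n + n) → ℂ) (v : E n) (w : Ext n) :
    contractM a (ctr v w) = ctr v (contractM a w) := by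
  simp only [contractM_apply, map_smul, map_sum]
  congr 1
  refine Finset.sum_congr rfl fun i _ => Finset.sum_congr rfl fun j _ => ?_
  rw [ctr_ctr v (stdVec j), ctr_ctr v (stdVec i), map_neg, neg_neg]

theorem contractM_pow_ctr (a : Fin (n + n) → Fin (n + n) → ℂ) (m : ℕ) (v : E n) (w : Ext n) :
    (contractM a ^ m) (ctr v w) = ctr v ((contractM a ^ m) w) := by
  induction m with
  | zero => rfl
  | succ m ih => rw [pow_succ', Module.End.mul_apply, Module.End.mul_apply, ih, contractM_ctr]

theorem contractM_comm (a b : Fin (n + n) → Fin (n + n) → ℂ) :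
    Commute (contractM a) (contractM b) := by
  refine LinearMap.ext fun w => ?_
  rw [Module.End.mul_apply, Module.End.mul_apply, contractM_apply b w, contractM_apply b]
  simp only [map_smul, map_sum, contractM_ctr]

/-- The vector `Π^♯ α` for the bivector `Π = ½ ∑ aᵢⱼ eᵢ ∧ eⱼ`. -/
def sharp (a : Fin (n + n) → Fin (n + n) → ℂ) (α : Cov n) : E n :=
  (1 / 2 : ℂ) • ∑ i, ∑ j, a i j • (α (stdVec i) • stdVec j - α (stdVec j) • stdVec i)

theorem contractM_wdg (a : Fin (n + n) → Fin (n + n) → ℂ) (α : Cov n) (w : Ext n) :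
    contractM a (wdg α w) = wdg α (contractM a w) + ctr (sharp a α) w := by
  simp only [contractM_apply, sharp, map_smul, map_sum, ctr_wdg, map_sub, LinearMap.smul_apply,
    LinearMap.sum_apply, LinearMap.sub_apply, ← smul_add, ← Finset.sum_add_distrib]
  congr 1
  refine Finset.sum_congr rfl fun i _ => Finset.sum_congr rfl fun j _ => ?_
  congr 1
  abel

/-- The commutator of `ι_Π^{k+1}` with `α ∧` is `(k + 1) ι_{Π^♯ α} ι_Π^k`. -/
theorem contractM_pow_wdg (a : Fin (n + n) → Fin (n + n) → ℂ) (α : Cov n) (k : ℕ) (w : Ext n) :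
    (contractM a ^ (k + 1)) (wdg α w) = wdg α ((contractM a ^ (k + 1)) w)
      + ((k + 1 : ℕ) : ℂ) • ctr (sharp a α) ((contractM a ^ k) w) := by
  induction k with
  | zero => simp [contractM_wdg]
  | succ k ih =>
    have e : ∀ k x, contractM a ((contractM a ^ k) x) = (contractM a ^ (k + 1)) x := fun k x => by
      rw [pow_succ', Module.End.mul_apply]
    rw [← e, ih, map_add, contractM_wdg, map_smul, contractM_ctr, e, e]
    push_cast
    module

/-! ### Top forms -/

variable (n) in
/-- The standard volume form. -/
def vol : Ext n := wedgeList ((List.finRange (n + n)).map stdCov)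

theorem homog_wedgeList (l : List (Cov n)) : Homog l.length (wedgeList l) := by
  induction l with
  | nil =>
    intro q hq
    cases q with
    | zero => simp at hq
    | succ q => rfl
  | cons a l ih =>
    simp only [List.length_cons, Nat.cast_succ]
    exact ih.wdg a

theorem homog_vol : Homog (n + n) (vol n) := by
  have := homog_wedgeList ((List.finRange (n + n)).map (stdCov (n := n)))
  unfold vol
  simpa using this

theorem ctr_wedgeList_eq_zero {l : List (Cov n)} {v : E n} (h : ∀ a ∈ l, a v = 0) :
    ctr v (wedgeList l) = 0 := by
  induction l with
  | nil => exact ((homog_wedgeList []).ctr v).eq_zero_of_neg (by simp)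
  | cons a l ih =>
    change ctr v (wdg a (wedgeList l)) = 0
    rw [ctr_wdg, h a (by simp), ih fun b hb => h b (by simp [hb])]
    simp

/-- A product of covectors, evaluated on dual vectors. -/
theorem wedgeList_apply_dual {ι : Type*} [DecidableEq ι] (a : ι → Cov n) (v : ι → E n)
    (h : ∀ i j, a i (v j) = if i = j then 1 else 0) (l : List ι) (hl : l.Nodup) :
    wedgeList (l.map a) l.length (fun t => v (l.get t)) = 1 := by
  induction l with
  | nil => rfl
  | cons i l ih =>
    have h1 : (fun t => v ((i :: l).get t)) = Matrix.vecCons (v i) (fun t => v (l.get t)) := by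
      funext t
      refine Fin.cases rfl (fun t => rfl) t
    rw [h1]
    change ctr (v i) (wdg (a i) (wedgeList (l.map a))) l.length _ = 1
    rw [List.nodup_cons] at hl
    rw [ctr_wdg, ctr_wedgeList_eq_zero, h]
    · simpa using ih hl.2
    · intro b hb
      obtain ⟨j, hj, rfl⟩ := List.mem_map.1 hb
      rw [h, if_neg]
      rintro rfl
      exact hl.1 hj

theorem vol_stdVec : vol n (n + n) stdVec = 1 := by
  have := wedgeList_apply_dual (n := n) stdCov stdVec stdCov_stdVec (List.finRange (n + n))
    (List.nodup_finRange _)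
  have h2 : ∀ (m : ℕ) (h : m = n + n) (v : Fin m → E n) ,
      vol n m v = vol n (n + n) (fun i => v (Fin.cast h.symm i)) := by
    rintro m rfl v
    rfl
  unfold vol at h2 ⊢
  rw [h2 _ (List.length_finRange)] at this
  simpa using this

/-- The coefficient of a form of top degree. -/
def topPart (w : Ext n) : ℂ := w (n + n) stdVec

theorem Homog.eq_topPart_smul {w : Ext n} (h : Homog (n + n) w) : w = topPart w • vol n := by
  funext q
  by_cases hq : q = n + n
  · subst hq
    have key : ∀ f : (E n) [⋀^Fin (n + n)]→L[ℂ] ℂ, f.toAlternatingMap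
        = f stdVec • (EuclideanSpace.basisFun (Fin (n + n)) ℂ).toBasis.det := by
      intro f
      have := f.toAlternatingMap.eq_smul_basis_det
        (EuclideanSpace.basisFun (Fin (n + n)) ℂ).toBasis
      convert this using 3
      change f _ = f _
      congr 1
      funext i
      simp [stdVec]
    apply ContinuousAlternatingMap.toAlternatingMap_injective
    rw [key, Ext.smul_apply]
    have h1 := key (vol n (n + n))
    rw [vol_stdVec, one_smul] at h1
    rw [← h1]
    rfl
  · rw [h q (by exact_mod_cast hq)]
    exact (Ext.smul_apply_eq_zero (homog_vol q (by exact_mod_cast hq))).symm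

/-! ### The Lefschetz isomorphism -/

/-- The coefficient of the `n`-th power of the bivector. -/
def topPow (a : Fin (n + n) → Fin (n + n) → ℂ) : ℂ := ((contractM a ^ n) (vol n)) 0 ![]

/-- If the bivector `Π` is nondegenerate, then `ι_Π^m` is injective on forms of degree `n + m`:
exterior multiplication by covectors commutes with `ι_Π^{m+1}` on the kernel of `ι_Π^m`, so that the
kernel is handled by descending induction on the degree. -/
theorem contractM_pow_injective {a : Fin (n + n) → Fin (n + n) → ℂ} (ha : topPow a ≠ 0) (k m : ℕ)
    (hk : n = m + k) (w : Ext n) (hw : Homog (n + m) w) (h : (contractM a ^ m) w = 0) : w = 0 := by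
  induction k generalizing m w with
  | zero =>
    obtain rfl : n = m := hk
    have h1 := hw.eq_topPart_smul
    rw [h1, map_smul] at h
    have h2 : topPart w * topPow a = 0 := congrArg (fun x : Ext n => x 0 ![]) h
    rw [h1, (mul_eq_zero.1 h2).resolve_right ha, zero_smul]
  | succ k ih =>
    have h1 : ∀ α, wdg α w = 0 := by
      intro α
      refine ih (m + 1) (by omega) _ ?_ ?_
      · have := hw.wdg α
        push_cast
        rwa [← add_assoc]
      · rw [contractM_pow_wdg, pow_succ', Module.End.mul_apply, h]
        simp
    have h2 := hw.ctr_wdg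
    simp only [h1, map_zero, Finset.sum_const_zero] at h2
    have h3 : ((n + n : ℂ) - ((n + m : ℤ) : ℂ)) ≠ 0 := by
      rw [hk]
      push_cast
      ring_nf
      exact_mod_cast (by omega : 1 + k ≠ 0)
    exact (smul_eq_zero.1 h2.symm).resolve_left h3

/-- If the bivector `Π` is nondegenerate, then `ι_Π^m` maps the forms of degree `n + m` onto those
of degree `n - m`. -/
theorem contractM_pow_surjective {a : Fin (n + n) → Fin (n + n) → ℂ} (ha : topPow a ≠ 0) (k m : ℕ)
    (hk : n = m + k) (w : Ext n) (hw : Homog (n - m) w) :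
    ∃ w', Homog (n + m) w' ∧ (contractM a ^ m) w' = w := by
  induction k generalizing m w with
  | zero =>
    obtain rfl : n = m := hk
    refine ⟨(w 0 ![] / topPow a) • vol n, homog_vol.smul _, ?_⟩
    rw [map_smul]
    have h0 : Homog 0 ((contractM a ^ n) (vol n)) := by
      have := homog_vol.contractM_pow a n
      rwa [show (n + n - 2 * n : ℤ) = 0 by ring] at this
    funext q
    cases q with
    | zero =>
      ext v
      obtain rfl : v = ![] := Subsingleton.elim _ _
      change (w 0 ![] / topPow a) * topPow a = _
      rw [div_mul_cancel₀ _ ha]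
    | succ q =>
      rw [hw (q + 1) (by push_cast; omega)]
      exact Ext.smul_apply_eq_zero (h0 (q + 1) (by push_cast; omega))
  | succ k ih =>
    have h1 : ∀ α, ∀ u, Homog (n - m - 1) u →
        ∃ w', Homog (n + m) w' ∧ (contractM a ^ m) w' = wdg α u := by
      intro α u hu
      obtain ⟨v, hv, rfl⟩ := ih (m + 1) (by omega) u (by push_cast; rwa [← sub_sub])
      refine ⟨contractM a (wdg α v) - ((m + 1 : ℕ) : ℂ) • ctr (sharp a α) v,
        Homog.sub ?_ (Homog.smul _ ?_), ?_⟩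
      · have := (hv.wdg α).contractM a
        convert this using 1
        push_cast; ring
      · have := hv.ctr (sharp a α)
        convert this using 1
        push_cast; ring
      · rw [map_sub, map_smul, contractM_pow_ctr, ← Module.End.mul_apply, ← pow_succ,
          contractM_pow_wdg, add_sub_cancel_right]
    choose f hf hf' using fun j => h1 (stdCov j) (ctr (stdVec j) w) (hw.ctr _)
    have h3 : ((n - m : ℤ) : ℂ) ≠ 0 := by
      rw [hk]
      push_cast
      ring_nf
      exact_mod_cast (by omega : 1 + k ≠ 0)
    refine ⟨((n - m : ℤ) : ℂ)⁻¹ • ∑ j, f j, Homog.smul _ (Homog.sum _ fun j _ => hf j), ?_⟩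
    simp only [map_smul, map_sum, hf', hw.wdg_ctr]
    rw [smul_smul, inv_mul_cancel₀ h3, one_smul]

end Algebra

/-! ### Holomorphic functions of several variables -/

section Analysis

variable {n : ℕ}

instance finiteDimensional_alternating (q : ℕ) :
    FiniteDimensional ℂ ((E n) [⋀^Fin q]→L[ℂ] ℂ) := by
  let f : (E n) [⋀^Fin q]→L[ℂ] ℂ →ₗ[ℂ] MultilinearMap ℂ (fun _ : Fin q => E n) ℂ :=
    { toFun := fun w => w.toMultilinearMap
      map_add' := fun _ _ => rfl
      map_smul' := fun _ _ => rfl }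
  refine FiniteDimensional.of_injective f fun a b h => ?_
  ext v
  exact congrArg (fun g : MultilinearMap ℂ (fun _ : Fin q => E n) ℂ => g v) h

variable {F : Type*} [NormedAddCommGroup F] [NormedSpace ℂ F] [FiniteDimensional ℂ F]

open MeasureTheory in
/-- Differentiation of `y ↦ ∫ c(t) f(L_t y) dt` for affine maps `L_t`. -/
theorem hasFDerivAt_intervalIntegral_affine {U : Set (E n)} (hU : IsOpen U) {f : E n → F}
    (hf : DifferentiableOn ℂ f U) {a b : ℝ} {c : ℝ → ℂ} (hc : Continuous c)
    {A : ℝ → E n →L[ℂ] E n} (hA : Continuous A) {u : ℝ → E n} (hu : Continuous u) {y₀ : E n}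
    {s : Set (E n)} (hs : s ∈ 𝓝 y₀) {C : ℝ}
    (hsU : ∀ t ∈ Set.uIcc a b, ∀ y ∈ s, A t y + u t ∈ U ∧ ‖fderiv ℂ f (A t y + u t)‖ ≤ C) :
    HasFDerivAt (fun y => ∫ t in a..b, c t • f (A t y + u t))
      (∫ t in a..b, c t • (fderiv ℂ f (A t y₀ + u t)).comp (A t)) y₀ := by
  have : CompleteSpace F := FiniteDimensional.complete ℂ F
  have : ProperSpace F := FiniteDimensional.proper ℂ F
  have : ProperSpace (E n →L[ℂ] F) := FiniteDimensional.proper ℂ _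
  borelize F
  borelize (E n →L[ℂ] F)
  have hL : ∀ y, Continuous fun t => A t y + u t := fun y =>
    ((ContinuousLinearMap.apply ℂ (E n) y).continuous.comp hA).add hu
  have hcont : ∀ y ∈ s, ContinuousOn (fun t => c t • f (A t y + u t)) (Set.uIcc a b) := fun y hy =>
    hc.continuousOn.smul (hf.continuousOn.comp (hL y).continuousOn fun t ht => (hsU t ht y hy).1)
  have hmem : y₀ ∈ s := mem_of_mem_nhds hs
  obtain ⟨C', hC'⟩ := (isCompact_uIcc (a := a) (b := b)).exists_bound_of_continuousOn
    (f := fun t => (‖c t‖ * ‖A t‖ : ℝ)) (hc.norm.mul hA.norm).continuousOn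
  refine intervalIntegral.hasFDerivAt_integral_of_dominated_of_fderiv_le (𝕜 := ℂ)
    (F := fun y t => c t • f (A t y + u t))
    (F' := fun y t => c t • (fderiv ℂ f (A t y + u t)).comp (A t)) (bound := fun _ => C' * C) hs
    ?_ ?_ ?_ ?_ ?_ ?_
  · filter_upwards [hs] with y hy
    exact ((hcont y hy).mono Set.uIoc_subset_uIcc).aestronglyMeasurable measurableSet_uIoc
  · exact (hcont y₀ hmem).intervalIntegrable
  · have h1 : StronglyMeasurable fun t => fderiv ℂ f (A t y₀ + u t) :=
      ((measurable_fderiv ℂ f).comp (hL y₀).measurable).stronglyMeasurable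
    refine (hc.stronglyMeasurable.smul ?_).aestronglyMeasurable
    exact (ContinuousLinearMap.compL ℂ (E n) (E n) F).continuous₂.comp_stronglyMeasurable
      (h1.prodMk hA.stronglyMeasurable)
  · refine Filter.Eventually.of_forall fun t ht y hy => ?_
    have ht' := Set.uIoc_subset_uIcc ht
    have h1 := (hsU t ht' y hy).2
    have h2 := hC' t ht'
    rw [Real.norm_of_nonneg (by positivity)] at h2
    calc ‖c t • (fderiv ℂ f (A t y + u t)).comp (A t)‖
        ≤ ‖c t‖ * (‖fderiv ℂ f (A t y + u t)‖ * ‖A t‖) := by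
          rw [norm_smul]
          gcongr
          exact ContinuousLinearMap.opNorm_comp_le _ _
      _ = (‖c t‖ * ‖A t‖) * ‖fderiv ℂ f (A t y + u t)‖ := by ring
      _ ≤ C' * C := by gcongr; exact (by positivity : 0 ≤ ‖c t‖ * ‖A t‖).trans h2
  · exact intervalIntegrable_const
  · refine Filter.Eventually.of_forall fun t ht y hy => ?_
    have h1 := (hf.differentiableAt (hU.mem_nhds (hsU t (Set.uIoc_subset_uIcc ht) y hy).1)).hasFDerivAt
    exact (h1.comp y ((A t).hasFDerivAt.add_const _)).const_smul (c t)

/-- Directional derivatives of holomorphic functions are holomorphic: by Cauchy's formula on complex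
lines in the given direction, they are integrals of translates of the function. -/
theorem differentiableOn_fderiv_apply {U : Set (E n)} (hU : IsOpen U) {f : E n → F}
    (hf : DifferentiableOn ℂ f U) (v : E n) :
    DifferentiableOn ℂ (fun y => fderiv ℂ f y v) U := by
  have : CompleteSpace F := FiniteDimensional.complete ℂ F
  intro y₀ hy₀
  obtain ⟨ε, hε, hεU⟩ := Metric.isOpen_iff.1 hU y₀ hy₀
  -- a ball on which `f` is bounded, so that its derivative is bounded on a smaller one
  obtain ⟨δ, hδ, hδε, hδf⟩ : ∃ δ > 0, 3 * δ ≤ ε ∧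
      ∀ y ∈ Metric.ball y₀ (3 * δ), ‖f y - f y₀‖ < 1 := by
    have hcf := (hf.continuousOn.continuousAt (hU.mem_nhds hy₀))
    obtain ⟨η, hη, hη'⟩ := Metric.continuousAt_iff.1 hcf 1 one_pos
    refine ⟨min η ε / 3, by positivity, by rw [mul_div_cancel₀ _ (by norm_num)]; exact min_le_right _ _,
      fun y hy => ?_⟩
    rw [mul_div_cancel₀ _ (by norm_num)] at hy
    have := hη' (Metric.ball_subset_ball (min_le_left _ _) hy)
    rwa [dist_eq_norm] at this
  have hball : Metric.ball y₀ (3 * δ) ⊆ U := (Metric.ball_subset_ball hδε).trans hεU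
  have hbound : ∀ z ∈ Metric.ball y₀ (2 * δ), ‖fderiv ℂ f z‖ ≤ 2 / δ := by
    intro z hz
    have hzb : Metric.ball z δ ⊆ Metric.ball y₀ (3 * δ) := by
      intro w hw
      rw [Metric.mem_ball] at *
      linarith [dist_triangle w z y₀]
    refine Complex.norm_fderiv_le_div_of_mapsTo_ball (hf.mono (hzb.trans hball)) ?_ hδ
    intro w hw
    have h1 := hδf w (hzb hw)
    have h2 := hδf z (hzb (Metric.mem_ball_self hδ))
    rw [mem_closedBall_iff_norm]
    have : f w - f z = (f w - f y₀) - (f z - f y₀) := by abel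
    rw [this]
    linarith [norm_sub_le (f w - f y₀) (f z - f y₀)]
  -- the circles of radius `ρ` in the direction `v` around points of `ball y₀ δ` stay in the domain
  set ρ : ℝ := δ / (‖v‖ + 1) with hρ
  have hρ0 : 0 < ρ := by positivity
  have hρv : ∀ ζ : ℂ, ‖ζ‖ ≤ ρ → ‖ζ • v‖ < δ := by
    intro ζ hζ
    rw [norm_smul]
    calc ‖ζ‖ * ‖v‖ ≤ ρ * ‖v‖ := by gcongr
      _ < ρ * (‖v‖ + 1) := by gcongr; linarith
      _ = δ := by rw [hρ, div_mul_cancel₀]; positivity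
  have hcauchy : ∀ y ∈ Metric.ball y₀ δ, fderiv ℂ f y v = ∫ θ in (0 : ℝ)..2 * Real.pi,
      ((2 * Real.pi * Complex.I : ℂ)⁻¹ * (deriv (circleMap 0 ρ) θ * ((circleMap 0 ρ θ) ^ 2)⁻¹)) •
        f ((ContinuousLinearMap.id ℂ (E n)) y + circleMap 0 ρ θ • v) := by
    intro y hy
    set V : Set ℂ := {ζ | y + ζ • v ∈ U}
    have hline : Differentiable ℂ fun ζ : ℂ => y + ζ • v := by fun_prop
    have hV : IsOpen V := hU.preimage hline.continuous
    have hfV : DifferentiableOn ℂ (fun ζ : ℂ => f (y + ζ • v)) V :=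
      hf.comp hline.differentiableOn fun ζ hζ => hζ
    have hsub : Metric.closedBall (0 : ℂ) ρ ⊆ V := by
      intro ζ hζ
      refine hball ?_
      rw [mem_closedBall_zero_iff] at hζ
      rw [Metric.mem_ball] at *
      have : dist (y + ζ • v) y < δ := by simpa [dist_eq_norm] using hρv ζ hζ
      linarith [dist_triangle (y + ζ • v) y y₀]
    have h1 := Complex.two_pi_I_inv_smul_circleIntegral_sub_sq_inv_smul_of_differentiable hV hsub hfV
      (Metric.mem_ball_self hρ0)
    have h2 : deriv (fun ζ : ℂ => f (y + ζ • v)) 0 = fderiv ℂ f y v := by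
      have hd : HasFDerivAt f (fderiv ℂ f y) (y + (0 : ℂ) • v) := by
        rw [zero_smul, add_zero]
        exact (hf.differentiableAt (hU.mem_nhds (hball
          (Metric.ball_subset_ball (by linarith) hy)))).hasFDerivAt
      have hl : HasDerivAt (fun ζ : ℂ => y + ζ • v) v 0 := by
        simpa using ((hasDerivAt_id (0 : ℂ)).smul_const v).const_add y
      exact (hd.comp_hasDerivAt 0 hl).deriv
    rw [← h2, ← h1, circleIntegral, ← intervalIntegral.integral_smul]
    refine intervalIntegral.integral_congr fun θ _ => ?_
    simp [smul_smul]
  have hmain := hasFDerivAt_intervalIntegral_affine (n := n) hU hf (a := 0) (b := 2 * Real.pi)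
    (c := fun θ => (2 * Real.pi * Complex.I : ℂ)⁻¹ *
      (deriv (circleMap 0 ρ) θ * ((circleMap 0 ρ θ) ^ 2)⁻¹))
    (by
      have : ∀ θ, circleMap 0 ρ θ ^ 2 ≠ 0 := fun θ => pow_ne_zero 2 (circleMap_ne_center hρ0.ne')
      simp only [deriv_circleMap]
      fun_prop (disch := exact this _))
    (A := fun _ => ContinuousLinearMap.id ℂ (E n)) continuous_const
    (u := fun θ => circleMap 0 ρ θ • v) (by fun_prop) (y₀ := y₀)
    (Metric.ball_mem_nhds y₀ hδ) (C := 2 / δ) (by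
      intro θ _ y hy
      have : ‖circleMap 0 ρ θ • v‖ < δ := hρv _ (by simp [abs_of_pos hρ0])
      have h3 : y + circleMap 0 ρ θ • v ∈ Metric.ball y₀ (2 * δ) := by
        rw [Metric.mem_ball] at *
        have : dist (y + circleMap 0 ρ θ • v) y < δ := by simpa [dist_eq_norm] using this
        linarith [dist_triangle (y + circleMap 0 ρ θ • v) y y₀]
      exact ⟨hball (Metric.ball_subset_ball (by linarith) h3), hbound _ h3⟩)
  refine (hmain.differentiableAt.congr_of_eventuallyEq ?_).differentiableWithinAt
  filter_upwards [Metric.ball_mem_nhds y₀ hδ] with y hy using hcauchy y hy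

theorem clm_eq_sum {G : Type*} [NormedAddCommGroup G] [NormedSpace ℂ G] (L : E n →L[ℂ] G) :
    L = ∑ i, (stdCov i).smulRight (L (stdVec i)) := by
  ext v
  conv_lhs => rw [← sum_stdCov v]
  simp [map_sum]

theorem differentiableOn_fderiv {U : Set (E n)} (hU : IsOpen U) {f : E n → F}
    (hf : DifferentiableOn ℂ f U) : DifferentiableOn ℂ (fderiv ℂ f) U := by
  have : fderiv ℂ f = fun y => ∑ i, ContinuousLinearMap.smulRightL ℂ (E n) F (stdCov i)
      (fderiv ℂ f y (stdVec i)) := by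
    funext y
    exact clm_eq_sum _
  rw [this]
  refine DifferentiableOn.fun_sum fun i _ => ?_
  exact (ContinuousLinearMap.differentiable _).comp_differentiableOn
    (differentiableOn_fderiv_apply hU hf (stdVec i))

/-- Holomorphic functions of several variables are of class `C^m` for every `m`. -/
theorem contDiffOn_of_differentiableOn {U : Set (E n)} (hU : IsOpen U) {f : E n → F}
    (hf : DifferentiableOn ℂ f U) (m : ℕ) : ContDiffOn ℂ m f U := by
  induction m generalizing F with
  | zero => exact contDiffOn_zero.2 hf.continuousOn
  | succ m ih =>
    push_cast
    rw [contDiffOn_succ_iff_fderiv_of_isOpen hU]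
    exact ⟨hf, by simp, ih (differentiableOn_fderiv hU hf)⟩

end Analysis

/-! ### Averages along a coordinate and division by a coordinate -/

section Slide

variable {n : ℕ} {F : Type*} [NormedAddCommGroup F] [NormedSpace ℂ F]

/-- Multiplication of the `k`-th coordinate of `y - p` by `t`. -/
def slide (p : E n) (k : Fin (n + n)) (t : ℂ) (y : E n) : E n :=
  y + ((t - 1) * (y k - p k)) • stdVec k

/-- The linear part of `slide`. -/
def slideLin (k : Fin (n + n)) (t : ℂ) : E n →L[ℂ] E n :=
  ContinuousLinearMap.id ℂ (E n) + (t - 1) • (stdCov k).smulRight (stdVec k)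

theorem slideLin_apply (k : Fin (n + n)) (t : ℂ) (v : E n) :
    slideLin k t v = v + ((t - 1) * v k) • stdVec k := by
  simp [slideLin, stdCov, smul_smul]

theorem slide_eq (p : E n) (k : Fin (n + n)) (t : ℂ) (y : E n) :
    slide p k t y = slideLin k t y + (-((t - 1) * p k)) • stdVec k := by
  rw [slideLin_apply, slide, add_assoc, ← add_smul]
  ring_nf

theorem slide_apply_self (p : E n) (k : Fin (n + n)) (t : ℂ) (y : E n) :
    slide p k t y k = p k + t * (y k - p k) := by
  simp [slide, stdVec]; ring

theorem slide_apply_ne (p : E n) {k j : Fin (n + n)} (h : j ≠ k) (t : ℂ) (y : E n) :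
    slide p k t y j = y j := by
  simp [slide, stdVec, h]

theorem slide_one (p : E n) (k : Fin (n + n)) (y : E n) : slide p k 1 y = y := by simp [slide]

theorem slide_mem_ball {p y : E n} {r : ℝ} (hy : y ∈ Metric.ball p r) (k : Fin (n + n)) {t : ℂ}
    (ht : ‖t‖ ≤ 1) : slide p k t y ∈ Metric.ball p r := by
  rw [mem_ball_iff_norm] at *
  refine lt_of_le_of_lt ?_ hy
  rw [EuclideanSpace.norm_eq, EuclideanSpace.norm_eq]
  refine Real.sqrt_le_sqrt (Finset.sum_le_sum fun j _ => ?_)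
  refine pow_le_pow_left₀ (norm_nonneg _) ?_ 2
  by_cases hj : j = k
  · subst hj
    simp only [PiLp.sub_apply, slide_apply_self, add_sub_cancel_left, norm_mul]
    exact mul_le_of_le_one_left (norm_nonneg _) ht
  · simp [slide_apply_ne p hj]

theorem norm_ofReal_le_one {t : ℝ} (ht : t ∈ Set.uIcc (0 : ℝ) 1) : ‖(t : ℂ)‖ ≤ 1 := by
  rw [Set.uIcc_of_le zero_le_one] at ht
  rw [Complex.norm_real, Real.norm_eq_abs, abs_of_nonneg ht.1]
  exact ht.2

theorem continuous_slideLin (k : Fin (n + n)) :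
    Continuous fun t : ℝ => slideLin k (t : ℂ) := by
  unfold slideLin
  fun_prop

theorem differentiable_slide (p : E n) (k : Fin (n + n)) (t : ℂ) :
    Differentiable ℂ (slide p k t) := by
  have : slide p k t = fun y => slideLin k t y + (-((t - 1) * p k)) • stdVec k :=
    funext (slide_eq p k t)
  rw [this]
  fun_prop

/-- The average of a function over the segment along the coordinate `k` between a point and the
hyperplane through `p`. -/
def avg (p : E n) (k : Fin (n + n)) (f : E n → F) (y : E n) : F :=
  ∫ t in (0 : ℝ)..1, f (slide p k t y)

variable [FiniteDimensional ℂ F] {p : E n} {r : ℝ} {f : E n → F}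

theorem hasFDerivAt_avg (hf : DifferentiableOn ℂ f (Metric.ball p r)) (k : Fin (n + n)) {y : E n}
    (hy : y ∈ Metric.ball p r) :
    HasFDerivAt (avg p k f)
      (∫ t in (0 : ℝ)..1, (fderiv ℂ f (slide p k t y)).comp (slideLin k t)) y := by
  obtain ⟨r', hyr', hr'⟩ := exists_between (Metric.mem_ball.1 hy)
  have hsub : Metric.closedBall p r' ⊆ Metric.ball p r := Metric.closedBall_subset_ball hr'
  obtain ⟨C, hC⟩ := (isCompact_closedBall p r').exists_bound_of_continuousOn
    ((differentiableOn_fderiv Metric.isOpen_ball hf).continuousOn.mono hsub)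
  have := hasFDerivAt_intervalIntegral_affine Metric.isOpen_ball hf (a := 0) (b := 1)
    (c := fun _ => 1) continuous_const (continuous_slideLin k)
    (u := fun t : ℝ => (-(((t : ℂ) - 1) * p k)) • stdVec k) (by fun_prop) (y₀ := y)
    (s := Metric.ball p r') (Metric.isOpen_ball.mem_nhds hyr') (C := C) (by
      intro t ht z hz
      rw [← slide_eq]
      have h1 := slide_mem_ball hz k (norm_ofReal_le_one ht)
      exact ⟨hsub (Metric.ball_subset_closedBall h1), hC _ (Metric.ball_subset_closedBall h1)⟩)
  simp only [one_smul, ← slide_eq] at this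
  exact this

theorem differentiableOn_avg (hf : DifferentiableOn ℂ f (Metric.ball p r)) (k : Fin (n + n)) :
    DifferentiableOn ℂ (avg p k f) (Metric.ball p r) := fun _ hy =>
  (hasFDerivAt_avg hf k hy).differentiableAt.differentiableWithinAt

theorem continuousOn_slide_path (k : Fin (n + n)) {y : E n} (hy : y ∈ Metric.ball p r)
    {G : Type*} [TopologicalSpace G] {g : E n → G} (hg : ContinuousOn g (Metric.ball p r)) :
    ContinuousOn (fun t : ℝ => g (slide p k t y)) (Set.uIcc 0 1) := by
  refine hg.comp ?_ fun t ht => slide_mem_ball hy k (norm_ofReal_le_one ht)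
  unfold slide
  fun_prop

theorem fderiv_avg_apply (hf : DifferentiableOn ℂ f (Metric.ball p r)) (k : Fin (n + n)) {y : E n}
    (hy : y ∈ Metric.ball p r) (v : E n) :
    fderiv ℂ (avg p k f) y v =
      ∫ t in (0 : ℝ)..1, fderiv ℂ f (slide p k t y) (slideLin k t v) := by
  have : CompleteSpace F := FiniteDimensional.complete ℂ F
  rw [(hasFDerivAt_avg hf k hy).fderiv, ContinuousLinearMap.intervalIntegral_apply]
  · rfl
  · refine ContinuousOn.intervalIntegrable ?_
    exact (continuousOn_slide_path k hy
      (differentiableOn_fderiv Metric.isOpen_ball hf).continuousOn).clm_comp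
      (continuous_slideLin k).continuousOn

theorem fderiv_avg_of_ne (hf : DifferentiableOn ℂ f (Metric.ball p r)) {j k : Fin (n + n)}
    (hjk : j ≠ k) {y : E n} (hy : y ∈ Metric.ball p r) :
    fderiv ℂ (avg p k f) y (stdVec j) = avg p k (fun z => fderiv ℂ f z (stdVec j)) y := by
  rw [fderiv_avg_apply hf k hy, avg]
  refine intervalIntegral.integral_congr fun t _ => ?_
  have : slideLin k (t : ℂ) (stdVec j) = stdVec j := by
    rw [slideLin_apply]
    simp [stdVec, Ne.symm hjk]
  simp only [this]

theorem hasDerivAt_slide_path (hf : DifferentiableOn ℂ f (Metric.ball p r)) (k : Fin (n + n))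
    {y : E n} (hy : y ∈ Metric.ball p r) {t : ℝ} (ht : t ∈ Set.uIcc (0 : ℝ) 1) :
    HasDerivAt (fun t : ℝ => f (slide p k t y))
      ((y k - p k) • fderiv ℂ f (slide p k t y) (stdVec k)) t := by
  have h1 := (hf.differentiableAt (Metric.isOpen_ball.mem_nhds
    (slide_mem_ball hy k (norm_ofReal_le_one ht)))).hasFDerivAt
  have h2 : HasDerivAt (fun s : ℝ => slide p k s y) ((y k - p k) • stdVec k) t := by
    unfold slide
    have := ((((Complex.ofRealCLM.hasDerivAt (x := t)).sub_const 1).mul_const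
      (y k - p k)).smul_const (stdVec (n := n) k)).const_add y
    simpa using this
  have := (h1.restrictScalars ℝ).comp_hasDerivAt t h2
  rw [ContinuousLinearMap.coe_restrictScalars', map_smul] at this
  exact this

/-- The fundamental theorem of calculus along the coordinate `k`. -/
theorem smul_avg_fderiv (hf : DifferentiableOn ℂ f (Metric.ball p r)) (k : Fin (n + n))
    {y : E n} (hy : y ∈ Metric.ball p r) :
    (y k - p k) • avg p k (fun z => fderiv ℂ f z (stdVec k)) y = f y - f (slide p k 0 y) := by
  have : CompleteSpace F := FiniteDimensional.complete ℂ F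
  rw [avg, ← intervalIntegral.integral_smul,
    intervalIntegral.integral_eq_sub_of_hasDerivAt (f := fun t : ℝ => f (slide p k t y))
      (fun t ht => hasDerivAt_slide_path hf k hy ht)]
  · simp [slide_one]
  · refine ContinuousOn.intervalIntegrable ?_
    exact (continuousOn_slide_path k hy
      (differentiableOn_fderiv_apply Metric.isOpen_ball hf _).continuousOn).const_smul _

/-- `(y_k - p_k) avg f` is a primitive of `f` along the coordinate `k`. -/
theorem fderiv_smul_avg (hf : DifferentiableOn ℂ f (Metric.ball p r)) (k : Fin (n + n))
    {y : E n} (hy : y ∈ Metric.ball p r) :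
    fderiv ℂ (fun z => (z k - p k) • avg p k f z) y (stdVec k) = f y := by
  have : CompleteSpace F := FiniteDimensional.complete ℂ F
  have h1 : HasFDerivAt (fun z : E n => z k - p k) (stdCov k) y :=
    ((EuclideanSpace.proj k : E n →L[ℂ] ℂ).hasFDerivAt).sub_const _
  have h2 : fderiv ℂ (fun z => (z k - p k) • avg p k f z) y = _ :=
    (h1.smul (hasFDerivAt_avg hf k hy)).fderiv
  rw [h2]
  simp only [add_apply, smul_apply, ContinuousLinearMap.smulRight_apply]
  rw [← (hasFDerivAt_avg hf k hy).fderiv, fderiv_avg_apply hf k hy]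
  have hA : ∀ t : ℂ, slideLin k t (stdVec k) = t • stdVec k := by
    intro t
    rw [slideLin_apply]
    simp [stdVec, sub_smul]
  -- integrate `d/dt (t f(p_t))` over `[0, 1]`, where `p_t = slide p k t y`
  have h3 : ∀ t ∈ Set.uIcc (0 : ℝ) 1, HasDerivAt (fun t : ℝ => (t : ℂ) • f (slide p k t y))
      ((t : ℂ) • ((y k - p k) • fderiv ℂ f (slide p k t y) (stdVec k))
        + (1 : ℂ) • f (slide p k t y)) t := fun t ht =>
    (Complex.ofRealCLM.hasDerivAt (x := t)).smul (hasDerivAt_slide_path hf k hy ht)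
  have hc1 := continuousOn_slide_path k hy
    (differentiableOn_fderiv_apply Metric.isOpen_ball hf (stdVec k)).continuousOn
  have hc2 := continuousOn_slide_path k hy hf.continuousOn
  have hc3 : ContinuousOn (fun t : ℝ => (t : ℂ)) (Set.uIcc 0 1) := by fun_prop
  have h4 := intervalIntegral.integral_eq_sub_of_hasDerivAt h3
    (((hc3.smul (hc1.const_smul _)).add (hc2.const_smul _)).intervalIntegrable)
  rw [intervalIntegral.integral_add
    (f := fun t : ℝ => (t : ℂ) • ((y k - p k) • fderiv ℂ f (slide p k t y) (stdVec k)))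
    (g := fun t : ℝ => (1 : ℂ) • f (slide p k t y))
    ((hc3.smul (hc1.const_smul _)).intervalIntegrable)
    ((hc2.const_smul _).intervalIntegrable)] at h4
  simp only [Complex.ofReal_one, one_smul, slide_one, Complex.ofReal_zero, zero_smul,
    sub_zero] at h4
  rw [← h4]
  congr 1
  · rw [← intervalIntegral.integral_smul]
    refine intervalIntegral.integral_congr fun t _ => ?_
    simp only [hA, map_smul]
    rw [smul_comm]
  · rw [stdCov_stdVec]
    simp [avg]

/-- A holomorphic function that vanishes on a coordinate hyperplane is divisible by the
coordinate. -/
theorem exists_eq_coord_smul (hf : DifferentiableOn ℂ f (Metric.ball p r)) {k : Fin (n + n)}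
    (hk : p k = 0) (h0 : ∀ y ∈ Metric.ball p r, f (slide p k 0 y) = 0) :
    ∃ g : E n → F, DifferentiableOn ℂ g (Metric.ball p r) ∧ ∀ y ∈ Metric.ball p r,
      f y = y k • g y := by
  refine ⟨avg p k (fun z => fderiv ℂ f z (stdVec k)), differentiableOn_avg
    (differentiableOn_fderiv_apply Metric.isOpen_ball hf _) k, fun y hy => ?_⟩
  have := smul_avg_fderiv hf k hy
  rw [hk, sub_zero, h0 y hy, sub_zero] at this
  exact this.symm

end Slide

/-! ### Density and the identity theorem -/

section Identity

variable {n : ℕ}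

theorem dense_coord_ne_zero (S : Finset (Fin (n + n))) :
    Dense {y : E n | ∏ j ∈ S, y j ≠ 0} ∧ IsOpen {y : E n | ∏ j ∈ S, y j ≠ 0} := by
  classical
  induction S using Finset.induction_on with
  | empty => simp
  | insert k S hk ih =>
    have h1 : {y : E n | ∏ j ∈ insert k S, y j ≠ 0} = {y : E n | y k ≠ 0} ∩ {y | ∏ j ∈ S, y j ≠ 0} := by
      ext y
      simp only [Finset.prod_insert hk, Set.mem_ofPred_eq, Set.mem_inter_iff, mul_ne_zero_iff]
    have ho : IsOpen {y : E n | y k ≠ 0} :=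
      isOpen_compl_singleton.preimage (EuclideanSpace.proj (𝕜 := ℂ) k).continuous
    have hd : Dense {y : E n | y k ≠ 0} := by
      have h2 : {y : E n | y k ≠ 0} = ((LinearMap.ker (stdCov (n := n) k).toLinearMap : Set (E n)))ᶜ := by
        ext y
        simp [stdCov]
      rw [h2, ← interior_eq_empty_iff_dense_compl]
      by_contra hne
      have h3 := Submodule.eq_top_of_nonempty_interior' _ (Set.nonempty_iff_ne_empty.2 hne)
      have h4 : stdVec k ∈ LinearMap.ker (stdCov (n := n) k).toLinearMap := by rw [h3]; trivial
      simp [stdCov, stdVec] at h4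
    rw [h1]
    exact ⟨hd.inter_of_isOpen_left ih.1 ho, ho.inter ih.2⟩

/-- Continuous functions that agree off the coordinate hyperplanes agree everywhere. -/
theorem eqOn_of_coord_ne_zero {G : Type*} [TopologicalSpace G] [T2Space G] {U : Set (E n)}
    (hU : IsOpen U) {f g : E n → G} (hf : ContinuousOn f U) (hg : ContinuousOn g U)
    (S : Finset (Fin (n + n))) (h : ∀ y ∈ U, ∏ j ∈ S, y j ≠ 0 → f y = g y) : Set.EqOn f g U := by
  refine Set.EqOn.of_subset_closure (s := U ∩ {y | ∏ j ∈ S, y j ≠ 0}) (fun y hy => h y hy.1 hy.2)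
    hf hg Set.inter_subset_left ?_
  exact (dense_coord_ne_zero S).1.open_subset_closure_inter hU

/-- If `f(a) ≠ 0`, then `g` vanishes near `a`, and the identity theorem on the complex line through
`a` and `b` gives `g(b) = 0`. -/
theorem eq_zero_or_eq_zero_of_mul {U : Set (E n)} (hU : IsOpen U) (hc : Convex ℝ U)
    {f g : E n → ℂ} (hf : ContinuousOn f U) (hg : DifferentiableOn ℂ g U)
    (h : ∀ y ∈ U, f y * g y = 0) : (∀ y ∈ U, f y = 0) ∨ ∀ y ∈ U, g y = 0 := by
  by_contra! hcon
  obtain ⟨⟨a, ha, hfa⟩, b, hb, hgb⟩ := hcon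
  apply hgb
  have hnear : ∀ᶠ y in 𝓝 a, g y = 0 := by
    filter_upwards [hU.mem_nhds ha, (hf.continuousAt (hU.mem_nhds ha)).eventually_ne hfa]
      with y hy hy' using (mul_eq_zero.1 (h y hy)).resolve_left hy'
  have hline : Differentiable ℂ fun ζ : ℂ => a + ζ • (b - a) := by fun_prop
  set V : Set ℂ := (fun ζ : ℂ => a + ζ • (b - a)) ⁻¹' U
  have hV : IsOpen V := hU.preimage hline.continuous
  have hVc : Convex ℝ V := by
    intro x hx y hy s t hs ht hst
    have := hc hx hy hs ht hst
    change a + (s • x + t • y) • (b - a) ∈ U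
    convert this using 1
    have h1 : s • a + t • a = a := by rw [← add_smul, hst, one_smul]
    simp only [add_smul, smul_add, smul_assoc]
    rw [add_add_add_comm, h1]
  have h0 : (0 : ℂ) ∈ V := by simpa [V] using ha
  have h1 : (1 : ℂ) ∈ V := by simpa [V] using hb
  have han : AnalyticOnNhd ℂ (fun ζ : ℂ => g (a + ζ • (b - a))) V :=
    (hg.comp hline.differentiableOn fun ζ hζ => hζ).analyticOnNhd hV
  have := han.eqOn_zero_of_preconnected_of_eventuallyEq_zero hVc.isPreconnected h0 (by
    have ht : Tendsto (fun ζ : ℂ => a + ζ • (b - a)) (𝓝 0) (𝓝 a) := by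
      simpa using hline.continuous.tendsto 0
    exact ht.eventually hnear) h1
  simpa using this

theorem differentiableOn_finset_prod {ι : Type*} {U : Set (E n)} (S : Finset ι) {f : ι → E n → ℂ}
    (hf : ∀ i ∈ S, DifferentiableOn ℂ (f i) U) :
    DifferentiableOn ℂ (fun y => ∏ i ∈ S, f i y) U := by
  classical
  induction S using Finset.induction_on with
  | empty => simp
  | insert k S hk ih =>
    simp only [Finset.prod_insert hk]
    exact (hf k (by simp)).mul (ih fun i hi => hf i (Finset.mem_insert_of_mem hi))

/-- The ring of holomorphic functions on a convex open set has no zero divisors. -/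
theorem exists_eq_zero_of_prod {ι : Type*} {U : Set (E n)} (hU : IsOpen U) (hc : Convex ℝ U)
    (hne : U.Nonempty) (S : Finset ι) {f : ι → E n → ℂ}
    (hf : ∀ i ∈ S, DifferentiableOn ℂ (f i) U)
    (h : ∀ y ∈ U, ∏ i ∈ S, f i y = 0) : ∃ i ∈ S, ∀ y ∈ U, f i y = 0 := by
  classical
  induction S using Finset.induction_on with
  | empty =>
    obtain ⟨y, hy⟩ := hne
    simpa using h y hy
  | insert k S hk ih =>
    simp only [Finset.prod_insert hk] at h
    have hS : DifferentiableOn ℂ (fun y => ∏ i ∈ S, f i y) U :=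
      differentiableOn_finset_prod S fun i hi => hf i (Finset.mem_insert_of_mem hi)
    rcases eq_zero_or_eq_zero_of_mul hU hc (hf k (by simp)).continuousOn
      hS h with h1 | h1
    · exact ⟨k, by simp, h1⟩
    · obtain ⟨i, hi, h2⟩ := ih (fun i hi => hf i (by simp [hi])) h1
      exact ⟨i, by simp [hi], h2⟩

end Identity

/-! ### Pullback of forms by linear maps -/

section Pull

variable {n : ℕ}

/-- Pullback of a form by a linear map. -/
def pull (A : E n →L[ℂ] E n) : Ext n →ₗ[ℂ] Ext n where
  toFun w q := (w q).compContinuousLinearMap A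
  map_add' _ _ := rfl
  map_smul' _ _ := rfl

theorem pull_apply (A : E n →L[ℂ] E n) (w : Ext n) (q : ℕ) :
    pull A w q = (w q).compContinuousLinearMap A := rfl

theorem pull_pull (A B : E n →L[ℂ] E n) (w : Ext n) : pull A (pull B w) = pull (B.comp A) w := rfl

theorem pull_id (w : Ext n) : pull (ContinuousLinearMap.id ℂ (E n)) w = w := rfl

theorem ctr_pull (A : E n →L[ℂ] E n) (v : E n) (w : Ext n) :
    ctr v (pull A w) = pull A (ctr (A v) w) := by
  funext q
  rw [ctr_apply, pull_apply, pull_apply, ctr_apply]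
  ext u
  simp only [ContinuousAlternatingMap.curryLeft_apply_apply,
    ContinuousAlternatingMap.compContinuousLinearMap_apply]
  congr 1
  funext t
  refine Fin.cases rfl (fun t => ?_) t
  rfl

theorem pull_wdg (A : E n →L[ℂ] E n) (α : Cov n) (w : Ext n) :
    pull A (wdg α w) = wdg (α.comp A) (pull A w) := by
  funext q
  cases q with
  | zero => ext u; rfl
  | succ q =>
    rw [pull_apply, wdg_succ_apply, wdg_succ_apply, pull_apply]
    ext u
    simp only [ContinuousAlternatingMap.compContinuousLinearMap_apply,
      ContinuousAlternatingMap.alternatizeUncurryFin_apply]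
    rfl

theorem pull_extOne (A : E n →L[ℂ] E n) : pull A (extOne (n := n)) = extOne := by
  funext q
  cases q with
  | zero => rfl
  | succ q => rfl

theorem pull_wedgeList (A : E n →L[ℂ] E n) (l : List (Cov n)) :
    pull A (wedgeList l) = wedgeList (l.map fun α => α.comp A) := by
  induction l with
  | nil => exact pull_extOne A
  | cons α l ih =>
    change pull A (wdg α (wedgeList l)) = wdg (α.comp A) (wedgeList _)
    rw [pull_wdg, ih]

theorem Homog.pull {r : ℤ} {w : Ext n} (h : Homog r w) (A : E n →L[ℂ] E n) :
    Homog r (pull A w) := by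
  intro q hq
  rw [pull_apply, h q hq]
  rfl

/-- Contractions and linear maps: `ι_a (A^* w)` is `A^* (ι_{A a Aᵀ} w)`. -/
theorem contractM_pull (A : E n →L[ℂ] E n) (b : Fin (n + n) → Fin (n + n) → ℂ) (w : Ext n) :
    contractM b (pull A w) = pull A (contractM
      (fun i j => ∑ k, ∑ l, b k l * (A (stdVec k) i * A (stdVec l) j)) w) := by
  have hA : ∀ k, A (stdVec k) = ∑ i, A (stdVec k) i • stdVec i := fun k =>
    (sum_stdCov (A (stdVec k))).symm
  rw [contractM_apply, contractM_apply, map_smul]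
  congr 1
  simp only [ctr_pull, ← map_smul (pull A), ← map_sum (pull A)]
  congr 1
  have e : ∀ k l, ctr (A (stdVec l)) (ctr (A (stdVec k)) w)
      = ∑ i, ∑ j, (A (stdVec k) i * A (stdVec l) j) • ctr (stdVec j) (ctr (stdVec i) w) := by
    intro k l
    conv_lhs => rw [hA k, hA l]
    simp only [map_sum, map_smul, LinearMap.sum_apply, LinearMap.smul_apply, Finset.smul_sum,
      smul_smul]
  simp only [e, Finset.smul_sum, Finset.sum_smul, smul_smul]
  calc _ = ∑ k, ∑ i, ∑ l, ∑ j, (b k l * (A (stdVec k) i * A (stdVec l) j)) •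
        ctr (stdVec j) (ctr (stdVec i) w) :=
        Finset.sum_congr rfl fun k _ => Finset.sum_comm
    _ = ∑ i, ∑ k, ∑ l, ∑ j, (b k l * (A (stdVec k) i * A (stdVec l) j)) •
        ctr (stdVec j) (ctr (stdVec i) w) := Finset.sum_comm
    _ = _ := by
      refine Finset.sum_congr rfl fun i _ => ?_
      calc _ = ∑ k, ∑ j, ∑ l, (b k l * (A (stdVec k) i * A (stdVec l) j)) •
            ctr (stdVec j) (ctr (stdVec i) w) :=
            Finset.sum_congr rfl fun k _ => Finset.sum_comm
        _ = _ := Finset.sum_comm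

end Pull

/-! ### Calculus of holomorphic forms on open subsets of `ℂ²ⁿ` -/

section Calculus

variable {n : ℕ}

/-- All components of the form are differentiable at `y`. -/
def DAt (f : E n → Ext n) (y : E n) : Prop := ∀ q, DifferentiableAt ℂ (fun z => f z q) y

/-- The partial derivative of a form along the `j`-th coordinate. -/
def pd (j : Fin (n + n)) (f : E n → Ext n) (y : E n) : Ext n :=
  fun q => fderiv ℂ (fun z => f z q) y (stdVec j)

/-- The exterior derivative on open subsets of `ℂ²ⁿ`. -/
def extd (f : E n → Ext n) (y : E n) : Ext n := ∑ j, wdg (stdCov j) (pd j f y)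

theorem extDeriv_eq_extd (f : E n → Ext n) (y : E n) (q : ℕ) :
    extDeriv (fun z => f z q) y = extd f y (q + 1) := by
  rw [extd, Ext.sum_apply]
  simp only [wdg_succ_apply, extDeriv]
  conv_lhs => rw [clm_eq_sum (fderiv ℂ (fun z => f z q) y)]
  rw [← ContinuousAlternatingMap.alternatizeUncurryFinCLM_apply, map_sum]
  rfl

theorem DAt.congr {f g : E n → Ext n} {y : E n} (hf : DAt f y) (h : f =ᶠ[𝓝 y] g) : DAt g y :=
  fun q => (hf q).congr_of_eventuallyEq (by filter_upwards [h] with z hz; rw [hz])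

theorem pd_congr {f g : E n → Ext n} {y : E n} (h : f =ᶠ[𝓝 y] g) (j : Fin (n + n)) :
    pd j f y = pd j g y := by
  funext q
  have : (fun z => f z q) =ᶠ[𝓝 y] fun z => g z q := by filter_upwards [h] with z hz; rw [hz]
  simp only [pd, this.fderiv_eq]

theorem extd_congr {f g : E n → Ext n} {y : E n} (h : f =ᶠ[𝓝 y] g) : extd f y = extd g y := by
  simp only [extd, pd_congr h]

theorem DAt.add {f g : E n → Ext n} {y : E n} (hf : DAt f y) (hg : DAt g y) :
    DAt (fun z => f z + g z) y := fun q => (hf q).add (hg q)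

theorem DAt.smul {f : E n → Ext n} {c : E n → ℂ} {y : E n} (hc : DifferentiableAt ℂ c y)
    (hf : DAt f y) : DAt (fun z => c z • f z) y := fun q => hc.smul (hf q)

theorem DAt.const (w : Ext n) (y : E n) : DAt (fun _ => w) y := fun _ => differentiableAt_const _

theorem DAt.sum {ι : Type*} {s : Finset ι} {f : ι → E n → Ext n} {y : E n}
    (hf : ∀ i ∈ s, DAt (f i) y) : DAt (fun z => ∑ i ∈ s, f i z) y := fun q => by
  simp only [Ext.sum_apply]
  exact DifferentiableAt.fun_sum fun i hi => hf i hi q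

/-- Interior multiplication in a fixed degree as a continuous linear map. -/
def ctrCLM (v : E n) (q : ℕ) : (E n) [⋀^Fin (q + 1)]→L[ℂ] ℂ →L[ℂ] (E n) [⋀^Fin q]→L[ℂ] ℂ :=
  LinearMap.toContinuousLinearMap
    { toFun := fun w => w.curryLeft v
      map_add' := fun _ _ => rfl
      map_smul' := fun _ _ => rfl }

/-- Exterior multiplication in a fixed degree as a continuous linear map. -/
def wdgCLM (a : Cov n) (q : ℕ) : (E n) [⋀^Fin q]→L[ℂ] ℂ →L[ℂ] (E n) [⋀^Fin (q + 1)]→L[ℂ] ℂ :=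
  (ContinuousAlternatingMap.alternatizeUncurryFinCLM ℂ (E n) ℂ).comp
    (ContinuousLinearMap.smulRightL ℂ (E n) _ a)

theorem ctr_apply_eq (v : E n) (w : Ext n) (q : ℕ) : ctr v w q = ctrCLM v q (w (q + 1)) := rfl

theorem wdg_apply_eq (a : Cov n) (w : Ext n) (q : ℕ) : wdg a w (q + 1) = wdgCLM a q (w q) := rfl

theorem DAt.ctr {f : E n → Ext n} {y : E n} (hf : DAt f y) (v : E n) :
    DAt (fun z => ctr v (f z)) y := fun q => by
  simp only [ctr_apply_eq]
  exact (ctrCLM v q).differentiableAt.comp y (hf (q + 1))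

theorem DAt.wdg {f : E n → Ext n} {y : E n} (hf : DAt f y) (a : Cov n) :
    DAt (fun z => wdg a (f z)) y := fun q => by
  cases q with
  | zero => exact differentiableAt_const (0 : (E n) [⋀^Fin 0]→L[ℂ] ℂ)
  | succ q => exact (wdgCLM a q).differentiableAt.comp y (hf q)

theorem DAt.contractM {f : E n → Ext n} {a : E n → Fin (n + n) → Fin (n + n) → ℂ} {y : E n}
    (ha : ∀ i j, DifferentiableAt ℂ (fun z => a z i j) y) (hf : DAt f y) :
    DAt (fun z => contractM (a z) (f z)) y := by
  simp only [contractM_apply]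
  refine DAt.smul (differentiableAt_const _) (DAt.sum fun i _ => DAt.sum fun j _ => ?_)
  exact DAt.smul (ha i j) ((hf.ctr _).ctr _)

theorem DAt.pull {f : E n → Ext n} {G : E n → E n →L[ℂ] E n} {y : E n}
    (hG : DifferentiableAt ℂ G y) (hf : DAt f y) : DAt (fun z => pull (G z) (f z)) y := fun q =>
  (hf q).continuousAlternatingMapCompContinuousLinearMap hG

variable {f g : E n → Ext n} {y : E n}

theorem pd_add (hf : DAt f y) (hg : DAt g y) (j : Fin (n + n)) :
    pd j (fun z => f z + g z) y = pd j f y + pd j g y := by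
  funext q
  have := fderiv_fun_add (hf q) (hg q)
  simp only [pd, Ext.add_apply, this]
  rfl

theorem pd_const (w : Ext n) (j : Fin (n + n)) : pd j (fun _ => w) y = 0 := by
  funext q
  simp [pd]

theorem pd_smul {c : E n → ℂ} (hc : DifferentiableAt ℂ c y) (hf : DAt f y) (j : Fin (n + n)) :
    pd j (fun z => c z • f z) y = c y • pd j f y + fderiv ℂ c y (stdVec j) • f y := by
  funext q
  have := fderiv_fun_smul hc (hf q)
  simp only [pd, Ext.add_apply, Ext.smul_apply, this]
  rfl

theorem pd_sum {ι : Type*} {s : Finset ι} {f : ι → E n → Ext n} (hf : ∀ i ∈ s, DAt (f i) y)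
    (j : Fin (n + n)) : pd j (fun z => ∑ i ∈ s, f i z) y = ∑ i ∈ s, pd j (f i) y := by
  funext q
  have := fderiv_fun_sum (fun i hi => hf i hi q)
  simp only [pd, Ext.sum_apply, this, sum_apply]

theorem pd_ctr (hf : DAt f y) (v : E n) (j : Fin (n + n)) :
    pd j (fun z => ctr v (f z)) y = ctr v (pd j f y) := by
  funext q
  simp only [pd, ctr_apply_eq]
  have := ((ctrCLM v q).hasFDerivAt.comp y (hf (q + 1)).hasFDerivAt).fderiv
  exact congrArg (fun L => L (stdVec j)) this

theorem pd_wdg (hf : DAt f y) (a : Cov n) (j : Fin (n + n)) :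
    pd j (fun z => wdg a (f z)) y = wdg a (pd j f y) := by
  funext q
  cases q with
  | zero => simp [pd, wdg_zero_apply]
  | succ q =>
    simp only [pd, wdg_apply_eq]
    have := ((wdgCLM a q).hasFDerivAt.comp y (hf q).hasFDerivAt).fderiv
    exact congrArg (fun L => L (stdVec j)) this

theorem pd_contractM {a : E n → Fin (n + n) → Fin (n + n) → ℂ}
    (ha : ∀ i j, DifferentiableAt ℂ (fun z => a z i j) y) (hf : DAt f y) (l : Fin (n + n)) :
    pd l (fun z => contractM (a z) (f z)) y = contractM (a y) (pd l f y)
      + contractM (fun i j => fderiv ℂ (fun z => a z i j) y (stdVec l)) (f y) := by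
  simp only [contractM_apply]
  rw [pd_smul (differentiableAt_const _) (DAt.sum fun i _ => DAt.sum fun j _ =>
      DAt.smul (ha i j) ((hf.ctr _).ctr _)), pd_sum (fun i _ => DAt.sum fun j _ =>
      DAt.smul (ha i j) ((hf.ctr _).ctr _))]
  have h1 : ∀ i, pd l (fun z => ∑ j, a z i j • ctr (stdVec j) (ctr (stdVec i) (f z))) y
      = ∑ j, (a y i j • ctr (stdVec j) (ctr (stdVec i) (pd l f y))
        + fderiv ℂ (fun z => a z i j) y (stdVec l) • ctr (stdVec j) (ctr (stdVec i) (f y))) := by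
    intro i
    rw [pd_sum (fun j _ => DAt.smul (ha i j) ((hf.ctr _).ctr _))]
    refine Finset.sum_congr rfl fun j _ => ?_
    rw [pd_smul (ha i j) ((hf.ctr _).ctr _), pd_ctr (hf.ctr _), pd_ctr hf]
  simp only [h1, Finset.sum_add_distrib, smul_add]
  simp

theorem Homog.pd {r : ℤ} (h : ∀ᶠ z in 𝓝 y, Homog r (f z)) (j : Fin (n + n)) :
    Homog r (pd j f y) := by
  intro q hq
  have : (fun z => f z q) =ᶠ[𝓝 y] fun _ => 0 := by
    filter_upwards [h] with z hz using hz q hq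
  simp only [LogSymp.pd, this.fderiv_eq]
  simp

theorem Homog.extd {r : ℤ} (h : ∀ᶠ z in 𝓝 y, Homog r (f z)) : Homog (r + 1) (extd f y) :=
  Homog.sum _ fun j _ => (Homog.pd h j).wdg _

/-- Exterior derivative of a pullback of a function with values in forms by a closed
vector-valued one-form `G`. -/
theorem extd_pull {G : E n → E n →L[ℂ] E n} (hG : DifferentiableAt ℂ G y)
    (hsymm : ∀ u v, fderiv ℂ G y u v = fderiv ℂ G y v u) (hf : DAt f y) :
    extd (fun z => pull (G z) (f z)) y = ∑ j, wdg (stdCov j) (pull (G y) (pd j f y)) := by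
  funext q
  cases q with
  | zero => simp only [extd, Ext.sum_apply, wdg_zero_apply]
  | succ q =>
    rw [← extDeriv_eq_extd]
    have h1 : fderiv ℂ (fun z => pull (G z) (f z) q) y = _ :=
      fderiv_continuousAlternatingMapCompContinuousLinearMap (hf q) hG
    rw [extDeriv, h1, ContinuousAlternatingMap.alternatizeUncurryFin_add,
      ContinuousAlternatingMap.alternatizeUncurryFin_fderivCompContinuousLinearMap_eq_zero _ _
        hsymm, add_zero, Ext.sum_apply]
    conv_lhs => rw [clm_eq_sum ((ContinuousAlternatingMap.compContinuousLinearMapCLM (G y)).comp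
      (fderiv ℂ (fun z => f z q) y))]
    rw [← ContinuousAlternatingMap.alternatizeUncurryFinCLM_apply, map_sum]
    rfl

/-- All components of the form are holomorphic on `U`. -/
def HolExt (U : Set (E n)) (f : E n → Ext n) : Prop :=
  ∀ q, DifferentiableOn ℂ (fun z => f z q) U

theorem HolExt.dAt {U : Set (E n)} (hU : IsOpen U) (h : HolExt U f) (hy : y ∈ U) : DAt f y :=
  fun q => (h q).differentiableAt (hU.mem_nhds hy)

theorem holExt_of_dAt {U : Set (E n)} (h : ∀ z ∈ U, DAt f z) : HolExt U f :=
  fun q z hz => (h z hz q).differentiableWithinAt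

theorem HolExt.pd {U : Set (E n)} (hU : IsOpen U) (h : HolExt U f) (j : Fin (n + n)) :
    HolExt U (pd j f) := fun q => differentiableOn_fderiv_apply hU (h q) (stdVec j)

theorem HolExt.extd {U : Set (E n)} (hU : IsOpen U) (h : HolExt U f) : HolExt U (extd f) :=
  holExt_of_dAt fun _ hz => DAt.sum fun j _ => ((h.pd hU j).dAt hU hz).wdg _

theorem pd_comm {U : Set (E n)} (hU : IsOpen U) (h : HolExt U f) (hy : y ∈ U)
    (i j : Fin (n + n)) : pd i (pd j f) y = pd j (pd i f) y := by
  funext q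
  have h1 : ContDiffAt ℂ 2 (fun z => f z q) y :=
    (contDiffOn_of_differentiableOn hU (h q) 2).contDiffAt (hU.mem_nhds hy)
  have h2 := h1.isSymmSndFDerivAt (by simp)
  have h3 : DifferentiableAt ℂ (fderiv ℂ (fun z => f z q)) y :=
    (differentiableOn_fderiv hU (h q)).differentiableAt (hU.mem_nhds hy)
  have h4 : ∀ v, fderiv ℂ (fun z => fderiv ℂ (fun z => f z q) z v) y
      = (fderiv ℂ (fderiv ℂ (fun z => f z q)) y).flip v := by
    intro v
    have := (h3.hasFDerivAt.clm_apply (hasFDerivAt_const v y)).fderiv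
    rw [ContinuousLinearMap.comp_zero, zero_add] at this
    exact this
  simp only [LogSymp.pd, h4]
  exact h2 _ _

end Calculus

/-! ### Forms in holomorphic charts -/

section Charts

variable {n : ℕ} {X : Type} [TopologicalSpace X] [ChartedSpace (E n) X]
  [IsManifold 𝓘(ℂ, E n) ω X]

/-- `φ` is a holomorphic chart. -/
abbrev HolChart (φ : OpenPartialHomeomorph X (E n)) : Prop :=
  φ ∈ IsManifold.maximalAtlas 𝓘(ℂ, E n) ω X

theorem holChart_chartAt (x : X) : HolChart (chartAt (E n) x) :=
  IsManifold.chart_mem_maximalAtlas x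

theorem HolChart.mdifferentiable {φ : OpenPartialHomeomorph X (E n)} (h : HolChart φ) :
    φ.MDifferentiable 𝓘(ℂ, E n) 𝓘(ℂ, E n) :=
  ⟨(contMDiffOn_of_mem_maximalAtlas h).mdifferentiableOn (by simp),
    (contMDiffOn_symm_of_mem_maximalAtlas h).mdifferentiableOn (by simp)⟩

/-- The transition map between two charts. -/
def trn (φ φ' : OpenPartialHomeomorph X (E n)) (y : E n) : E n := φ' (φ.symm y)


variable {φ φ' : OpenPartialHomeomorph X (E n)} {y : E n} {x : X}

theorem contDiffAt_trn (h : HolChart φ) (h' : HolChart φ') (hy : y ∈ φ.target)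
    (hy' : φ.symm y ∈ φ'.source) : ContDiffAt ℂ ω (trn φ φ') y := by
  rw [← contMDiffAt_iff_contDiffAt]
  have h1 := (contMDiffOn_symm_of_mem_maximalAtlas h).contMDiffAt (φ.open_target.mem_nhds hy)
  have h2 := (contMDiffOn_of_mem_maximalAtlas h').contMDiffAt (φ'.open_source.mem_nhds hy')
  exact h2.comp y h1

theorem mdifferentiableAt_symm (h : HolChart φ) (hy : y ∈ φ.target) :
    MDifferentiableAt 𝓘(ℂ, E n) 𝓘(ℂ, E n) φ.symm y :=
  h.mdifferentiable.mdifferentiableAt_symm hy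

theorem tan_comp_tanSymm (h : HolChart φ) (h' : HolChart φ') (hy : y ∈ φ.target)
    (hy' : φ.symm y ∈ φ'.source) :
    (tan φ' (φ.symm y)).comp (tanSymm φ y) = fderiv ℂ (trn φ φ') y := by
  have := mfderiv_comp y (h'.mdifferentiable.mdifferentiableAt hy') (mdifferentiableAt_symm h hy)
  rw [← mfderiv_eq_fderiv]
  exact this.symm

theorem tanSymm_tan (h : HolChart φ) (hx : x ∈ φ.source) (v : E n) :
    tanSymm φ (φ x) (tan φ x v) = v :=
  DFunLike.congr_fun (h.mdifferentiable.symm_comp_deriv hx) v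

theorem tan_tanSymm (h : HolChart φ) (hx : x ∈ φ.source) (v : E n) :
    tan φ x (tanSymm φ (φ x) v) = v := by
  have := h.mdifferentiable.comp_symm_deriv (φ.map_source hx)
  rw [φ.left_inv hx] at this
  exact DFunLike.congr_fun this v

theorem tanSymm_eq (h : HolChart φ) (h' : HolChart φ') (hy : y ∈ φ.target)
    (hy' : φ.symm y ∈ φ'.source) :
    tanSymm φ y = (tanSymm φ' (trn φ φ' y)).comp (fderiv ℂ (trn φ φ') y) := by
  rw [← tan_comp_tanSymm h h' hy hy']
  ext1 v
  exact (tanSymm_tan h' hy' _).symm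

/-- The expression of a form in a chart. -/
def repE (φ : OpenPartialHomeomorph X (E n)) (w : Forms n X) (y : E n) : Ext n :=
  pull (tanSymm φ y) (w (φ.symm y))

theorem repE_trn (h : HolChart φ) (h' : HolChart φ') (hy : y ∈ φ.target)
    (hy' : φ.symm y ∈ φ'.source) (w : Forms n X) :
    repE φ w y = pull (fderiv ℂ (trn φ φ') y) (repE φ' w (trn φ φ' y)) := by
  rw [repE, repE, pull_pull, ← tanSymm_eq h h' hy hy', trn, φ'.left_inv hy']

theorem eventually_mem (hy : y ∈ φ.target) {W : Set X} (hW : W ∈ 𝓝 (φ.symm y)) :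
    ∀ᶠ z in 𝓝 y, z ∈ φ.target ∧ φ.symm z ∈ W :=
  Filter.Eventually.and (φ.open_target.mem_nhds hy) ((φ.continuousAt_symm hy).eventually hW)

theorem repE_trn_eventually (h : HolChart φ) (h' : HolChart φ') (hy : y ∈ φ.target)
    (hy' : φ.symm y ∈ φ'.source) (w : Forms n X) :
    repE φ w =ᶠ[𝓝 y] fun z => pull (fderiv ℂ (trn φ φ') z) (repE φ' w (trn φ φ' z)) := by
  filter_upwards [eventually_mem hy (φ'.open_source.mem_nhds hy')] with z hz
  exact repE_trn h h' hz.1 hz.2 w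

theorem differentiableAt_fderiv_trn (h : HolChart φ) (h' : HolChart φ') (hy : y ∈ φ.target)
    (hy' : φ.symm y ∈ φ'.source) : DifferentiableAt ℂ (fderiv ℂ (trn φ φ')) y :=
  ((contDiffAt_trn h h' hy hy').fderiv_right (m := 1) le_top).differentiableAt (by simp)

theorem differentiableAt_trn (h : HolChart φ) (h' : HolChart φ') (hy : y ∈ φ.target)
    (hy' : φ.symm y ∈ φ'.source) : DifferentiableAt ℂ (trn φ φ') y :=
  (contDiffAt_trn h h' hy hy').differentiableAt (by simp)

/-- Holomorphy does not depend on the chart. -/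
theorem dAt_repE_trn (h : HolChart φ) (h' : HolChart φ') (hx : x ∈ φ.source) (hx' : x ∈ φ'.source)
    {w : Forms n X} (hw : DAt (repE φ' w) (φ' x)) : DAt (repE φ w) (φ x) := by
  have hy := φ.map_source hx
  have hy' : φ.symm (φ x) ∈ φ'.source := by rwa [φ.left_inv hx]
  have hT : trn φ φ' (φ x) = φ' x := by rw [trn, φ.left_inv hx]
  refine DAt.congr ?_ (repE_trn_eventually h h' hy hy' w).symm
  refine DAt.pull (differentiableAt_fderiv_trn h h' hy hy') fun q => ?_
  refine DifferentiableAt.comp (f := trn φ φ') (g := fun z => repE φ' w z q) (φ x) ?_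
    (differentiableAt_trn h h' hy hy')
  rw [hT]
  exact hw q

theorem dAt_repE_of_holOn (h : HolChart φ) {W : Opens X} {w : Forms n X} (hw : HolOn W w)
    (hy : y ∈ φ.target) (hy' : φ.symm y ∈ W) : DAt (repE φ w) y := by
  have := dAt_repE_trn h (holChart_chartAt (φ.symm y)) (φ.map_target hy) (mem_chart_source _ _)
    (fun q => hw _ hy' q)
  rwa [φ.right_inv hy] at this

theorem holOn_of_dAt {W : Opens X} {w : Forms n X}
    (h : ∀ x ∈ W, ∃ φ : OpenPartialHomeomorph X (E n), HolChart φ ∧ x ∈ φ.source ∧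
      DAt (repE φ w) (φ x)) : HolOn W w := by
  intro x hx
  obtain ⟨φ, hφ, hxφ, hw⟩ := h x hx
  exact dAt_repE_trn (holChart_chartAt x) hφ (mem_chart_source _ x) hxφ hw

theorem dExt_eq (w : Forms n X) (x : X) : dExt w x =
    pull (tan (chartAt (E n) x) x) (extd (repE (chartAt (E n) x) w) (chartAt (E n) x x)) := by
  funext q
  cases q with
  | zero =>
    rw [pull_apply, extd, Ext.sum_apply]
    simp only [wdg_zero_apply, Finset.sum_const_zero]
    rfl
  | succ q =>
    rw [pull_apply, ← extDeriv_eq_extd]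
    rfl

/-- Exterior derivatives may be computed in every holomorphic chart. -/
theorem repE_dExt (h : HolChart φ) {w : Forms n X} (hy : y ∈ φ.target) (hw : DAt (repE φ w) y) :
    repE φ (dExt w) y = extd (repE φ w) y := by
  set ψ := chartAt (E n) (φ.symm y) with hψ
  have hψ' : HolChart ψ := holChart_chartAt _
  have hy' : φ.symm y ∈ ψ.source := mem_chart_source _ _
  have hw' : DAt (repE ψ w) (trn φ ψ y) := dAt_repE_trn hψ' h hy' (φ.map_target hy)
    (by rwa [φ.right_inv hy])
  rw [extd_congr (repE_trn_eventually h hψ' hy hy' w)]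
  rw [repE, dExt_eq, pull_pull, tan_comp_tanSymm h hψ' hy hy']
  funext q
  cases q with
  | zero =>
    rw [pull_apply, extd, Ext.sum_apply, extd, Ext.sum_apply]
    simp only [wdg_zero_apply, Finset.sum_const_zero]
    rfl
  | succ q =>
    rw [← extDeriv_eq_extd, pull_apply, ← extDeriv_eq_extd]
    exact (extDeriv_pullback (hw' q) (contDiffAt_trn h hψ' hy hy') (by simp)).symm

theorem HolOn.dExt {W : Opens X} {w : Forms n X} (hw : HolOn W w) : HolOn W (dExt w) := by
  refine holOn_of_dAt fun x hx => ⟨chartAt (E n) x, holChart_chartAt x, mem_chart_source _ x, ?_⟩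
  set φ := chartAt (E n) x
  have hφ : HolChart φ := holChart_chartAt x
  set U : Set (E n) := φ.target ∩ φ.symm ⁻¹' W
  have hU : IsOpen U := φ.isOpen_inter_preimage_symm W.isOpen
  have hmem : φ x ∈ U := ⟨mem_chart_target _ x, by simpa [φ] using hx⟩
  have h1 : HolExt U (repE φ w) := holExt_of_dAt fun y hy => dAt_repE_of_holOn hφ hw hy.1 hy.2
  refine DAt.congr ((h1.extd hU).dAt hU hmem) ?_
  filter_upwards [hU.mem_nhds hmem] with y hy
  exact (repE_dExt hφ hy.1 (dAt_repE_of_holOn hφ hw hy.1 hy.2)).symm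

theorem extd_extd {U : Set (E n)} (hU : IsOpen U) {f : E n → Ext n} (hf : HolExt U f)
    (hy : y ∈ U) : extd (extd f) y = 0 := by
  have h1 : ∀ i, pd i (extd f) y = ∑ j, wdg (stdCov j) (pd i (pd j f) y) := by
    intro i
    have : extd f = fun z => ∑ j, wdg (stdCov j) (pd j f z) := rfl
    rw [this, pd_sum fun j _ => ((hf.pd hU j).dAt hU hy).wdg _]
    exact Finset.sum_congr rfl fun j _ => pd_wdg ((hf.pd hU j).dAt hU hy) _ _
  have h2 : extd (extd f) y = -extd (extd f) y := by
    conv_lhs => rw [extd]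
    conv_rhs => rw [extd]
    simp only [h1, map_sum]
    conv_rhs => rw [Finset.sum_comm]
    rw [← Finset.sum_neg_distrib]
    refine Finset.sum_congr rfl fun i _ => ?_
    rw [← Finset.sum_neg_distrib]
    refine Finset.sum_congr rfl fun j _ => ?_
    rw [wdg_wdg (stdCov i) (stdCov j), pd_comm hU hf hy i j]
  rwa [eq_neg_iff_add_eq_zero, ← two_smul ℂ, smul_eq_zero_iff_right (two_ne_zero)] at h2

theorem eq_zero_of_repE (h : HolChart φ) (hx : x ∈ φ.source) {w : Forms n X}
    (hw : repE φ w (φ x) = 0) : w x = 0 := by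
  have h1 : pull (tan φ x) (repE φ w (φ x)) = w x := by
    rw [repE, pull_pull, φ.left_inv hx]
    have : (tanSymm φ (φ x)).comp (tan φ x) = ContinuousLinearMap.id ℂ (E n) := by
      ext1 v
      exact tanSymm_tan h hx v
    rw [this, pull_id]
  rw [← h1, hw, map_zero]

theorem dExt_dExt {W : Opens X} {w : Forms n X} (hw : HolOn W w) (hx : x ∈ W) :
    dExt (dExt w) x = 0 := by
  have hφ : HolChart (chartAt (E n) x) := holChart_chartAt x
  set φ := chartAt (E n) x
  refine eq_zero_of_repE hφ (mem_chart_source _ x) ?_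
  set U : Set (E n) := φ.target ∩ φ.symm ⁻¹' W
  have hU : IsOpen U := φ.isOpen_inter_preimage_symm W.isOpen
  have hmem : φ x ∈ U := ⟨mem_chart_target _ x, by simpa [φ] using hx⟩
  have h1 : HolExt U (repE φ w) := holExt_of_dAt fun y hy => dAt_repE_of_holOn hφ hw hy.1 hy.2
  rw [repE_dExt hφ hmem.1 (dAt_repE_of_holOn hφ hw.dExt hmem.1 hmem.2)]
  have h2 : repE φ (dExt w) =ᶠ[𝓝 (φ x)] extd (repE φ w) := by
    filter_upwards [hU.mem_nhds hmem] with y hy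
    exact repE_dExt hφ hy.1 (dAt_repE_of_holOn hφ hw hy.1 hy.2)
  rw [extd_congr h2, extd_extd hU h1 hmem]

theorem repE_add (w w' : Forms n X) (y : E n) : repE φ (w + w') y = repE φ w y + repE φ w' y :=
  map_add _ _ _

theorem repE_smul (c : ℂ) (w : Forms n X) (y : E n) : repE φ (c • w) y = c • repE φ w y :=
  map_smul (pull (tanSymm φ y)) c (w (φ.symm y))

end Charts

/-! ### The Poisson bivector in holomorphic charts -/

section PoissonCharts

/-- A bivector as a bilinear map on covectors. -/
def bivL {n : ℕ} (B : Bivec n) : Cov n →ₗ[ℂ] Cov n →ₗ[ℂ] ℂ :=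
  have u0 : ∀ a b c : Cov n, Function.update ![a, b] 0 c = ![c, b] := fun a b c => by
    funext t
    fin_cases t <;> rfl
  have u1 : ∀ a b c : Cov n, Function.update ![a, b] 1 c = ![a, c] := fun a b c => by
    funext t
    fin_cases t <;> rfl
  LinearMap.mk₂ ℂ (fun a b => B ![a, b])
    (fun a a' b => by simpa only [u0] using B.map_update_add ![a, b] 0 a a')
    (fun c a b => by simpa only [u0] using B.map_update_smul ![a, b] 0 c a)
    (fun a b b' => by simpa only [u1] using B.map_update_add ![a, b] 1 b b')
    (fun c a b => by simpa only [u1] using B.map_update_smul ![a, b] 1 c b)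

theorem bivL_apply {n : ℕ} (B : Bivec n) (a b : Cov n) : bivL B a b = B ![a, b] := rfl

theorem biv_swap {n : ℕ} (B : Bivec n) (a b : Cov n) : B ![a, b] = -B ![b, a] := by
  have := B.map_swap ![b, a] (i := 0) (j := 1) (by simp)
  rw [← this]
  congr 1
  funext t
  fin_cases t <;> rfl

variable {n : ℕ}

theorem sharp_stdCov {A : Fin (n + n) → Fin (n + n) → ℂ} (hA : ∀ i j, A i j = -A j i)
    (l : Fin (n + n)) : sharp A (stdCov l) = ∑ j, A l j • stdVec j := by
  simp only [sharp, stdCov_stdVec, smul_sub, Finset.sum_sub_distrib, ite_smul, one_smul,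
    zero_smul, smul_ite, smul_zero]
  simp only [Finset.sum_ite_eq, Finset.mem_univ, if_true]
  rw [Finset.sum_comm]
  simp only [Finset.sum_ite_eq, Finset.mem_univ, if_true]
  have : ∑ i, A i l • stdVec (n := n) i = -∑ i, A l i • stdVec i := by
    rw [← Finset.sum_neg_distrib]
    exact Finset.sum_congr rfl fun i _ => by rw [hA i l, neg_smul]
  rw [this, ← smul_sub, sub_neg_eq_add]
  module

/-- The Jacobi identity, as an identity between contractions. The iterated contraction of `w` with
three basis vectors is invariant under cyclic permutations of them, and by the Jacobi identity the
coefficients add up to zero over each cyclic orbit. -/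
theorem sum_ctr_sharp_contractM {A : Fin (n + n) → Fin (n + n) → ℂ}
    {D : Fin (n + n) → Fin (n + n) → Fin (n + n) → ℂ} (hA : ∀ i j, A i j = -A j i)
    (hJ : ∀ a b c, ∑ l, (A a l * D l b c + A b l * D l c a + A c l * D l a b) = 0) (w : Ext n) :
    ∑ l, ctr (sharp A (stdCov l)) (contractM (D l) w) = 0 := by
  have hs := fun l => sharp_stdCov hA l
  set Y : Fin (n + n) → Fin (n + n) → Fin (n + n) → Ext n := fun j b c =>
    ctr (stdVec j) (ctr (stdVec c) (ctr (stdVec b) w)) with hY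
  set T : Fin (n + n) → Fin (n + n) → Fin (n + n) → ℂ := fun j b c => ∑ l, A l j * D l b c with hT
  have hT0 : ∀ j b c, T j b c + T b c j + T c j b = 0 := by
    intro j b c
    simp only [hT, ← Finset.sum_add_distrib]
    rw [← neg_eq_zero, ← Finset.sum_neg_distrib, ← hJ j b c]
    refine Finset.sum_congr rfl fun l _ => ?_
    rw [hA j l, hA b l, hA c l]
    ring
  have hY1 : ∀ j b c, Y j b c = Y b c j := by
    intro j b c
    simp only [hY]
    rw [ctr_ctr (stdVec c) (stdVec b), map_neg, ctr_ctr (stdVec j) (stdVec b), neg_neg]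
  have hrel : ∀ f : Fin (n + n) → Fin (n + n) → Fin (n + n) → Ext n,
      ∑ j, ∑ b, ∑ c, f b c j = ∑ j, ∑ b, ∑ c, f j b c := by
    intro f
    rw [Finset.sum_comm]
    exact Finset.sum_congr rfl fun b _ => Finset.sum_comm
  have h1 : ∑ l, ctr (sharp A (stdCov l)) (contractM (D l) w)
      = (1 / 2 : ℂ) • ∑ j, ∑ b, ∑ c, T j b c • Y j b c := by
    simp only [hs, contractM_apply, map_smul, map_sum, LinearMap.sum_apply, LinearMap.smul_apply]
    rw [← Finset.smul_sum]
    congr 1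
    simp only [hT, Finset.sum_smul]
    have e : ∀ j b, ∑ c, ∑ l, (A l j * D l b c) • Y j b c
        = ∑ l, ∑ c, (A l j * D l b c) • Y j b c := fun j b => Finset.sum_comm
    have e2 : ∀ j, ∑ b, ∑ l, ∑ c, (A l j * D l b c) • Y j b c
        = ∑ l, ∑ b, ∑ c, (A l j * D l b c) • Y j b c := fun j => Finset.sum_comm
    simp only [e, e2]
    rw [Finset.sum_comm (γ := Fin (n + n)) (f := fun j l =>
      ∑ b, ∑ c, (A l j * D l b c) • Y j b c)]
    refine Finset.sum_congr rfl fun l _ => ?_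
    have e3 : ∀ b, ∑ c, ∑ j, (A l j * D l b c) • Y j b c
      = ∑ j, ∑ c, (A l j * D l b c) • Y j b c := fun b => Finset.sum_comm
    have e4 : ∑ j, ∑ b, ∑ c, (A l j * D l b c) • Y j b c
        = ∑ b, ∑ j, ∑ c, (A l j * D l b c) • Y j b c := Finset.sum_comm
    rw [e4]
    refine Finset.sum_congr rfl fun b _ => ?_
    rw [← e3]
    refine Finset.sum_congr rfl fun c _ => ?_
    simp only [Finset.smul_sum, smul_smul, hY]
    exact Finset.sum_congr rfl fun j _ => by rw [mul_comm]
  have h3 : (3 : ℂ) • ∑ j, ∑ b, ∑ c, T j b c • Y j b c = 0 := by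
    have e1 := hrel fun j b c => T j b c • Y j b c
    have e2 := hrel fun j b c => T b c j • Y b c j
    have : (3 : ℂ) • ∑ j, ∑ b, ∑ c, T j b c • Y j b c = ∑ j, ∑ b, ∑ c, T j b c • Y j b c
        + ∑ j, ∑ b, ∑ c, T b c j • Y b c j + ∑ j, ∑ b, ∑ c, T c j b • Y c j b := by
      rw [e2, e1]
      module
    rw [this, ← Finset.sum_add_distrib, ← Finset.sum_add_distrib]
    refine Finset.sum_eq_zero fun j _ => ?_
    rw [← Finset.sum_add_distrib, ← Finset.sum_add_distrib]
    refine Finset.sum_eq_zero fun b _ => ?_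
    rw [← Finset.sum_add_distrib, ← Finset.sum_add_distrib]
    refine Finset.sum_eq_zero fun c _ => ?_
    rw [← hY1 j b c, ← hY1 b c j, ← hY1 j b c, ← add_smul, ← add_smul, hT0, zero_smul]
  rw [h1, (smul_eq_zero.1 h3).resolve_left (by norm_num), smul_zero]

/-- The double commutator of contraction with a Poisson bivector and `d` vanishes: it is
contraction with the Schouten bracket `[Π, Π]`. In coordinates only the terms with one derivative
of the bivector survive, and they cancel by the Jacobi identity. -/
theorem contractM_contractM_extd {U : Set (E n)} (hU : IsOpen U)
    {a : E n → Fin (n + n) → Fin (n + n) → ℂ}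
    (ha : ∀ i j, DifferentiableOn ℂ (fun z => a z i j) U) {y : E n} (hy : y ∈ U)
    (hanti : ∀ i j, a y i j = -a y j i)
    (hJ : ∀ i j k, ∑ l, (a y i l * fderiv ℂ (fun z => a z j k) y (stdVec l)
      + a y j l * fderiv ℂ (fun z => a z k i) y (stdVec l)
      + a y k l * fderiv ℂ (fun z => a z i j) y (stdVec l)) = 0)
    {f : E n → Ext n} (hf : HolExt U f) :
    contractM (a y) (contractM (a y) (extd f y))
      - (2 : ℂ) • contractM (a y) (extd (fun z => contractM (a z) (f z)) y)
      + extd (fun z => contractM (a z) (contractM (a z) (f z))) y = 0 := by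
  have ha' : ∀ i j, DifferentiableAt ℂ (fun z => a z i j) y := fun i j =>
    (ha i j).differentiableAt (hU.mem_nhds hy)
  have hf' := hf.dAt hU hy
  have hCf : DAt (fun z => contractM (a z) (f z)) y := DAt.contractM ha' hf'
  set D : Fin (n + n) → Fin (n + n) → Fin (n + n) → ℂ := fun l i j =>
    fderiv ℂ (fun z => a z i j) y (stdVec l) with hD
  have h0 := sum_ctr_sharp_contractM (D := D) hanti hJ (f y)
  simp only [extd, map_sum]
  rw [Finset.smul_sum, ← Finset.sum_sub_distrib, ← Finset.sum_add_distrib]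
  have : ∀ l, contractM (a y) (contractM (a y) (wdg (stdCov l) (pd l f y)))
      - (2 : ℂ) • contractM (a y) (wdg (stdCov l) (pd l (fun z => contractM (a z) (f z)) y))
      + wdg (stdCov l) (pd l (fun z => contractM (a z) (contractM (a z) (f z))) y)
      = (-2 : ℂ) • ctr (sharp (a y) (stdCov l)) (contractM (D l) (f y)) := by
    intro l
    have hcomm : contractM (D l) (contractM (a y) (f y))
        = contractM (a y) (contractM (D l) (f y)) :=
      LinearMap.congr_fun (contractM_comm (D l) (a y)) (f y)
    rw [pd_contractM ha' hCf, pd_contractM ha' hf']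
    simp only [contractM_wdg, map_add, contractM_ctr]
    rw [hcomm]
    module
  simp only [this]
  rw [← Finset.smul_sum, h0, smul_zero]

variable {X : Type} [TopologicalSpace X] [ChartedSpace (E n) X] [IsManifold 𝓘(ℂ, E n) ω X]
  (P : Poisson n X) {φ : OpenPartialHomeomorph X (E n)} {x : X} {y : E n}

/-- The coefficients of the bivector in a chart. -/
def amat (φ : OpenPartialHomeomorph X (E n)) (y : E n) (i j : Fin (n + n)) : ℂ :=
  P.biv (φ.symm y) ![dF (coord φ i) (φ.symm y), dF (coord φ j) (φ.symm y)]

theorem amat_swap (φ : OpenPartialHomeomorph X (E n)) (y : E n) (i j : Fin (n + n)) :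
    amat P φ y i j = -amat P φ y j i := biv_swap _ _ _

theorem mdifferentiableOn_coord (h : HolChart φ) (i : Fin (n + n)) :
    MDifferentiableOn 𝓘(ℂ, E n) 𝓘(ℂ, ℂ) (coord φ i) φ.source := fun z hz =>
  (((EuclideanSpace.proj i : E n →L[ℂ] ℂ).mdifferentiableAt).comp z
    (h.mdifferentiable.mdifferentiableAt hz)).mdifferentiableWithinAt

theorem dF_coord (h : HolChart φ) (hx : x ∈ φ.source) (i : Fin (n + n)) :
    dF (coord φ i) x = (stdCov i).comp (tan φ x) := by
  have := mfderiv_comp x ((EuclideanSpace.proj i : E n →L[ℂ] ℂ).mdifferentiableAt)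
    (h.mdifferentiable.mdifferentiableAt hx)
  rw [ContinuousLinearMap.mfderiv_eq] at this
  exact this

theorem mdifferentiableAt_comp_symm (h : HolChart φ) {g : X → ℂ} (hy : y ∈ φ.target)
    (hg : MDifferentiableAt 𝓘(ℂ, E n) 𝓘(ℂ, ℂ) g (φ.symm y)) :
    DifferentiableAt ℂ (fun z => g (φ.symm z)) y :=
  mdifferentiableAt_iff_differentiableAt.1 (hg.comp y (mdifferentiableAt_symm h hy))

theorem mdifferentiableAt_comp_chart (h : HolChart φ) {g : E n → ℂ} (hx : x ∈ φ.source)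
    (hg : DifferentiableAt ℂ g (φ x)) :
    MDifferentiableAt 𝓘(ℂ, E n) 𝓘(ℂ, ℂ) (fun z => g (φ z)) x :=
  (mdifferentiableAt_iff_differentiableAt.2 hg).comp x (h.mdifferentiable.mdifferentiableAt hx)

theorem dF_eq_sum (h : HolChart φ) (hx : x ∈ φ.source) {g : X → ℂ}
    (hg : MDifferentiableAt 𝓘(ℂ, E n) 𝓘(ℂ, ℂ) g x) :
    dF (n := n) g x = ∑ l, fderiv ℂ (fun z => g (φ.symm z)) (φ x) (stdVec l) • dF (coord φ l) x := by
  have hx' : g =ᶠ[𝓝 x] (fun z => g (φ.symm z)) ∘ φ := by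
    filter_upwards [φ.open_source.mem_nhds hx] with z hz
    rw [Function.comp_apply, φ.left_inv hz]
  have hd : DifferentiableAt ℂ (fun z => g (φ.symm z)) (φ x) :=
    mdifferentiableAt_comp_symm h (φ.map_source hx) (by rwa [φ.left_inv hx])
  have h1 : dF (n := n) g x = (fderiv ℂ (fun z => g (φ.symm z)) (φ x)).comp (tan φ x) := by
    rw [dF, hx'.mfderiv_eq, ← mfderiv_eq_fderiv]
    exact mfderiv_comp x (mdifferentiableAt_iff_differentiableAt.2 hd)
      (h.mdifferentiable.mdifferentiableAt hx)
  rw [h1]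
  conv_lhs => rw [clm_eq_sum (fderiv ℂ (fun z => g (φ.symm z)) (φ x))]
  ext v
  simp only [dF_coord h hx]
  simp [mul_comm]

theorem repE_iota (h : HolChart φ) (hy : y ∈ φ.target) (w : Forms n X) :
    repE φ (iota P w) y = contractM (amat P φ y) (repE φ w y) := by
  have hA : ∀ v, tanSymm φ y (tan φ (φ.symm y) v) = v := by
    intro v
    have := tanSymm_tan h (φ.map_target hy) v
    rwa [φ.right_inv hy] at this
  rw [contractM_apply]
  funext q
  have := contract_comp (P.biv (φ.symm y)) (w (φ.symm y)) q (tanSymm φ y) (tan φ (φ.symm y)) hA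
  simp only [repE, amat, dF_coord h (φ.map_target hy), Ext.smul_apply, Ext.sum_apply, ctr_apply]
  exact this

theorem differentiableOn_amat (h : HolChart φ) (i j : Fin (n + n)) :
    DifferentiableOn ℂ (fun y => amat P φ y i j) φ.target := fun y hy => by
  have h1 := P.holo ⟨φ.source, φ.open_source⟩ _ _ (mdifferentiableOn_coord h i)
    (mdifferentiableOn_coord h j)
  have h2 := (h1 (φ.symm y) (φ.map_target hy)).mdifferentiableAt
    (φ.open_source.mem_nhds (φ.map_target hy))
  exact (mdifferentiableAt_comp_symm h hy h2).differentiableWithinAt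

theorem jacobi_amat (h : HolChart φ) (hy : y ∈ φ.target) (i j k : Fin (n + n)) :
    ∑ l, (amat P φ y i l * fderiv ℂ (fun z => amat P φ z j k) y (stdVec l)
      + amat P φ y j l * fderiv ℂ (fun z => amat P φ z k i) y (stdVec l)
      + amat P φ y k l * fderiv ℂ (fun z => amat P φ z i j) y (stdVec l)) = 0 := by
  have hx := φ.map_target hy
  have hb : ∀ a b c : Fin (n + n), P.biv (φ.symm y) ![dF (coord φ a) (φ.symm y),
      dF (fun z => P.biv z ![dF (coord φ b) z, dF (coord φ c) z]) (φ.symm y)]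
      = ∑ l, amat P φ y a l * fderiv ℂ (fun z => amat P φ z b c) y (stdVec l) := by
    intro a b c
    have h1 := P.holo ⟨φ.source, φ.open_source⟩ _ _ (mdifferentiableOn_coord h b)
      (mdifferentiableOn_coord h c)
    have h2 := (h1 (φ.symm y) hx).mdifferentiableAt (φ.open_source.mem_nhds hx)
    rw [dF_eq_sum h hx h2, ← bivL_apply, map_sum, φ.right_inv hy]
    refine Finset.sum_congr rfl fun l _ => ?_
    rw [map_smul, smul_eq_mul, mul_comm]
    rfl
  have := P.jacobi ⟨φ.source, φ.open_source⟩ _ _ _ (mdifferentiableOn_coord h i)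
    (mdifferentiableOn_coord h j) (mdifferentiableOn_coord h k) (φ.symm y) hx
  rw [hb, hb, hb, ← Finset.sum_add_distrib, ← Finset.sum_add_distrib] at this
  exact this

/-! ### The commutation relations between `ι_Π` and `d` -/

/-- Contraction with the bivector at a point. -/
def iotaAt (x : X) : Ext n →ₗ[ℂ] Ext n :=
  contractM fun i j => P.biv x ![stdCov i, stdCov j]

theorem iota_apply (w : Forms n X) (x : X) : iota P w x = iotaAt P x (w x) :=
  contract_eq_contractM _ _

theorem iota_iterate_apply (m : ℕ) (w : Forms n X) (x : X) :
    (iota P)^[m] w x = (iotaAt P x ^ m) (w x) := by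
  induction m with
  | zero => rfl
  | succ m ih =>
    rw [Function.iterate_succ_apply', iota_apply, ih, pow_succ', Module.End.mul_apply]

theorem HolOn.iota_iterate {W : Opens X} {w : Forms n X} (hw : HolOn W w) (m : ℕ) :
    HolOn W ((LogSymp.iota P)^[m] w) := by
  induction m with
  | zero => exact hw
  | succ m ih =>
    rw [Function.iterate_succ_apply']
    exact ih.iota P

/-- `[ι_Π, [ι_Π, d]] = 0`. -/
theorem iota_iota_dExt {W : Opens X} {w : Forms n X} (hw : HolOn W w) (hx : x ∈ W) :
    iota P (iota P (dExt w)) x - (2 : ℂ) • iota P (dExt (iota P w)) x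
      + dExt (iota P (iota P w)) x = 0 := by
  have hφ : HolChart (chartAt (E n) x) := holChart_chartAt x
  set φ := chartAt (E n) x
  refine eq_zero_of_repE (w := iota P (iota P (dExt w)) - (2 : ℂ) • iota P (dExt (iota P w))
      + dExt (iota P (iota P w))) hφ (mem_chart_source _ x) ?_
  set U : Set (E n) := φ.target ∩ φ.symm ⁻¹' W
  have hU : IsOpen U := φ.isOpen_inter_preimage_symm W.isOpen
  have hmem : φ x ∈ U := ⟨mem_chart_target _ x, by simpa [φ] using hx⟩
  have h1 : HolExt U (repE φ w) := holExt_of_dAt fun y hy => dAt_repE_of_holOn hφ hw hy.1 hy.2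
  have h2 : repE φ (iota P w) =ᶠ[𝓝 (φ x)] fun z => contractM (amat P φ z) (repE φ w z) := by
    filter_upwards [hU.mem_nhds hmem] with y hy using repE_iota P hφ hy.1 w
  have h3 : repE φ (iota P (iota P w)) =ᶠ[𝓝 (φ x)] fun z =>
      contractM (amat P φ z) (contractM (amat P φ z) (repE φ w z)) := by
    filter_upwards [hU.mem_nhds hmem] with y hy
    rw [repE_iota P hφ hy.1, repE_iota P hφ hy.1]
  have key := contractM_contractM_extd hU
    (fun i j => (differentiableOn_amat P hφ i j).mono Set.inter_subset_left) hmem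
    (amat_swap P φ _) (jacobi_amat P hφ hmem.1) h1
  rw [← extd_congr h2, ← extd_congr h3,
    ← repE_dExt hφ hmem.1 (dAt_repE_of_holOn hφ hw hmem.1 hmem.2),
    ← repE_dExt hφ hmem.1 (dAt_repE_of_holOn hφ (hw.iota P) hmem.1 hmem.2),
    ← repE_dExt hφ hmem.1 (dAt_repE_of_holOn hφ ((hw.iota P).iota P) hmem.1 hmem.2),
    ← repE_iota P hφ hmem.1, ← repE_iota P hφ hmem.1, ← repE_iota P hφ hmem.1] at key
  rw [← key, sub_eq_add_neg, ← neg_one_smul ℂ, repE_add, repE_add, repE_smul, repE_smul]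
  module

/-- `ι_Π^{m+1} d = (m + 1) ι_Π d ι_Π^m - m d ι_Π^{m+1}`: by induction on `m`, since
`[ι_Π, d]` commutes with `ι_Π`. -/
theorem iota_iterate_dExt {W : Opens X} {w : Forms n X} (hw : HolOn W w) (m : ℕ) (hx : x ∈ W) :
    (iota P)^[m + 1] (dExt w) x = ((m : ℂ) + 1) • iota P (dExt ((iota P)^[m] w)) x
      - (m : ℂ) • dExt ((iota P)^[m + 1] w) x := by
  induction m with
  | zero => simp
  | succ m ih =>
    have h1 := iota_iota_dExt P (hw.iota_iterate P m) hx
    have h2 : iota P (iota P (dExt ((iota P)^[m] w))) x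
        = (2 : ℂ) • iota P (dExt ((iota P)^[m + 1] w)) x - dExt ((iota P)^[m + 1 + 1] w) x := by
      rw [Function.iterate_succ_apply' _ (m + 1), Function.iterate_succ_apply' _ m]
      exact eq_sub_of_add_eq (sub_eq_zero.1 ((sub_add_eq_add_sub _ _ _).symm.trans h1))
    rw [Function.iterate_succ_apply', iota_apply, ih, map_sub, map_smul, map_smul, ← iota_apply,
      ← iota_apply, h2]
    generalize iota P (dExt ((iota P)^[m + 1] w)) x = u, dExt ((iota P)^[m + 1 + 1] w) x = v
    push_cast
    module

/-- `ι_Π^k δ_{k+1} = d ι_Π^{k+1}`. -/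
theorem iota_iterate_mdp {W : Opens X} {w : Forms n X} (hw : HolOn W w) (k : ℕ) (hx : x ∈ W) :
    (iota P)^[k] (mdp P (k + 1) w) x = dExt ((iota P)^[k + 1] w) x := by
  have e : mdp P (k + 1) w x = ((k : ℂ) + 1) • dExt (iota P w) x - (k : ℂ) • iota P (dExt w) x := by
    simp [mdp]
  rw [iota_iterate_apply, e, map_sub, map_smul, map_smul, ← iota_iterate_apply,
    ← iota_iterate_apply]
  cases k with
  | zero => simp
  | succ j =>
    have h1 := iota_iterate_dExt P (hw.iota P) j hx
    have h2 := iota_iterate_dExt P hw (j + 1) hx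
    rw [← Function.iterate_succ_apply, ← Function.iterate_succ_apply] at h1
    rw [h1, ← Function.iterate_succ_apply, h2]
    push_cast
    module

/-- `ι_Π^{m+1} d = δ_{-m} ι_Π^m`. -/
theorem iota_iterate_dExt_eq_mdp {W : Opens X} {w : Forms n X} (hw : HolOn W w) (m : ℕ)
    (hx : x ∈ W) : (iota P)^[m + 1] (dExt w) x = mdp P (-m) ((iota P)^[m] w) x := by
  rw [iota_iterate_dExt P hw m hx]
  simp only [mdp, Forms.sub_apply, Forms.smul_apply, ← Function.iterate_succ_apply' (iota P)]
  push_cast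
  module

end PoissonCharts

/-! ### Diagonal changes of frame -/

section Diagonal

variable {n : ℕ}

/-- The diagonal endomorphism with entries `c`. -/
def diag (c : Fin (n + n) → ℂ) : E n →L[ℂ] E n := ∑ j, c j • (stdCov j).smulRight (stdVec j)

theorem diag_apply (c : Fin (n + n) → ℂ) (v : E n) : diag c v = ∑ j, (c j * v j) • stdVec j := by
  simp [diag, stdCov, smul_smul]

theorem diag_stdVec (c : Fin (n + n) → ℂ) (j : Fin (n + n)) :
    diag c (stdVec j) = c j • stdVec j := by
  rw [diag_apply, Finset.sum_eq_single j]
  · simp [stdVec]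
  · intro i _ hi
    simp [stdVec, hi]
  · simp

theorem stdCov_comp_diag (c : Fin (n + n) → ℂ) (j : Fin (n + n)) :
    (stdCov j).comp (diag c) = c j • stdCov j := by
  ext v
  simp only [ContinuousLinearMap.comp_apply, diag_apply, map_sum, map_smul, stdCov_stdVec]
  simp [stdCov]

theorem diag_comp (c c' : Fin (n + n) → ℂ) :
    (diag c).comp (diag c') = diag fun j => c j * c' j := by
  ext v : 1
  rw [ContinuousLinearMap.comp_apply, diag_apply c' v, map_sum, diag_apply]
  refine Finset.sum_congr rfl fun j _ => ?_
  rw [map_smul, diag_stdVec, smul_smul]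
  congr 1
  ring

theorem diag_one : diag (fun _ : Fin (n + n) => 1) = ContinuousLinearMap.id ℂ (E n) := by
  ext v : 1
  rw [diag_apply]
  simpa [stdCov] using sum_stdCov v

theorem pull_diag_pull_diag {c c' : Fin (n + n) → ℂ} (h : ∀ j, c j * c' j = 1) (w : Ext n) :
    pull (diag c) (pull (diag c') w) = w := by
  rw [pull_pull, diag_comp, show (fun j => c' j * c j) = fun _ => 1 from
    funext fun j => (mul_comm _ _).trans (h j), diag_one, pull_id]

theorem pull_diag_vol (c : Fin (n + n) → ℂ) : pull (diag c) (vol n) = (∏ j, c j) • vol n := by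
  rw [(homog_vol.pull (diag c)).eq_topPart_smul]
  congr 1
  have : topPart (pull (diag c) (vol n)) = vol n (n + n) (fun j => c j • stdVec j) := by
    simp only [topPart, pull_apply, ContinuousAlternatingMap.compContinuousLinearMap_apply]
    congr 1
    funext j
    exact diag_stdVec c j
  rw [this]
  refine ((vol n (n + n)).toMultilinearMap.map_smul_univ c stdVec).trans ?_
  exact (congrArg (_ • ·) vol_stdVec).trans (mul_one _)

theorem contractM_pull_diag (c : Fin (n + n) → ℂ) (b : Fin (n + n) → Fin (n + n) → ℂ)
    (w : Ext n) : contractM b (pull (diag c) w)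
      = pull (diag c) (contractM (fun i j => c i * c j * b i j) w) := by
  rw [contractM_pull]
  congr 3
  funext i j
  simp only [diag_stdVec]
  rw [Finset.sum_eq_single i, Finset.sum_eq_single j]
  · simp [stdVec]
    ring
  · intro l _ hl
    simp [stdVec, hl.symm]
  · simp
  · intro k _ hk
    simp [stdVec, hk.symm]
  · simp

theorem contractM_pow_pull_diag (c : Fin (n + n) → ℂ) (b : Fin (n + n) → Fin (n + n) → ℂ) (m : ℕ)
    (w : Ext n) : (contractM b ^ m) (pull (diag c) w)
      = pull (diag c) ((contractM (fun i j => c i * c j * b i j) ^ m) w) := by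
  induction m with
  | zero => rfl
  | succ m ih =>
    rw [pow_succ', pow_succ', Module.End.mul_apply, Module.End.mul_apply, ih, contractM_pull_diag]

theorem pull_apply_zero (A : E n →L[ℂ] E n) (w : Ext n) : pull A w 0 ![] = w 0 ![] := by
  rw [pull_apply, ContinuousAlternatingMap.compContinuousLinearMap_apply]
  congr 1
  exact Subsingleton.elim _ _

theorem topPow_of_diag (c : Fin (n + n) → ℂ) (b : Fin (n + n) → Fin (n + n) → ℂ) :
    topPow (fun i j => c i * c j * b i j) = (∏ j, c j) * topPow b := by
  have := contractM_pow_pull_diag c b n (vol n)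
  rw [pull_diag_vol, map_smul] at this
  rw [topPow, ← pull_apply_zero (diag c), ← this]
  rfl

theorem wdg_apply_eq_zero {q : ℕ} (α : Cov n) (w : Ext n) (v : Fin q → E n)
    (h : ∀ a, α (v a) = 0) : wdg α w q v = 0 := by
  cases q with
  | zero => rfl
  | succ q =>
    rw [wdg_succ_apply, ContinuousAlternatingMap.alternatizeUncurryFin_apply]
    refine Finset.sum_eq_zero fun a _ => ?_
    simp [h a]

/-- The scale factors `y_j` (`j ∈ S`) and `1` (`j ∉ S`) of the logarithmic frame. -/
def theta (S : Finset (Fin (n + n))) (y : E n) (j : Fin (n + n)) : ℂ := if j ∈ S then y j else 1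

theorem theta_of_mem {S : Finset (Fin (n + n))} {j : Fin (n + n)} (h : j ∈ S) (y : E n) :
    theta S y j = y j := if_pos h

theorem theta_of_notMem {S : Finset (Fin (n + n))} {j : Fin (n + n)} (h : j ∉ S) (y : E n) :
    theta S y j = 1 := if_neg h

theorem prod_theta (S : Finset (Fin (n + n))) (y : E n) : ∏ j, theta S y j = ∏ j ∈ S, y j := by
  simp [theta, Finset.prod_ite_mem]

theorem theta_ne_zero {S : Finset (Fin (n + n))} {y : E n} (h : ∏ j ∈ S, y j ≠ 0)
    (j : Fin (n + n)) : theta S y j ≠ 0 := by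
  by_cases hj : j ∈ S
  · rw [theta_of_mem hj]
    exact Finset.prod_ne_zero_iff.1 h j hj
  · rw [theta_of_notMem hj]
    exact one_ne_zero

theorem differentiable_coord (j : Fin (n + n)) : Differentiable ℂ fun y : E n => y j :=
  (EuclideanSpace.proj j : E n →L[ℂ] ℂ).differentiable

theorem differentiable_theta (S : Finset (Fin (n + n))) (j : Fin (n + n)) :
    Differentiable ℂ fun y : E n => theta S y j := by
  by_cases hj : j ∈ S
  · simpa only [theta_of_mem hj] using differentiable_coord j
  · simpa only [theta_of_notMem hj] using differentiable_const (1 : ℂ)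

theorem differentiableAt_diag {c : E n → Fin (n + n) → ℂ} {y : E n}
    (h : ∀ j, DifferentiableAt ℂ (fun z => c z j) y) :
    DifferentiableAt ℂ (fun z => diag (c z)) y := by
  unfold diag
  exact DifferentiableAt.fun_sum fun j _ => (h j).smul_const _

end Diagonal

/-! ### The degeneracy divisor -/

section Divisor

variable {n : ℕ} {X : Type} [TopologicalSpace X] [ChartedSpace (E n) X]
  [IsManifold 𝓘(ℂ, E n) ω X] (P : Poisson n X) {φ φ' : OpenPartialHomeomorph X (E n)}
  {S S' : Finset (Fin (n + n))} {x p : X} {y : E n}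

theorem repE_iota_iterate (h : HolChart φ) (hy : y ∈ φ.target) (w : Forms n X) (m : ℕ) :
    repE φ ((iota P)^[m] w) y = (contractM (amat P φ y) ^ m) (repE φ w y) := by
  induction m with
  | zero => rfl
  | succ m ih =>
    rw [Function.iterate_succ_apply', repE_iota P h hy, ih, pow_succ', Module.End.mul_apply]

theorem coordVol_eq (h : HolChart φ) (hx : x ∈ φ.source) :
    coordVol φ x = pull (tan φ x) (vol n) := by
  rw [vol, pull_wedgeList, List.map_map, coordVol]
  congr 2
  funext i
  exact dF_coord h hx i

theorem pull_tanSymm_pull_tan (h : HolChart φ) (hx : x ∈ φ.source) (w : Ext n) :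
    pull (tanSymm φ (φ x)) (pull (tan φ x) w) = w := by
  rw [pull_pull]
  have : (tan φ x).comp (tanSymm φ (φ x)) = ContinuousLinearMap.id ℂ (E n) := by
    ext1 v
    exact tan_tanSymm h hx v
  rw [this, pull_id]

theorem topCoeff_eq (h : HolChart φ) (hx : x ∈ φ.source) :
    topCoeff P φ x = topPow (amat P φ (φ x)) := by
  have h1 := repE_iota_iterate P h (φ.map_source hx) (coordVol φ) n
  have h2 : repE φ (coordVol φ) (φ x) = vol n := by
    rw [repE, φ.left_inv hx, coordVol_eq h hx, pull_tanSymm_pull_tan h hx]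
  rw [h2] at h1
  rw [topPow, ← h1, repE, φ.left_inv hx, pull_apply_zero]
  rfl

/-- Nondegeneracy can be tested in any chart, or in the standard frame of the model space. -/
theorem topCoeff_ne_zero_iff (h : HolChart φ) (hx : x ∈ φ.source) :
    topCoeff P φ x ≠ 0 ↔ ((iotaAt P x ^ n) (vol n)) 0 ![] ≠ 0 := by
  have h1 := (homog_vol.pull (tan φ x)).eq_topPart_smul
  have h2 : topPart (pull (tan φ x) (vol n)) ≠ 0 := by
    intro h0
    rw [h0, zero_smul] at h1
    have h3 := pull_tanSymm_pull_tan h hx (vol n)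
    rw [h1, map_zero] at h3
    have h4 := vol_stdVec (n := n)
    rw [← h3] at h4
    exact zero_ne_one h4
  have h3 : topCoeff P φ x
      = topPart (pull (tan φ x) (vol n)) * ((iotaAt P x ^ n) (vol n)) 0 ![] := by
    rw [topCoeff, iota_iterate_apply, coordVol_eq h hx]
    conv_lhs => rw [h1, map_smul]
    rfl
  rw [h3]
  exact ⟨fun h => right_ne_zero_of_mul h, fun h => mul_ne_zero h2 h⟩

/-- In an adapted chart the complement of the symplectic locus is the union of the distinguished
coordinate hyperplanes. -/
theorem IsAdapted.mem_symplLocus_iff (h : IsAdapted P φ S) (hx : x ∈ φ.source) :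
    x ∈ symplLocus P ↔ ∏ j ∈ S, φ x j ≠ 0 := by
  obtain ⟨u, -, hu⟩ := h.2
  have key : ∀ z ∈ φ.source, topCoeff P (chartAt (E n) z) z ≠ 0 ↔ ∏ j ∈ S, φ z j ≠ 0 := by
    intro z hz
    rw [topCoeff_ne_zero_iff P (holChart_chartAt z) (mem_chart_source _ z),
      ← topCoeff_ne_zero_iff P h.1 hz, (hu z hz).2]
    exact ⟨fun h => right_ne_zero_of_mul h, fun h' => mul_ne_zero (hu z hz).1 h'⟩
  refine ⟨fun hx' => (key x hx).1 (interior_subset hx'), fun hx' => ?_⟩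
  rw [← SetLike.mem_coe]
  change x ∈ interior _
  rw [mem_interior_iff_mem_nhds]
  have hcont : ContinuousAt (fun z => ∏ j ∈ S, φ z j) x := by
    refine tendsto_finsetProd S fun j _ => ?_
    exact ((differentiable_coord j).continuous.continuousAt).comp (φ.continuousAt hx)
  filter_upwards [hcont.eventually_ne hx', φ.open_source.mem_nhds hx] with z h1 h2
  exact (key z h2).2 h1

theorem IsAdapted.symm_mem_symplLocus_iff (h : IsAdapted P φ S) (hy : y ∈ φ.target) :
    φ.symm y ∈ symplLocus P ↔ ∏ j ∈ S, y j ≠ 0 := by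
  rw [h.mem_symplLocus_iff P (φ.map_target hy), φ.right_inv hy]

/-- A Hamiltonian vector field multiplies the coefficient of `Πⁿ` by a function. -/
theorem exists_sum_amat_mul_fderiv (h : HolChart φ) (hy : y ∈ φ.target) (k : Fin (n + n)) :
    ∃ c : ℂ, ∑ l, amat P φ y k l * fderiv ℂ (fun z => topPow (amat P φ z)) y (stdVec l)
      = c * topPow (amat P φ y) := by
  obtain _ | m := n
  · exact k.elim0
  set A := amat P φ y with hA
  set D : Fin (m + 1 + (m + 1)) → Fin (m + 1 + (m + 1)) → Fin (m + 1 + (m + 1)) → ℂ := fun l i j =>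
    fderiv ℂ (fun z => amat P φ z i j) y (stdVec l) with hD
  have hd : ∀ i j, DifferentiableAt ℂ (fun z => amat P φ z i j) y := fun i j =>
    (differentiableOn_amat P h i j).differentiableAt (φ.open_target.mem_nhds hy)
  -- derivatives of the powers of the contraction operator
  have hpow : ∀ k : ℕ, DAt (fun z => (contractM (amat P φ z) ^ k) (vol (m + 1))) y ∧
      ∀ l, pd l (fun z => (contractM (amat P φ z) ^ (k + 1)) (vol (m + 1))) y
        = ((k : ℂ) + 1) • (contractM A ^ k) (contractM (D l) (vol (m + 1))) := by
    intro k
    induction k with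
    | zero =>
      refine ⟨DAt.const _ _, fun l => ?_⟩
      simp only [zero_add, pow_one, pow_zero]
      rw [pd_contractM hd (DAt.const _ _), pd_const, map_zero, zero_add]
      simp [hD]
    | succ k ih =>
      have e : ∀ k : ℕ, (fun z => (contractM (amat P φ z) ^ (k + 1)) (vol (m + 1)))
          = fun z => contractM (amat P φ z) ((contractM (amat P φ z) ^ k) (vol (m + 1))) := by
        intro k
        funext z
        rw [pow_succ', Module.End.mul_apply]
      have h1 : DAt (fun z => (contractM (amat P φ z) ^ (k + 1)) (vol (m + 1))) y := by
        rw [e]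
        exact DAt.contractM hd ih.1
      refine ⟨h1, fun l => ?_⟩
      rw [e (k + 1), pd_contractM hd h1, ih.2 l, map_smul, ← Module.End.mul_apply, ← pow_succ']
      have h2 : contractM (D l) ((contractM A ^ (k + 1)) (vol (m + 1)))
          = (contractM A ^ (k + 1)) (contractM (D l) (vol (m + 1))) :=
        LinearMap.congr_fun ((contractM_comm (D l) A).pow_right (k + 1)).eq (vol (m + 1))
      rw [← hA, h2]
      push_cast
      module
  have hfd : ∀ l, fderiv ℂ (fun z => topPow (amat P φ z)) y (stdVec l)
      = ((m : ℂ) + 1) * ((contractM A ^ m) (contractM (D l) (vol (m + 1)))) 0 ![] := by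
    intro l
    have h1 := congrArg (fun w : Ext (m + 1) => w 0 ![]) ((hpow m).2 l)
    have h2 : fderiv ℂ (fun z => topPow (amat P φ z)) y (stdVec l)
        = (pd l (fun z => (contractM (amat P φ z) ^ (m + 1)) (vol (m + 1))) y) 0 ![] := by
      have h3 := (hpow (m + 1)).1 0
      have h4 : HasFDerivAt (fun z => topPow (amat P φ z)) _ y :=
        ((ContinuousAlternatingMap.apply ℂ (E (m + 1)) ℂ
          (![] : Fin 0 → E (m + 1))).hasFDerivAt).comp y h3.hasFDerivAt
      rw [h4.fderiv]
      rfl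
    rw [h2]
    exact h1
  -- `G` has degree `2n - 1`, hence `ι_Π^n G = 0`; the commutator formula for `dy_k ∧ G` then gives
  -- the claim, with the top coefficient of `dy_k ∧ G` as the factor
  set G : Ext (m + 1) := ∑ l, wdg (stdCov l) (contractM (D l) (vol (m + 1))) with hG
  have hGh : Homog (((m + 1 : ℕ) : ℤ) + (m + 1 : ℕ) - 2 + 1) G :=
    Homog.sum _ fun l _ => (homog_vol.contractM _).wdg _
  have hC0 : (contractM A ^ (m + 1)) G = 0 :=
    (hGh.contractM_pow A (m + 1)).eq_zero_of_neg (by push_cast; omega)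
  have hJ := sum_ctr_sharp_contractM (D := D) (amat_swap P φ y) (jacobi_amat P h hy)
    (vol (m + 1))
  -- the commutator terms add up to zero by the Jacobi identity
  have hC1 : (contractM A ^ m) G
      = ∑ l, wdg (stdCov l) ((contractM A ^ m) (contractM (D l) (vol (m + 1)))) := by
    cases m with
    | zero => rfl
    | succ m =>
      rw [hG, map_sum]
      simp only [contractM_pow_wdg, Finset.sum_add_distrib]
      rw [← Finset.smul_sum]
      simp only [← contractM_pow_ctr]
      rw [← map_sum, hJ, map_zero, smul_zero, add_zero]
  refine ⟨topPart (wdg (stdCov k) G), ?_⟩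
  have h1 := contractM_pow_wdg A (stdCov k) m G
  rw [hC0, map_zero, zero_add, hC1] at h1
  have hk : Homog (((m + 1 : ℕ) : ℤ) + (m + 1 : ℕ)) (wdg (stdCov k) G) := by
    have := hGh.wdg (stdCov k)
    rwa [show (((m + 1 : ℕ) : ℤ) + (m + 1 : ℕ) - 2 + 1 + 1) = ((m + 1 : ℕ) : ℤ) + (m + 1 : ℕ) by
      ring] at this
  rw [hk.eq_topPart_smul, map_smul] at h1
  have h2 := congrArg (fun w : Ext (m + 1) => w 0 ![]) h1
  have h3 : ∀ v : E (m + 1), (ctr v (∑ l, wdg (stdCov l)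
      ((contractM A ^ m) (contractM (D l) (vol (m + 1)))))) 0 ![]
      = ∑ l, stdCov l v * ((contractM A ^ m) (contractM (D l) (vol (m + 1)))) 0 ![] := by
    intro v
    rw [map_sum, Ext.sum_apply, ContinuousAlternatingMap.sum_apply]
    refine Finset.sum_congr rfl fun l _ => ?_
    rw [ctr_wdg, Ext.sub_apply, wdg_zero_apply, sub_zero]
    rfl
  have hs : ∀ l, stdCov l (sharp A (stdCov k)) = A k l := by
    intro l
    rw [sharp_stdCov (amat_swap P φ y)]
    simp only [map_sum, map_smul, stdCov_stdVec, smul_eq_mul, mul_ite, mul_one, mul_zero,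
      Finset.sum_ite_eq, Finset.mem_univ, if_true]
    rfl
  calc ∑ l, A k l * fderiv ℂ (fun z => topPow (amat P φ z)) y (stdVec l)
      = ((m : ℂ) + 1) * ∑ l, stdCov l (sharp A (stdCov k))
          * ((contractM A ^ m) (contractM (D l) (vol (m + 1)))) 0 ![] := by
        rw [Finset.mul_sum]
        refine Finset.sum_congr rfl fun l _ => ?_
        rw [hfd, hs]
        ring
    _ = _ := by
        rw [← h3]
        push_cast at h2
        exact h2.symm

/-- The bivector is logarithmic: in the frame `y_j ∂_j` (`j ∈ S`), `∂_j` (`j ∉ S`) its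
coefficients are holomorphic, and it is nondegenerate. -/
theorem IsAdapted.exists_log_matrix (h : IsAdapted P φ S) {c : E n} {r : ℝ}
    (hball : Metric.ball c r ⊆ φ.target) (hc : ∀ j ∈ S, c j = 0) :
    ∃ B : E n → Fin (n + n) → Fin (n + n) → ℂ,
      (∀ i j, DifferentiableOn ℂ (fun y => B y i j) (Metric.ball c r)) ∧
      (∀ y ∈ Metric.ball c r, ∀ i j,
        amat P φ y i j = theta S y i * theta S y j * B y i j) ∧
      ∀ y ∈ Metric.ball c r, topPow (B y) ≠ 0 := by
  obtain ⟨u, hu, hu'⟩ := h.2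
  have hA : ∀ i j, DifferentiableOn ℂ (fun y => amat P φ y i j) (Metric.ball c r) := fun i j =>
    (differentiableOn_amat P h.1 i j).mono hball
  have hF : ∀ y ∈ Metric.ball c r, u (φ.symm y) ≠ 0 ∧
      topPow (amat P φ y) = u (φ.symm y) * ∏ j ∈ S, y j := by
    intro y hy
    have h1 := φ.map_target (hball hy)
    have h2 := hu' _ h1
    rw [topCoeff_eq P h.1 h1, φ.right_inv (hball hy)] at h2
    refine ⟨h2.1, h2.2.trans ?_⟩
    simp only [coord, φ.right_inv (hball hy)]
  have hud : DifferentiableOn ℂ (fun y => u (φ.symm y)) (Metric.ball c r) := fun y hy =>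
    (mdifferentiableAt_comp_symm h.1 (hball hy) ((hu _ (φ.map_target (hball hy))).mdifferentiableAt
      (φ.open_source.mem_nhds (φ.map_target (hball hy))))).differentiableWithinAt
  have hslide : ∀ (k : Fin (n + n)), ∀ y ∈ Metric.ball c r, slide c k 0 y ∈ Metric.ball c r :=
    fun k y hy => slide_mem_ball hy k (by simp)
  -- the coefficients `A k l` vanish on `y_l = 0`: there `A k l` times the derivative of `Πⁿ` along
  -- `y_l` vanishes, and the derivative is not zero off the other branches
  have hvan : ∀ k, ∀ l ∈ S, ∀ y ∈ Metric.ball c r, amat P φ (slide c l 0 y) k l = 0 := by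
    intro k l hl
    refine eqOn_of_coord_ne_zero Metric.isOpen_ball (f := fun y => amat P φ (slide c l 0 y) k l)
      (g := fun _ => 0) ((hA k l).continuousOn.comp
        (differentiable_slide c l 0).continuous.continuousOn (hslide l)) continuousOn_const
      (S.erase l) fun y hy hne => ?_
    set z := slide c l 0 y with hz
    have hzb : z ∈ Metric.ball c r := hslide l y hy
    have hzl : z l = 0 := by rw [hz, slide_apply_self, hc l hl]; ring
    obtain ⟨a, ha⟩ := exists_sum_amat_mul_fderiv P h.1 (hball hzb) k
    have hg : DifferentiableAt ℂ (fun y => u (φ.symm y) * ∏ j ∈ S.erase l, y j) z :=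
      (hud.differentiableAt (Metric.isOpen_ball.mem_nhds hzb)).mul
        ((differentiableOn_finset_prod (U := Set.univ) (S.erase l) fun j _ =>
          (differentiable_coord j).differentiableOn).differentiableAt Filter.univ_mem)
    have hev : (fun y => topPow (amat P φ y))
        =ᶠ[𝓝 z] fun y => (u (φ.symm y) * ∏ j ∈ S.erase l, y j) * y l := by
      filter_upwards [Metric.isOpen_ball.mem_nhds hzb] with y hy
      rw [(hF y hy).2, mul_assoc, Finset.prod_erase_mul _ _ hl]
    have hfd : ∀ m, fderiv ℂ (fun y => topPow (amat P φ y)) z (stdVec m)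
        = (u (φ.symm z) * ∏ j ∈ S.erase l, z j) * (if l = m then 1 else 0) := by
      intro m
      have h1 : HasFDerivAt (fun y : E n => y l) (stdCov l) z :=
        (EuclideanSpace.proj l : E n →L[ℂ] ℂ).hasFDerivAt
      rw [hev.fderiv_eq, (hg.hasFDerivAt.fun_mul h1).fderiv, hzl]
      simp [stdCov_stdVec]
    simp only [hfd, (hF z hzb).2] at ha
    rw [Finset.prod_eq_zero hl hzl, mul_zero, mul_zero] at ha
    simp only [mul_ite, mul_one, mul_zero, Finset.sum_ite_eq, Finset.mem_univ, if_true] at ha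
    refine (mul_eq_zero.1 ha).resolve_right (mul_ne_zero (hF z hzb).1 ?_)
    refine Finset.prod_ne_zero_iff.2 fun j hj => ?_
    rw [hz, slide_apply_ne _ (Finset.ne_of_mem_erase hj)]
    exact Finset.prod_ne_zero_iff.1 hne j hj
  have hdiv : ∀ (f : E n → ℂ) (k : Fin (n + n)), DifferentiableOn ℂ f (Metric.ball c r) →
      (k ∈ S → ∀ y ∈ Metric.ball c r, f (slide c k 0 y) = 0) →
      ∃ g : E n → ℂ, DifferentiableOn ℂ g (Metric.ball c r) ∧
        ∀ y ∈ Metric.ball c r, f y = theta S y k * g y := by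
    intro f k hf h0
    by_cases hk : k ∈ S
    · simpa only [theta_of_mem hk, smul_eq_mul] using exists_eq_coord_smul hf (hc k hk) (h0 hk)
    · exact ⟨f, hf, fun y _ => by rw [theta_of_notMem hk, one_mul]⟩
  have hex : ∀ i j, ∃ g : E n → ℂ, DifferentiableOn ℂ g (Metric.ball c r) ∧
      ∀ y ∈ Metric.ball c r, amat P φ y i j = theta S y i * theta S y j * g y := by
    intro i j
    by_cases hij : i = j
    · subst hij
      refine ⟨fun _ => 0, differentiableOn_const _, fun y _ => ?_⟩
      rw [mul_zero]
      exact self_eq_neg.1 (amat_swap P φ y i i)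
    obtain ⟨g, hg, hg'⟩ := hdiv _ j (hA i j) fun hj y hy => hvan i j hj y hy
    obtain ⟨f, hf, hf'⟩ := hdiv g i hg fun hi => by
      refine eqOn_of_coord_ne_zero Metric.isOpen_ball (f := fun y => g (slide c i 0 y))
        (g := fun _ => 0) (hg.continuousOn.comp
          (differentiable_slide c i 0).continuous.continuousOn (hslide i)) continuousOn_const
        S fun y hy hne => ?_
      have h1 := hg' _ (hslide i y hy)
      rw [amat_swap, hvan j i hi y hy, neg_zero] at h1
      refine (mul_eq_zero.1 h1.symm).resolve_left ?_
      by_cases hj : j ∈ S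
      · rw [theta_of_mem hj, slide_apply_ne _ (Ne.symm hij)]
        exact Finset.prod_ne_zero_iff.1 hne j hj
      · rw [theta_of_notMem hj]
        exact one_ne_zero
    refine ⟨f, hf, fun y hy => ?_⟩
    rw [hg' y hy, hf' y hy]
    ring
  choose B hB hB' using hex
  refine ⟨fun y i j => B i j y, hB, fun y hy i j => hB' i j y hy, fun y hy => ?_⟩
  have hcont : ContinuousOn (fun y => topPow fun i j => B i j y) (Metric.ball c r) := by
    have : ∀ k : ℕ, ∀ z ∈ Metric.ball c r,
        DAt (fun y => (contractM (fun i j => B i j y) ^ k) (vol n)) z := by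
      intro k
      induction k with
      | zero => exact fun z _ => DAt.const _ _
      | succ k ih =>
        intro z hz
        simp only [pow_succ', Module.End.mul_apply]
        exact DAt.contractM (fun i j => (hB i j).differentiableAt
          (Metric.isOpen_ball.mem_nhds hz)) (ih z hz)
    intro z hz
    exact (((ContinuousAlternatingMap.apply ℂ (E n) ℂ (![] : Fin 0 → E n)).continuous.continuousAt
      (x := _)).comp (this n z hz 0).continuousAt).continuousWithinAt
  -- the top power of `B` is the unit in `Πⁿ`, off the divisor and hence everywhere
  have hEq : Set.EqOn (fun y => topPow fun i j => B i j y) (fun y => u (φ.symm y))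
      (Metric.ball c r) := by
    refine eqOn_of_coord_ne_zero Metric.isOpen_ball hcont hud.continuousOn S fun y hy hne => ?_
    have h1 : topPow (amat P φ y) = (∏ j, theta S y j) * topPow fun i j => B i j y := by
      rw [← topPow_of_diag]
      congr 1
      funext i j
      exact hB' i j y hy
    rw [(hF y hy).2, prod_theta, mul_comm] at h1
    exact (mul_left_cancel₀ hne h1).symm
  rw [show topPow (fun i j => B i j y) = u (φ.symm y) from hEq hy]
  exact (hF y hy).1

end Divisor

/-! ### Comparison of adapted charts -/

section Comparison

variable {n : ℕ} {X : Type} [TopologicalSpace X] [ChartedSpace (E n) X]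
  [IsManifold 𝓘(ℂ, E n) ω X] (P : Poisson n X) {φ φ' : OpenPartialHomeomorph X (E n)}
  {S S' : Finset (Fin (n + n))} {x p : X} {y : E n}

/-- An adapted chart can be shrunk so that all its distinguished coordinates vanish at a given
point. -/
theorem IsAdapted.exists_centered (h : IsAdapted P φ S) (hp : p ∈ φ.source) :
    ∃ (φ' : OpenPartialHomeomorph X (E n)) (S' : Finset (Fin (n + n))), IsAdapted P φ' S' ∧
      p ∈ φ'.source ∧ ⇑φ' = φ ∧ ∀ j, j ∈ S' ↔ j ∈ S ∧ φ p j = 0 := by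
  classical
  obtain ⟨u, hu, hu'⟩ := h.2
  set T := S.filter fun j => φ p j ≠ 0 with hT
  set s : Set X := φ.source ∩ φ ⁻¹' {y | ∏ j ∈ T, y j ≠ 0} with hs
  have hso : IsOpen s := φ.isOpen_inter_preimage (dense_coord_ne_zero T).2
  have hsrc : (φ.restr s).source = s := by
    rw [φ.restr_source' s hso, Set.inter_eq_right.2 Set.inter_subset_left]
  refine ⟨φ.restr s, S.filter fun j => φ p j = 0, ⟨restr_mem_maximalAtlas _ h.1 hso,
    fun x => u x * ∏ j ∈ T, φ x j, ?_, ?_⟩, ?_, rfl, fun j => Finset.mem_filter⟩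
  · rw [hsrc]
    intro x hx
    refine MDifferentiableAt.mdifferentiableWithinAt (MDifferentiableAt.mul
      ((hu x hx.1).mdifferentiableAt (φ.open_source.mem_nhds hx.1)) ?_)
    exact mdifferentiableAt_comp_chart (g := fun y => ∏ j ∈ T, y j) h.1 hx.1
      ((differentiableOn_finset_prod (U := Set.univ) T fun j _ =>
        (differentiable_coord j).differentiableOn).differentiableAt Filter.univ_mem)
  · rw [hsrc]
    intro x hx
    refine ⟨mul_ne_zero (hu' x hx.1).1 hx.2, (hu' x hx.1).2.trans ?_⟩
    rw [mul_assoc]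
    congr 1
    exact ((mul_comm _ _).trans (Finset.prod_filter_mul_prod_filter_not S _ _)).symm
  · rw [hsrc]
    exact ⟨hp, Finset.prod_ne_zero_iff.2 fun j hj => (Finset.mem_filter.1 hj).2⟩

/-- Distinct coordinate hyperplanes through a point have distinct germs. -/
theorem eq_of_coord_germ_eq (hp : p ∈ φ.source) {k k' : Fin (n + n)} (hk : φ p k = 0)
    (h : ∀ᶠ x in 𝓝 p, φ x k = 0 ↔ φ x k' = 0) : k = k' := by
  by_contra hne
  have hk' : φ p k' = 0 := h.self_of_nhds.1 hk
  have h1 : ∀ᶠ y in 𝓝 (φ p), y k = 0 ↔ y k' = 0 := by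
    have h2 : ∀ᶠ y in 𝓝 (φ p), y ∈ φ.target ∧ φ.symm y ∈ {x | φ x k = 0 ↔ φ x k' = 0} :=
      eventually_mem (φ.map_source hp) (by rw [φ.left_inv hp]; exact h)
    filter_upwards [h2] with y hy
    have : φ (φ.symm y) k = 0 ↔ φ (φ.symm y) k' = 0 := hy.2
    rwa [φ.right_inv hy.1] at this
  have h2 : Tendsto (fun t : ℂ => φ p + t • stdVec k') (𝓝[≠] 0) (𝓝 (φ p)) := by
    have : Continuous fun t : ℂ => φ p + t • stdVec k' := by fun_prop
    have h3 := this.tendsto 0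
    simp only [zero_smul, add_zero] at h3
    exact h3.mono_left nhdsWithin_le_nhds
  obtain ⟨t, ht, ht0⟩ := ((h2.eventually h1).and self_mem_nhdsWithin).exists
  apply ht0
  have h3 : (φ p + t • stdVec k') k = 0 := by simp [hk, stdVec, hne]
  have h4 := ht.1 h3
  simpa [hk', stdVec] using h4

/-- The coordinates of two adapted charts which vanish on the same branch of the divisor differ by
an invertible factor, and every branch is seen in each chart. -/
theorem IsAdapted.exists_unit (h : IsAdapted P φ S) (h' : IsAdapted P φ' S') (hp : p ∈ φ.source)
    (hp' : p ∈ φ'.source) {k : Fin (n + n)} (hk : k ∈ S) (hk0 : φ p k = 0) :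
    ∃ j ∈ S', φ' p j = 0 ∧ ∃ u : X → ℂ, ∀ᶠ x in 𝓝 p,
      MDifferentiableAt 𝓘(ℂ, E n) 𝓘(ℂ, ℂ) u x ∧ u x ≠ 0 ∧ φ' x j = u x * φ x k := by
  set c := φ p with hc
  have hct : c ∈ φ.target := φ.map_source hp
  have hcp : φ.symm c = p := φ.left_inv hp
  obtain ⟨r, hr, hball⟩ := Metric.mem_nhds_iff.1
    (eventually_mem hct (φ'.open_source.mem_nhds (by rwa [hcp])))
  have hcb : c ∈ Metric.ball c r := Metric.mem_ball_self hr
  set f : Fin (n + n) → E n → ℂ := fun j y => trn φ φ' y j with hf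
  have hfd : ∀ j, DifferentiableOn ℂ (f j) (Metric.ball c r) := fun j y hy =>
    ((EuclideanSpace.proj j : E n →L[ℂ] ℂ).differentiableAt.comp y (differentiableAt_trn h.1 h'.1
      (hball hy).1 (hball hy).2)).differentiableWithinAt
  have hslide : ∀ y ∈ Metric.ball c r, slide c k 0 y ∈ Metric.ball c r :=
    fun y hy => slide_mem_ball hy k (by simp)
  -- the equation of the divisor in the second chart vanishes on `y_k = 0`, so one of its factors does
  obtain ⟨j, hj, hj0⟩ := exists_eq_zero_of_prod Metric.isOpen_ball (convex_ball c r) ⟨c, hcb⟩ S'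
    (f := fun j y => f j (slide c k 0 y)) (fun j _ => (hfd j).comp
      (differentiable_slide c k 0).differentiableOn hslide) (fun y hy => by
        have hy' := hball (hslide y hy)
        by_contra hne
        have h1 := (h'.mem_symplLocus_iff P hy'.2).2 hne
        rw [h.symm_mem_symplLocus_iff P hy'.1] at h1
        refine h1 (Finset.prod_eq_zero hk ?_)
        rw [slide_apply_self, hk0]
        ring)
  obtain ⟨g, hg, hg'⟩ := exists_eq_coord_smul (hfd j) hk0 hj0
  have hslc : slide c k 0 c = c := by simp [slide, hk0]
  refine ⟨j, hj, ?_, fun x => g (φ x), ?_⟩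
  · have := hj0 c hcb
    simp only [hslc, hf, trn, hcp] at this
    exact this
  -- otherwise the differential of the coordinate `j` of `φ'` would vanish at `p`
  have hgc : g c ≠ 0 := by
    intro h0
    have e1 : HasFDerivAt (f j) ((stdCov j).comp (fderiv ℂ (trn φ φ') c)) c :=
      (EuclideanSpace.proj j : E n →L[ℂ] ℂ).hasFDerivAt.comp c (differentiableAt_trn h.1 h'.1
        hct (by rwa [hcp])).hasFDerivAt
    have e2 : HasFDerivAt (f j) (c k • fderiv ℂ g c + (stdCov k).smulRight (g c)) c := by
      have h1 : HasFDerivAt (fun y : E n => y k) (stdCov k) c :=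
        (EuclideanSpace.proj k : E n →L[ℂ] ℂ).hasFDerivAt
      refine (h1.smul (hg.differentiableAt (Metric.isOpen_ball.mem_nhds hcb)).hasFDerivAt
        ).congr_of_eventuallyEq ?_
      filter_upwards [Metric.isOpen_ball.mem_nhds hcb] with y hy using hg' y hy
    have e3 := DFunLike.congr_fun (e1.unique e2)
      (tan φ p (tanSymm φ' (φ' p) (stdVec j)))
    rw [← tan_comp_tanSymm h.1 h'.1 hct (by rwa [hcp]), hcp] at e3
    simp only [ContinuousLinearMap.comp_apply, hk0, h0] at e3
    rw [hc, tanSymm_tan h.1 hp, tan_tanSymm h'.1 hp', stdCov_stdVec] at e3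
    simp at e3
  have hev : ∀ᶠ x in 𝓝 p, x ∈ φ.source ∧ φ x ∈ Metric.ball c r ∧ g (φ x) ≠ 0 := by
    refine Filter.Eventually.and (φ.open_source.mem_nhds hp) (Filter.Eventually.and
      ((φ.continuousAt hp).eventually (Metric.isOpen_ball.mem_nhds hcb)) ?_)
    have : ContinuousAt (fun x => g (φ x)) p := ContinuousAt.comp (f := φ) (g := g)
      (hg.differentiableAt (Metric.isOpen_ball.mem_nhds hcb)).continuousAt (φ.continuousAt hp)
    exact this.eventually_ne hgc
  filter_upwards [hev] with x hx
  refine ⟨mdifferentiableAt_comp_chart h.1 hx.1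
    (hg.differentiableAt (Metric.isOpen_ball.mem_nhds hx.2.1)), hx.2.2, ?_⟩
  have := hg' _ hx.2.1
  simp only [hf, trn, φ.left_inv hx.1, smul_eq_mul] at this
  rw [this, mul_comm]

/-- The change of logarithmic frame between two adapted charts is holomorphic. At `p` it maps the
vectors `y_k ∂_k` to each other according to the branches of the divisor. -/
theorem IsAdapted.exists_frame_change (h : IsAdapted P φ S) (h' : IsAdapted P φ' S')
    (hp : p ∈ φ.source) (hp' : p ∈ φ'.source) :
    ∃ M : E n → E n →L[ℂ] E n, (∀ᶠ y in 𝓝 (φ p), DifferentiableAt ℂ M y ∧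
      (diag (theta S' (trn φ φ' y))).comp (M y)
        = (fderiv ℂ (trn φ φ') y).comp (diag (theta S y))) ∧
      ∀ k ∈ S, φ p k = 0 → ∀ j ∈ S', (∀ᶠ x in 𝓝 p, φ x k = 0 ↔ φ' x j = 0) →
        M (φ p) (stdVec k) = stdVec j := by
  classical
  set c := φ p with hc
  have hct : c ∈ φ.target := φ.map_source hp
  have hcp : φ.symm c = p := φ.left_inv hp
  have htc : trn φ φ' c = φ' p := congrArg φ' hcp
  have hdom : ∀ᶠ y in 𝓝 c, y ∈ φ.target ∧ φ.symm y ∈ φ'.source :=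
    eventually_mem hct (φ'.open_source.mem_nhds (by rwa [hcp]))
  have hD : ∀ᶠ y in 𝓝 c, DifferentiableAt ℂ (fun y => (fderiv ℂ (trn φ φ') y).comp
      (diag (theta S y))) y := by
    filter_upwards [hdom] with y hy
    exact (differentiableAt_fderiv_trn h.1 h'.1 hy.1 hy.2).clm_comp
      (differentiableAt_diag fun j => (differentiable_theta S j).differentiableAt)
  have hDj : ∀ j, ∀ᶠ y in 𝓝 c, DifferentiableAt ℂ (fun y => (stdCov j).comp
      ((fderiv ℂ (trn φ φ') y).comp (diag (theta S y)))) y := by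
    intro j
    filter_upwards [hD] with y hy
    exact (differentiableAt_const _).clm_comp hy
  have hfj : ∀ j, ∀ᶠ y in 𝓝 c, DifferentiableAt ℂ (fun y => trn φ φ' y j) y := by
    intro j
    filter_upwards [hdom] with y hy
    exact (EuclideanSpace.proj j : E n →L[ℂ] ℂ).differentiableAt.comp y
      (differentiableAt_trn h.1 h'.1 hy.1 hy.2)
  have hzero : ∀ k ∈ S, c k = 0 → diag (theta S c) (stdVec k) = 0 := by
    intro k hk hk0
    rw [diag_stdVec, theta_of_mem hk, hk0, zero_smul]
  -- the rows of the matrix are `dy'_j` for `j ∉ S'` and `dlog y'_j` for `j ∈ S'` in the frame of the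
  -- first chart; in the second case `y'_j` is invertible at `p` or a unit times some `y_k`
  have hrow : ∀ j, ∃ R : E n → Cov n, (∀ᶠ y in 𝓝 c, DifferentiableAt ℂ R y ∧
      theta S' (trn φ φ' y) j • R y
        = (stdCov j).comp ((fderiv ℂ (trn φ φ') y).comp (diag (theta S y)))) ∧
      ∀ k ∈ S, c k = 0 → R c (stdVec k)
        = if j ∈ S' ∧ ∀ᶠ x in 𝓝 p, φ x k = 0 ↔ φ' x j = 0 then 1 else 0 := by
    intro j
    by_cases hj : j ∈ S'
    swap
    · refine ⟨fun y => (stdCov j).comp ((fderiv ℂ (trn φ φ') y).comp (diag (theta S y))), ?_,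
        fun k hk hk0 => ?_⟩
      · filter_upwards [hDj j] with y hy
        refine ⟨hy, ?_⟩
        rw [theta_of_notMem hj, one_smul]
      · simp [hzero k hk hk0, hj]
    by_cases hj0 : φ' p j = 0
    swap
    · refine ⟨fun y => (trn φ φ' y j)⁻¹ • (stdCov j).comp
        ((fderiv ℂ (trn φ φ') y).comp (diag (theta S y))), ?_, fun k hk hk0 => ?_⟩
      · have hne : ∀ᶠ y in 𝓝 c, trn φ φ' y j ≠ 0 :=
          ((hfj j).self_of_nhds.continuousAt).eventually_ne (by rwa [htc])
        filter_upwards [hDj j, hfj j, hne] with y hy hf hy'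
        exact ⟨(hf.inv hy').smul hy, by rw [theta_of_mem hj, smul_inv_smul₀ hy']⟩
      · rw [if_neg]
        · simp [hzero k hk hk0]
        · rintro ⟨-, hev⟩
          exact hj0 (hev.self_of_nhds.1 hk0)
    obtain ⟨k₀, hk₀, hk₀0, u, hu⟩ := h'.exists_unit P h hp' hp hj hj0
    set g : E n → ℂ := fun y => (u (φ.symm y))⁻¹ with hg
    have hgd : ∀ᶠ y in 𝓝 c, DifferentiableAt ℂ g y ∧ g y ≠ 0 ∧ trn φ φ' y j = g y * y k₀ := by
      filter_upwards [eventually_mem hct (by rw [hcp]; exact hu)] with y hy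
      obtain ⟨hy1, hy2, hy3, hy4⟩ := hy
      refine ⟨(mdifferentiableAt_comp_symm h.1 hy1 hy2).inv hy3, inv_ne_zero hy3, ?_⟩
      rw [φ.right_inv hy1] at hy4
      rw [hy4, hg, inv_mul_cancel_left₀ hy3]
      rfl
    obtain ⟨r, hr, hball⟩ := Metric.mem_nhds_iff.1 hgd
    have hgd2 : ∀ᶠ y in 𝓝 c, DifferentiableAt ℂ (fderiv ℂ g) y := by
      filter_upwards [Metric.ball_mem_nhds c hr] with y hy
      exact (differentiableOn_fderiv Metric.isOpen_ball fun z hz =>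
        (hball hz).1.differentiableWithinAt).differentiableAt (Metric.isOpen_ball.mem_nhds hy)
    have hgerm : ∀ᶠ x in 𝓝 p, φ x k₀ = 0 ↔ φ' x j = 0 := by
      filter_upwards [hu] with x hx
      rw [hx.2.2]
      exact ⟨fun h0 => (mul_eq_zero.1 h0).resolve_left hx.2.1, fun h0 => by rw [h0, mul_zero]⟩
    refine ⟨fun y => (g y)⁻¹ • (fderiv ℂ g y).comp (diag (theta S y)) + stdCov k₀, ?_,
      fun k hk hk0 => ?_⟩
    · filter_upwards [hgd, hgd2, hgd.eventually_nhds, hdom] with y hy hy2 hy3 hy4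
      refine ⟨((hy.1.inv hy.2.1).smul (hy2.clm_comp (differentiableAt_diag fun j =>
        (differentiable_theta S j).differentiableAt))).add_const _, ?_⟩
      have e1 : HasFDerivAt (fun y => trn φ φ' y j) ((stdCov j).comp (fderiv ℂ (trn φ φ') y)) y :=
        (EuclideanSpace.proj j : E n →L[ℂ] ℂ).hasFDerivAt.comp y (differentiableAt_trn h.1 h'.1
          hy4.1 hy4.2).hasFDerivAt
      have e2 : HasFDerivAt (fun y => trn φ φ' y j) (g y • stdCov k₀ + y k₀ • fderiv ℂ g y) y := by
        have h1 : HasFDerivAt (fun y : E n => y k₀) (stdCov k₀) y :=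
          (EuclideanSpace.proj k₀ : E n →L[ℂ] ℂ).hasFDerivAt
        refine (hy.1.hasFDerivAt.fun_mul h1).congr_of_eventuallyEq ?_
        filter_upwards [hy3] with z hz using hz.2.2
      rw [← ContinuousLinearMap.comp_assoc, e1.unique e2, theta_of_mem hj, hy.2.2,
        ContinuousLinearMap.add_comp, ContinuousLinearMap.smul_comp, ContinuousLinearMap.smul_comp,
        stdCov_comp_diag, theta_of_mem hk₀, smul_add, smul_smul, smul_smul,
        mul_right_comm, mul_inv_cancel₀ hy.2.1, one_mul, add_comm]
    · have : k₀ = k ↔ (j ∈ S' ∧ ∀ᶠ x in 𝓝 p, φ x k = 0 ↔ φ' x j = 0) := by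
        refine ⟨fun e => e ▸ ⟨hj, hgerm⟩, fun e => eq_of_coord_germ_eq hp hk₀0 ?_⟩
        filter_upwards [hgerm, e.2] with x h1 h2 using h1.trans h2.symm
      simp [hzero k hk hk0, stdCov_stdVec, ← this]
  choose R hR hR' using hrow
  refine ⟨fun y => ∑ j, (R j y).smulRight (stdVec j), ?_, fun k hk hk0 j hj hgerm => ?_⟩
  · filter_upwards [eventually_all.2 hR] with y hy
    refine ⟨DifferentiableAt.fun_sum fun j _ => ?_, ?_⟩
    · have : (fun z => (R j z).smulRight (stdVec j))
          = fun z => ContinuousLinearMap.smulRightL ℂ (E n) (E n) |>.flip (stdVec j) (R j z) := rfl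
      rw [this]
      exact (ContinuousLinearMap.differentiableAt _).comp y (hy j).1
    · ext v : 1
      rw [← sum_stdCov (((fderiv ℂ (trn φ φ') y).comp (diag (theta S y))) v),
        ContinuousLinearMap.comp_apply, sum_apply, map_sum]
      refine Finset.sum_congr rfl fun j _ => ?_
      rw [ContinuousLinearMap.smulRight_apply, map_smul, diag_stdVec, smul_smul]
      congr 1
      have := DFunLike.congr_fun (hy j).2 v
      rw [mul_comm]
      exact this
  · rw [sum_apply, Finset.sum_eq_single j]
    · rw [ContinuousLinearMap.smulRight_apply, hR' j k hk hk0, if_pos ⟨hj, hgerm⟩, one_smul]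
    · intro i _ hi
      rw [ContinuousLinearMap.smulRight_apply, hR' i k hk hk0, if_neg, zero_smul]
      rintro ⟨-, hi'⟩
      refine hi (eq_of_coord_germ_eq hp' (hi'.self_of_nhds.1 hk0) ?_)
      filter_upwards [hi', hgerm] with x h1 h2 using h1.symm.trans h2
    · simp

end Comparison

/-! ### Logarithmic representatives -/

section LogRep

variable {n : ℕ} {X : Type} [TopologicalSpace X] [ChartedSpace (E n) X]
  [IsManifold 𝓘(ℂ, E n) ω X] {P : Poisson n X} {φ φ' : OpenPartialHomeomorph X (E n)}
  {S S' : Finset (Fin (n + n))} {x p : X} {y c : E n} {w w' : Forms n X} {W W' : E n → Ext n}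

/-- The expression of a form in the logarithmic frame. -/
def lrep (φ : OpenPartialHomeomorph X (E n)) (S : Finset (Fin (n + n))) (w : Forms n X) (y : E n) :
    Ext n := pull (diag (theta S y)) (repE φ w y)

/-- Near `c`, the expression of the form in the logarithmic frame extends to the holomorphic
function `W`. -/
def LogRep (φ : OpenPartialHomeomorph X (E n)) (S : Finset (Fin (n + n))) (w : Forms n X) (c : E n)
    (W : E n → Ext n) : Prop :=
  ∀ᶠ y in 𝓝 c, DAt W y ∧ (∏ j ∈ S, y j ≠ 0 → lrep φ S w y = W y)

theorem lrep_apply_stdVec (hy : y ∈ φ.target) (w : Forms n X) {q : ℕ} (K : Fin q → Fin (n + n)) :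
    lrep φ S w y q (fun a => stdVec (K a))
      = w (φ.symm y) q (fun a => logVec φ S (K a) (φ.symm y)) := by
  simp only [lrep, repE, pull_apply, ContinuousAlternatingMap.compContinuousLinearMap_apply]
  congr 1
  funext a
  simp only [Function.comp_apply, diag_stdVec, map_smul, logVec, coord, φ.right_inv hy]
  rfl

theorem repE_eq_pull_lrep (h : ∏ j ∈ S, y j ≠ 0) (w : Forms n X) :
    repE φ w y = pull (diag fun j => (theta S y j)⁻¹) (lrep φ S w y) := by
  rw [lrep, pull_diag_pull_diag fun j => inv_mul_cancel₀ (theta_ne_zero h j)]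

theorem eventually_ne_of_prod_ne {S : Finset (Fin (n + n))} (h : ∏ j ∈ S, y j ≠ 0) :
    ∀ᶠ z in 𝓝 y, ∏ j ∈ S, z j ≠ 0 := (dense_coord_ne_zero S).2.mem_nhds h

theorem LogRep.dAt (h : LogRep φ S w c W) : DAt W c := h.self_of_nhds.1

/-- The complement of the divisor is dense. -/
theorem LogRep.unique (h : LogRep φ S w c W) (h' : LogRep φ S w c W') : W =ᶠ[𝓝 c] W' := by
  obtain ⟨r, hr, hball⟩ := Metric.mem_nhds_iff.1 (Filter.Eventually.and h h')
  filter_upwards [Metric.ball_mem_nhds c hr] with y hy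
  funext q
  refine eqOn_of_coord_ne_zero Metric.isOpen_ball (f := fun y => W y q) (g := fun y => W' y q)
    (fun z hz => ((hball hz).1.1 q).continuousAt.continuousWithinAt)
    (fun z hz => ((hball hz).2.1 q).continuousAt.continuousWithinAt) S (fun z hz hne => ?_) hy
  exact congrFun (((hball hz).1.2 hne).symm.trans ((hball hz).2.2 hne)) q

theorem LogRep.add (h : LogRep φ S w c W) (h' : LogRep φ S w' c W') :
    LogRep φ S (w + w') c fun y => W y + W' y := by
  filter_upwards [h, h'] with y h1 h2
  refine ⟨h1.1.add h2.1, fun hy => ?_⟩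
  rw [← h1.2 hy, ← h2.2 hy, lrep, repE_add, map_add]
  rfl

theorem LogRep.smul (h : LogRep φ S w c W) (a : ℂ) : LogRep φ S (a • w) c fun y => a • W y := by
  filter_upwards [h] with y h1
  refine ⟨h1.1.smul (differentiableAt_const a), fun hy => ?_⟩
  rw [← h1.2 hy, lrep, repE_smul, map_smul]
  rfl

theorem LogRep.zero : LogRep φ S (0 : Forms n X) c fun _ => 0 := by
  refine Eventually.of_forall fun y => ⟨DAt.const _ _, fun _ => ?_⟩
  exact (congrArg (pull (diag (theta S y))) (map_zero (pull (tanSymm φ y)))).trans (map_zero _)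

theorem LogRep.congr_left (h : LogRep φ S w c W) (hS : IsAdapted P φ S) (hc : c ∈ φ.target)
    (hw : ∀ᶠ x in 𝓝 (φ.symm c), x ∈ symplLocus P → w x = w' x) : LogRep φ S w' c W := by
  filter_upwards [h, eventually_mem hc hw] with y h1 h2
  refine ⟨h1.1, fun hy => ?_⟩
  rw [← h1.2 hy, lrep, lrep, repE, repE, h2.2 ((hS.symm_mem_symplLocus_iff P h2.1).2 hy)]

/-- Being logarithmic does not depend on the adapted chart, and the values at `p` on the vectors
`y_k ∂_k` belonging to branches through `p` depend only on the branches. -/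
theorem LogRep.trans (h : IsAdapted P φ S) (h' : IsAdapted P φ' S')
    (hp : p ∈ φ.source) (hp' : p ∈ φ'.source) (hW : LogRep φ' S' w (φ' p) W') :
    ∃ W, LogRep φ S w (φ p) W ∧ (∀ r, (∀ y, Homog r (W' y)) → ∀ y, Homog r (W y)) ∧
      ∀ {q : ℕ} (J J' : Fin q → Fin (n + n)), (∀ a, J a ∈ S ∧ φ p (J a) = 0 ∧ J' a ∈ S' ∧
        ∀ᶠ x in 𝓝 p, φ x (J a) = 0 ↔ φ' x (J' a) = 0) →
        W (φ p) q (fun a => stdVec (J a)) = W' (φ' p) q (fun a => stdVec (J' a)) := by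
  obtain ⟨M, hM, hM'⟩ := h.exists_frame_change P h' hp hp'
  have hcp : φ.symm (φ p) = p := φ.left_inv hp
  have htc : trn φ φ' (φ p) = φ' p := congrArg φ' hcp
  have hct := φ.map_source hp
  refine ⟨fun y => pull (M y) (W' (trn φ φ' y)), ?_, fun r hr y => (hr _).pull _,
    fun {q} J J' hJ => ?_⟩
  · have hcont : ContinuousAt (trn φ φ') (φ p) :=
      (differentiableAt_trn h.1 h'.1 hct (by rwa [hcp])).continuousAt
    rw [← htc] at hW
    filter_upwards [hM, eventually_mem hct (φ'.open_source.mem_nhds (by rwa [hcp])),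
      hcont.eventually hW] with y h1 h2 h3
    have h4 := differentiableAt_trn h.1 h'.1 h2.1 h2.2
    refine ⟨DAt.pull h1.1 fun q => (h3.1 q).comp y h4, fun hy => ?_⟩
    have h5 : ∏ j ∈ S', trn φ φ' y j ≠ 0 := by
      rw [trn, ← h'.mem_symplLocus_iff P h2.2, h.symm_mem_symplLocus_iff P h2.1]
      exact hy
    rw [← h3.2 h5, lrep, repE_trn h.1 h'.1 h2.1 h2.2, pull_pull, ← h1.2]
    rfl
  · change (W' (trn φ φ' (φ p)) q).compContinuousLinearMap (M (φ p)) _ = _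
    rw [htc, ContinuousAlternatingMap.compContinuousLinearMap_apply]
    congr 1
    funext a
    exact hM' _ (hJ a).1 (hJ a).2.1 _ (hJ a).2.2.1 (hJ a).2.2.2

/-- An alternating map depends linearly on its values on the standard basis vectors. -/
theorem exists_alternating_of_values (q : ℕ) :
    ∃ Φ : ((Fin q → Fin (n + n)) → ℂ) →L[ℂ] (E n) [⋀^Fin q]→L[ℂ] ℂ,
      ∀ f : (E n) [⋀^Fin q]→L[ℂ] ℂ, Φ (fun K => f fun a => stdVec (K a)) = f := by
  let ev : (E n) [⋀^Fin q]→L[ℂ] ℂ →ₗ[ℂ] ((Fin q → Fin (n + n)) → ℂ) :=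
    { toFun := fun f K => f fun a => stdVec (K a)
      map_add' := fun _ _ => rfl
      map_smul' := fun _ _ => rfl }
  have hinj : LinearMap.ker ev = ⊥ := by
    refine LinearMap.ker_eq_bot'.2 fun f hf => ?_
    apply ContinuousAlternatingMap.toAlternatingMap_injective
    refine Module.Basis.ext_alternating (EuclideanSpace.basisFun (Fin (n + n)) ℂ).toBasis
      fun K _ => ?_
    have := congrFun hf K
    simpa [ev, stdVec] using this
  obtain ⟨Φ, hΦ⟩ := LinearMap.exists_leftInverse_of_injective ev hinj
  exact ⟨Φ.toContinuousLinearMap, fun f => LinearMap.congr_fun hΦ f⟩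

/-- A logarithmic form has a holomorphic expression in the logarithmic frame of every adapted
chart. -/
theorem IsLogAt.exists_logRep (hw : IsLogAt P w p) {r : ℤ} (hr : ∀ x, Homog r (w x))
    (h : IsAdapted P φ S) (hp : p ∈ φ.source) :
    ∃ W, LogRep φ S w (φ p) W ∧ ∀ y, Homog r (W y) := by
  have hct := φ.map_source hp
  have hcp : φ.symm (φ p) = p := φ.left_inv hp
  by_cases hr0 : r < 0
  · have : w = 0 := funext fun x => (hr x).eq_zero_of_neg hr0
    subst this
    exact ⟨_, LogRep.zero, fun _ => Homog.zero r⟩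
  obtain ⟨q, rfl⟩ := Int.eq_ofNat_of_zero_le (not_lt.1 hr0)
  obtain ⟨Φ, hΦ⟩ := exists_alternating_of_values (n := n) q
  choose g hg hg' using hw φ S hp h q
  set W : E n → Ext n := fun y =>
    Pi.single (M := fun q => (E n) [⋀^Fin q]→L[ℂ] ℂ) q (Φ fun K => g K (φ.symm y)) with hW
  have hW0 : ∀ y, ∀ q', q' ≠ q → W y q' = 0 := fun y q' hq' => Pi.single_eq_of_ne hq' _
  have hWq : ∀ y, W y q = Φ fun K => g K (φ.symm y) := fun y => Pi.single_eq_same _ _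
  refine ⟨W, ?_, fun y q' hq' => hW0 y q' fun e => hq' (by rw [e])⟩
  have hg2 : ∀ᶠ x in 𝓝 p, ∀ K, MDifferentiableAt 𝓘(ℂ, E n) 𝓘(ℂ, ℂ) (g K) x :=
    eventually_all.2 hg
  have hg3 : ∀ᶠ x in 𝓝 p, ∀ K, x ∈ symplLocus P → w x q (fun a => logVec φ S (K a) x) = g K x :=
    eventually_all.2 hg'
  rw [← hcp] at hg2 hg3
  filter_upwards [eventually_mem hct hg2, eventually_mem hct hg3] with y h2 h3
  refine ⟨fun q' => ?_, fun hy => ?_⟩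
  · by_cases hq' : q' = q
    · subst hq'
      simp only [hWq]
      exact Φ.differentiableAt.comp y
        (differentiableAt_pi.2 fun K => mdifferentiableAt_comp_symm h.1 h2.1 (h2.2 K))
    · simp only [hW0 _ q' hq']
      exact differentiableAt_const _
  · funext q'
    by_cases hq' : q' = q
    · subst hq'
      rw [hWq, ← hΦ (lrep φ S w y q')]
      congr 1
      funext K
      rw [lrep_apply_stdVec h2.1]
      exact h3.2 K ((h.symm_mem_symplLocus_iff P h2.1).2 hy)
    · rw [hW0 y q' hq']
      exact (((hr _).pull _).pull _) q' fun e => hq' (by exact_mod_cast e)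

/-- The logarithmic frame of a single adapted chart suffices to detect logarithmic forms. -/
theorem LogRep.isLogAt (hW : LogRep φ S w (φ p) W) (h : IsAdapted P φ S) (hp : p ∈ φ.source) :
    IsLogAt P w p := by
  intro φ' S' hp' h' q K
  obtain ⟨W', hW', -⟩ := LogRep.trans h' h hp' hp hW
  have hcont := φ'.continuousAt hp'
  refine ⟨fun x => W' (φ' x) q fun a => stdVec (K a), ?_, ?_⟩
  · filter_upwards [hcont.eventually hW', φ'.open_source.mem_nhds hp'] with x h1 h2
    exact mdifferentiableAt_comp_chart (g := fun y => W' y q fun a => stdVec (K a)) h'.1 h2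
      ((ContinuousAlternatingMap.apply ℂ (E n) ℂ fun a => stdVec (K a)).differentiableAt.comp _
        (h1.1 q))
  · filter_upwards [hcont.eventually hW', φ'.open_source.mem_nhds hp'] with x h1 h2 h3
    rw [← h1.2 ((h'.mem_symplLocus_iff P h2).1 h3), lrep_apply_stdVec (φ'.map_source h2),
      φ'.left_inv h2]

theorem dAt_diag_inv_theta (hy : ∏ j ∈ S, y j ≠ 0) (j : Fin (n + n)) :
    DifferentiableAt ℂ (fun z : E n => (theta S z j)⁻¹) y :=
  (differentiable_theta S j).differentiableAt.inv (theta_ne_zero hy j)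

theorem LogRep.eventually_repE (hW : LogRep φ S w c W) : ∀ᶠ y in 𝓝 c, ∏ j ∈ S, y j ≠ 0 →
    repE φ w =ᶠ[𝓝 y] fun z => pull (diag fun j => (theta S z j)⁻¹) (W z) := by
  filter_upwards [hW.eventually_nhds] with y h1 hy
  filter_upwards [h1, eventually_ne_of_prod_ne hy] with z h2 h3
  rw [repE_eq_pull_lrep h3, h2.2 h3]

theorem LogRep.dAt_repE (hW : LogRep φ S w c W) (hc : ∏ j ∈ S, c j ≠ 0) : DAt (repE φ w) c :=
  (DAt.pull (differentiableAt_diag fun j => dAt_diag_inv_theta hc j) hW.dAt).congr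
    (hW.eventually_repE.self_of_nhds hc).symm

theorem mem_logForms_of_logRep {V : Opens X} {r : ℤ} (hr : ∀ x, Homog r (w x))
    (hsupp : ∀ x, x ∉ V ⊓ symplLocus P → w x = 0)
    (hlog : ∀ p ∈ V, ∃ (φ : OpenPartialHomeomorph X (E n)) (S : Finset (Fin (n + n))),
      IsAdapted P φ S ∧ p ∈ φ.source ∧ ∃ W, LogRep φ S w (φ p) W) : w ∈ logForms P V r := by
  refine ⟨hr, hsupp, holOn_of_dAt fun x hx => ?_, fun p hp => ?_⟩
  · obtain ⟨φ, S, h, hxφ, W, hW⟩ := hlog x hx.1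
    exact ⟨φ, h.1, hxφ, hW.dAt_repE ((h.mem_symplLocus_iff P hxφ).1 hx.2)⟩
  · obtain ⟨φ, S, h, hpφ, W, hW⟩ := hlog p hp
    exact hW.isLogAt h hpφ

theorem exists_logRep_of_mem {V : Opens X} {r : ℤ} (hw : w ∈ logForms P V r) (hpV : p ∈ V)
    (h : IsAdapted P φ S) (hp : p ∈ φ.source) :
    ∃ W, LogRep φ S w (φ p) W ∧ ∀ y, Homog r (W y) :=
  (hw.2.2.2 p hpV).exists_logRep hw.1 h hp

/-- The exterior derivative in the logarithmic frame. -/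
def extdLog (S : Finset (Fin (n + n))) (W : E n → Ext n) (y : E n) : Ext n :=
  ∑ l, theta S y l • wdg (stdCov l) (pd l W y)

/-- The one-forms `dlog y_j` are closed. -/
theorem hasFDerivAt_diag_inv (hy : ∏ j ∈ S, y j ≠ 0) (u v : E n) :
    fderiv ℂ (fun z => diag fun j => (theta S z j)⁻¹) y u v
      = fderiv ℂ (fun z => diag fun j => (theta S z j)⁻¹) y v u := by
  have h1 : ∀ j, HasFDerivAt (fun z => (theta S z j)⁻¹ • (stdCov j).smulRight (stdVec j))
      ((fderiv ℂ (fun z => (theta S z j)⁻¹) y).smulRight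
        ((stdCov j).smulRight (stdVec (n := n) j))) y :=
    fun j => HasFDerivAt.smul_const (F := E n →L[ℂ] E n)
      (dAt_diag_inv_theta hy j).hasFDerivAt ((stdCov j).smulRight (stdVec j))
  have h2 : HasFDerivAt (fun z => diag fun j => (theta S z j)⁻¹) _ y :=
    HasFDerivAt.fun_sum fun j (_ : j ∈ Finset.univ) => h1 j
  rw [h2.fderiv]
  have h3 : ∀ j, ∃ a : ℂ, fderiv ℂ (fun z => (theta S z j)⁻¹) y = a • stdCov j := by
    intro j
    by_cases hj : j ∈ S
    · have h4 : HasFDerivAt (fun y : E n => theta S y j) (stdCov j) y := by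
        simp only [theta_of_mem hj]
        exact (EuclideanSpace.proj j : E n →L[ℂ] ℂ).hasFDerivAt
      exact ⟨_, (HasDerivAt.comp_hasFDerivAt y (hasDerivAt_inv (theta_ne_zero hy j)) h4).fderiv⟩
    · simp only [theta_of_notMem hj]
      refine ⟨0, ?_⟩
      rw [fderiv_fun_const]
      exact (zero_smul ℂ (stdCov j)).symm
  simp only [sum_apply]
  refine Finset.sum_congr rfl fun j _ => ?_
  obtain ⟨a, ha⟩ := h3 j
  simp only [ContinuousLinearMap.smulRight_apply, smul_apply, ha, smul_smul,
    smul_eq_mul]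
  congr 1
  ring

theorem extdLog_dAt {U : Set (E n)} (hU : IsOpen U) (hW : HolExt U W) (S : Finset (Fin (n + n))) :
    HolExt U (extdLog S W) := holExt_of_dAt fun _ hz => DAt.sum fun l _ =>
      DAt.smul (differentiable_theta S l).differentiableAt (((hW.pd hU l).dAt hU hz).wdg _)

theorem LogRep.exists_ball (h : LogRep φ S w c W) : ∃ r > 0, HolExt (Metric.ball c r) W ∧
    ∀ y ∈ Metric.ball c r, ∏ j ∈ S, y j ≠ 0 → lrep φ S w y = W y := by
  obtain ⟨r, hr, hball⟩ := Metric.mem_nhds_iff.1 h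
  exact ⟨r, hr, holExt_of_dAt fun z hz => (hball hz).1, fun y hy => (hball hy).2⟩

/-- In the logarithmic frame the exterior derivative is `extdLog`. -/
theorem LogRep.dExt (hW : LogRep φ S w c W) (h : HolChart φ) (hc : c ∈ φ.target) :
    LogRep φ S (dExt w) c (extdLog S W) := by
  obtain ⟨r, hr, hW1, -⟩ := hW.exists_ball
  filter_upwards [Metric.ball_mem_nhds c hr, φ.open_target.mem_nhds hc, hW.eventually_repE]
    with y hy hyt hy2
  refine ⟨(extdLog_dAt Metric.isOpen_ball hW1 S).dAt Metric.isOpen_ball hy, fun hne => ?_⟩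
  have hWy := hW1.dAt Metric.isOpen_ball hy
  have hG := differentiableAt_diag (fun j => dAt_diag_inv_theta hne j)
  have h1 : DAt (repE φ w) y := (DAt.pull hG hWy).congr (hy2 hne).symm
  rw [lrep, repE_dExt h hyt h1, extd_congr (hy2 hne), extd_pull hG (hasFDerivAt_diag_inv hne) hWy,
    map_sum, extdLog]
  refine Finset.sum_congr rfl fun l _ => ?_
  rw [pull_wdg, stdCov_comp_diag, map_smul, LinearMap.smul_apply,
    pull_diag_pull_diag fun j => mul_inv_cancel₀ (theta_ne_zero hne j)]

/-- The residues of an exact logarithmic form vanish. -/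
theorem extdLog_apply_eq_zero {q : ℕ} (J : Fin q → Fin (n + n))
    (hJ : ∀ a, J a ∈ S ∧ y (J a) = 0) (W : E n → Ext n) :
    extdLog S W y q (fun a => stdVec (J a)) = 0 := by
  rw [extdLog, Ext.sum_apply, ContinuousAlternatingMap.sum_apply]
  refine Finset.sum_eq_zero fun l _ => ?_
  rw [← LinearMap.smul_apply, ← map_smul]
  refine wdg_apply_eq_zero _ _ _ fun a => ?_
  simp only [smul_apply, stdCov_stdVec, smul_eq_mul]
  split_ifs with hl
  · rw [hl, theta_of_mem (hJ a).1, (hJ a).2, zero_mul]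
  · rw [mul_zero]

end LogRep

/-! ### The logarithmic Poincaré lemma -/

section Primitive

variable {n : ℕ} {F G : Type*} [NormedAddCommGroup F] [NormedSpace ℂ F] [FiniteDimensional ℂ F]
  [NormedAddCommGroup G] [NormedSpace ℂ G] [FiniteDimensional ℂ G]
  {S : Finset (Fin (n + n))} {p y : E n} {r : ℝ} {k l : Fin (n + n)} {f : E n → F}

theorem avg_congr {f g : E n → F} (h : ∀ z ∈ Metric.ball p r, f z = g z)
    (hy : y ∈ Metric.ball p r) : avg p k f y = avg p k g y :=
  intervalIntegral.integral_congr fun _ ht => h _ (slide_mem_ball hy k (norm_ofReal_le_one ht))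

theorem avg_clm (hf : DifferentiableOn ℂ f (Metric.ball p r)) (hy : y ∈ Metric.ball p r)
    (L : F →L[ℂ] G) : avg p k (fun z => L (f z)) y = L (avg p k f y) := by
  have : CompleteSpace F := FiniteDimensional.complete ℂ F
  have : CompleteSpace G := FiniteDimensional.complete ℂ G
  exact L.intervalIntegral_comp_comm
    (continuousOn_slide_path k hy hf.continuousOn).intervalIntegrable

theorem theta_slide (h : l ≠ k) (t : ℂ) (y : E n) : theta S (slide p k t y) l = theta S y l := by
  unfold theta
  rw [slide_apply_ne p h]

theorem avg_theta_smul (h : l ≠ k) (f : E n → F) (y : E n) :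
    avg p k (fun z => theta S z l • f z) y = theta S y l • avg p k f y := by
  simp only [avg, theta_slide h]
  exact intervalIntegral.integral_smul _ _

/-- The primitive along the coordinate `k` for the derivation `y_k ∂_k` (if `k ∈ S`) or `∂_k`. In
the first case the function is replaced by `(f - f|_{y_k = 0}) / y_k`, which is the average of its
derivative. -/
def prim (S : Finset (Fin (n + n))) (p : E n) (k : Fin (n + n)) (f : E n → F) (y : E n) : F :=
  (y k - p k) • avg p k (if k ∈ S then avg p k (fun z => fderiv ℂ f z (stdVec k)) else f) y

theorem prim_of_mem (hk : k ∈ S) (f : E n → F) : prim S p k f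
    = fun y => (y k - p k) • avg p k (avg p k (fun z => fderiv ℂ f z (stdVec k))) y := by
  funext y
  rw [prim, if_pos hk]

theorem prim_of_notMem (hk : k ∉ S) (f : E n → F) :
    prim S p k f = fun y => (y k - p k) • avg p k f y := by
  funext y
  rw [prim, if_neg hk]

theorem differentiableOn_fderiv_stdVec (hf : DifferentiableOn ℂ f (Metric.ball p r))
    (k : Fin (n + n)) : DifferentiableOn ℂ (fun z => fderiv ℂ f z (stdVec k)) (Metric.ball p r) :=
  differentiableOn_fderiv_apply Metric.isOpen_ball hf _

theorem differentiableOn_prim_core (hf : DifferentiableOn ℂ f (Metric.ball p r)) :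
    DifferentiableOn ℂ (if k ∈ S then avg p k (fun z => fderiv ℂ f z (stdVec k)) else f)
      (Metric.ball p r) := by
  split_ifs
  · exact differentiableOn_avg (differentiableOn_fderiv_stdVec hf k) k
  · exact hf

theorem differentiableOn_prim (hf : DifferentiableOn ℂ f (Metric.ball p r)) :
    DifferentiableOn ℂ (prim S p k f) (Metric.ball p r) :=
  (((differentiable_coord k).sub_const _).differentiableOn).smul
    (differentiableOn_avg (differentiableOn_prim_core hf) k)

theorem fderiv_congr_ball {f g : E n → F} (h : ∀ z ∈ Metric.ball p r, f z = g z)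
    (hy : y ∈ Metric.ball p r) : fderiv ℂ f y = fderiv ℂ g y :=
  Filter.EventuallyEq.fderiv_eq
    (Filter.eventually_of_mem (Metric.isOpen_ball.mem_nhds hy) h)

theorem prim_congr {f g : E n → F} (h : ∀ z ∈ Metric.ball p r, f z = g z)
    (hy : y ∈ Metric.ball p r) : prim S p k f y = prim S p k g y := by
  by_cases hk : k ∈ S
  · rw [prim_of_mem hk, prim_of_mem hk]
    refine congrArg _ (avg_congr (fun z hz => avg_congr (fun u hu => ?_) hz) hy)
    rw [fderiv_congr_ball h hu]
  · rw [prim_of_notMem hk, prim_of_notMem hk]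
    exact congrArg _ (avg_congr h hy)

theorem prim_clm (hf : DifferentiableOn ℂ f (Metric.ball p r)) (hy : y ∈ Metric.ball p r)
    (L : F →L[ℂ] G) : prim S p k (fun z => L (f z)) y = L (prim S p k f y) := by
  by_cases hk : k ∈ S
  · rw [prim_of_mem hk, prim_of_mem hk, map_smul]
    have h1 := differentiableOn_fderiv_stdVec hf k
    rw [← avg_clm (differentiableOn_avg h1 k) hy]
    refine congrArg _ (avg_congr (fun z hz => ?_) hy)
    rw [← avg_clm h1 hz]
    refine avg_congr (fun u hu => ?_) hz
    have h2 : HasFDerivAt (fun z => L (f z)) (L.comp (fderiv ℂ f u)) u :=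
      L.hasFDerivAt.comp u (hf.differentiableAt (Metric.isOpen_ball.mem_nhds hu)).hasFDerivAt
    rw [h2.fderiv]
    rfl
  · rw [prim_of_notMem hk, prim_of_notMem hk, map_smul]
    exact congrArg ((y k - p k) • ·) (avg_clm hf hy L)

theorem fderiv_smul_of_ne {c : E n → ℂ} (hc : DifferentiableAt ℂ c y)
    (hf : DifferentiableAt ℂ f y) (h : fderiv ℂ c y (stdVec k) = 0) :
    fderiv ℂ (fun z => c z • f z) y (stdVec k) = c y • fderiv ℂ f y (stdVec k) := by
  rw [fderiv_fun_smul hc hf]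
  simp [h]

theorem fderiv_coord (k l : Fin (n + n)) (y : E n) :
    fderiv ℂ (fun z : E n => z k) y (stdVec l) = if k = l then 1 else 0 := by
  have h1 : HasFDerivAt (fun y : E n => y k) (stdCov k) y :=
    (EuclideanSpace.proj k : E n →L[ℂ] ℂ).hasFDerivAt
  rw [h1.fderiv, stdCov_stdVec]

theorem fderiv_theta (k l : Fin (n + n)) (y : E n) :
    fderiv ℂ (fun z : E n => theta S z k) y (stdVec l) = if k = l ∧ k ∈ S then 1 else 0 := by
  by_cases hk : k ∈ S
  · simp only [theta_of_mem hk, fderiv_coord, hk, and_true]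
  · simp [theta_of_notMem hk, hk]

theorem prim_theta_smul (hf : DifferentiableOn ℂ f (Metric.ball p r)) (hy : y ∈ Metric.ball p r)
    (h : l ≠ k) : prim S p k (fun z => theta S z l • f z) y = theta S y l • prim S p k f y := by
  by_cases hk : k ∈ S
  · rw [prim_of_mem hk, prim_of_mem hk, smul_comm, ← avg_theta_smul h]
    refine congrArg _ (avg_congr (fun z hz => ?_) hy)
    rw [← avg_theta_smul h]
    refine avg_congr (fun u hu => ?_) hz
    refine fderiv_smul_of_ne (differentiable_theta S l).differentiableAt
      (hf.differentiableAt (Metric.isOpen_ball.mem_nhds hu)) ?_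
    rw [fderiv_theta, if_neg fun e => h e.1]
  · rw [prim_of_notMem hk, prim_of_notMem hk, smul_comm, ← avg_theta_smul h]

theorem fderiv_stdVec_comm {U : Set (E n)} (hU : IsOpen U) (hf : DifferentiableOn ℂ f U)
    (hy : y ∈ U) (k l : Fin (n + n)) :
    fderiv ℂ (fun z => fderiv ℂ f z (stdVec k)) y (stdVec l)
      = fderiv ℂ (fun z => fderiv ℂ f z (stdVec l)) y (stdVec k) := by
  have h1 : ∀ v : E n, HasFDerivAt (fun z => fderiv ℂ f z v)
      ((ContinuousLinearMap.apply ℂ F v).comp (fderiv ℂ (fderiv ℂ f) y)) y := fun v =>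
    (ContinuousLinearMap.apply ℂ F v).hasFDerivAt.comp y
      ((differentiableOn_fderiv hU hf).differentiableAt (hU.mem_nhds hy)).hasFDerivAt
  have h2 : IsSymmSndFDerivAt ℂ f y :=
    ((contDiffOn_of_differentiableOn hU hf 2).contDiffAt (hU.mem_nhds hy)).isSymmSndFDerivAt
      (by simp)
  rw [(h1 _).fderiv, (h1 _).fderiv]
  exact h2 _ _

theorem fderiv_prim_of_ne (hf : DifferentiableOn ℂ f (Metric.ball p r))
    (hy : y ∈ Metric.ball p r) (h : l ≠ k) : fderiv ℂ (prim S p k f) y (stdVec l)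
      = prim S p k (fun z => fderiv ℂ f z (stdVec l)) y := by
  have h0 : ∀ g : E n → F, DifferentiableOn ℂ g (Metric.ball p r) →
      fderiv ℂ (fun z => (z k - p k) • avg p k g z) y (stdVec l)
        = (y k - p k) • avg p k (fun z => fderiv ℂ g z (stdVec l)) y := by
    intro g hg
    rw [fderiv_smul_of_ne ((differentiable_coord k).sub_const _).differentiableAt
      ((differentiableOn_avg hg k).differentiableAt (Metric.isOpen_ball.mem_nhds hy)),
      fderiv_avg_of_ne hg h hy]
    rw [fderiv_sub_const, fderiv_coord, if_neg (Ne.symm h)]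
  by_cases hk : k ∈ S
  · have h1 := differentiableOn_fderiv_stdVec hf k
    rw [prim_of_mem hk, prim_of_mem hk, h0 _ (differentiableOn_avg h1 k)]
    refine congrArg _ (avg_congr (fun z hz => ?_) hy)
    rw [fderiv_avg_of_ne h1 h hz]
    exact avg_congr (fun u hu => fderiv_stdVec_comm Metric.isOpen_ball hf hu k l) hz
  · rw [prim_of_notMem hk, prim_of_notMem hk, h0 f hf]

/-- The derivation inverts `prim`, up to the restriction to the hyperplane if `k ∈ S`. -/
theorem theta_smul_fderiv_prim (hf : DifferentiableOn ℂ f (Metric.ball p r))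
    (hy : y ∈ Metric.ball p r) (hp : k ∈ S → p k = 0) :
    theta S y k • fderiv ℂ (prim S p k f) y (stdVec k)
      = f y - if k ∈ S then f (slide p k 0 y) else 0 := by
  by_cases hk : k ∈ S
  · have h1 := differentiableOn_fderiv_stdVec hf k
    rw [prim_of_mem hk, fderiv_smul_avg (differentiableOn_avg h1 k) k hy, theta_of_mem hk,
      if_pos hk]
    have := smul_avg_fderiv hf k hy
    rwa [hp hk, sub_zero] at this
  · rw [prim_of_notMem hk, fderiv_smul_avg hf k hy, theta_of_notMem hk, if_neg hk, one_smul,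
      sub_zero]

/-- `prim` inverts the derivation, up to the restriction to the hyperplane. -/
theorem prim_theta_smul_fderiv (hf : DifferentiableOn ℂ f (Metric.ball p r))
    (hy : y ∈ Metric.ball p r) (hp : k ∈ S → p k = 0) :
    prim S p k (fun z => theta S z k • fderiv ℂ f z (stdVec k)) y = f y - f (slide p k 0 y) := by
  have h1 := differentiableOn_fderiv_stdVec hf k
  rw [← smul_avg_fderiv hf k hy]
  by_cases hk : k ∈ S
  · rw [prim_of_mem hk]
    refine congrArg _ (avg_congr (fun z hz => ?_) hy)
    simp only [theta_of_mem hk]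
    have h2 : DifferentiableOn ℂ (fun z : E n => z k • fderiv ℂ f z (stdVec k))
        (Metric.ball p r) := (differentiable_coord k).differentiableOn.smul h1
    refine eqOn_of_coord_ne_zero Metric.isOpen_ball (f := avg p k fun z =>
      fderiv ℂ (fun z : E n => z k • fderiv ℂ f z (stdVec k)) z (stdVec k))
      (g := fun z => fderiv ℂ f z (stdVec k))
      (differentiableOn_avg (differentiableOn_fderiv_stdVec h2 k) k).continuousOn h1.continuousOn
      {k} (fun u hu hne => ?_) hz
    have h3 := smul_avg_fderiv h2 k hu
    rw [Finset.prod_singleton] at hne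
    simp only [slide_apply_self, hp hk, sub_zero, zero_mul, add_zero, zero_smul] at h3
    exact smul_right_injective _ hne h3
  · rw [prim_of_notMem hk]
    simp only [theta_of_notMem hk, one_smul]

end Primitive

section Poincare

variable {n : ℕ} {S : Finset (Fin (n + n))} {p y : E n} {r : ℝ} {k l : Fin (n + n)}
  {W : E n → Ext n}

/-- The logarithmic derivative of a form along the coordinate `l`. -/
def nabla (S : Finset (Fin (n + n))) (l : Fin (n + n)) (W : E n → Ext n) (y : E n) : Ext n :=
  theta S y l • pd l W y

theorem extdLog_eq (S : Finset (Fin (n + n))) (W : E n → Ext n) (y : E n) :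
    extdLog S W y = ∑ l, wdg (stdCov l) (nabla S l W y) := by
  simp only [extdLog, nabla, map_smul]

theorem HolExt.nabla {U : Set (E n)} (hU : IsOpen U) (hW : HolExt U W) (l : Fin (n + n)) :
    HolExt U (nabla S l W) := holExt_of_dAt fun _ hz =>
  DAt.smul (differentiable_theta S l).differentiableAt ((hW.pd hU l).dAt hU hz)

theorem HolExt.extdLog {U : Set (E n)} (hU : IsOpen U) (hW : HolExt U W) :
    HolExt U (extdLog S W) := extdLog_dAt hU hW S

theorem sum_wdg_wdg_eq_zero {T : Fin (n + n) → Fin (n + n) → Ext n} (h : ∀ i j, T i j = T j i) :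
    ∑ i, ∑ j, wdg (stdCov i) (wdg (stdCov j) (T i j)) = 0 := by
  have h2 : ∑ i, ∑ j, wdg (stdCov i) (wdg (stdCov j) (T i j))
      = -∑ i, ∑ j, wdg (stdCov i) (wdg (stdCov j) (T i j)) := by
    conv_rhs => rw [Finset.sum_comm]
    rw [← Finset.sum_neg_distrib]
    refine Finset.sum_congr rfl fun i _ => ?_
    rw [← Finset.sum_neg_distrib]
    refine Finset.sum_congr rfl fun j _ => ?_
    rw [wdg_wdg (stdCov i) (stdCov j), h i j]
  rwa [eq_neg_iff_add_eq_zero, ← two_smul ℂ, smul_eq_zero_iff_right (two_ne_zero)] at h2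

/-- The derivations `y_l ∂_l`, `∂_l` commute, and the coframe consists of closed forms. -/
theorem extdLog_extdLog {U : Set (E n)} (hU : IsOpen U) (hW : HolExt U W) (hy : y ∈ U) :
    extdLog S (extdLog S W) y = 0 := by
  have hn : ∀ l, DAt (nabla S l W) y := fun l => (hW.nabla hU l).dAt hU hy
  have h1 : ∀ i, nabla S i (extdLog S W) y
      = ∑ j, wdg (stdCov j) (nabla S i (nabla S j W) y) := by
    intro i
    have : extdLog S W = fun z => ∑ j, wdg (stdCov j) (nabla S j W z) :=
      funext (extdLog_eq S W)
    rw [nabla, this, pd_sum fun j _ => (hn j).wdg _, Finset.smul_sum]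
    refine Finset.sum_congr rfl fun j _ => ?_
    rw [pd_wdg (hn j), nabla, map_smul]
  rw [extdLog_eq]
  simp only [h1, map_sum]
  refine sum_wdg_wdg_eq_zero fun i j => ?_
  have h2 : ∀ i j, nabla S i (nabla S j W) y = (theta S y i * theta S y j) • pd i (pd j W) y
      + (theta S y i * if j = i ∧ j ∈ S then 1 else 0) • pd j W y := by
    intro i j
    rw [nabla]
    change theta S y i • pd i (fun z => theta S z j • pd j W z) y = _
    rw [pd_smul (differentiable_theta S j).differentiableAt ((hW.pd hU j).dAt hU hy),
      fderiv_theta, smul_add, smul_smul, smul_smul]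
  rw [h2, h2, pd_comm hU hW hy i j, mul_comm (theta S y i)]
  by_cases hij : i = j
  · rw [hij]
  · simp [hij, Ne.symm hij]

/-- `prim` on forms. -/
def primE (S : Finset (Fin (n + n))) (p : E n) (k : Fin (n + n)) (W : E n → Ext n) (y : E n) :
    Ext n := fun q => prim S p k (fun z => W z q) y

theorem HolExt.primE (hW : HolExt (Metric.ball p r) W) :
    HolExt (Metric.ball p r) (primE S p k W) := fun q => differentiableOn_prim (hW q)

theorem nabla_primE_of_ne (hW : HolExt (Metric.ball p r) W) (hy : y ∈ Metric.ball p r)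
    (h : l ≠ k) : nabla S l (primE S p k W) y = primE S p k (nabla S l W) y := by
  funext q
  refine (congrArg (theta S y l • ·) (fderiv_prim_of_ne (hW q) hy h)).trans ?_
  exact (prim_theta_smul (differentiableOn_fderiv_stdVec (hW q) l) hy h).symm

theorem nabla_primE_self (hW : HolExt (Metric.ball p r) W) (hy : y ∈ Metric.ball p r)
    (hp : k ∈ S → p k = 0) : nabla S k (primE S p k W) y
      = W y - if k ∈ S then W (slide p k 0 y) else 0 := by
  funext q
  refine (theta_smul_fderiv_prim (hW q) hy hp).trans ?_
  split_ifs <;> rfl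

theorem primE_nabla_self (hW : HolExt (Metric.ball p r) W) (hy : y ∈ Metric.ball p r)
    (hp : k ∈ S → p k = 0) : primE S p k (nabla S k W) y = W y - W (slide p k 0 y) := by
  funext q
  exact prim_theta_smul_fderiv (hW q) hy hp

theorem primE_sum_wdg {f : Fin (n + n) → E n → Ext n}
    (hf : ∀ l, HolExt (Metric.ball p r) (f l)) (hy : y ∈ Metric.ball p r) :
    primE S p k (fun z => ∑ l, wdg (stdCov l) (f l z)) y
      = ∑ l, wdg (stdCov l) (primE S p k (f l) y) := by
  funext q
  cases q with
  | zero =>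
    simp only [primE, Ext.sum_apply, wdg_zero_apply, Finset.sum_const_zero]
    have := prim_clm (S := S) (k := k) (f := fun _ : E n => (0 : ℂ))
      (differentiableOn_const (0 : ℂ)) hy
      (0 : ℂ →L[ℂ] (E n) [⋀^Fin 0]→L[ℂ] ℂ)
    simpa using this
  | succ q =>
    let L : (Fin (n + n) → (E n) [⋀^Fin q]→L[ℂ] ℂ) →L[ℂ] (E n) [⋀^Fin (q + 1)]→L[ℂ] ℂ :=
      ∑ l, (wdgCLM (stdCov l) q).comp (ContinuousLinearMap.proj l)
    have hL : ∀ g : Fin (n + n) → (E n) [⋀^Fin q]→L[ℂ] ℂ, L g = ∑ l, wdgCLM (stdCov l) q (g l) :=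
      fun g => by simp [L]
    have hd : DifferentiableOn ℂ (fun z l => f l z q) (Metric.ball p r) :=
      differentiableOn_pi.2 fun l => hf l q
    have h1 := prim_clm (S := S) (k := k) hd hy L
    simp only [hL] at h1
    have h2 : ∀ l, prim S p k (fun z l => f l z q) y l = prim S p k (fun z => f l z q) y :=
      fun l => (prim_clm (S := S) (k := k) hd hy (ContinuousLinearMap.proj
        (φ := fun _ : Fin (n + n) => (E n) [⋀^Fin q]→L[ℂ] ℂ) (R := ℂ) l)).symm
    simp only [h2] at h1
    simp only [primE, Ext.sum_apply, wdg_apply_eq]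
    exact h1

/-- The result of eliminating the coordinate `k` from a closed form. -/
def elim (S : Finset (Fin (n + n))) (p : E n) (k : Fin (n + n)) (W : E n → Ext n) (y : E n) :
    Ext n :=
  if k ∈ S then W (slide p k 0 y)
  else ctr (stdVec k) (wdg (stdCov k) (W (slide p k 0 y)))

/-- One coordinate at a time, a closed logarithmic form is cohomologous to one that is constant
along the coordinate and, if the coordinate is not a distinguished one, does not involve its
differential. -/
theorem eq_elim_add_extdLog (hW : HolExt (Metric.ball p r) W)
    (hclosed : ∀ z ∈ Metric.ball p r, extdLog S W z = 0) (hp : k ∈ S → p k = 0)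
    (hy : y ∈ Metric.ball p r) :
    W y = elim S p k W y + extdLog S (fun z => ctr (stdVec k) (primE S p k W z)) y := by
  have hb := Metric.isOpen_ball (x := p) (ε := r)
  have hpr := (hW.primE (S := S) (k := k)).dAt hb hy
  have h1 : ∀ l, nabla S l (fun z => ctr (stdVec k) (primE S p k W z)) y
      = ctr (stdVec k) (nabla S l (primE S p k W) y) := by
    intro l
    rw [nabla, pd_ctr hpr, nabla, map_smul]
  have h2 : ∑ l, wdg (stdCov l) (primE S p k (nabla S l W) y) = 0 := by
    rw [← primE_sum_wdg (fun l => hW.nabla hb l) hy]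
    funext q
    have : ∀ z ∈ Metric.ball p r, (fun z => (∑ l, wdg (stdCov l) (nabla S l W z)) q) z
        = (fun _ => (0 : (E n) [⋀^Fin q]→L[ℂ] ℂ)) z := by
      intro z hz
      simp only [← extdLog_eq, hclosed z hz]
      rfl
    rw [primE, prim_congr this hy]
    have := prim_clm (S := S) (k := k) (f := fun _ : E n => (0 : ℂ))
      (differentiableOn_const (0 : ℂ)) hy (0 : ℂ →L[ℂ] (E n) [⋀^Fin q]→L[ℂ] ℂ)
    simpa using this
  have h3 : ∑ l, wdg (stdCov l) (nabla S l (primE S p k W) y)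
      = wdg (stdCov k) (W (slide p k 0 y) - if k ∈ S then W (slide p k 0 y) else 0) := by
    refine (sub_zero _).symm.trans ((congrArg (_ - ·) h2.symm).trans ?_)
    rw [← Finset.sum_sub_distrib, Finset.sum_eq_single k]
    · rw [nabla_primE_self hW hy hp, primE_nabla_self hW hy hp, ← map_sub]
      congr 1
      abel
    · intro l _ hl
      rw [nabla_primE_of_ne hW hy hl, sub_self]
    · simp
  have h4 : extdLog S (fun z => ctr (stdVec k) (primE S p k W z)) y
      = nabla S k (primE S p k W) y
        - ctr (stdVec k) (∑ l, wdg (stdCov l) (nabla S l (primE S p k W) y)) := by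
    rw [extdLog_eq, map_sum]
    simp only [h1, ctr_wdg, stdCov_stdVec, Finset.sum_sub_distrib, ite_smul, one_smul, zero_smul,
      Finset.sum_ite_eq', Finset.mem_univ, if_true]
    abel
  rw [h4, h3, nabla_primE_self hW hy hp, elim]
  split_ifs
  · rw [sub_self, map_zero, map_zero, sub_zero]
    abel
  · rw [sub_zero, sub_zero]
    abel

theorem slide_idem (k : Fin (n + n)) (y : E n) : slide p k 0 (slide p k 0 y) = slide p k 0 y := by
  have h := slide_apply_self p k 0 y
  conv_lhs => rw [slide, h]
  simp

theorem slide_comm (k l : Fin (n + n)) (y : E n) :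
    slide p k 0 (slide p l 0 y) = slide p l 0 (slide p k 0 y) := by
  by_cases h : k = l
  · rw [h]
  · conv_lhs => rw [slide, slide_apply_ne p h]
    conv_rhs => rw [slide, slide_apply_ne p (Ne.symm h)]
    simp only [slide]
    abel

/-- A closed logarithmic form on a ball is cohomologous to a constant one which involves
only the logarithmic differentials `dlog y_j`, `j ∈ S`. -/
theorem exists_extdLog_primitive (hS : ∀ j ∈ S, p j = 0) (hr : 0 < r)
    (hW : HolExt (Metric.ball p r) W)
    (hclosed : ∀ z ∈ Metric.ball p r, extdLog S W z = 0) {d : ℤ}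
    (hd : ∀ z ∈ Metric.ball p r, Homog d (W z)) :
    ∃ (η : E n → Ext n) (w₀ : Ext n), HolExt (Metric.ball p r) η ∧
      (∀ z ∈ Metric.ball p r, Homog (d - 1) (η z)) ∧ Homog d w₀ ∧
      (∀ k ∉ S, ctr (stdVec k) w₀ = 0) ∧
      ∀ z ∈ Metric.ball p r, W z = w₀ + extdLog S η z := by
  have hb := Metric.isOpen_ball (x := p) (ε := r)
  -- elimination of the coordinates in `T` one by one; `V` is the remaining form
  have key : ∀ T : Finset (Fin (n + n)), ∃ η V : E n → Ext n, HolExt (Metric.ball p r) η ∧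
      (∀ z ∈ Metric.ball p r, Homog (d - 1) (η z)) ∧ HolExt (Metric.ball p r) V ∧
      (∀ z ∈ Metric.ball p r, Homog d (V z)) ∧
      (∀ z ∈ Metric.ball p r, W z = V z + extdLog S η z) ∧
      (∀ k ∈ T, ∀ z, V (slide p k 0 z) = V z) ∧
      ∀ k ∈ T, k ∉ S → ∀ z, ctr (stdVec k) (V z) = 0 := by
    classical
    intro T
    induction T using Finset.induction_on with
    | empty =>
      refine ⟨fun _ => 0, W, fun q => differentiableOn_const _, fun _ _ => Homog.zero _, hW, hd,
        fun z _ => ?_, by simp, by simp⟩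
      rw [extdLog]
      simp only [pd_const, map_zero, smul_zero, Finset.sum_const_zero, add_zero]
    | insert k T hk ih =>
      obtain ⟨η, V, hη, hηd, hV, hVd, hWV, hT1, hT2⟩ := ih
      have hVc : ∀ z ∈ Metric.ball p r, extdLog S V z = 0 := by
        intro z hz
        have h0 : extdLog S (fun z => V z + extdLog S η z) z = 0 := by
          rw [← hclosed z hz, extdLog, extdLog]
          refine Finset.sum_congr rfl fun l _ => ?_
          rw [pd_congr (Filter.eventually_of_mem (hb.mem_nhds hz) hWV)]
        have h1 := extdLog_extdLog (S := S) hb hη hz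
        rw [extdLog] at h0 h1 ⊢
        simp only [pd_add (hV.dAt hb hz) ((hη.extdLog hb).dAt hb hz), map_add, smul_add,
          Finset.sum_add_distrib] at h0
        rwa [h1, add_zero] at h0
      have hpr := hV.primE (S := S) (k := k)
      have hcp : HolExt (Metric.ball p r) fun z => ctr (stdVec k) (primE S p k V z) :=
        holExt_of_dAt fun z hz => (hpr.dAt hb hz).ctr _
      have hsl : ∀ z ∈ Metric.ball p r, slide p k 0 z ∈ Metric.ball p r :=
        fun z hz => slide_mem_ball hz k (by simp)
      have hVs : HolExt (Metric.ball p r) fun z => V (slide p k 0 z) := fun q =>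
        (hV q).comp (differentiable_slide p k 0).differentiableOn hsl
      refine ⟨fun z => η z + ctr (stdVec k) (primE S p k V z), elim S p k V, ?_, ?_, ?_, ?_, ?_,
        ?_, ?_⟩
      · exact holExt_of_dAt fun z hz => (hη.dAt hb hz).add (hcp.dAt hb hz)
      · refine fun z hz => (hηd z hz).add (Homog.ctr (fun q hq => ?_) _)
        have : ∀ u ∈ Metric.ball p r, (fun u => V u q) u
            = (fun _ => (0 : (E n) [⋀^Fin q]→L[ℂ] ℂ)) u := fun u hu => hVd u hu q hq
        rw [primE, prim_congr this hz]
        have := prim_clm (S := S) (k := k) (f := fun _ : E n => (0 : ℂ))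
          (differentiableOn_const (0 : ℂ)) hz (0 : ℂ →L[ℂ] (E n) [⋀^Fin q]→L[ℂ] ℂ)
        simpa using this
      · unfold elim
        split_ifs
        · exact hVs
        · exact holExt_of_dAt fun z hz => ((hVs.dAt hb hz).wdg _).ctr _
      · intro z hz
        have := hVd _ (hsl z hz)
        unfold elim
        split_ifs
        · exact this
        · have h2 := (this.wdg (stdCov k)).ctr (stdVec k)
          rwa [add_sub_cancel_right] at h2
      · intro z hz
        rw [hWV z hz, eq_elim_add_extdLog hV hVc (hS k) hz, extdLog, extdLog, extdLog]
        simp only [pd_add (hη.dAt hb hz) (hcp.dAt hb hz), map_add, smul_add,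
          Finset.sum_add_distrib]
        abel
      · intro l hl z
        rcases Finset.mem_insert.1 hl with rfl | hl
        · simp only [elim, slide_idem]
        · simp only [elim, slide_comm k l, hT1 l hl]
      · intro l hl hlS z
        rcases Finset.mem_insert.1 hl with rfl | hl
        · rw [elim, if_neg hlS, ctr_self]
        · unfold elim
          split_ifs with hkS
          · exact hT2 l hl hlS _
          · have hne : k ≠ l := fun e => hk (e ▸ hl)
            rw [ctr_ctr, ctr_wdg, hT2 l hl hlS, stdCov_stdVec, if_neg hne]
            simp
  obtain ⟨η, V, hη, hηd, hV, hVd, hWV, hT1, hT2⟩ := key Finset.univ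
  -- a form that is constant along all coordinates is constant
  have hVp : ∀ z, V z = V p := by
    have h1 : ∀ T : Finset (Fin (n + n)), ∀ z : E n, ∃ z' : E n, V z' = V z ∧
        (∀ k ∈ T, z' k = p k) := by
      classical
      intro T z
      induction T using Finset.induction_on with
      | empty => exact ⟨z, rfl, by simp⟩
      | insert k T hk ih =>
        obtain ⟨z', hz', hT⟩ := ih
        refine ⟨slide p k 0 z', (hT1 k (Finset.mem_univ k) z').trans hz', fun l hl => ?_⟩
        by_cases hlk : l = k
        · rw [hlk, slide_apply_self]
          ring
        · rw [slide_apply_ne p hlk]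
          exact hT l ((Finset.mem_insert.1 hl).resolve_left hlk)
    intro z
    obtain ⟨z', hz', hz⟩ := h1 Finset.univ z
    rw [← hz']
    congr 1
    ext k
    exact hz k (Finset.mem_univ k)
  refine ⟨η, V p, hη, hηd, hVd p (Metric.mem_ball_self hr),
    fun k hk => hT2 k (Finset.mem_univ k) hk p, fun z hz => ?_⟩
  rw [hWV z hz, hVp]

/-- An alternating form which is killed by the basis vectors outside `S` is determined by
its values on the basis vectors in `S`. -/
theorem eq_zero_of_stdVec_eq_zero {w : Ext n} (h : ∀ k ∉ S, ctr (stdVec k) w = 0) {q : ℕ}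
    (h0 : ∀ J : Fin q → Fin (n + n), Function.Injective J → (∀ a, J a ∈ S) →
      w q (fun a => stdVec (J a)) = 0) : w q = 0 := by
  apply ContinuousAlternatingMap.toAlternatingMap_injective
  refine Module.Basis.ext_alternating (EuclideanSpace.basisFun (Fin (n + n)) ℂ).toBasis
    fun J hJ => ?_
  have hb : (fun a => (EuclideanSpace.basisFun (Fin (n + n)) ℂ).toBasis (J a))
      = fun a => stdVec (J a) := by
    funext a
    simp [stdVec]
  rw [hb]
  change w q (fun a => stdVec (J a)) = 0
  by_cases hJS : ∀ a, J a ∈ S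
  · exact h0 J hJ hJS
  push Not at hJS
  obtain ⟨a, ha⟩ := hJS
  obtain _ | q := q
  · exact a.elim0
  have h1 : ∀ v : Fin (q + 1) → E n, v 0 = stdVec (J a) → w (q + 1) v = 0 := by
    intro v hv
    have h2 := congrArg (fun u : Ext n => u q (Fin.tail v)) (h (J a) ha)
    rw [← Fin.cons_self_tail v, hv]
    exact h2
  by_cases ha0 : a = 0
  · exact h1 _ (by rw [ha0])
  · have h2 := (w (q + 1)).map_swap (fun a => stdVec (n := n) (J a)) ha0
    have h3 : w (q + 1) ((fun a => stdVec (J a)) ∘ Equiv.swap a 0) = 0 := h1 _ (by simp)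
    exact neg_eq_zero.1 (h2.symm.trans h3)

end Poincare

/-! ### The log de Rham and log MdP complexes -/

section Complexes

variable {n : ℕ} {X : Type} [TopologicalSpace X] [ChartedSpace (E n) X]
  [IsManifold 𝓘(ℂ, E n) ω X] {P : Poisson n X} {φ : OpenPartialHomeomorph X (E n)}
  {S : Finset (Fin (n + n))} {x p : X} {w : Forms n X} {W : E n → Ext n} {V : Opens X}

theorem IsLogSymplectic.exists_centered (hP : IsLogSymplectic P) (p : X) :
    ∃ (φ : OpenPartialHomeomorph X (E n)) (S : Finset (Fin (n + n))), IsAdapted P φ S ∧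
      p ∈ φ.source ∧ ∀ j ∈ S, φ p j = 0 := by
  obtain ⟨φ, S, hp, h⟩ := hP p
  obtain ⟨φ', S', h', hp', hφ, hS⟩ := h.exists_centered P hp
  exact ⟨φ', S', h', hp', fun j hj => hφ ▸ ((hS j).1 hj).2⟩

theorem exists_ball_subset_target (hp : p ∈ φ.source) :
    ∃ r > 0, Metric.ball (φ p) r ⊆ φ.target :=
  Metric.isOpen_iff.1 φ.open_target _ (φ.map_source hp)

theorem LogRep.iota_iterate (hW : LogRep φ S w (φ p) W) (h : IsAdapted P φ S)
    {r : ℝ} (hr : 0 < r) (hball : Metric.ball (φ p) r ⊆ φ.target)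
    {B : E n → Fin (n + n) → Fin (n + n) → ℂ}
    (hB : ∀ i j, DifferentiableOn ℂ (fun y => B y i j) (Metric.ball (φ p) r))
    (hB' : ∀ y ∈ Metric.ball (φ p) r, ∀ i j,
      amat P φ y i j = theta S y i * theta S y j * B y i j) (m : ℕ) :
    LogRep φ S ((iota P)^[m] w) (φ p) fun y => (contractM (B y) ^ m) (W y) := by
  filter_upwards [hW, Metric.ball_mem_nhds _ hr] with y h1 h2
  constructor
  · induction m with
    | zero => exact h1.1
    | succ m ih =>
      simp only [pow_succ', Module.End.mul_apply]
      exact DAt.contractM (fun i j => (hB i j).differentiableAt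
        (Metric.isOpen_ball.mem_nhds h2)) ih
  · intro hy
    rw [lrep, repE_iota_iterate P h.1 (hball h2), ← h1.2 hy, lrep, contractM_pow_pull_diag]
    congr 3
    exact congrArg contractM (funext fun i => funext fun j => hB' y h2 i j)

theorem exists_logRep_iota_iterate (hP : IsLogSymplectic P) {r : ℤ} (hw : w ∈ logForms P V r)
    (hp : p ∈ V) (m : ℕ) : ∃ (φ : OpenPartialHomeomorph X (E n)) (S : Finset (Fin (n + n))),
      IsAdapted P φ S ∧ p ∈ φ.source ∧ ∃ W, LogRep φ S ((iota P)^[m] w) (φ p) W := by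
  obtain ⟨φ, S, h, hpφ, hS⟩ := hP.exists_centered p
  obtain ⟨r, hr, hball⟩ := exists_ball_subset_target hpφ
  obtain ⟨B, hB, hB', -⟩ := h.exists_log_matrix P hball hS
  obtain ⟨W, hW, -⟩ := exists_logRep_of_mem hw hp h hpφ
  exact ⟨φ, S, h, hpφ, _, hW.iota_iterate h hr hball hB hB' m⟩

theorem iota_iterate_mem_logForms (hP : IsLogSymplectic P) {r : ℤ} (hw : w ∈ logForms P V r)
    (m : ℕ) : (iota P)^[m] w ∈ logForms P V (r - 2 * m) := by
  refine mem_logForms_of_logRep (fun x => ?_) (fun x hx => ?_) fun p hp =>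
    exists_logRep_iota_iterate hP hw hp m
  · rw [iota_iterate_apply]
    exact Homog.contractM_pow (hw.1 x) _ m
  · rw [iota_iterate_apply, hw.2.1 x hx, map_zero]

theorem homog_dExt {r : ℤ} (hw : ∀ x, Homog r (w x)) (x : X) : Homog (r + 1) (dExt w x) := by
  rw [dExt_eq]
  exact (Homog.extd (Eventually.of_forall fun _ => (hw _).pull _)).pull _

theorem homog_restr {r : ℤ} (U : Opens X) (hw : ∀ x, Homog r (w x)) (x : X) :
    Homog r (restr U w x) := by
  by_cases hx : x ∈ U
  · rw [restr_mem _ hx]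
    exact hw x
  · rw [restr_notMem _ hx]
    exact Homog.zero r

theorem LogRep.restr (hW : LogRep φ S w (φ p) W) (h : IsAdapted P φ S) (hp : p ∈ φ.source)
    (hpV : p ∈ V) : LogRep φ S (restr (V ⊓ symplLocus P) w) (φ p) W := by
  refine hW.congr_left h (φ.map_source hp) ?_
  rw [φ.left_inv hp]
  filter_upwards [V.isOpen.mem_nhds hpV] with x hx hx'
  exact (restr_mem (W := V ⊓ symplLocus P) w ⟨hx, hx'⟩).symm

theorem LogRep.deRhamOn (hW : LogRep φ S w (φ p) W) (h : IsAdapted P φ S) (hp : p ∈ φ.source)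
    (hpV : p ∈ V) : LogRep φ S (deRhamOn P V w) (φ p) (extdLog S W) :=
  (hW.dExt h.1 (φ.map_source hp)).restr h hp hpV

theorem deRhamOn_mem (hP : IsLogSymplectic P) {r : ℤ} (hw : w ∈ logForms P V r) :
    deRhamOn P V w ∈ logForms P V (r + 1) := by
  refine mem_logForms_of_logRep (homog_restr _ (homog_dExt hw.1))
    (fun x hx => restr_notMem _ hx) fun p hp => ?_
  obtain ⟨φ, S, hpφ, h⟩ := hP p
  obtain ⟨W, hW, -⟩ := exists_logRep_of_mem hw hp h hpφ
  exact ⟨φ, S, h, hpφ, _, hW.deRhamOn h hpφ hp⟩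

theorem deRhamOn_deRhamOn {r : ℤ} (hw : w ∈ logForms P V r) :
    deRhamOn P V (deRhamOn P V w) = 0 := by
  funext x
  by_cases hx : x ∈ V ⊓ symplLocus P
  · rw [LogSymp.deRhamOn, restr_mem _ hx]
    exact (dExt_congr (W := V ⊓ symplLocus P) (w := deRhamOn P V w) (w' := dExt w)
      (fun y hy => restr_mem _ hy) hx).trans (dExt_dExt hw.2.2.1 hx)
  · exact restr_notMem _ hx

/-- The operators `δ_i` preserve logarithmic forms, since `ι_Π` and `d` do. -/
theorem mdpOn_mem (hP : IsLogSymplectic P) {j : ℤ} (hw : w ∈ Theta P V j) :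
    mdpOn P V j w ∈ Theta P V (j + 1) := by
  refine mem_logForms_of_logRep (homog_restr _ fun x => ?_)
    (fun x hx => restr_notMem _ hx) fun p hp => ?_
  · have h1 : Homog (2 * n - (j + 1)) (dExt (iota P w) x) := by
      have := homog_dExt (fun x => (iota_apply P w x) ▸ Homog.contractM (hw.1 x) _) x
      rwa [show (2 * n - j - 2 + 1 : ℤ) = 2 * n - (j + 1) by ring] at this
    have h2 : Homog (2 * n - (j + 1)) (iota P (dExt w) x) := by
      rw [iota_apply]
      have := Homog.contractM (homog_dExt hw.1 x) fun i j => P.biv x ![stdCov i, stdCov j]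
      rwa [show (2 * n - j + 1 - 2 : ℤ) = 2 * n - (j + 1) by ring] at this
    exact (h1.smul _).sub (h2.smul _)
  · obtain ⟨φ, S, h, hpφ, hS⟩ := hP.exists_centered p
    obtain ⟨r, hr, hball⟩ := exists_ball_subset_target hpφ
    obtain ⟨B, hB, hB', -⟩ := h.exists_log_matrix P hball hS
    obtain ⟨W, hW, -⟩ := exists_logRep_of_mem hw hp h hpφ
    have hct := φ.map_source hpφ
    have h1 := (hW.iota_iterate h hr hball hB hB' 1).dExt h.1 hct
    have h2 := (hW.dExt h.1 hct).iota_iterate h hr hball hB hB' 1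
    have h3 := (h1.smul ((n - j : ℤ) : ℂ)).add (h2.smul (-(((n - j : ℤ) : ℂ) - 1)))
    have e : mdp P (n - j) w = ((n - j : ℤ) : ℂ) • dExt ((iota P)^[1] w)
        + (-(((n - j : ℤ) : ℂ) - 1)) • (iota P)^[1] (dExt w) := by
      rw [mdp, sub_eq_add_neg, neg_smul]
      rfl
    rw [← e] at h3
    exact ⟨φ, S, h, hpφ, _, h3.restr h hpφ hp⟩

theorem topPow_biv_ne_zero (hx : x ∈ symplLocus P) :
    topPow (fun i j => P.biv x ![stdCov i, stdCov j]) ≠ 0 :=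
  (topCoeff_ne_zero_iff P (holChart_chartAt x) (mem_chart_source _ x)).1 (interior_subset hx)

theorem iotaAt_pow_injective (hx : x ∈ symplLocus P) {m : ℕ} {v : Ext n} (hv : Homog (n + m) v)
    (h : (iotaAt P x ^ m) v = 0) : v = 0 := by
  by_cases hm : m ≤ n
  · obtain ⟨k, hk⟩ := Nat.exists_eq_add_of_le hm
    exact contractM_pow_injective (topPow_biv_ne_zero hx) k m hk v hv h
  · exact hv.eq_zero_of_lt (by omega)

theorem iotaAt_pow_surjective (hx : x ∈ symplLocus P) {m : ℕ} {v : Ext n} (hv : Homog (n - m) v) :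
    ∃ v', Homog (n + m) v' ∧ (iotaAt P x ^ m) v' = v := by
  by_cases hm : m ≤ n
  · obtain ⟨k, hk⟩ := Nat.exists_eq_add_of_le hm
    exact contractM_pow_surjective (topPow_biv_ne_zero hx) k m hk v hv
  · exact ⟨0, Homog.zero _, by rw [map_zero, hv.eq_zero_of_neg (by omega)]⟩

theorem iota_iterate_injOn {m : ℕ} {w w' : Forms n X} (hw : w ∈ logForms P V (n + m))
    (hw' : w' ∈ logForms P V (n + m)) (h : (iota P)^[m] w = (iota P)^[m] w') : w = w' := by
  funext x
  by_cases hx : x ∈ V ⊓ symplLocus P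
  · have h1 := congrFun h x
    rw [iota_iterate_apply, iota_iterate_apply, ← sub_eq_zero, ← map_sub] at h1
    exact sub_eq_zero.1 (iotaAt_pow_injective hx.2 (Homog.sub (hw.1 x) (hw'.1 x)) h1)
  · rw [hw.2.1 x hx, hw'.2.1 x hx]

/-- The form of degree `q` with a given component. -/
def Ext.single (q : ℕ) : (E n) [⋀^Fin q]→L[ℂ] ℂ →ₗ[ℂ] Ext n :=
  LinearMap.single ℂ (fun q => (E n) [⋀^Fin q]→L[ℂ] ℂ) q

theorem Ext.single_same (q : ℕ) (f : (E n) [⋀^Fin q]→L[ℂ] ℂ) : Ext.single q f q = f :=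
  Pi.single_eq_same (M := fun q => (E n) [⋀^Fin q]→L[ℂ] ℂ) _ _

theorem homog_single (q : ℕ) (f : (E n) [⋀^Fin q]→L[ℂ] ℂ) : Homog q (Ext.single q f) :=
  fun q' hq' => Pi.single_eq_of_ne (M := fun q => (E n) [⋀^Fin q]→L[ℂ] ℂ)
    (fun e => hq' (by rw [e])) _

theorem Homog.eq_single {q : ℕ} {v : Ext n} (h : Homog q v) : v = Ext.single q (v q) := by
  funext q'
  by_cases hq : q' = q
  · subst hq
    exact (Ext.single_same _ _).symm
  · rw [h q' (by exact_mod_cast hq), homog_single q _ q' (by exact_mod_cast hq)]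

/-- The inverse of the contraction operators depends holomorphically on parameters. -/
theorem exists_holExt_contractM_pow_eq {U : Set (E n)} (hU : IsOpen U)
    {B : E n → Fin (n + n) → Fin (n + n) → ℂ}
    (hB : ∀ i j, DifferentiableOn ℂ (fun y => B y i j) U) (hB0 : ∀ y ∈ U, topPow (B y) ≠ 0)
    {m k : ℕ} (hk : n = m + k) (hW : HolExt U W) (hWk : ∀ y ∈ U, Homog (n - m) (W y)) :
    ∃ W', HolExt U W' ∧ (∀ y, Homog (n + m) (W' y)) ∧
      ∀ y ∈ U, (contractM (B y) ^ m) (W' y) = W y := by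
  have hnm : ((n + m : ℕ) : ℤ) = n + m := by push_cast; ring
  have hnk : (n - m : ℤ) = k := by omega
  let L : E n → (E n) [⋀^Fin (n + m)]→L[ℂ] ℂ →L[ℂ] (E n) [⋀^Fin k]→L[ℂ] ℂ := fun y =>
    LinearMap.toContinuousLinearMap
      ((Ext.comp k).comp ((contractM (B y) ^ m).comp (Ext.single (n + m))))
  have hL : ∀ y f, L y f = (contractM (B y) ^ m) (Ext.single (n + m) f) k := fun y f => rfl
  have hLh : ∀ y f, Homog k ((contractM (B y) ^ m) (Ext.single (n + m) f)) := by
    intro y f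
    have := (homog_single (n + m) f).contractM_pow (B y) m
    rwa [show ((n + m : ℕ) - 2 * m : ℤ) = k by omega] at this
  have hLd : ContDiffOn ℂ 1 L U := by
    refine contDiffOn_clm_apply.2 fun f => ?_
    refine contDiffOn_of_differentiableOn hU (f := fun y => L y f) (fun y hy => ?_) 1
    have h1 : ∀ m' : ℕ, DAt (fun y => (contractM (B y) ^ m') (Ext.single (n + m) f)) y := by
      intro m'
      induction m' with
      | zero => exact DAt.const _ _
      | succ m' ih =>
        simp only [pow_succ', Module.End.mul_apply]
        exact DAt.contractM (fun i j => (hB i j).differentiableAt (hU.mem_nhds hy)) ih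
    exact (h1 m k).differentiableWithinAt
  have hbij : ∀ y ∈ U, Function.Bijective (L y) := by
    intro y hy
    constructor
    · refine (injective_iff_map_eq_zero (L y)).2 fun f hf => ?_
      have h1 : (contractM (B y) ^ m) (Ext.single (n + m) f) = 0 := by
        rw [(hLh y f).eq_single, ← hL, hf, map_zero]
      have h2 := contractM_pow_injective (hB0 y hy) k m hk _ (by
        have := homog_single (n + m) f
        rwa [hnm] at this) h1
      rw [← Ext.single_same (n + m) f, h2]
      rfl
    · intro g
      obtain ⟨v, hv, hv'⟩ := contractM_pow_surjective (hB0 y hy) k m hk (Ext.single k g) (by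
        rw [hnk]
        exact homog_single k g)
      refine ⟨v (n + m), ?_⟩
      rw [← hnm] at hv
      rw [hL, ← hv.eq_single, hv', Ext.single_same]
  let e : ∀ y ∈ U, (E n) [⋀^Fin (n + m)]→L[ℂ] ℂ ≃L[ℂ] (E n) [⋀^Fin k]→L[ℂ] ℂ := fun y hy =>
    (LinearEquiv.ofBijective (L y).toLinearMap (hbij y hy)).toContinuousLinearEquiv
  have he : ∀ y (hy : y ∈ U), (e y hy : _ →L[ℂ] _) = L y := fun y hy => by
    ext1 f
    rfl
  refine ⟨fun y => Ext.single (n + m) ((L y).inverse (W y k)), fun q y hy => ?_,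
    fun y => hnm ▸ homog_single _ _, fun y hy => ?_⟩
  · have h1 : DifferentiableAt ℂ (fun y => (L y).inverse (W y k)) y := by
      refine DifferentiableAt.clm_apply ?_ ((hW k).differentiableAt (hU.mem_nhds hy))
      have h2 := (contDiffAt_map_inverse (𝕜 := ℂ) (n := 1) (e y hy)).differentiableAt (by simp)
      rw [he y hy] at h2
      exact h2.comp y ((hLd.contDiffAt (hU.mem_nhds hy)).differentiableAt (by simp))
    by_cases hq : q = n + m
    · subst hq
      simp only [Ext.single_same]
      exact h1.differentiableWithinAt
    · have : (fun y => Ext.single (n + m) ((L y).inverse (W y k)) q) = fun _ => 0 :=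
        funext fun z => homog_single _ _ q (by exact_mod_cast hq)
      rw [this]
      exact differentiableWithinAt_const _
  · have h1 := hWk y hy
    rw [hnk] at h1
    rw [h1.eq_single, (hLh y _).eq_single, ← hL, ← he y hy, ContinuousLinearMap.inverse_equiv]
    congr 1
    exact (e y hy).apply_symm_apply _

/-- The pointwise inverse of `ι_Π^m` on the symplectic locus is logarithmic: in the logarithmic
frame of an adapted chart it extends holomorphically across the divisor. -/
theorem iota_iterate_surjOn (hP : IsLogSymplectic P) {m : ℕ} (hw : w ∈ logForms P V (n - m)) :
    ∃ w' ∈ logForms P V (n + m), (iota P)^[m] w' = w := by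
  classical
  by_cases hm : m ≤ n
  swap
  · refine ⟨0, Submodule.zero_mem _, ?_⟩
    funext x
    rw [iota_iterate_apply, Forms.zero_apply, map_zero,
      Homog.eq_zero_of_neg (hw.1 x) (by omega)]
  obtain ⟨k, hk⟩ := Nat.exists_eq_add_of_le hm
  have hex : ∀ x : X, ∃ v : Ext n, Homog (n + m) v ∧ (x ∈ V ⊓ symplLocus P →
      (iotaAt P x ^ m) v = w x) ∧ (x ∉ V ⊓ symplLocus P → v = 0) := by
    intro x
    by_cases hx : x ∈ V ⊓ symplLocus P
    · obtain ⟨v, hv, hv'⟩ := iotaAt_pow_surjective hx.2 (hw.1 x)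
      exact ⟨v, hv, fun _ => hv', fun h => absurd hx h⟩
    · exact ⟨0, Homog.zero _, fun h => absurd h hx, fun _ => rfl⟩
  choose f hf1 hf2 hf3 using hex
  obtain ⟨w', hw'1, hw'2, hw'3⟩ : ∃ w' : Forms n X, (∀ x, Homog (n + m) (w' x)) ∧
      (∀ x ∈ V ⊓ symplLocus P, (iotaAt P x ^ m) (w' x) = w x) ∧
      ∀ x ∉ V ⊓ symplLocus P, w' x = 0 := ⟨f, hf1, hf2, hf3⟩
  refine ⟨w', mem_logForms_of_logRep hw'1 hw'3 fun p hp => ?_, ?_⟩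
  · obtain ⟨φ, S, h, hpφ, hS⟩ := hP.exists_centered p
    obtain ⟨W, hW, hWh⟩ := exists_logRep_of_mem hw hp h hpφ
    obtain ⟨r₁, hr₁, hW1, hW2⟩ := hW.exists_ball
    have hct := φ.map_source hpφ
    obtain ⟨r₂, hr₂, hb₂⟩ := Metric.mem_nhds_iff.1
      (eventually_mem hct (V.isOpen.mem_nhds (by rwa [φ.left_inv hpφ])))
    set r := min r₁ r₂
    have hr : 0 < r := lt_min hr₁ hr₂
    have h1 : Metric.ball (φ p) r ⊆ Metric.ball (φ p) r₁ :=
      Metric.ball_subset_ball (min_le_left _ _)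
    have h2 : Metric.ball (φ p) r ⊆ Metric.ball (φ p) r₂ :=
      Metric.ball_subset_ball (min_le_right _ _)
    obtain ⟨B, hB, hB', hB0⟩ := h.exists_log_matrix P (fun y hy => (hb₂ (h2 hy)).1) hS
    obtain ⟨W', hW', hW'h, hW'2⟩ := exists_holExt_contractM_pow_eq Metric.isOpen_ball hB hB0 hk
      (fun q => (hW1 q).mono h1) fun y _ => hWh y
    refine ⟨φ, S, h, hpφ, W', ?_⟩
    filter_upwards [Metric.ball_mem_nhds _ hr] with y hy
    refine ⟨hW'.dAt Metric.isOpen_ball hy, fun hne => ?_⟩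
    obtain ⟨hyt, hyV⟩ := hb₂ (h2 hy)
    have hsy : φ.symm y ∈ V ⊓ symplLocus P := ⟨hyV, (h.symm_mem_symplLocus_iff P hyt).2 hne⟩
    have h3 : (contractM (B y) ^ m) (lrep φ S w' y) = W y := by
      rw [← hW2 y (h1 hy) hne, lrep, contractM_pow_pull_diag]
      have : (fun i j => theta S y i * theta S y j * B y i j) = amat P φ y :=
        funext fun i => funext fun j => (hB' y hy i j).symm
      rw [this, ← repE_iota_iterate P h.1 hyt, lrep]
      have h4 : (iota P)^[m] w' (φ.symm y) = w (φ.symm y) := by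
        rw [iota_iterate_apply, hw'2 _ hsy]
      rw [repE, h4, repE]
    have h5 : (contractM (B y) ^ m) (lrep φ S w' y - W' y) = 0 := by
      rw [map_sub, h3, hW'2 y hy, sub_self]
    exact sub_eq_zero.1 (contractM_pow_injective (hB0 y hy) k m hk _
      ((((hw'1 _).pull _).pull _).sub (hW'h y)) h5)
  · funext x
    rw [iota_iterate_apply]
    by_cases hx : x ∈ V ⊓ symplLocus P
    · exact hw'2 x hx
    · rw [hw'3 x hx, map_zero, hw.2.1 x hx]

/-- Contraction with `Π^m`, as a map `Ω^{n+m}(log D) → Ω^{n-m}(log D)`. -/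
def iotaLin (hP : IsLogSymplectic P) (V : Opens X) (m : ℕ) :
    logForms P V (n + m) →ₗ[ℂ] logForms P V (n - m) where
  toFun w := ⟨(iota P)^[m] (w : Forms n X), by
    have := iota_iterate_mem_logForms hP w.2 m
    rwa [show (n + m - 2 * m : ℤ) = n - m by ring] at this⟩
  map_add' a b := Subtype.ext (funext fun x => by
    simp only [Submodule.coe_add, Forms.add_apply, iota_iterate_apply, map_add])
  map_smul' c a := Subtype.ext (funext fun x => by
    simp only [Submodule.coe_smul, Forms.smul_apply, iota_iterate_apply, map_smul,
      RingHom.id_apply])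

/-- Contraction with `Π^m`, as an isomorphism `Ω^{n+m}(log D) ≃ Ω^{n-m}(log D)`. -/
def iotaEquiv (hP : IsLogSymplectic P) (V : Opens X) (m : ℕ) :
    logForms P V (n + m) ≃ₗ[ℂ] logForms P V (n - m) :=
  LinearEquiv.ofBijective (iotaLin hP V m)
    ⟨fun a b h => Subtype.ext (iota_iterate_injOn a.2 b.2 (congrArg Subtype.val h)), fun w => by
      obtain ⟨w', hw', h⟩ := iota_iterate_surjOn hP w.2
      exact ⟨⟨w', hw'⟩, Subtype.ext h⟩⟩

theorem iotaEquiv_coe (hP : IsLogSymplectic P) (V : Opens X) (m : ℕ)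
    (w : logForms P V (n + m)) : (iotaEquiv hP V m w : Forms n X) = (iota P)^[m] w := rfl

/-- The isomorphism from the log MdP complex to the log de Rham complex. -/
def piEquiv (hP : IsLogSymplectic P) (V : Opens X) (j : ℤ) : Theta P V j ≃ₗ[ℂ] logForms P V j :=
  if h : j ≤ n then
    (LinearEquiv.ofEq (Theta P V j) (logForms P V (n + (n - j).toNat))
        (congrArg (logForms P V) (by omega))).trans
      ((iotaEquiv hP V (n - j).toNat).trans
        (LinearEquiv.ofEq (logForms P V (n - (n - j).toNat)) (logForms P V j)
          (congrArg (logForms P V) (by omega))))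
  else
    (LinearEquiv.ofEq (Theta P V j) (logForms P V (n - (j - n).toNat))
        (congrArg (logForms P V) (by omega))).trans
      ((iotaEquiv hP V (j - n).toNat).symm.trans
        (LinearEquiv.ofEq (logForms P V (n + (j - n).toNat)) (logForms P V j)
          (congrArg (logForms P V) (by omega))))

theorem piEquiv_of_eq_sub (hP : IsLogSymplectic P) {j : ℤ} {m : ℕ} (hj : j = n - m)
    (w : Theta P V j) : (piEquiv hP V j w : Forms n X) = (iota P)^[m] (w : Forms n X) := by
  have h : j ≤ n := by omega
  rw [piEquiv, dif_pos h]
  simp only [LinearEquiv.trans_apply, LinearEquiv.coe_ofEq_apply, iotaEquiv_coe]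
  rw [show (n - j).toNat = m by omega]

theorem iota_iterate_piEquiv (hP : IsLogSymplectic P) {j : ℤ} {m : ℕ} (hj : j = n + m)
    (w : Theta P V j) : (iota P)^[m] (piEquiv hP V j w : Forms n X) = (w : Forms n X) := by
  obtain _ | m := m
  · exact piEquiv_of_eq_sub hP (m := 0) (by simpa using hj) w
  have h : ¬ j ≤ n := by push_cast at hj; omega
  rw [piEquiv, dif_neg h]
  simp only [LinearEquiv.trans_apply, LinearEquiv.coe_ofEq_apply]
  have h1 : (j - n).toNat = m + 1 := by omega
  conv_lhs => rw [← h1]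
  rw [← iotaEquiv_coe hP V, LinearEquiv.apply_symm_apply, LinearEquiv.coe_ofEq_apply]

theorem iota_iterate_restr (U : Opens X) (m : ℕ) (w : Forms n X) :
    (iota P)^[m] (restr U w) = restr U ((iota P)^[m] w) := by
  funext x
  rw [iota_iterate_apply]
  by_cases hx : x ∈ U
  · rw [restr_mem _ hx, restr_mem _ hx, iota_iterate_apply]
  · rw [restr_notMem _ hx, restr_notMem _ hx, map_zero]

theorem exists_degree (n : ℕ) (j : ℤ) : (∃ m : ℕ, j = n - (m + 1 : ℕ)) ∨ ∃ m : ℕ, j = n + m := by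
  rcases lt_or_ge j n with h | h
  · exact Or.inl ⟨(n - j - 1).toNat, by omega⟩
  · exact Or.inr ⟨(j - n).toNat, by omega⟩

theorem piEquiv_injOn {j : ℤ} {m : ℕ} (hj : j = n + m) {a b : logForms P V j}
    (h : (iota P)^[m] (a : Forms n X) = (iota P)^[m] (b : Forms n X)) : a = b := by
  subst hj
  exact Subtype.ext (iota_iterate_injOn a.2 b.2 h)

theorem resLog_coe {V V' : Opens X} (h : V' ≤ V) (r : ℤ) (w : logForms P V r) :
    (resLog P h r w : Forms n X) = restr (V' ⊓ symplLocus P) w := rfl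

theorem piEquiv_res (hP : IsLogSymplectic P) {V V' : Opens X} (h : V' ≤ V) (j : ℤ)
    (w : Theta P V j) :
    piEquiv hP V' j (resLog P h _ w) = resLog P h _ (piEquiv hP V j w) := by
  rcases exists_degree n j with ⟨m, hj⟩ | ⟨m, hj⟩
  · apply Subtype.ext
    rw [piEquiv_of_eq_sub hP hj, resLog_coe, resLog_coe, piEquiv_of_eq_sub hP hj,
      iota_iterate_restr]
  · refine piEquiv_injOn hj ?_
    rw [iota_iterate_piEquiv hP hj, resLog_coe, resLog_coe, iota_iterate_restr,
      iota_iterate_piEquiv hP hj]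

/-- The isomorphism is compatible with the differentials. In degrees below `n` this is the
commutation relation for `ι_Π^k δ_{k+1}`; in the other degrees the relation for `ι_Π^{m+1} d` is
used, after application of the injective map `ι_Π^{m+1}`. -/
theorem piEquiv_mdpOn (hP : IsLogSymplectic P) {j : ℤ} (w : Theta P V j) (w' : Theta P V (j + 1))
    (h : (w' : Forms n X) = mdpOn P V j w) :
    (piEquiv hP V (j + 1) w' : Forms n X) = deRhamOn P V (piEquiv hP V j w) := by
  rcases exists_degree n j with ⟨m, hj⟩ | ⟨m, hj⟩
  · rw [piEquiv_of_eq_sub hP (m := m) (by omega), h, piEquiv_of_eq_sub hP hj, mdpOn, deRhamOn,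
      iota_iterate_restr]
    funext x
    by_cases hx : x ∈ V ⊓ symplLocus P
    · rw [restr_mem _ hx, restr_mem _ hx, ← iota_iterate_mdp P w.2.2.2.1 m hx]
      rw [show (n - j : ℤ) = m + 1 by omega]
    · rw [restr_notMem _ hx, restr_notMem _ hx]
  · have hmem := deRhamOn_mem hP (piEquiv hP V j w).2
    refine congrArg Subtype.val (piEquiv_injOn (m := m + 1) (by omega)
      (a := piEquiv hP V (j + 1) w') (b := ⟨_, hmem⟩) ?_)
    rw [iota_iterate_piEquiv hP (by omega), h, mdpOn]
    change _ = (iota P)^[m + 1]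
      (restr (V ⊓ symplLocus P) (dExt (piEquiv hP V j w : Forms n X)))
    rw [iota_iterate_restr]
    funext x
    by_cases hx : x ∈ V ⊓ symplLocus P
    · rw [restr_mem _ hx, restr_mem _ hx,
        iota_iterate_dExt_eq_mdp P (piEquiv hP V j w).2.2.2.1 m hx, iota_iterate_piEquiv hP hj]
      rw [show (n - j : ℤ) = -m by omega]
    · rw [restr_notMem _ hx, restr_notMem _ hx]

/-- `δ ∘ δ = 0`, by transport of `d ∘ d = 0`. -/
theorem mdpOn_mdpOn (hP : IsLogSymplectic P) {j : ℤ} (hw : w ∈ Theta P V j) :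
    mdpOn P V (j + 1) (mdpOn P V j w) = 0 := by
  have h1 := mdpOn_mem hP hw
  have h2 := mdpOn_mem hP h1
  have h3 := piEquiv_mdpOn hP ⟨w, hw⟩ ⟨_, h1⟩ rfl
  have h4 := piEquiv_mdpOn hP ⟨_, h1⟩ ⟨_, h2⟩ rfl
  rw [h3, deRhamOn_deRhamOn (piEquiv hP V j ⟨w, hw⟩).2] at h4
  have h5 : piEquiv hP V (j + 1 + 1) ⟨_, h2⟩ = 0 := Subtype.ext h4
  exact congrArg Subtype.val ((LinearEquiv.map_eq_zero_iff _).1 h5)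

end Complexes

/-! ### Residues along the branches of the divisor -/

section Residues

variable {n : ℕ} {X : Type} [TopologicalSpace X] [ChartedSpace (E n) X]
  [IsManifold 𝓘(ℂ, E n) ω X] {P : Poisson n X} {φ φ' : OpenPartialHomeomorph X (E n)}
  {S S' : Finset (Fin (n + n))} {x p : X} {w w' : Forms n X} {W : E n → Ext n} {V : Opens X} {i : ℕ}

/-- The germ at `p` of the hypersurface where the coordinate `j` vanishes. -/
def hypGerm (φ : OpenPartialHomeomorph X (E n)) (j : Fin (n + n)) (p : X) : Germ (𝓝 p) Prop :=
  ((fun x => coord φ j x = 0 : X → Prop) : Germ (𝓝 p) Prop)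

theorem hypGerm_eq_iff {j k : Fin (n + n)} :
    hypGerm φ k p = hypGerm φ' j p ↔ ∀ᶠ x in 𝓝 p, φ x k = 0 ↔ φ' x j = 0 := by
  rw [hypGerm, hypGerm, Germ.coe_eq]
  exact ⟨fun h => h.mono fun x hx => iff_of_eq hx, fun h => h.mono fun x hx => propext hx⟩

/-- The branches at a point can be read off from a single adapted chart. -/
theorem isBranch_iff (h : IsAdapted P φ S) (hp : p ∈ φ.source) {b : Germ (𝓝 p) Prop} :
    IsBranch P p b ↔ ∃ k ∈ S, φ p k = 0 ∧ b = hypGerm φ k p := by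
  constructor
  · rintro ⟨φ', S', hp', h', j, hj, hj0, rfl⟩
    obtain ⟨k, hk, hk0, u, hu⟩ := h'.exists_unit P h hp' hp hj hj0
    refine ⟨k, hk, hk0, hypGerm_eq_iff.2 ?_⟩
    filter_upwards [hu] with x hx
    rw [hx.2.2]
    exact ⟨fun h0 => by rw [h0, mul_zero], fun h0 => (mul_eq_zero.1 h0).resolve_left hx.2.1⟩
  · rintro ⟨k, hk, hk0, rfl⟩
    exact ⟨φ, S, hp, h, k, hk, hk0, rfl⟩

theorem OrdLocus.exists_mem_plaque (h : IsAdapted P φ S) (z : OrdLocus P i)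
    (hz : z.pt ∈ φ.source) : ∃ J : Fin i → Fin (n + n), (∀ a, J a ∈ S) ∧ z ∈ plaque P φ J := by
  have h1 : ∀ a, ∃ k ∈ S, φ z.pt k = 0 ∧ z.1.2 a = hypGerm φ k z.pt := fun a =>
    (isBranch_iff h hz).1 (z.2.2 a)
  choose J hJ hJ0 hJz using h1
  exact ⟨J, hJ, hz, fun a => ⟨hJ0 a, hJz a⟩⟩

/-- The point of `OrdLocus` over `p` given by branches in an adapted chart. -/
theorem exists_ordLocus (h : IsAdapted P φ S) (hp : p ∈ φ.source) {J : Fin i → Fin (n + n)}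
    (hJ : Function.Injective J) (hJS : ∀ a, J a ∈ S ∧ φ p (J a) = 0) :
    ∃ z : OrdLocus P i, z.pt = p ∧ z ∈ plaque P φ J := by
  refine ⟨⟨⟨p, fun a => hypGerm φ (J a) p⟩, fun a b hab => ?_, fun a =>
    (isBranch_iff h hp).2 ⟨J a, (hJS a).1, (hJS a).2, rfl⟩⟩, rfl, hp, fun a => ⟨(hJS a).2, rfl⟩⟩
  exact hJ (eq_of_coord_germ_eq hp (hJS a).2 (hypGerm_eq_iff.1 hab))

theorem plaque_ext {z z' : OrdLocus P i} {J : Fin i → Fin (n + n)} (hz : z ∈ plaque P φ J)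
    (hz' : z' ∈ plaque P φ J) (h : z.pt = z'.pt) : z = z' := by
  obtain ⟨⟨p, b⟩, hb⟩ := z
  obtain ⟨⟨p', b'⟩, hb'⟩ := z'
  obtain rfl : p = p' := h
  refine Subtype.ext (Sigma.ext rfl (heq_of_eq ?_))
  funext a
  exact ((hz.2 a).2).trans ((hz'.2 a).2).symm

theorem plaque_injective {z : OrdLocus P i} {J : Fin i → Fin (n + n)} (hz : z ∈ plaque P φ J) :
    Function.Injective J := fun a b hab => z.2.1 (by rw [(hz.2 a).2, (hz.2 b).2, hab])

theorem perm_mem_plaque {z : OrdLocus P i} {J : Fin i → Fin (n + n)} (hz : z ∈ plaque P φ J)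
    (s : Equiv.Perm (Fin i)) : OrdLocus.perm P s z ∈ plaque P φ (J ∘ s) :=
  ⟨hz.1, fun a => hz.2 (s a)⟩

theorem plaque_eventually {z : OrdLocus P i} {J J' : Fin i → Fin (n + n)}
    (hz : z ∈ plaque P φ J) (hz' : z ∈ plaque P φ' J') (a : Fin i) :
    ∀ᶠ x in 𝓝 z.pt, φ x (J a) = 0 ↔ φ' x (J' a) = 0 :=
  hypGerm_eq_iff.1 ((hz.2 a).2.symm.trans (hz'.2 a).2)

/-- The lifts of a stratum of an adapted chart form a neighbourhood basis. -/
theorem comap_inf_principal_plaque_le {z : OrdLocus P i}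
    {J : Fin i → Fin (n + n)} (hz : z ∈ plaque P φ J) :
    comap (OrdLocus.pt P) (𝓝 z.pt) ⊓ 𝓟 (plaque P φ J) ≤ 𝓝 z := by
  have e : 𝓝 z = @nhds _ (TopologicalSpace.induced (OrdLocus.pt P) inferInstance) z ⊓
      @nhds _ (TopologicalSpace.generateFrom {A | ∃ φ S, IsAdapted P φ S ∧
        ∃ J : Fin i → Fin (n + n), (∀ a, J a ∈ S) ∧ A = plaque P φ J}) z :=
    nhds_inf (t₁ := TopologicalSpace.induced (OrdLocus.pt P) inferInstance)
      (t₂ := TopologicalSpace.generateFrom {A | ∃ φ S, IsAdapted P φ S ∧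
        ∃ J : Fin i → Fin (n + n), (∀ a, J a ∈ S) ∧ A = plaque P φ J}) (a := z)
  rw [e, nhds_induced, TopologicalSpace.nhds_generateFrom]
  refine le_inf inf_le_left (le_iInf₂ ?_)
  rintro _ ⟨hzA, φ', S', h', J', hJ', rfl⟩
  rw [le_principal_iff, mem_inf_principal, mem_comap]
  have h1 := eventually_all.2 fun a => (plaque_eventually hz hzA a).eventually_nhds
  refine ⟨_, Filter.inter_mem (φ'.open_source.mem_nhds hzA.1) h1, ?_⟩
  rintro z' ⟨hz'1, hz'2⟩ hz'
  refine ⟨hz'1, fun a => ⟨?_, ?_⟩⟩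
  · exact (hz'2 a).self_of_nhds.1 (hz'.2 a).1
  · rw [(hz'.2 a).2]
    exact hypGerm_eq_iff.2 (hz'2 a)

theorem plaque_mem_nhds (h : IsAdapted P φ S) {z : OrdLocus P i} {J : Fin i → Fin (n + n)}
    (hJ : ∀ a, J a ∈ S) (hz : z ∈ plaque P φ J) : plaque P φ J ∈ 𝓝 z := by
  have h1 : IsOpen (plaque P φ J) := by
    have h2 := TopologicalSpace.isOpen_generateFrom_of_mem (g := {A | ∃ φ S, IsAdapted P φ S ∧
      ∃ J : Fin i → Fin (n + n), (∀ a, J a ∈ S) ∧ A = plaque P φ J}) ⟨φ, S, h, J, hJ, rfl⟩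
    exact h2.mono inf_le_right
  exact h1.mem_nhds hz

/-- `c` is the residue of the logarithmic form `w` at `z`: the value at the point `z` of `w` on
the vectors `y_j ∂_j` of an adapted chart, where `j` runs over the indices of the branches. -/
def IsResid (w : Forms n X) (z : OrdLocus P i) (c : ℂ) : Prop :=
  ∃ (φ : OpenPartialHomeomorph X (E n)) (S : Finset (Fin (n + n))) (J : Fin i → Fin (n + n))
    (W : E n → Ext n), IsAdapted P φ S ∧ (∀ a, J a ∈ S) ∧ z ∈ plaque P φ J ∧
      LogRep φ S w (φ z.pt) W ∧ c = W (φ z.pt) i fun a => stdVec (J a)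

/-- The residue does not depend on the adapted chart. -/
theorem IsResid.unique {z : OrdLocus P i} {c c' : ℂ} (h : IsResid w z c) (h' : IsResid w z c') :
    c = c' := by
  obtain ⟨φ, S, J, W, hS, hJ, hz, hW, rfl⟩ := h
  obtain ⟨φ', S', J', W', hS', hJ', hz', hW', rfl⟩ := h'
  obtain ⟨W₂, hW₂, -, h2⟩ := LogRep.trans hS hS' hz.1 hz'.1 hW'
  rw [(hW.unique hW₂).self_of_nhds]
  exact h2 J J' fun a => ⟨hJ a, (hz.2 a).1, hJ' a, plaque_eventually hz hz' a⟩

open Classical in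
/-- The residue of a logarithmic form. It is `0` by convention if there is none,
which does not happen for logarithmic forms. -/
def resid (w : Forms n X) (z : OrdLocus P i) : ℂ :=
  if h : ∃ c, IsResid w z c then h.choose else 0

theorem IsResid.resid_eq {z : OrdLocus P i} {c : ℂ} (h : IsResid w z c) : resid w z = c := by
  have : ∃ c, IsResid w z c := ⟨c, h⟩
  rw [resid, dif_pos this]
  exact this.choose_spec.unique h

theorem LogRep.resid_eq (hW : LogRep φ S w (φ p) W) (h : IsAdapted P φ S)
    {J : Fin i → Fin (n + n)} (hJ : ∀ a, J a ∈ S) {z : OrdLocus P i} (hz : z ∈ plaque P φ J)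
    (hzp : z.pt = p) : resid w z = W (φ p) i fun a => stdVec (J a) := by
  subst hzp
  exact IsResid.resid_eq ⟨φ, S, J, W, h, hJ, hz, hW, rfl⟩

theorem exists_chart_of_mem (hP : IsLogSymplectic P) {r : ℤ} (hw : w ∈ logForms P V r)
    (z : OrdLocus P i) (hz : z.pt ∈ V) : ∃ (φ : OpenPartialHomeomorph X (E n))
      (S : Finset (Fin (n + n))) (J : Fin i → Fin (n + n)) (W : E n → Ext n), IsAdapted P φ S ∧
        (∀ a, J a ∈ S) ∧ z ∈ plaque P φ J ∧ LogRep φ S w (φ z.pt) W := by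
  obtain ⟨φ, S, hp, h⟩ := hP z.pt
  obtain ⟨J, hJ, hz'⟩ := OrdLocus.exists_mem_plaque h z hp
  obtain ⟨W, hW, -⟩ := exists_logRep_of_mem hw hz h hp
  exact ⟨φ, S, J, W, h, hJ, hz', hW⟩

theorem resid_add (hP : IsLogSymplectic P) {r : ℤ} (hw : w ∈ logForms P V r)
    (hw' : w' ∈ logForms P V r) (z : OrdLocus P i) (hz : z.pt ∈ V) :
    resid (w + w') z = resid w z + resid w' z := by
  obtain ⟨φ, S, J, W, h, hJ, hz', hW⟩ := exists_chart_of_mem hP hw z hz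
  obtain ⟨W', hW', -⟩ := exists_logRep_of_mem hw' hz h hz'.1
  rw [hW.resid_eq h hJ hz' rfl, hW'.resid_eq h hJ hz' rfl, (hW.add hW').resid_eq h hJ hz' rfl]
  rfl

theorem resid_smul (hP : IsLogSymplectic P) {r : ℤ} (hw : w ∈ logForms P V r) (c : ℂ)
    (z : OrdLocus P i) (hz : z.pt ∈ V) : resid (c • w) z = c * resid w z := by
  obtain ⟨φ, S, J, W, h, hJ, hz', hW⟩ := exists_chart_of_mem hP hw z hz
  rw [hW.resid_eq h hJ hz' rfl, (hW.smul c).resid_eq h hJ hz' rfl]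
  rfl

theorem resid_perm (hP : IsLogSymplectic P) {r : ℤ} (hw : w ∈ logForms P V r)
    (z : OrdLocus P i) (hz : z.pt ∈ V) (s : Equiv.Perm (Fin i)) :
    resid w (OrdLocus.perm P s z) = ((Equiv.Perm.sign s : ℤ) : ℂ) * resid w z := by
  obtain ⟨φ, S, J, W, h, hJ, hz', hW⟩ := exists_chart_of_mem hP hw z hz
  rw [hW.resid_eq h hJ hz' rfl, hW.resid_eq h (fun a => hJ (s a)) (perm_mem_plaque hz' s) rfl]
  refine ((W (φ z.pt) i).toAlternatingMap.map_perm (fun a => stdVec (J a)) s).trans ?_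
  rw [Units.smul_def, zsmul_eq_mul]
  rfl

theorem resid_congr (hP : IsLogSymplectic P) {r : ℤ} (hw : w ∈ logForms P V r)
    (z : OrdLocus P i) (hz : z.pt ∈ V)
    (h : ∀ᶠ x in 𝓝 z.pt, x ∈ symplLocus P → w x = w' x) : resid w' z = resid w z := by
  obtain ⟨φ, S, J, W, hS, hJ, hz', hW⟩ := exists_chart_of_mem hP hw z hz
  have hps : z.pt ∈ φ.source := hz'.1
  have hW' : LogRep φ S w' (φ z.pt) W := hW.congr_left hS (φ.map_source hps) (by
    rwa [φ.left_inv hps])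
  rw [hW.resid_eq hS hJ hz' rfl, hW'.resid_eq hS hJ hz' rfl]

theorem resid_deRhamOn (hP : IsLogSymplectic P) {r : ℤ} (hw : w ∈ logForms P V r)
    (z : OrdLocus P i) (hz : z.pt ∈ V) : resid (deRhamOn P V w) z = 0 := by
  obtain ⟨φ, S, J, W, h, hJ, hz', hW⟩ := exists_chart_of_mem hP hw z hz
  rw [(hW.deRhamOn h hz'.1 hz).resid_eq h hJ hz' rfl]
  exact extdLog_apply_eq_zero J (fun a => ⟨hJ a, (hz'.2 a).1⟩) W

/-- In the logarithmic frame of a small adapted chart a closed logarithmic form is the sum of a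
constant form in the `dlog y_j`, `j ∈ S`, and an exact one. -/
theorem exists_local_structure {r : ℤ} (hw : w ∈ logForms P V r)
    (hcl : deRhamOn P V w = 0) (hpV : p ∈ V) (h : IsAdapted P φ S) (hp : p ∈ φ.source)
    (hS : ∀ j ∈ S, φ p j = 0) :
    ∃ ε > 0, (∀ y ∈ Metric.ball (φ p) ε, y ∈ φ.target ∧ φ.symm y ∈ V) ∧
      ∃ (η : E n → Ext n) (w₀ : Ext n), HolExt (Metric.ball (φ p) ε) η ∧
        (∀ y ∈ Metric.ball (φ p) ε, Homog (r - 1) (η y)) ∧ Homog r w₀ ∧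
        (∀ k ∉ S, ctr (stdVec k) w₀ = 0) ∧ ∀ y ∈ Metric.ball (φ p) ε, ∏ j ∈ S, y j ≠ 0 →
          lrep φ S w y = w₀ + extdLog S η y := by
  obtain ⟨W, hW, hWr⟩ := exists_logRep_of_mem hw hpV h hp
  have hct := φ.map_source hp
  have h1 := hW.deRhamOn h hp hpV
  rw [hcl] at h1
  have h2 : ∀ᶠ y in 𝓝 (φ p), (DAt W y ∧ (∏ j ∈ S, y j ≠ 0 → lrep φ S w y = W y)) ∧
      extdLog S W y = 0 ∧ y ∈ φ.target ∧ φ.symm y ∈ V := by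
    refine hW.and (((h1.unique LogRep.zero)).and (eventually_mem hct (V.isOpen.mem_nhds ?_)))
    rwa [φ.left_inv hp]
  obtain ⟨ε, hε, hball⟩ := Metric.mem_nhds_iff.1 h2
  obtain ⟨η, w₀, hη, hηr, hw₀, hw₀S, hWη⟩ := exists_extdLog_primitive hS hε
    (holExt_of_dAt fun y hy => (hball hy).1.1) (fun y hy => (hball hy).2.1)
    fun y _ => hWr y
  exact ⟨ε, hε, fun y hy => (hball hy).2.2, η, w₀, hη, hηr, hw₀, hw₀S, fun y hy hne =>
    ((hball hy).1.2 hne).trans (hWη y hy)⟩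

theorem logRep_of_ball {ε : ℝ} {c : E n} (hW : HolExt (Metric.ball c ε) W)
    (h : ∀ y ∈ Metric.ball c ε, ∏ j ∈ S, y j ≠ 0 → lrep φ S w y = W y) {c' : E n}
    (hc' : c' ∈ Metric.ball c ε) : LogRep φ S w c' W := by
  filter_upwards [Metric.isOpen_ball.mem_nhds hc'] with y hy
  exact ⟨hW.dAt Metric.isOpen_ball hy, h y hy⟩

/-- Residues of closed forms are constant along the strata of a small adapted chart. -/
theorem resid_eq_of_local_structure {ε : ℝ} {η : E n → Ext n} {w₀ : Ext n}
    (hη : HolExt (Metric.ball (φ p) ε) η)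
    (hw : ∀ y ∈ Metric.ball (φ p) ε, ∏ j ∈ S, y j ≠ 0 → lrep φ S w y = w₀ + extdLog S η y)
    (h : IsAdapted P φ S) {J : Fin i → Fin (n + n)} (hJ : ∀ a, J a ∈ S) {z : OrdLocus P i}
    (hz : z ∈ plaque P φ J) (hzε : φ z.pt ∈ Metric.ball (φ p) ε) :
    resid w z = w₀ i fun a => stdVec (J a) := by
  have hd : HolExt (Metric.ball (φ p) ε) fun y => w₀ + extdLog S η y :=
    holExt_of_dAt fun y hy => (DAt.const _ _).add
      ((hη.extdLog Metric.isOpen_ball).dAt Metric.isOpen_ball hy)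
  rw [(logRep_of_ball hd hw hzε).resid_eq h hJ hz rfl, Ext.add_apply]
  change w₀ i _ + extdLog S η (φ z.pt) i _ = _
  have e := extdLog_apply_eq_zero (y := φ z.pt) J (fun a => ⟨hJ a, (hz.2 a).1⟩) η
  rw [e, add_zero]

/-- The open set of points of a chart domain whose coordinates lie in a ball. -/
def chartBall (φ : OpenPartialHomeomorph X (E n)) (c : E n) (ε : ℝ) : Opens X :=
  ⟨φ.source ∩ φ ⁻¹' Metric.ball c ε, φ.isOpen_inter_preimage Metric.isOpen_ball⟩

/-- Residues of closed logarithmic forms are locally constant. -/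
theorem resid_locallyConstant (hP : IsLogSymplectic P) {r : ℤ} (hw : w ∈ logForms P V r)
    (hcl : deRhamOn P V w = 0) (z : OrdLocus P i) (hz : z.pt ∈ V) :
    ∀ᶠ z' in 𝓝 z, resid w z' = resid w z := by
  obtain ⟨φ, S, h, hp, hS⟩ := hP.exists_centered z.pt
  obtain ⟨ε, hε, -, η, w₀, hη, -, -, -, hwη⟩ := exists_local_structure hw hcl hz h hp hS
  obtain ⟨J, hJ, hzJ⟩ := OrdLocus.exists_mem_plaque h z hp
  have h1 : ∀ᶠ z' : OrdLocus P i in 𝓝 z, z'.pt ∈ chartBall φ (φ z.pt) ε :=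
    (OrdLocus.continuous_pt P i).continuousAt.eventually
      ((chartBall φ (φ z.pt) ε).isOpen.mem_nhds ⟨hp, Metric.mem_ball_self hε⟩)
  filter_upwards [h1, plaque_mem_nhds h hJ hzJ] with z' h2 h3
  rw [resid_eq_of_local_structure hη hwη h hJ h3 h2.2,
    resid_eq_of_local_structure hη hwη h hJ hzJ (Metric.mem_ball_self hε)]

theorem pull_tan_pull_tanSymm (h : HolChart φ) (hx : x ∈ φ.source) (v : Ext n) :
    pull (tan φ x) (pull (tanSymm φ (φ x)) v) = v := by
  rw [pull_pull]
  have : (tanSymm φ (φ x)).comp (tan φ x) = ContinuousLinearMap.id ℂ (E n) := by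
    ext1 u
    exact tanSymm_tan h hx u
  rw [this, pull_id]

theorem eq_of_lrep_eq (h : IsAdapted P φ S) (hx : x ∈ φ.source) (hxs : x ∈ symplLocus P)
    (hw : lrep φ S w (φ x) = lrep φ S w' (φ x)) : w x = w' x := by
  have hne := (h.mem_symplLocus_iff P hx).1 hxs
  have h1 : repE φ w (φ x) = repE φ w' (φ x) := by
    rw [repE_eq_pull_lrep hne, hw, ← repE_eq_pull_lrep hne]
  rw [repE, repE, φ.left_inv hx] at h1
  rw [← pull_tan_pull_tanSymm h.1 hx (w x), h1, pull_tan_pull_tanSymm h.1 hx]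

/-- Logarithmic forms can be prescribed by their expression in a logarithmic frame. -/
theorem exists_form_of_lrep (h : IsAdapted P φ S) {c : E n} {ε : ℝ}
    (hball : Metric.ball c ε ⊆ φ.target) (hW : HolExt (Metric.ball c ε) W) {r : ℤ}
    (hWr : ∀ y ∈ Metric.ball c ε, Homog r (W y)) :
    ∃ w ∈ logForms P (chartBall φ c ε) r,
      ∀ y ∈ Metric.ball c ε, ∏ j ∈ S, y j ≠ 0 → lrep φ S w y = W y := by
  set V := chartBall φ c ε with hV
  set w₁ : Forms n X := fun x =>
    pull (tan φ x) (pull (diag fun j => (theta S (φ x) j)⁻¹) (W (φ x))) with hw₁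
  have key : ∀ y ∈ Metric.ball c ε, ∏ j ∈ S, y j ≠ 0 →
      lrep φ S (restr (V ⊓ symplLocus P) w₁) y = W y := by
    intro y hy hne
    have hyt := hball hy
    have hmem : φ.symm y ∈ V ⊓ symplLocus P :=
      ⟨⟨φ.map_target hyt, by rwa [Set.mem_preimage, φ.right_inv hyt]⟩,
        (h.symm_mem_symplLocus_iff P hyt).2 hne⟩
    have e := pull_tanSymm_pull_tan h.1 (φ.map_target hyt)
    rw [φ.right_inv hyt] at e
    rw [lrep, repE, restr_mem _ hmem, hw₁]
    simp only [φ.right_inv hyt]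
    rw [e, pull_diag_pull_diag fun j => mul_inv_cancel₀ (theta_ne_zero hne j)]
  refine ⟨restr (V ⊓ symplLocus P) w₁, mem_logForms_of_logRep (fun x => ?_)
    (fun x hx => restr_notMem _ hx) fun p hp => ⟨φ, S, h, hp.1, W, logRep_of_ball hW key hp.2⟩,
    key⟩
  by_cases hx : x ∈ V ⊓ symplLocus P
  · rw [restr_mem _ hx]
    exact ((hWr _ hx.1.2).pull _).pull _
  · rw [restr_notMem _ hx]
    exact Homog.zero r

theorem deRhamOn_eq_of_lrep (h : IsAdapted P φ S) {c : E n} {ε : ℝ}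
    (hball : Metric.ball c ε ⊆ φ.target) (hW : HolExt (Metric.ball c ε) W)
    (hw : ∀ y ∈ Metric.ball c ε, ∏ j ∈ S, y j ≠ 0 → lrep φ S w y = W y)
    (hw' : ∀ y ∈ Metric.ball c ε, ∏ j ∈ S, y j ≠ 0 → lrep φ S w' y = extdLog S W y)
    (hx : x ∈ chartBall φ c ε ⊓ symplLocus P) :
    deRhamOn P (chartBall φ c ε) w x = w' x := by
  rw [deRhamOn, restr_mem _ hx]
  have hne := (h.mem_symplLocus_iff P hx.1.1).1 hx.2
  have h1 := ((logRep_of_ball hW hw hx.1.2).dExt h.1 (hball hx.1.2)).self_of_nhds.2 hne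
  exact eq_of_lrep_eq h hx.1.1 hx.2 (h1.trans (hw' _ hx.1.2 hne).symm)

/-- A closed logarithmic form without residues is locally exact. -/
theorem exists_local_primitive (hP : IsLogSymplectic P) (hw : w ∈ logForms P V i)
    (hcl : deRhamOn P V w = 0) (hpV : p ∈ V)
    (hres : ∀ z : OrdLocus P i, z.pt = p → resid w z = 0) :
    ∃ V' : Opens X, p ∈ V' ∧ V' ≤ V ∧ ∃ v ∈ logForms P V' (i - 1),
      deRhamOn P V' v = restr (V' ⊓ symplLocus P) w := by
  obtain ⟨φ, S, h, hp, hS⟩ := hP.exists_centered p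
  obtain ⟨ε, hε, hball, η, w₀, hη, hηr, hw₀, hw₀S, hwη⟩ :=
    exists_local_structure hw hcl hpV h hp hS
  -- the coefficients of the constant part are residues at points over `p`
  have hw₀0 : w₀ = 0 := by
    rw [hw₀.eq_single, eq_zero_of_stdVec_eq_zero hw₀S (q := i) fun J hJ hJS => ?_, map_zero]
    obtain ⟨z, hzp, hz⟩ := exists_ordLocus h hp hJ fun a => ⟨hJS a, hS _ (hJS a)⟩
    rw [← resid_eq_of_local_structure hη hwη h hJS hz (by
      rw [hzp]
      exact Metric.mem_ball_self hε), hres z hzp]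
  have hbt : Metric.ball (φ p) ε ⊆ φ.target := fun y hy => (hball y hy).1
  obtain ⟨v, hv, hv'⟩ := exists_form_of_lrep h hbt hη hηr
  refine ⟨chartBall φ (φ p) ε, ⟨hp, Metric.mem_ball_self hε⟩, fun x hx => ?_, v, hv, ?_⟩
  · have := (hball _ hx.2).2
    rwa [φ.left_inv hx.1] at this
  · funext x
    by_cases hx : x ∈ chartBall φ (φ p) ε ⊓ symplLocus P
    · rw [restr_mem _ hx]
      refine deRhamOn_eq_of_lrep h hbt hη hv' (fun y hy hne => ?_) hx
      rw [hwη y hy hne, hw₀0, zero_add]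
    · rw [restr_notMem _ hx]
      exact restr_notMem _ hx

/-- An alternating form can be prescribed on the standard basis vectors. -/
theorem exists_ext_of_coeff (c : (Fin i → Fin (n + n)) → ℂ)
    (hc : ∀ (s : Equiv.Perm (Fin i)) J, c (J ∘ s) = ((Equiv.Perm.sign s : ℤ) : ℂ) * c J) :
    ∃ w₀ : Ext n, Homog i w₀ ∧ ∀ J, w₀ i (fun a => stdVec (J a)) = c J := by
  let m : ContinuousMultilinearMap ℂ (fun _ : Fin i => E n) ℂ :=
    ∑ J : Fin i → Fin (n + n), c J • (ContinuousMultilinearMap.mkPiAlgebra ℂ (Fin i) ℂ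
      ).compContinuousLinearMap fun a => stdCov (J a)
  have hm : ∀ v, m v = ∑ J, c J * ∏ a, v a (J a) := fun v => by
    simp [m, stdCov]
  have hperm : ∀ (s : Equiv.Perm (Fin i)) v,
      m (v ∘ s) = ((Equiv.Perm.sign s : ℤ) : ℂ) * m v := by
    intro s v
    rw [hm, hm, ← (Equiv.arrowCongr s.symm (Equiv.refl (Fin (n + n)))).sum_comp, Finset.mul_sum]
    refine Finset.sum_congr rfl fun J _ => ?_
    have e : Equiv.arrowCongr s.symm (Equiv.refl (Fin (n + n))) J = J ∘ s := by
      funext a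
      simp
    rw [e, hc, ← Equiv.prod_comp s (fun a => v a (J a))]
    simp only [Function.comp_apply]
    ring
  let f : (E n) [⋀^Fin i]→L[ℂ] ℂ :=
    { m with
      map_eq_zero_of_eq' := fun v a b hab hne => by
        have h1 := hperm (Equiv.swap a b) v
        have h2 : v ∘ Equiv.swap a b = v := by
          funext t
          rw [Function.comp_apply, Equiv.swap_apply_def]
          split_ifs with h3 h4
          · rw [h3, hab]
          · rw [h4, hab]
          · rfl
        rw [h2, Equiv.Perm.sign_swap hne] at h1
        have h3 : m v = 0 := by
          push_cast at h1
          linear_combination h1 / 2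
        exact h3 }
  refine ⟨Ext.single i f, homog_single i f, fun J => ?_⟩
  rw [Ext.single_same]
  refine (hm _).trans ?_
  rw [Finset.sum_eq_single J]
  · simp [stdVec]
  · intro J' _ hJ'
    obtain ⟨a, ha⟩ := Function.ne_iff.1 hJ'
    rw [Finset.prod_eq_zero (Finset.mem_univ a), mul_zero]
    simp [stdVec, ha]
  · simp

/-- Locally constant residues are locally the residues of a closed logarithmic form. -/
theorem exists_local_form_of_resid (hP : IsLogSymplectic P) (f : altConst P i V) (hpV : p ∈ V) :
    ∃ V' : Opens X, p ∈ V' ∧ ∃ h' : V' ≤ V, ∃ w ∈ logForms P V' i, deRhamOn P V' w = 0 ∧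
      ∀ (z : OrdLocus P i) (hz : z.pt ∈ V'), resid w z = f.1 ⟨z, h' hz⟩ := by
  classical
  obtain ⟨φ, S, h, hp, hS⟩ := hP.exists_centered p
  -- the values of `f` over `p`, extended by zero, are the coefficients of a constant form
  have hz₀ : ∀ J : Fin i → Fin (n + n), ∃ c : ℂ, (Function.Injective J ∧ (∀ a, J a ∈ S) →
      ∃ (z : OrdLocus P i) (hz : z.pt ∈ V), z.pt = p ∧ z ∈ plaque P φ J ∧ f.1 ⟨z, hz⟩ = c) ∧
      (¬ (Function.Injective J ∧ ∀ a, J a ∈ S) → c = 0) := by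
    intro J
    by_cases hJ : Function.Injective J ∧ ∀ a, J a ∈ S
    · obtain ⟨z, hzp, hz⟩ := exists_ordLocus h hp hJ.1 fun a => ⟨hJ.2 a, hS _ (hJ.2 a)⟩
      exact ⟨f.1 ⟨z, by rw [Set.mem_preimage, hzp]; exact hpV⟩,
        fun _ => ⟨z, by rw [hzp]; exact hpV, hzp, hz, rfl⟩, fun h => absurd hJ h⟩
    · exact ⟨0, fun h => absurd h hJ, fun _ => rfl⟩
  choose c hc hc0 using hz₀
  have hcalt : ∀ (s : Equiv.Perm (Fin i)) J, c (J ∘ s) = ((Equiv.Perm.sign s : ℤ) : ℂ) * c J := by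
    intro s J
    by_cases hJ : Function.Injective J ∧ ∀ a, J a ∈ S
    · obtain ⟨z, hz, hzp, hzJ, hzc⟩ := hc J hJ
      obtain ⟨z', hz', hzp', hzJ', hzc'⟩ := hc (J ∘ s)
        ⟨hJ.1.comp s.injective, fun a => hJ.2 (s a)⟩
      have e : z' = OrdLocus.perm P s z :=
        plaque_ext hzJ' (perm_mem_plaque hzJ s) (hzp'.trans hzp.symm)
      subst e
      rw [← hzc, ← hzc']
      exact f.2 s z hz
    · rw [hc0 J hJ, hc0, mul_zero]
      rintro ⟨h1, h2⟩
      refine hJ ⟨?_, fun a => ?_⟩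
      · have := h1.comp s.symm.injective
        rwa [Function.comp_assoc, Equiv.self_comp_symm, Function.comp_id] at this
      · have := h2 (s.symm a)
        rwa [Function.comp_apply, Equiv.apply_symm_apply] at this
  obtain ⟨w₀, hw₀, hw₀c⟩ := exists_ext_of_coeff c hcalt
  -- `f` is constant along the strata of a small ball
  have hf : ∀ J : Fin i → Fin (n + n), ∀ᶠ x in 𝓝 p, ∀ (z : OrdLocus P i) (hz : z.pt ∈ V),
      z.pt = x → z ∈ plaque P φ J → (∀ a, J a ∈ S) → f.1 ⟨z, hz⟩ = c J := by
    intro J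
    by_cases hJ : Function.Injective J ∧ ∀ a, J a ∈ S
    swap
    · refine Eventually.of_forall fun x z hz _ hzJ hJS => ?_
      exact absurd ⟨plaque_injective hzJ, hJS⟩ hJ
    obtain ⟨z, hz, hzp, hzJ, hzc⟩ := hc J hJ
    have h1 : ∀ᶠ z' in 𝓝 z, ∀ hz' : z'.pt ∈ V, f.1 ⟨z', hz'⟩ = c J := by
      have h2 : ∀ᶠ u : OrdLocus.pt P (i := i) ⁻¹' (V : Set X) in 𝓝 ⟨z, hz⟩, f.1 u = f.1 ⟨z, hz⟩ :=
        f.1.isLocallyConstant.eventually_eq ⟨z, hz⟩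
      rw [nhds_subtype_eq_comap] at h2
      obtain ⟨N, hN, hN'⟩ := mem_comap.1 h2
      filter_upwards [hN] with z' hz'N hz'
      rw [← hzc]
      exact hN' (a := ⟨z', hz'⟩) hz'N
    have h3 := comap_inf_principal_plaque_le hzJ h1
    rw [hzp, mem_inf_principal, mem_comap] at h3
    obtain ⟨U, hU, hU'⟩ := h3
    filter_upwards [hU] with x hx z' hz' hz'x hz'J _
    exact hU' (by rw [Set.mem_preimage, hz'x]; exact hx) hz'J hz'
  have hct := φ.map_source hp
  have hev : ∀ᶠ y in 𝓝 (φ p), y ∈ φ.target ∧ φ.symm y ∈ V ∧ ∀ (J : Fin i → Fin (n + n))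
      (z : OrdLocus P i) (hz : z.pt ∈ V), z.pt = φ.symm y → z ∈ plaque P φ J →
        (∀ a, J a ∈ S) → f.1 ⟨z, hz⟩ = c J := by
    refine eventually_mem hct (W := {x | x ∈ V ∧ ∀ (J : Fin i → Fin (n + n))
      (z : OrdLocus P i) (hz : z.pt ∈ V), z.pt = x → z ∈ plaque P φ J →
        (∀ a, J a ∈ S) → f.1 ⟨z, hz⟩ = c J}) ?_
    rw [φ.left_inv hp]
    exact Filter.inter_mem (V.isOpen.mem_nhds hpV) (eventually_all.2 hf)
  obtain ⟨ε, hε, hball⟩ := Metric.mem_nhds_iff.1 hev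
  have hbt : Metric.ball (φ p) ε ⊆ φ.target := fun y hy => (hball hy).1
  have hconst : HolExt (Metric.ball (φ p) ε) fun _ => w₀ := fun q => differentiableOn_const _
  obtain ⟨w, hw, hw'⟩ := exists_form_of_lrep h hbt hconst fun _ _ => hw₀
  have hV' : chartBall φ (φ p) ε ≤ V := fun x hx => by
    have := (hball hx.2).2.1
    rwa [φ.left_inv hx.1] at this
  refine ⟨chartBall φ (φ p) ε, ⟨hp, Metric.mem_ball_self hε⟩, hV', w, hw, ?_, fun z hz => ?_⟩
  · funext x
    by_cases hx : x ∈ chartBall φ (φ p) ε ⊓ symplLocus P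
    · refine deRhamOn_eq_of_lrep h hbt hconst hw' (w' := 0) (fun y hy hne => ?_) hx
      have e : lrep φ S (0 : Forms n X) y = 0 :=
        ((congrArg (pull (diag (theta S y))) (map_zero (pull (tanSymm φ y)))).trans (map_zero _))
      rw [e, extdLog]
      simp only [pd_const, map_zero, smul_zero, Finset.sum_const_zero]
    · exact restr_notMem _ hx
  · obtain ⟨J, hJ, hzJ⟩ := OrdLocus.exists_mem_plaque h z hz.1
    rw [(logRep_of_ball hconst hw' hz.2).resid_eq h hJ hzJ rfl, hw₀c,
      (hball hz.2).2.2 J z (hV' hz) (φ.left_inv hz.1).symm hzJ hJ]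

end Residues

/-! ### The cohomology sheaves -/

section SheafLemmas

variable {C : Type*} [Category* C] {J : GrothendieckTopology C} {A : Type*} [Category* A]
  [HasWeakSheafify J A]

/-- A locally bijective morphism from a presheaf to a sheaf identifies the sheaf with the
sheafification. -/
theorem exists_iso_sheafify {F G : Cᵒᵖ ⥤ A} (f : F ⟶ G) (hG : Presheaf.IsSheaf J G) (hf : J.W f) :
    ∃ e : sheafify J F ≅ G, toSheafify J F ≫ e.hom = f := by
  have h1 : IsIso ((presheafToSheaf J A).map f) := (J.W_iff f).1 hf
  have h2 : IsIso (sheafifyMap J f) :=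
    inferInstanceAs (IsIso ((sheafToPresheaf J A).map ((presheafToSheaf J A).map f)))
  refine ⟨asIso (sheafifyMap J f) ≪≫ (isoSheafify J hG).symm, ?_⟩
  rw [Iso.trans_hom, asIso_hom, ← Category.assoc, ← toSheafify_naturality, Category.assoc,
    Iso.symm_hom, Iso.comp_inv_eq_id _ |>.2, Category.comp_id]
  rfl

end SheafLemmas

section Cohomology

variable {n : ℕ} {X : Type} [TopologicalSpace X] [ChartedSpace (E n) X]
  [IsManifold 𝓘(ℂ, E n) ω X] {P : Poisson n X} {p : X} {V : Opens X} {i : ℕ}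

theorem piEquiv_mdpOn_of_eq (hP : IsLogSymplectic P) {j j' : ℤ} (hj : j' = j + 1)
    (w : Theta P V j) (w' : Theta P V j') (h : (w' : Forms n X) = mdpOn P V j w) :
    (piEquiv hP V j' w' : Forms n X) = deRhamOn P V (piEquiv hP V j w) := by
  subst hj
  exact piEquiv_mdpOn hP w w' h

theorem deRhamOn_piEquiv (hP : IsLogSymplectic P) {j : ℤ} (w : cocycles P V j) :
    deRhamOn P V (piEquiv hP V j w.1) = 0 := by
  have h : delta P V j w.1 = 0 := w.2
  rw [← piEquiv_mdpOn hP w.1 0 h.symm, map_zero]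
  rfl

/-- The residues of a cocycle of the log MdP complex, by transport to the log de Rham complex. -/
def residMap (hP : IsLogSymplectic P) (V : Opens X) (i : ℕ) :
    cocycles P V i →ₗ[ℂ] altConst P i V where
  toFun w := ⟨⟨fun z => resid (piEquiv hP V i w.1 : Forms n X) z.1,
    (IsLocallyConstant.iff_eventually_eq _).2 fun z => continuous_subtype_val.continuousAt.eventually
      (resid_locallyConstant hP (piEquiv hP V i w.1).2 (deRhamOn_piEquiv hP w) z.1 z.2)⟩,
    fun s z hz => resid_perm hP (piEquiv hP V i w.1).2 z hz s⟩
  map_add' w w' := by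
    refine Subtype.ext (LocallyConstant.ext fun z => ?_)
    refine (congrArg (fun u : logForms P V i => resid (u : Forms n X) z.1)
      (map_add (piEquiv hP V i) w.1 w'.1)).trans ?_
    exact resid_add hP (piEquiv hP V i w.1).2 (piEquiv hP V i w'.1).2 z.1 z.2
  map_smul' c w := by
    refine Subtype.ext (LocallyConstant.ext fun z => ?_)
    refine (congrArg (fun u : logForms P V i => resid (u : Forms n X) z.1)
      (map_smul (piEquiv hP V i) c w.1)).trans ?_
    exact resid_smul hP (piEquiv hP V i w.1).2 c z.1 z.2

theorem residMap_apply (hP : IsLogSymplectic P) (w : cocycles P V i) (z : OrdLocus P i)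
    (hz : z.pt ∈ V) :
    (residMap hP V i w).1 ⟨z, hz⟩ = resid (piEquiv hP V i w.1 : Forms n X) z := rfl

/-- Coboundaries have no residues. -/
theorem coboundaries_le_ker_residMap (hP : IsLogSymplectic P) (V : Opens X) (i : ℕ) :
    coboundaries P V i ≤ LinearMap.ker (residMap hP V i) := by
  rintro w ⟨v, hv⟩
  refine Subtype.ext (LocallyConstant.ext fun z => ?_)
  have h := piEquiv_mdpOn_of_eq hP (by omega) v w.1 hv.symm
  rw [residMap_apply, h]
  exact resid_deRhamOn hP (piEquiv hP V _ v).2 z.1 z.2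

theorem resid_resLog (hP : IsLogSymplectic P) {V' : Opens X} (h : V' ≤ V) {r : ℤ}
    (w : logForms P V r) (z : OrdLocus P i) (hz : z.pt ∈ V') :
    resid (resLog P h r w : Forms n X) z = resid (w : Forms n X) z := by
  refine resid_congr hP w.2 z (h hz) ?_
  filter_upwards [V'.isOpen.mem_nhds hz] with x hx hx'
  exact (restr_mem (W := V' ⊓ symplLocus P) _ ⟨hx, hx'⟩).symm

theorem residMap_res (hP : IsLogSymplectic P) {V' : Opens X} (h : V' ≤ V) (w : cocycles P V i)
    (z : OrdLocus P i) (hz : z.pt ∈ V') :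
    (residMap hP V' i (resCocycles P h i w)).1 ⟨z, hz⟩ = (residMap hP V i w).1 ⟨z, h hz⟩ := by
  rw [residMap_apply, residMap_apply, ← resid_resLog hP h _ z hz, ← piEquiv_res]
  rfl

/-- The residue map on cohomology presheaves. -/
def residHom (hP : IsLogSymplectic P) (i : ℕ) : cohPresheaf P i ⟶ nuOrient P i where
  app V := ModuleCat.ofHom
    (Submodule.liftQ _ (residMap hP V.unop i) (coboundaries_le_ker_residMap hP V.unop i))
  naturality V V' f := by
    ext w
    obtain ⟨w, rfl⟩ := Submodule.Quotient.mk_surjective _ w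
    exact Subtype.ext (LocallyConstant.ext fun z => residMap_res hP f.unop.le w z.1 z.2)

/-- Closed logarithmic forms correspond to cocycles of the log MdP complex. -/
theorem exists_cocycle_of_closed (hP : IsLogSymplectic P) (w : logForms P V i)
    (hw : deRhamOn P V w = 0) : ∃ v : cocycles P V i, piEquiv hP V i v.1 = w := by
  obtain ⟨v, rfl⟩ := (piEquiv hP V i).surjective w
  have hm := mdpOn_mem hP v.2
  refine ⟨⟨v, ?_⟩, rfl⟩
  have h1 := piEquiv_mdpOn hP v ⟨_, hm⟩ rfl
  rw [hw] at h1
  have h2 : (⟨_, hm⟩ : Theta P V (i + 1)) = 0 :=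
    (piEquiv hP V (i + 1)).injective (by rw [map_zero]; exact Subtype.ext h1)
  exact congrArg Subtype.val h2

/-- A cocycle without residues at a point is a coboundary near this point. -/
theorem exists_resCocycles_mem_coboundaries (hP : IsLogSymplectic P) (w : cocycles P V i)
    (hp : p ∈ V)
    (h : ∀ z : OrdLocus P i, z.pt = p → resid (piEquiv hP V i w.1 : Forms n X) z = 0) :
    ∃ V' : Opens X, p ∈ V' ∧ ∃ h' : V' ≤ V, resCocycles P h' i w ∈ coboundaries P V' i := by
  obtain ⟨V', hpV', h', u, hu, hu'⟩ := exists_local_primitive hP (piEquiv hP V i w.1).2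
    (deRhamOn_piEquiv hP w) hp h
  obtain ⟨v, hv⟩ := (piEquiv hP V' (i - 1)).surjective ⟨u, hu⟩
  refine ⟨V', hpV', h', v, ?_⟩
  have hm : mdpOn P V' (i - 1) v ∈ Theta P V' i := by
    have := mdpOn_mem hP v.2
    rwa [sub_add_cancel] at this
  have h1 := piEquiv_mdpOn_of_eq hP (by omega) v ⟨_, hm⟩ rfl
  rw [hv] at h1
  have h2 : (⟨_, hm⟩ : Theta P V' i) = resLog P h' _ w.1 := by
    refine (piEquiv hP V' i).injective (Subtype.ext ?_)
    rw [h1, piEquiv_res]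
    exact hu'
  exact congrArg Subtype.val h2

theorem residHom_isLocallyInjective (hP : IsLogSymplectic P) (i : ℕ) :
    Presheaf.IsLocallyInjective (Opens.grothendieckTopology (TopCat.of X)) (residHom hP i) where
  equalizerSieve_mem {V} x y h p hp := by
    obtain ⟨x, rfl⟩ := Submodule.Quotient.mk_surjective _ x
    obtain ⟨y, rfl⟩ := Submodule.Quotient.mk_surjective _ y
    have h1 : residMap hP V.unop i (x - y) = 0 := by
      rw [map_sub, sub_eq_zero]
      exact h
    obtain ⟨V', hpV', h', hxy⟩ := exists_resCocycles_mem_coboundaries hP (x - y) hp fun z hz =>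
      congrArg (fun f : altConst P i V.unop =>
        f.1 ⟨z, (by rw [Set.mem_preimage, hz]; exact hp : z ∈ OrdLocus.pt P ⁻¹' _)⟩) h1
    refine ⟨V', homOfLE h', ?_, hpV'⟩
    rw [map_sub] at hxy
    exact (Submodule.Quotient.eq _).2 hxy

theorem residHom_isLocallySurjective (hP : IsLogSymplectic P) (i : ℕ) :
    Presheaf.IsLocallySurjective (Opens.grothendieckTopology (TopCat.of X)) (residHom hP i) where
  imageSieve_mem {V} f p hp := by
    obtain ⟨V', hpV', h', w, hw, hcl, hres⟩ := exists_local_form_of_resid hP f hp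
    obtain ⟨v, hv⟩ := exists_cocycle_of_closed hP ⟨w, hw⟩ hcl
    refine ⟨V', homOfLE h', ⟨Submodule.Quotient.mk v, ?_⟩, hpV'⟩
    refine Subtype.ext (LocallyConstant.ext fun z => ?_)
    refine Eq.trans ?_ (hres z.1 z.2)
    change resid (piEquiv hP V' i v.1 : Forms n X) z.1 = _
    rw [hv]

theorem isSheaf_nuOrient (P : Poisson n X) (i : ℕ) : (nuOrient P i).IsSheaf := by
  rw [TopCat.Presheaf.isSheaf_iff_isSheafUniqueGluing]
  intro ι U f hf
  have hcomp : ∀ a b (z : OrdLocus P i) (ha : z.pt ∈ U a) (hb : z.pt ∈ U b),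
      (f a).1 ⟨z, ha⟩ = (f b).1 ⟨z, hb⟩ := fun a b z ha hb =>
    congrArg (fun g : altConst P i (U a ⊓ U b) => g.1 ⟨z, ⟨ha, hb⟩⟩) (hf a b)
  have hmem : ∀ z : OrdLocus P i, z.pt ∈ iSup U → ∃ a, z.pt ∈ U a := fun z hz =>
    Opens.mem_iSup.1 hz
  choose idx hidx using hmem
  have hval : ∀ (z : OrdLocus P i) (hz : z.pt ∈ iSup U) (a) (ha : z.pt ∈ U a),
      (f (idx z hz)).1 ⟨z, hidx z hz⟩ = (f a).1 ⟨z, ha⟩ := fun z hz a ha => hcomp _ _ z _ ha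
  let g : altConst P i (iSup U) := ⟨⟨fun z => (f (idx z.1 z.2)).1 ⟨z.1, hidx z.1 z.2⟩, by
      rw [IsLocallyConstant.iff_eventually_eq]
      rintro ⟨z, hz⟩
      obtain ⟨a, ha⟩ := Opens.mem_iSup.1 hz
      have h1 := (f a).1.isLocallyConstant.eventually_eq ⟨z, ha⟩
      rw [nhds_subtype_eq_comap, eventually_comap] at h1
      rw [nhds_subtype_eq_comap, eventually_comap]
      have h2 : ∀ᶠ z' : OrdLocus P i in 𝓝 z, z'.pt ∈ U a :=
        (OrdLocus.continuous_pt P i).continuousAt.eventually ((U a).isOpen.mem_nhds ha)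
      filter_upwards [h1, h2] with z' h3 h4
      rintro ⟨z'', hz''⟩ rfl
      rw [hval _ hz'' a h4, hval _ hz a ha]
      exact h3 ⟨_, h4⟩ rfl⟩, fun s z hz => by
    obtain ⟨a, ha⟩ := Opens.mem_iSup.1 hz
    refine (hval (OrdLocus.perm P s z) hz a ha).trans (((f a).2 s z ha).trans ?_)
    exact congrArg _ (hval z hz a ha).symm⟩
  refine ⟨g, fun a => Subtype.ext (LocallyConstant.ext fun z => hval _ _ a z.2), fun g' hg' => ?_⟩
  refine Subtype.ext (LocallyConstant.ext fun z => ?_)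
  obtain ⟨a, ha⟩ := Opens.mem_iSup.1 z.2
  refine Eq.trans ?_ (hval z.1 z.2 a ha).symm
  exact congrArg (fun h : altConst P i (U a) => h.1 ⟨z.1, ha⟩) (hg' a)

/-- The cohomology sheaves are the sheaves `ν_{i*} ε_i`, by the residue map. -/
theorem exists_cohSheaf_iso (hP : IsLogSymplectic P) (i : ℕ) :
    ∃ e : (cohSheaf P i).presheaf ≅ nuOrient P i,
      ∀ (V : Opens X) (w : cocycles P V i),
        (e.hom.app (op V)).hom (cohClass P V i w) = residMap hP V i w := by
  have := residHom_isLocallyInjective hP i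
  have := residHom_isLocallySurjective hP i
  obtain ⟨e, he⟩ := exists_iso_sheafify (residHom hP i) (isSheaf_nuOrient P i)
    (GrothendieckTopology.W_of_isLocallyBijective _ _)
  refine ⟨e, fun V w => ?_⟩
  have h1 := congrArg (fun f => (f.app (op V)).hom (Submodule.Quotient.mk w)) he
  exact h1

/-! ### Stalks of the cohomology sheaves -/

/-- The germ of the class of a cocycle, as a linear map. -/
def cohGermLin (P : Poisson n X) (V : Opens X) (hp : p ∈ V) (j : ℤ) :
    cocycles P V j →ₗ[ℂ] (cohSheaf P j).presheaf.stalk p :=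
  ((cohSheaf P j).presheaf.germ V p hp).hom ∘ₗ
    ((toSheafify (Opens.grothendieckTopology (TopCat.of X)) (cohPresheaf P j)).app (op V)).hom ∘ₗ
      (coboundaries P V j).mkQ

theorem cohGermLin_apply (hp : p ∈ V) {j : ℤ} (w : cocycles P V j) :
    cohGermLin P V hp j w = cohGerm P V p hp j w := rfl

theorem cohClass_res {V' : Opens X} (h : V' ≤ V) {j : ℤ} (w : cocycles P V j) :
    cohClass P V' j (resCocycles P h j w) =
      ((cohSheaf P j).presheaf.map (homOfLE h).op).hom (cohClass P V j w) :=
  congrArg (fun f => f.hom (Submodule.Quotient.mk w))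
    ((toSheafify (Opens.grothendieckTopology (TopCat.of X)) (cohPresheaf P j)).naturality
      (homOfLE h).op)

theorem cohGerm_res {V' : Opens X} (h : V' ≤ V) (hp : p ∈ V') {j : ℤ} (w : cocycles P V j) :
    cohGerm P V' p hp j (resCocycles P h j w) = cohGerm P V p (h hp) j w := by
  rw [cohGerm, cohGerm, cohClass_res]
  exact TopCat.Presheaf.germ_res_apply (cohSheaf P j).presheaf (homOfLE h) p hp _

theorem cohGerm_eq_zero_of_mem {j : ℤ} (hp : p ∈ V) {w : cocycles P V j}
    (hw : w ∈ coboundaries P V j) : cohGerm P V p hp j w = 0 := by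
  have h : cohClass P V j w = 0 :=
    (congrArg _ ((Submodule.Quotient.mk_eq_zero _).2 hw)).trans (map_zero _)
  rw [cohGerm, h, map_zero]

/-- The germ of a cohomology class vanishes if and only if all residues at the point do. -/
theorem cohGerm_eq_zero_iff (hP : IsLogSymplectic P) (hp : p ∈ V) (w : cocycles P V i) :
    cohGerm P V p hp i w = 0 ↔
      ∀ z : OrdLocus P i, z.pt = p → resid (piEquiv hP V i w.1 : Forms n X) z = 0 := by
  constructor
  · intro h z hz
    have h0 : ((cohSheaf P i).presheaf.germ V p hp).hom (cohClass P V i w) =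
        ((cohSheaf P i).presheaf.germ V p hp).hom 0 := by
      rw [map_zero]
      exact h
    obtain ⟨V', hpV', h1, h2, h3⟩ := TopCat.Presheaf.germ_eq (cohSheaf P i).presheaf p hp hp
      (cohClass P V i w) 0 h0
    obtain ⟨e, he⟩ := exists_cohSheaf_iso hP i
    have h4 : cohClass P V' i (resCocycles P h1.le i w) = 0 := by
      rw [cohClass_res]
      refine Eq.trans h3 (map_zero _)
    have h5 := he V' (resCocycles P h1.le i w)
    rw [h4, map_zero] at h5
    have hz' : z.pt ∈ V' := by rwa [hz]
    have h6 := residMap_res hP h1.le w z hz'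
    rw [← h5] at h6
    exact h6.symm
  · intro h
    obtain ⟨V', hpV', h', hV'⟩ := exists_resCocycles_mem_coboundaries hP w hp h
    rw [← cohGerm_res h' hpV' w, cohGerm_eq_zero_of_mem hpV' hV']

/-- Every germ of the cohomology sheaf is represented by a cocycle near the point: by the log forms
with prescribed residues. -/
theorem exists_cohGerm_eq (hP : IsLogSymplectic P) (hp : p ∈ V)
    (t : (cohSheaf P i).presheaf.stalk p) :
    ∃ (V' : Opens X) (_ : V' ≤ V) (hp' : p ∈ V') (w : cocycles P V' i),
      cohGerm P V' p hp' i w = t := by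
  obtain ⟨U, hpU, s, rfl⟩ := TopCat.Presheaf.exists_germ_eq _ t
  obtain ⟨e, he⟩ := exists_cohSheaf_iso hP i
  have hle : U ⊓ V ≤ U := inf_le_left
  let f : altConst P i (U ⊓ V) := ((nuOrient P i).map (homOfLE hle).op).hom
    ((e.hom.app (op U)).hom s)
  obtain ⟨V', hpV', h', w, hw, hcl, hres⟩ :=
    exists_local_form_of_resid hP f (p := p) ⟨hpU, hp⟩
  obtain ⟨v, hv⟩ := exists_cocycle_of_closed hP ⟨w, hw⟩ hcl
  refine ⟨V', h'.trans inf_le_right, hpV', v, ?_⟩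
  have h1 : residMap hP V' i v =
      ((nuOrient P i).map (homOfLE (h'.trans hle)).op).hom ((e.hom.app (op U)).hom s) := by
    refine Subtype.ext (LocallyConstant.ext fun z => ?_)
    refine Eq.trans ?_ (hres z.1 z.2)
    rw [residMap_apply hP v z.1 z.2, hv]
  have h2 := congrArg (fun f => f.hom s) (e.hom.naturality (homOfLE (h'.trans hle)).op)
  have h3 : (e.hom.app (op V')).hom (cohClass P V' i v) = (e.hom.app (op V')).hom
      (((cohSheaf P i).presheaf.map (homOfLE (h'.trans hle)).op).hom s) :=
    (he V' v).trans (h1.trans h2.symm)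
  have h4 := congrArg (fun t => (e.inv.app (op V')).hom t) h3
  have h5 : ∀ t : (cohSheaf P i).presheaf.obj (op V'),
      (e.inv.app (op V')).hom ((e.hom.app (op V')).hom t) = t := fun t =>
    congrArg (fun f => f.hom t) (e.hom_inv_id_app (op V'))
  have h6 : cohClass P V' i v =
      ((cohSheaf P i).presheaf.map (homOfLE (h'.trans hle)).op).hom s :=
    (h5 _).symm.trans (h4.trans (h5 _))
  rw [cohGerm, h6]
  exact TopCat.Presheaf.germ_res_apply (cohSheaf P i).presheaf (homOfLE (h'.trans hle)) p hpV' s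

end Cohomology

/-! ### Simple normal crossings -/

section SimpleNC

/-- The sign of the permutation that sorts a tuple. -/
def sortSign {α : Type*} [LinearOrder α] {i : ℕ} (f : Fin i → α) : ℤˣ :=
  Equiv.Perm.sign (Tuple.sort f)

/-- For an injective tuple the sign of the sorting permutation is an orientation. -/
theorem sortSign_comp {α : Type*} [LinearOrder α] {i : ℕ} {f : Fin i → α}
    (hf : Function.Injective f) (s : Equiv.Perm (Fin i)) :
    sortSign (f ∘ s) = Equiv.Perm.sign s * sortSign f := by
  have h1 : f ∘ (s * Tuple.sort (f ∘ s) : Equiv.Perm (Fin i)) = f ∘ Tuple.sort f :=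
    Tuple.unique_monotone (Tuple.monotone_sort (f ∘ s)) (Tuple.monotone_sort f)
  have h2 : s * Tuple.sort (f ∘ s) = Tuple.sort f :=
    Equiv.ext fun a => hf (congrFun h1 a)
  rw [sortSign, sortSign, ← h2, map_mul, ← mul_assoc, Int.units_mul_self, one_mul]

variable {n : ℕ} {X : Type} [TopologicalSpace X] [ChartedSpace (E n) X]
  [IsManifold 𝓘(ℂ, E n) ω X] {P : Poisson n X} {i : ℕ}

/-- A continuous choice of orientations of the sets of branches trivializes `ε_i`. -/
theorem nonempty_iso_nuConst_of_sign (σ : OrdLocus P i → ℤˣ) (hσ : IsLocallyConstant σ)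
    (hperm : ∀ s z, σ (OrdLocus.perm P s z) = Equiv.Perm.sign s * σ z) :
    Nonempty (nuOrient P i ≅ nuConst P i) := by
  have hσσ : ∀ z, ((σ z : ℤ) : ℂ) * ((σ z : ℤ) : ℂ) = 1 := fun z => by
    rw [← Int.cast_mul, ← Units.val_mul, Int.units_mul_self]
    simp
  have hpermC : ∀ s z, ((σ (OrdLocus.perm P s z) : ℤ) : ℂ) =
      ((Equiv.Perm.sign s : ℤ) : ℂ) * ((σ z : ℤ) : ℂ) := fun s z => by
    rw [hperm, Units.val_mul, Int.cast_mul]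
  have hquot : ∀ s z, (Quotient.mk _ (OrdLocus.perm P s z) : MultLocus P i) = Quotient.mk _ z :=
    fun s z => (Quotient.sound (s := OrdLocus.setoid P i)
      (show (OrdLocus.setoid P i).r z _ from ⟨s, rfl⟩)).symm
  have hmk : Continuous fun z : OrdLocus P i => (Quotient.mk _ z : MultLocus P i) :=
    continuous_quotient_mk'
  let F (V : Opens X) : LocallyConstant (nu P i ⁻¹' (V : Set X)) ℂ →ₗ[ℂ] altConst P i V :=
    { toFun := fun g => ⟨⟨fun z => ((σ z.1 : ℤ) : ℂ) * g ⟨Quotient.mk _ z.1, z.2⟩, by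
          refine IsLocallyConstant.mul ?_ ?_
          · exact (hσ.comp fun u : ℤˣ => ((u : ℤ) : ℂ)).comp_continuous continuous_subtype_val
          · refine g.isLocallyConstant.comp_continuous ?_
            exact (hmk.comp continuous_subtype_val).subtype_mk _⟩, fun s z hz => by
          change ((σ (OrdLocus.perm P s z) : ℤ) : ℂ) * g ⟨Quotient.mk _ (OrdLocus.perm P s z), _⟩ =
            _ * (((σ z : ℤ) : ℂ) * g ⟨Quotient.mk _ z, _⟩)
          rw [hpermC, mul_assoc]
          congr 3
          exact Subtype.ext (hquot s z)⟩
      map_add' := fun g g' => Subtype.ext (LocallyConstant.ext fun z => mul_add _ _ _)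
      map_smul' := fun c g => Subtype.ext (LocallyConstant.ext fun z => mul_left_comm _ _ _) }
  have hF : ∀ (V : Opens X) g (z : OrdLocus P i) (hz : z.pt ∈ V),
      (F V g).1 ⟨z, hz⟩ = ((σ z : ℤ) : ℂ) * g ⟨Quotient.mk _ z, hz⟩ := fun V g z hz => rfl
  have hbij : ∀ V, Function.Bijective (F V) := by
    refine fun V => ⟨fun g g' h => LocallyConstant.ext ?_, fun f => ?_⟩
    · rintro ⟨m, hm⟩
      obtain ⟨z, rfl⟩ := Quotient.exists_rep m
      have hz : z.pt ∈ V := hm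
      have h1 : ((σ z : ℤ) : ℂ) * (F V g).1 ⟨z, hz⟩ = ((σ z : ℤ) : ℂ) * (F V g').1 ⟨z, hz⟩ := by
        rw [h]
      rw [hF V g, hF V g', ← mul_assoc, ← mul_assoc, hσσ, one_mul, one_mul] at h1
      exact h1
    · classical
      let G₀ : OrdLocus P i → ℂ := fun z =>
        if h : z.pt ∈ V then ((σ z : ℤ) : ℂ) * f.1 ⟨z, h⟩ else 0
      have hG₀ : ∀ z (h : z.pt ∈ V), G₀ z = ((σ z : ℤ) : ℂ) * f.1 ⟨z, h⟩ := fun z h => dif_pos h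
      have hG₀' : ∀ z : OrdLocus P i, z.pt ∉ V → G₀ z = 0 := fun z h => dif_neg h
      let G : MultLocus P i → ℂ := Quotient.lift G₀ (by
        rintro z _ ⟨s, rfl⟩
        by_cases h : z.pt ∈ V
        · have h' : (OrdLocus.perm P s z).pt ∈ V := h
          have h2 : ((Equiv.Perm.sign s : ℤ) : ℂ) * ((Equiv.Perm.sign s : ℤ) : ℂ) = 1 := by
            rw [← Int.cast_mul, ← Units.val_mul, Int.units_mul_self]
            simp
          rw [hG₀ z h, hG₀ _ h', f.2 s z h, hpermC]
          linear_combination (-((σ z : ℤ) : ℂ) * f.1 ⟨z, h⟩) * h2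
        · have h' : (OrdLocus.perm P s z).pt ∉ V := h
          rw [hG₀' z h, hG₀' _ h'])
      have hGopen : ∀ c, IsOpen {m : MultLocus P i | nu P i m ∈ V ∧ G m = c} := fun c => by
        have h1 : IsOpen {z : OrdLocus P i | z.pt ∈ V ∧ G₀ z = c} := by
          rw [isOpen_iff_mem_nhds]
          rintro z ⟨hz, rfl⟩
          have h2 := f.1.isLocallyConstant.eventually_eq ⟨z, hz⟩
          rw [nhds_subtype_eq_comap, eventually_comap] at h2
          have h3 : ∀ᶠ z' : OrdLocus P i in 𝓝 z, z'.pt ∈ V :=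
            (OrdLocus.continuous_pt P i).continuousAt.eventually (V.isOpen.mem_nhds hz)
          filter_upwards [h2, h3, hσ.eventually_eq z] with z' h4 h5 h6
          refine ⟨h5, ?_⟩
          have h7 : f.1 ⟨z', h5⟩ = f.1 ⟨z, hz⟩ := h4 ⟨z', h5⟩ rfl
          rw [hG₀ z' h5, hG₀ z hz, h6, h7]
        exact isQuotientMap_quotient_mk'.isOpen_preimage.1 h1
      refine ⟨⟨fun m => G m.1, IsLocallyConstant.iff_isOpen_fiber.2 fun c => ?_⟩, ?_⟩
      · have h1 := (hGopen c).preimage (continuous_subtype_val (p := (· ∈ nu P i ⁻¹' (V : Set X))))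
        convert h1 using 1
        ext m
        exact ⟨fun h => ⟨m.2, h⟩, fun h => h.2⟩
      · refine Subtype.ext (LocallyConstant.ext fun z => ?_)
        rw [hF V _ z.1 z.2]
        change ((σ z.1 : ℤ) : ℂ) * G₀ z.1 = _
        rw [hG₀ z.1 z.2, ← mul_assoc, hσσ, one_mul]
  refine ⟨(NatIso.ofComponents (fun V =>
    (LinearEquiv.ofBijective (F V.unop) (hbij V.unop)).toModuleIso) fun {V V'} f => ?_).symm⟩
  ext g
  rfl

/-- For a divisor with simple normal crossings a linear order on the set of components orders the
branches at each point, and the sign of the permutation that sorts a tuple of branches trivializes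
`ε_i`. -/
theorem nonempty_iso_nuConst (hP : IsLogSymplectic P) (hD : IsSimpleNC P) (i : ℕ) :
    Nonempty (nuOrient P i ≅ nuConst P i) := by
  obtain ⟨C, -, hC⟩ := hD
  have h1 : ∀ (z : OrdLocus P i) (a : Fin i), ∃ Z : Set X, (Z ∈ C ∧ z.pt ∈ Z) ∧
      ((fun x => x ∈ Z : X → Prop) : Germ (𝓝 z.pt) Prop) = z.1.2 a := fun z a =>
    (hC z.pt).surjOn (z.2.2 a)
  choose Z hZ hZ' using h1
  have huniq : ∀ (z : OrdLocus P i) (a : Fin i) (Z' : Set X), Z' ∈ C → z.pt ∈ Z' →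
      ((fun x => x ∈ Z' : X → Prop) : Germ (𝓝 z.pt) Prop) = z.1.2 a → Z z a = Z' :=
    fun z a Z' h2 h3 h4 => (hC z.pt).injOn (hZ z a) ⟨h2, h3⟩ ((hZ' z a).trans h4.symm)
  have hinj : ∀ z, Function.Injective (Z z) := fun z a b hab => z.2.1 (by
    rw [← hZ' z a, ← hZ' z b, hab])
  -- the branches stay on the same components
  have hloc : ∀ z, ∀ᶠ z' in 𝓝 z, Z z' = Z z := fun z => by
    obtain ⟨φ, S, hp, h⟩ := hP z.pt
    obtain ⟨J, hJ, hzJ⟩ := OrdLocus.exists_mem_plaque h z hp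
    have h2 : ∀ a, ∀ᶠ x in 𝓝 z.pt, x ∈ Z z a ↔ φ x (J a) = 0 := fun a => by
      have h3 : ∀ᶠ x in 𝓝 z.pt, (x ∈ Z z a) = (φ x (J a) = 0) :=
        Germ.coe_eq.1 ((hZ' z a).trans (hzJ.2 a).2)
      exact h3.mono fun x hx => iff_of_eq hx
    have h4 := (OrdLocus.continuous_pt P i).continuousAt.eventually
      (eventually_all.2 fun a => (h2 a).eventually_nhds)
    filter_upwards [h4, plaque_mem_nhds h hJ hzJ] with z' h5 h6
    funext a
    exact huniq z' a _ (hZ z a).1 ((h5 a).self_of_nhds.2 (h6.2 a).1)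
      ((Germ.coe_eq.2 ((h5 a).mono fun x hx => propext hx)).trans (h6.2 a).2.symm)
  refine nonempty_iso_nuConst_of_sign
    (fun z => sortSign fun a => embeddingToCardinal (Z z a)) ?_ fun s z => ?_
  · rw [IsLocallyConstant.iff_eventually_eq]
    intro z
    filter_upwards [hloc z] with z' hz'
    rw [hz']
  · refine Eq.trans ?_ (sortSign_comp (f := fun a => embeddingToCardinal (Z z a))
      (fun a b hab => hinj z (embeddingToCardinal.injective hab)) s)
    refine congrArg sortSign (funext fun a => congrArg _ ?_)
    exact huniq (OrdLocus.perm P s z) a _ (hZ z (s a)).1 (hZ z (s a)).2 (hZ' z (s a))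

end SimpleNC

/-! ### Normal coordinates -/

section Darboux

variable {n : ℕ}

/-- The matrix of the bivector `∑ ∂_{x_i} ∧ ∂_{y_i}`. -/
def darboux (n : ℕ) (i j : Fin (n + n)) : ℂ :=
  Fin.addCases (fun a => Fin.addCases (fun _ => 0) (fun b => if a = b then 1 else 0) j)
    (fun a => Fin.addCases (fun b => if a = b then -1 else 0) (fun _ => 0) j) i

theorem darboux_xx (i j : Fin n) : darboux n (xIdx i) (xIdx j) = 0 := by
  simp only [darboux, xIdx, Fin.addCases_left]

theorem darboux_yy (i j : Fin n) : darboux n (yIdx i) (yIdx j) = 0 := by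
  simp only [darboux, yIdx, Fin.addCases_right]

theorem darboux_xy (i j : Fin n) : darboux n (xIdx i) (yIdx j) = if i = j then 1 else 0 := by
  simp only [darboux, xIdx, yIdx, Fin.addCases_left, Fin.addCases_right]

theorem darboux_yx (i j : Fin n) : darboux n (yIdx i) (xIdx j) = if i = j then -1 else 0 := by
  simp only [darboux, xIdx, yIdx, Fin.addCases_left, Fin.addCases_right]

/-- Case distinction on the two kinds of indices. -/
theorem forall_idx {p : Fin (n + n) → Prop} (hx : ∀ i : Fin n, p (xIdx i))
    (hy : ∀ i : Fin n, p (yIdx i)) (k : Fin (n + n)) : p k :=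
  Fin.addCases hx hy k

theorem xIdx_injective : Function.Injective (xIdx (n := n)) := Fin.castAdd_injective n n

theorem yIdx_injective : Function.Injective (yIdx (n := n)) := Fin.natAdd_injective n n

theorem xIdx_ne_yIdx (i j : Fin n) : xIdx i ≠ yIdx j := fun h => by
  have := congrArg Fin.val h
  simp only [xIdx, yIdx, Fin.val_castAdd, Fin.val_natAdd] at this
  omega

theorem darboux_swap (i j : Fin (n + n)) : darboux n i j = -darboux n j i := by
  induction i using forall_idx <;> rename_i a <;> induction j using forall_idx <;> rename_i b
  · simp only [darboux_xx, neg_zero]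
  · simp only [darboux_xy, darboux_yx, eq_comm (a := b)]
    split_ifs <;> simp
  · simp only [darboux_xy, darboux_yx, eq_comm (a := b)]
    split_ifs <;> simp
  · simp only [darboux_yy, neg_zero]

theorem sum_idx {M : Type*} [AddCommMonoid M] (f : Fin (n + n) → M) :
    ∑ k, f k = ∑ i : Fin n, f (xIdx i) + ∑ i : Fin n, f (yIdx i) :=
  Fin.sum_univ_add f

theorem sharp_darboux_x (i : Fin n) : sharp (darboux n) (stdCov (xIdx i)) = stdVec (yIdx i) := by
  rw [sharp_stdCov darboux_swap, sum_idx]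
  simp [darboux_xx, darboux_xy, -map_sum]

theorem sharp_darboux_y (i : Fin n) :
    sharp (darboux n) (stdCov (yIdx i)) = -stdVec (xIdx i) := by
  rw [sharp_stdCov darboux_swap, sum_idx]
  simp [darboux_yx, darboux_yy]

theorem stdCov_x_x (i j : Fin n) :
    stdCov (n := n) (xIdx i) (stdVec (xIdx j)) = if i = j then 1 else 0 := by
  rw [stdCov_stdVec]
  simp only [xIdx_injective.eq_iff]

theorem stdCov_y_y (i j : Fin n) :
    stdCov (n := n) (yIdx i) (stdVec (yIdx j)) = if i = j then 1 else 0 := by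
  rw [stdCov_stdVec]
  simp only [yIdx_injective.eq_iff]

theorem stdCov_x_y (i j : Fin n) : stdCov (n := n) (xIdx i) (stdVec (yIdx j)) = 0 := by
  rw [stdCov_stdVec, if_neg (xIdx_ne_yIdx i j)]

theorem stdCov_y_x (i j : Fin n) : stdCov (n := n) (yIdx i) (stdVec (xIdx j)) = 0 := by
  rw [stdCov_stdVec, if_neg (xIdx_ne_yIdx j i).symm]

/-- The commutator of `ι_Π` with `dx_i ∧ dy_i ∧` is the identity on forms that do not involve
`x_i` and `y_i`. -/
theorem contractM_darboux_pair (i : Fin n) {w : Ext n} (hx : ctr (stdVec (xIdx i)) w = 0)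
    (hy : ctr (stdVec (yIdx i)) w = 0) :
    contractM (darboux n) (wdg (stdCov (xIdx i)) (wdg (stdCov (yIdx i)) w)) =
      wdg (stdCov (xIdx i)) (wdg (stdCov (yIdx i)) (contractM (darboux n) w)) + w := by
  rw [contractM_wdg, contractM_wdg, sharp_darboux_x, sharp_darboux_y, ctr_wdg, stdCov_y_y,
    if_pos rfl, one_smul, hy, map_zero, sub_zero, map_neg, LinearMap.neg_apply, hx, neg_zero,
    add_zero]

theorem contractM_darboux_pow_pair (i : Fin n) (m : ℕ) {w : Ext n}
    (hx : ctr (stdVec (xIdx i)) w = 0) (hy : ctr (stdVec (yIdx i)) w = 0) :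
    (contractM (darboux n) ^ (m + 1)) (wdg (stdCov (xIdx i)) (wdg (stdCov (yIdx i)) w)) =
      wdg (stdCov (xIdx i)) (wdg (stdCov (yIdx i)) ((contractM (darboux n) ^ (m + 1)) w)) +
        ((m + 1 : ℕ) : ℂ) • (contractM (darboux n) ^ m) w := by
  induction m with
  | zero => simpa using contractM_darboux_pair i hx hy
  | succ m ih =>
    have h1 : ∀ v : E n, ctr v w = 0 → ctr v ((contractM (darboux n) ^ (m + 1)) w) = 0 :=
      fun v hv => by rw [← contractM_pow_ctr, hv, map_zero]
    have h2 : ∀ k (u : Ext n), (contractM (darboux n) ^ (k + 1)) u =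
        contractM (darboux n) ((contractM (darboux n) ^ k) u) := fun k u => by
      rw [pow_succ', Module.End.mul_apply]
    rw [h2 (m + 1), ih, map_add, map_smul, contractM_darboux_pair i (h1 _ hx) (h1 _ hy), ← h2,
      ← h2, add_assoc, Nat.cast_succ (m + 1), add_smul, one_smul]
    exact congrArg _ (add_comm _ _)

/-- The covectors `dx_i, dy_i` for `i` in a list. -/
def pairList (l : List (Fin n)) : List (Cov n) :=
  l.flatMap fun i => [stdCov (xIdx i), stdCov (yIdx i)]

/-- `ι_Π^{|l|}` removes the factors `dx_i ∧ dy_i`, `i ∈ l`, from a product, up to the number of orders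
in which this can be done; a further contraction gives zero. -/
theorem contractM_darboux_pow_pairList {l : List (Fin n)} (hl : l.Nodup) {t : List (Cov n)}
    (ht : ∀ i ∈ l, ∀ a ∈ t, a (stdVec (xIdx i)) = 0 ∧ a (stdVec (yIdx i)) = 0)
    (ht' : contractM (darboux n) (wedgeList t) = 0) :
    (contractM (darboux n) ^ l.length) (wedgeList (pairList l ++ t)) =
        (l.length.factorial : ℂ) • wedgeList t ∧
      (contractM (darboux n) ^ (l.length + 1)) (wedgeList (pairList l ++ t)) = 0 := by
  induction l with
  | nil => simpa [pairList] using ht'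
  | cons i l ih =>
    rw [List.nodup_cons] at hl
    obtain ⟨h1, h2⟩ := ih hl.2 fun j hj => ht j (List.mem_cons_of_mem _ hj)
    set w := wedgeList (pairList l ++ t) with hw
    have e : wedgeList (pairList (i :: l) ++ t) =
      wdg (stdCov (xIdx i)) (wdg (stdCov (yIdx i)) w) := rfl
    have hmem : ∀ a ∈ pairList l ++ t, a (stdVec (xIdx i)) = 0 ∧ a (stdVec (yIdx i)) = 0 := by
      intro a ha
      rcases List.mem_append.1 ha with ha | ha
      · obtain ⟨j, hj, ha⟩ := List.mem_flatMap.1 ha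
        have hji : j ≠ i := fun h => hl.1 (h ▸ hj)
        simp only [List.mem_cons, List.not_mem_nil, or_false] at ha
        rcases ha with rfl | rfl
        · rw [stdCov_x_x, stdCov_x_y, if_neg hji]
          exact ⟨rfl, rfl⟩
        · rw [stdCov_y_x, stdCov_y_y, if_neg hji]
          exact ⟨rfl, rfl⟩
      · exact ht i List.mem_cons_self a ha
    have hx : ctr (stdVec (xIdx i)) w = 0 := ctr_wedgeList_eq_zero fun a ha => (hmem a ha).1
    have hy : ctr (stdVec (yIdx i)) w = 0 := ctr_wedgeList_eq_zero fun a ha => (hmem a ha).2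
    have h3 : (contractM (darboux n) ^ (l.length + 1 + 1)) w = 0 := by
      rw [pow_succ', Module.End.mul_apply, h2, map_zero]
    rw [e, List.length_cons, contractM_darboux_pow_pair i _ hx hy,
      contractM_darboux_pow_pair i _ hx hy, h1, h2, h3]
    simp only [map_zero, zero_add, smul_smul, smul_zero, and_true, Nat.factorial_succ]
    push_cast
    rfl

theorem contractM_extOne (a : Fin (n + n) → Fin (n + n) → ℂ) :
    contractM a (extOne : Ext n) = 0 := by
  rw [contractM_apply]
  have h : ∀ v : E n, ctr v (extOne : Ext n) = 0 := fun v =>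
    ((homog_wedgeList []).ctr v).eq_zero_of_neg (by simp)
  simp only [h, map_zero, smul_zero, Finset.sum_const_zero]

theorem contractM_darboux_wedgeList_x (l : List (Fin n)) :
    contractM (darboux n) (wedgeList (l.map fun i => stdCov (xIdx i))) = 0 := by
  induction l with
  | nil => exact contractM_extOne _
  | cons i l ih =>
    change contractM (darboux n) (wdg (stdCov (xIdx i)) (wedgeList (l.map _))) = 0
    rw [contractM_wdg, ih, map_zero, zero_add, sharp_darboux_x, ctr_wedgeList_eq_zero]
    intro a ha
    obtain ⟨j, -, rfl⟩ := List.mem_map.1 ha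
    exact stdCov_x_y j i

theorem length_pairList (l : List (Fin n)) : (pairList l).length = 2 * l.length := by
  induction l with
  | nil => rfl
  | cons i l ih =>
    change (pairList l).length + 1 + 1 = _
    rw [ih, List.length_cons]
    omega

theorem topPow_darboux_ne_zero : topPow (darboux n) ≠ 0 := by
  have h1 := (contractM_darboux_pow_pairList (n := n) (List.nodup_finRange n) (t := [])
    (by simp) (contractM_extOne _)).1
  have h2 := homog_wedgeList (pairList (List.finRange n) ++ [])
  rw [List.length_append, length_pairList, List.length_finRange, List.length_nil, add_zero,
    two_mul, Nat.cast_add] at h2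
  rw [List.length_finRange, h2.eq_topPart_smul, map_smul] at h1
  have h3 := congrArg (fun w : Ext n => w 0 ![]) h1
  intro h
  rw [topPow] at h
  have h4 : ((n.factorial : ℂ) • (wedgeList [] : Ext n)) 0 ![] = n.factorial := mul_one _
  simp only [h4] at h3
  rw [Ext.smul_apply, ContinuousAlternatingMap.smul_apply, h, smul_zero] at h3
  exact Nat.cast_ne_zero.2 n.factorial_ne_zero h3.symm

/-- A product of covectors vanishes on vectors that are all killed by one of them. -/
theorem wedgeList_apply_eq_zero {l : List (Cov n)} {q : ℕ} {v : Fin q → E n} {a : Cov n}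
    (ha : a ∈ l) (h : ∀ t, a (v t) = 0) : wedgeList l q v = 0 := by
  induction l generalizing q with
  | nil => simp at ha
  | cons b l ih =>
    change wdg b (wedgeList l) q v = 0
    rcases List.mem_cons.1 ha with rfl | ha
    · exact wdg_apply_eq_zero _ _ _ h
    · cases q with
      | zero => rfl
      | succ q =>
        rw [wdg_succ_apply, ContinuousAlternatingMap.alternatizeUncurryFin_apply]
        refine Finset.sum_eq_zero fun t _ => ?_
        have h1 : wedgeList l q (t.removeNth v) = 0 := ih ha fun s => h _
        simp [h1]

end Darboux

section Normal

variable {n : ℕ} {X : Type} [TopologicalSpace X] [ChartedSpace (E n) X]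
  [IsManifold 𝓘(ℂ, E n) ω X] {P : Poisson n X} {φ : OpenPartialHomeomorph X (E n)}
  {K J : Finset (Fin n)} {x p : X} {y : E n} {V : Opens X} {i : ℕ}

/-- The indices of the coordinates `x_i`, `i ∈ K`. -/
def xSet (K : Finset (Fin n)) : Finset (Fin (n + n)) := K.map ⟨xIdx, xIdx_injective⟩

theorem mem_xSet {k : Fin (n + n)} : k ∈ xSet K ↔ ∃ i ∈ K, xIdx i = k := Finset.mem_map

theorem xIdx_mem_xSet {i : Fin n} : xIdx i ∈ xSet K ↔ i ∈ K := by
  rw [mem_xSet]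
  exact ⟨fun ⟨j, hj, h⟩ => xIdx_injective h ▸ hj, fun h => ⟨i, h, rfl⟩⟩

theorem yIdx_notMem_xSet {i : Fin n} : yIdx i ∉ xSet K := fun h => by
  obtain ⟨j, -, h⟩ := mem_xSet.1 h
  exact xIdx_ne_yIdx j i h

theorem theta_yIdx (y : E n) (i : Fin n) : theta (xSet K) y (yIdx i) = 1 :=
  theta_of_notMem yIdx_notMem_xSet y

theorem theta_xIdx (y : E n) (i : Fin n) :
    theta (xSet K) y (xIdx i) = if i ∈ K then y (xIdx i) else 1 := by
  rw [theta]
  simp only [xIdx_mem_xSet]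

theorem IsNormal.amat_eq (h : IsNormal P φ K) (hy : y ∈ φ.target) (i j : Fin (n + n)) :
    amat P φ y i j = theta (xSet K) y i * theta (xSet K) y j * darboux n i j := by
  have h1 := h.2 _ (φ.map_target hy)
  have hc : ∀ k : Fin (n + n), coord φ k (φ.symm y) = y k := fun k => by
    rw [coord, φ.right_inv hy]
  induction i using forall_idx <;> rename_i a <;> induction j using forall_idx <;> rename_i b
  · rw [darboux_xx, mul_zero]
    exact (h1 a b).1
  · rw [darboux_xy, theta_yIdx, theta_xIdx]
    refine (h1 a b).2.2.trans ?_
    rw [hc]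
    simp
  · rw [darboux_yx, theta_yIdx, theta_xIdx, amat_swap]
    refine (congrArg Neg.neg (h1 b a).2.2).trans ?_
    rw [hc]
    by_cases hab : a = b
    · subst hab
      simp
    · simp [hab, Ne.symm hab]
  · rw [darboux_yy, mul_zero]
    exact (h1 a b).2.1

/-- In normal coordinates `Πⁿ` is a constant multiple of `∏ x_i · ∂_{x_1} ∧ ⋯`. -/
theorem IsNormal.isAdapted (h : IsNormal P φ K) : IsAdapted P φ (xSet K) := by
  refine ⟨h.1, fun _ => topPow (darboux n), mdifferentiableOn_const, fun x hx =>
    ⟨topPow_darboux_ne_zero, ?_⟩⟩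
  have e : amat P φ (φ x) = fun i j =>
      theta (xSet K) (φ x) i * theta (xSet K) (φ x) j * darboux n i j :=
    funext fun i => funext fun j => h.amat_eq (φ.map_source hx) i j
  rw [topCoeff_eq P h.1 hx, e, topPow_of_diag, prod_theta, mul_comm]
  rfl

theorem card_xSet_le (K : Finset (Fin n)) : (xSet K).card ≤ n := by
  rw [xSet, Finset.card_map]
  exact K.card_le_univ.trans_eq (Fintype.card_fin n)

/-- At a point with normal coordinates there are at most `n` branches. -/
theorem isEmpty_ordLocus (hN : IsPNormal P) (hi : n < i) : IsEmpty (OrdLocus P i) := by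
  refine ⟨fun z => ?_⟩
  obtain ⟨φ, K, hp, h⟩ := hN z.pt
  obtain ⟨J, hJ, hz⟩ := OrdLocus.exists_mem_plaque h.isAdapted z hp
  have h1 := Finset.card_le_card_of_injOn (s := Finset.univ) (t := xSet K) J (fun a _ => hJ a)
    (plaque_injective hz).injOn
  rw [Finset.card_univ, Fintype.card_fin] at h1
  exact absurd (h1.trans (card_xSet_le K)) (by omega)

/-- There are no residues in degrees above `n`, because at most `n` branches meet. -/
theorem isZero_cohSheaf (hP : IsLogSymplectic P) (hN : IsPNormal P) (hi : n < i) :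
    Limits.IsZero (cohSheaf P i) := by
  have := isEmpty_ordLocus hN hi
  obtain ⟨e, -⟩ := exists_cohSheaf_iso hP i
  have h1 : Limits.IsZero (cohSheaf P i).presheaf := by
    refine Limits.IsZero.of_iso (Functor.isZero _ fun V => ?_) e
    have : Subsingleton ((nuOrient P i).obj V) :=
      ⟨fun f g => Subtype.ext (LocallyConstant.ext fun z => (IsEmpty.false z.1).elim)⟩
    exact ModuleCat.isZero_of_subsingleton _
  exact (Limits.IsZero.iff_id_eq_zero _).2 (Sheaf.hom_ext (h1.eq_of_src _ _))

end Normal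

/-! ### Local generators in normal coordinates -/

section Generators

variable {n : ℕ} {X : Type} [TopologicalSpace X] [ChartedSpace (E n) X]
  [IsManifold 𝓘(ℂ, E n) ω X] {P : Poisson n X} {φ : OpenPartialHomeomorph X (E n)}
  {K J : Finset (Fin n)} {x p q : X} {y : E n} {V : Opens X} {i : ℕ}

/-- The expression of `normalForm` in the logarithmic frame. -/
def normalList (J : Finset (Fin n)) : List (Cov n) :=
  pairList ((List.finRange n).filter (· ∉ J)) ++
    ((List.finRange n).filter (· ∈ J)).map fun j => stdCov (xIdx j)

theorem length_filter_finRange (J : Finset (Fin n)) :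
    ((List.finRange n).filter (· ∈ J)).length = J.card := by
  rw [← List.toFinset_card_of_nodup ((List.nodup_finRange n).filter _)]
  congr 1
  ext a
  simp

theorem length_filter_finRange_notMem (J : Finset (Fin n)) :
    ((List.finRange n).filter (· ∉ J)).length = n - J.card := by
  have h := length_filter_finRange Jᶜ
  simpa [Finset.card_compl] using h

theorem homog_wedgeList_normalList (hJ : J.card = i) :
    Homog (2 * n - i) (wedgeList (normalList J)) := by
  have h := homog_wedgeList (normalList J)
  rw [normalList, List.length_append, length_pairList, List.length_map, length_filter_finRange,
    length_filter_finRange_notMem] at h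
  have h1 : J.card ≤ n := J.card_le_univ.trans_eq (Fintype.card_fin n)
  have e : (2 * n - i : ℤ) = ((2 * (n - J.card) + J.card : ℕ) : ℤ) := by omega
  rw [e]
  exact h

/-- `ι_Π^{n - i}` takes `d_I ∧ dlog(x)_J`, `|J| = i`, to a multiple of `dlog(x)_J`. -/
theorem contractM_darboux_pow_normalList (hJ : J.card = i) :
    (contractM (darboux n) ^ (n - i)) (wedgeList (normalList J)) =
      ((n - i).factorial : ℂ) •
        wedgeList (((List.finRange n).filter (· ∈ J)).map fun j => stdCov (xIdx j)) := by
  have h := (contractM_darboux_pow_pairList (n := n) (l := (List.finRange n).filter (· ∉ J))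
    ((List.nodup_finRange n).filter _)
    (t := ((List.finRange n).filter (· ∈ J)).map fun j => stdCov (xIdx j)) ?_
    (contractM_darboux_wedgeList_x _)).1
  · rwa [length_filter_finRange_notMem, hJ] at h
  · intro a ha b hb
    obtain ⟨j, hj, rfl⟩ := List.mem_map.1 hb
    have haJ : a ∉ J := by simpa using ha
    have hjJ : j ∈ J := by simpa using hj
    rw [stdCov_x_x, stdCov_x_y, if_neg (fun h : j = a => haJ (h ▸ hjJ))]
    exact ⟨rfl, rfl⟩

theorem lrep_normalForm (h : IsNormal P φ K) (hy : y ∈ φ.target)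
    (hne : ∏ j ∈ xSet K, y j ≠ 0) (J : Finset (Fin n)) :
    lrep φ (xSet K) (normalForm φ K J) y = wedgeList (normalList J) := by
  have hs := φ.map_target hy
  have hdF : ∀ k : Fin (n + n), ((dF (coord φ k) (φ.symm y)).comp (tanSymm φ y)).comp
      (diag (theta (xSet K) y)) = theta (xSet K) y k • stdCov k := fun k => by
    rw [← stdCov_comp_diag, dF_coord h.1 hs]
    congr 1
    ext1 v
    have h1 := tan_tanSymm h.1 hs v
    rw [φ.right_inv hy] at h1
    exact congrArg (stdCov k) h1
  have hY : ∀ i : Fin n, ((dF (coord φ (yIdx i)) (φ.symm y)).comp (tanSymm φ y)).comp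
      (diag (theta (xSet K) y)) = stdCov (yIdx i) := fun i => by
    rw [hdF, theta_yIdx, one_smul]
  have hX : ∀ i : Fin n, ((xCov φ K i (φ.symm y)).comp (tanSymm φ y)).comp
      (diag (theta (xSet K) y)) = stdCov (xIdx i) := fun i => by
    by_cases hi : i ∈ K
    · have h1 : y (xIdx i) ≠ 0 := Finset.prod_ne_zero_iff.1 hne _ (xIdx_mem_xSet.2 hi)
      rw [xCov, if_pos hi, ContinuousLinearMap.smul_comp, ContinuousLinearMap.smul_comp, hdF,
        theta_xIdx, if_pos hi, coord, φ.right_inv hy, smul_smul, inv_mul_cancel₀ h1, one_smul]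
    · rw [xCov, if_neg hi, hdF, theta_xIdx, if_neg hi, one_smul]
  rw [lrep, repE, normalForm, pull_wedgeList, pull_wedgeList, List.map_map, normalList, pairList,
    List.map_append, List.map_flatMap, List.map_map]
  simp only [List.map_cons, List.map_nil, Function.comp_def, hX, hY]

theorem logRep_normalForm (h : IsNormal P φ K) (hp : p ∈ φ.source) (J : Finset (Fin n)) :
    LogRep φ (xSet K) (normalForm φ K J) (φ p) fun _ => wedgeList (normalList J) := by
  filter_upwards [φ.open_target.mem_nhds (φ.map_source hp)] with y hy
  exact ⟨DAt.const _ _, fun hne => lrep_normalForm h hy hne J⟩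

theorem homog_normalForm (hJ : J.card = i) (x : X) :
    Homog (2 * n - i) (normalForm φ K J x) := by
  have h := homog_wedgeList_normalList (n := n) hJ
  have e : (normalList J).length = ((((List.finRange n).filter (· ∉ J)).flatMap fun i =>
        [xCov φ K i x, dF (coord φ (yIdx i)) x]) ++
      ((List.finRange n).filter (· ∈ J)).map fun j => xCov φ K j x).length := by
    simp [normalList, pairList, List.length_flatMap]
  have h1 := homog_wedgeList ((((List.finRange n).filter (· ∉ J)).flatMap fun i =>
        [xCov φ K i x, dF (coord φ (yIdx i)) x]) ++
      ((List.finRange n).filter (· ∈ J)).map fun j => xCov φ K j x)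
  rw [← e, normalList, List.length_append, length_pairList, List.length_map,
    length_filter_finRange, length_filter_finRange_notMem] at h1
  have h2 : J.card ≤ n := J.card_le_univ.trans_eq (Fintype.card_fin n)
  have e : (2 * n - i : ℤ) = ((2 * (n - J.card) + J.card : ℕ) : ℤ) := by omega
  rw [e]
  exact h1

theorem restr_normalForm_mem (h : IsNormal P φ K) (hV : (V : Set X) = φ.source)
    (hJ : J.card = i) : restr (V ⊓ symplLocus P) (normalForm φ K J) ∈ Theta P V i := by
  refine mem_logForms_of_logRep (homog_restr _ (homog_normalForm hJ))
    (fun x hx => restr_notMem _ hx) fun p hp => ?_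
  have hps : p ∈ φ.source := hV ▸ hp
  exact ⟨φ, xSet K, h.isAdapted, hps, _, (logRep_normalForm h hps J).restr h.isAdapted hps hp⟩

theorem logRep_piEquiv_normalForm (hP : IsLogSymplectic P) (h : IsNormal P φ K)
    (hV : (V : Set X) = φ.source) (hJ : J.card = i) (hp : p ∈ V) :
    LogRep φ (xSet K)
      (piEquiv hP V i ⟨_, restr_normalForm_mem h hV hJ⟩ : Forms n X) (φ p) fun _ =>
        ((n - i).factorial : ℂ) •
          wedgeList (((List.finRange n).filter (· ∈ J)).map fun j => stdCov (xIdx j)) := by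
  have hps : p ∈ φ.source := hV ▸ hp
  have hi : i ≤ n := hJ ▸ J.card_le_univ.trans_eq (Fintype.card_fin n)
  obtain ⟨r, hr, hball⟩ := exists_ball_subset_target hps
  rw [piEquiv_of_eq_sub hP (m := n - i) (by omega), ← contractM_darboux_pow_normalList hJ]
  exact ((logRep_normalForm h hps J).restr h.isAdapted hps hp).iota_iterate h.isAdapted hr hball
    (B := fun _ => darboux n) (fun _ _ => differentiableOn_const _)
    (fun y hy => h.amat_eq (hball hy)) (n - i)

theorem mem_cocycles_of_deRhamOn (hP : IsLogSymplectic P) {w : Theta P V i}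
    (hw : deRhamOn P V (piEquiv hP V i w) = 0) : w ∈ cocycles P V i := by
  obtain ⟨v, hv⟩ := exists_cocycle_of_closed hP _ hw
  rw [← (piEquiv hP V i).injective hv]
  exact v.2

theorem extdLog_const (S : Finset (Fin (n + n))) (v : Ext n) (y : E n) :
    extdLog S (fun _ => v) y = 0 := by
  rw [extdLog]
  simp only [pd_const, map_zero, smul_zero, Finset.sum_const_zero]

theorem restr_normalForm_mem_cocycles (hP : IsLogSymplectic P) (h : IsNormal P φ K)
    (hV : (V : Set X) = φ.source) (hJ : J.card = i) :
    (⟨_, restr_normalForm_mem h hV hJ⟩ : Theta P V i) ∈ cocycles P V i := by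
  refine mem_cocycles_of_deRhamOn hP ?_
  funext x
  by_cases hx : x ∈ V ⊓ symplLocus P
  · have hxs : x ∈ φ.source := hV ▸ hx.1
    have hne := (h.isAdapted.mem_symplLocus_iff P hxs).1 hx.2
    have h1 := (logRep_piEquiv_normalForm hP h hV hJ hx.1).deRhamOn h.isAdapted hxs hx.1
    refine eq_of_lrep_eq (w' := 0) h.isAdapted hxs hx.2 ?_
    rw [h1.self_of_nhds.2 hne, extdLog_const]
    exact (LogRep.zero.self_of_nhds.2 hne).symm
  · exact restr_notMem _ hx

/-- The residue at a point of `OrdLocus`, as a linear form on cocycles. -/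
def residAt (hP : IsLogSymplectic P) (z : OrdLocus P i) (hz : z.pt ∈ V) :
    cocycles P V i →ₗ[ℂ] ℂ where
  toFun w := (residMap hP V i w).1 ⟨z, hz⟩
  map_add' w w' := by rw [map_add]; rfl
  map_smul' c w := by rw [map_smul]; rfl

/-- The cocycle `d_I ∧ dlog(x)_J`. -/
def normalCocycle (hP : IsLogSymplectic P) (h : IsNormal P φ K)
    (hV : (V : Set X) = φ.source) (hJ : J.card = i) : cocycles P V i :=
  ⟨_, restr_normalForm_mem_cocycles hP h hV hJ⟩

/-- The residues of `d_I ∧ dlog(x)_J` are a multiple of the coefficients of `dlog(x)_J`. -/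
theorem residAt_normalCocycle (hP : IsLogSymplectic P) (h : IsNormal P φ K)
    (hV : (V : Set X) = φ.source) (hJ : J.card = i) {z : OrdLocus P i} (hz : z.pt ∈ V)
    {I : Fin i → Fin n} (hI : ∀ a, I a ∈ K) (hzI : z ∈ plaque P φ fun a => xIdx (I a)) :
    residAt hP z hz (normalCocycle hP h hV hJ) = ((n - i).factorial : ℂ) *
      wedgeList (((List.finRange n).filter (· ∈ J)).map fun j => stdCov (xIdx j)) i
        fun a => stdVec (xIdx (I a)) :=
  (logRep_piEquiv_normalForm hP h hV hJ hz).resid_eq h.isAdapted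
    (fun a => xIdx_mem_xSet.2 (hI a)) hzI rfl

theorem residAt_normalCocycle_eq_zero (hP : IsLogSymplectic P) (h : IsNormal P φ K)
    (hV : (V : Set X) = φ.source) (hJ : J.card = i) {z : OrdLocus P i} (hz : z.pt ∈ V)
    {I : Fin i → Fin n} (hI : ∀ a, I a ∈ K) (hzI : z ∈ plaque P φ fun a => xIdx (I a))
    {j : Fin n} (hj : j ∈ J) (hjI : ∀ a, I a ≠ j) :
    residAt hP z hz (normalCocycle hP h hV hJ) = 0 := by
  rw [residAt_normalCocycle hP h hV hJ hz hI hzI, wedgeList_apply_eq_zero (a := stdCov (xIdx j)),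
    mul_zero]
  · exact List.mem_map.2 ⟨j, by simpa using hj, rfl⟩
  · intro a
    rw [stdCov_x_x, if_neg (hjI a).symm]

theorem exists_plaque_xIdx (h : IsNormal P φ K) (z : OrdLocus P i) (hz : z.pt ∈ φ.source) :
    ∃ I : Fin i → Fin n, (∀ a, I a ∈ K) ∧ z ∈ plaque P φ fun a => xIdx (I a) := by
  obtain ⟨J, hJ, hzJ⟩ := OrdLocus.exists_mem_plaque h.isAdapted z hz
  choose I hI hIJ using fun a => mem_xSet.1 (hJ a)
  exact ⟨I, hI, by rwa [show (fun a => xIdx (I a)) = J from funext hIJ]⟩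

theorem cohGerm_eq_zero_iff_residAt (hP : IsLogSymplectic P) (hp : p ∈ V) (w : cocycles P V i) :
    cohGerm P V p hp i w = 0 ↔ ∀ (z : OrdLocus P i) (hz : z.pt ∈ V), z.pt = p →
      residAt hP z hz w = 0 := by
  rw [cohGerm_eq_zero_iff hP hp]
  exact ⟨fun h z _ hzp => h z hzp, fun h z hzp => h z (by rw [hzp]; exact hp) hzp⟩

theorem cohGerm_normalCocycle_eq_zero (hP : IsLogSymplectic P) (h : IsNormal P φ K)
    (hV : (V : Set X) = φ.source) (hJ : J.card = i) (hq : q ∈ V)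
    (hJq : ∃ j ∈ J, coord φ (xIdx j) q ≠ 0) :
    cohGerm P V q hq i (normalCocycle hP h hV hJ) = 0 := by
  rw [cohGerm_eq_zero_iff_residAt hP]
  rintro z hz rfl
  obtain ⟨I, hI, hzI⟩ := exists_plaque_xIdx h z (hV ▸ hz : z.pt ∈ (φ.source : Set X))
  obtain ⟨j, hj, hjq⟩ := hJq
  refine residAt_normalCocycle_eq_zero hP h hV hJ hz hI hzI hj fun a ha => hjq ?_
  rw [← ha]
  exact (hzI.2 a).1

/-- The ordered tuple of the branches `x_j = 0`, `j ∈ J`, with nonzero residue of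
`d_I ∧ dlog(x)_J`. -/
theorem exists_dual_ordLocus (hP : IsLogSymplectic P) (h : IsNormal P φ K)
    (hV : (V : Set X) = φ.source) (hJ : J.card = i) (hJK : J ⊆ K) (hq : q ∈ V)
    (hJq : ∀ j ∈ J, coord φ (xIdx j) q = 0) :
    ∃ (z : OrdLocus P i) (hz : z.pt ∈ V) (I : Fin i → Fin n), z.pt = q ∧
      z ∈ plaque P φ (fun a => xIdx (I a)) ∧ Function.Injective I ∧ (∀ a, I a ∈ J) ∧
        residAt hP z hz (normalCocycle hP h hV hJ) ≠ 0 := by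
  set l := (List.finRange n).filter (· ∈ J) with hl
  have hlen : l.length = i := (length_filter_finRange J).trans hJ
  have hnd : l.Nodup := (List.nodup_finRange n).filter _
  have hqs : q ∈ φ.source := hV ▸ hq
  have hmem : ∀ a ∈ l, a ∈ J := fun a ha => by simpa [hl] using ha
  obtain ⟨I, hinj, hIJ, hI1⟩ : ∃ I : Fin i → Fin n, Function.Injective I ∧ (∀ a, I a ∈ J) ∧
      wedgeList (l.map fun j => stdCov (xIdx j)) i (fun a => stdVec (xIdx (I a))) = 1 := by
    clear_value l
    subst hlen
    exact ⟨l.get, List.nodup_iff_injective_get.1 hnd, fun a => hmem _ (l.get_mem a),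
      wedgeList_apply_dual (fun j => stdCov (xIdx j)) (fun j => stdVec (xIdx j)) stdCov_x_x l hnd⟩
  obtain ⟨z, hzq, hzI⟩ := exists_ordLocus h.isAdapted hqs (J := fun a => xIdx (I a))
    (fun a b hab => hinj (xIdx_injective hab))
    fun a => ⟨xIdx_mem_xSet.2 (hJK (hIJ a)), hJq _ (hIJ a)⟩
  have hz : z.pt ∈ V := by rwa [hzq]
  refine ⟨z, hz, I, hzq, hzI, hinj, hIJ, ?_⟩
  rw [residAt_normalCocycle hP h hV hJ hz (fun a => hJK (hIJ a)) hzI, hI1, mul_one]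
  exact Nat.cast_ne_zero.2 (Nat.factorial_ne_zero _)

theorem residAt_res (hP : IsLogSymplectic P) {V' : Opens X} (h : V' ≤ V) (z : OrdLocus P i)
    (hz : z.pt ∈ V') (w : cocycles P V i) :
    residAt hP z hz (resCocycles P h i w) = residAt hP z (h hz) w :=
  residMap_res hP h w z hz

theorem residAt_perm (hP : IsLogSymplectic P) (z : OrdLocus P i) (hz : z.pt ∈ V)
    (w : cocycles P V i) (s : Equiv.Perm (Fin i)) :
    residAt hP (OrdLocus.perm P s z) hz w = ((Equiv.Perm.sign s : ℤ) : ℂ) * residAt hP z hz w :=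
  (residMap hP V i w).2 s z hz

theorem exists_mem_notMem_of_card_eq {J J' : Finset (Fin n)} (hJ : J.card = i)
    (hJ' : J'.card = i) (h : J ≠ J') : ∃ j ∈ J, j ∉ J' := by
  by_contra! hcon
  exact h (Finset.eq_of_subset_of_card_le hcon (by rw [hJ, hJ']))

/-- The residues along the sets of branches `x_j = 0`, `j ∈ J`, separate the classes. -/
theorem linearIndependent_cohGerm (hP : IsLogSymplectic P) (h : IsNormal P φ K)
    (hV : (V : Set X) = φ.source) (hq : q ∈ V) :
    LinearIndependent ℂ (fun J : {J : {J : Finset (Fin n) // J ⊆ K ∧ J.card = i} //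
      ∀ j ∈ J.1, coord φ (xIdx j) q = 0} =>
        cohGerm P V q hq i (normalCocycle hP h hV J.1.2.2)) := by
  rw [linearIndependent_iff']
  intro s c hc J₀ hJ₀
  obtain ⟨z, hz, I, hzq, hzI, -, hI, hne⟩ :=
    exists_dual_ordLocus hP h hV J₀.1.2.2 J₀.1.2.1 hq J₀.2
  have h1 : cohGermLin P V hq i (∑ J ∈ s, c J • normalCocycle hP h hV J.1.2.2) = 0 := by
    rw [map_sum, ← hc]
    exact Finset.sum_congr rfl fun J _ => map_smul _ _ _
  have h2 := (cohGerm_eq_zero_iff_residAt hP hq _).1 h1 z hz hzq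
  rw [map_sum, Finset.sum_eq_single J₀] at h2
  · rw [map_smul, smul_eq_mul] at h2
    exact (mul_eq_zero.1 h2).resolve_right hne
  · intro J _ hJ
    obtain ⟨j, hj, hj'⟩ := exists_mem_notMem_of_card_eq J.1.2.2 J₀.1.2.2 fun h =>
      hJ (Subtype.ext (Subtype.ext h))
    rw [map_smul, residAt_normalCocycle_eq_zero hP h hV J.1.2.2 hz
      (fun a => J₀.1.2.1 (hI a)) hzI hj fun a ha => hj' (ha ▸ hI a), smul_zero]
  · exact fun h => absurd hJ₀ h

/-- Subtraction of a combination of the classes `d_I ∧ dlog(x)_J` kills all residues of a germ. -/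
theorem span_cohGerm_eq_top (hP : IsLogSymplectic P) (h : IsNormal P φ K)
    (hV : (V : Set X) = φ.source) (hq : q ∈ V) :
    Submodule.span ℂ (Set.range fun J : {J : Finset (Fin n) // J ⊆ K ∧ J.card = i} =>
      cohGerm P V q hq i (normalCocycle hP h hV J.2.2)) = ⊤ := by
  classical
  rw [eq_top_iff]
  rintro t -
  obtain ⟨V', hV', hq', w, rfl⟩ := exists_cohGerm_eq hP hq t
  have hc : ∀ J : {J : Finset (Fin n) // J ⊆ K ∧ J.card = i}, ∃ c : ℂ,
      (∀ j ∈ J.1, coord φ (xIdx j) q = 0) →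
        ∃ (z : OrdLocus P i) (hz : z.pt ∈ V') (I : Fin i → Fin n), z.pt = q ∧
          z ∈ plaque P φ (fun a => xIdx (I a)) ∧ Function.Injective I ∧ (∀ a, I a ∈ J.1) ∧
            residAt hP z hz w = c * residAt hP z (hV' hz) (normalCocycle hP h hV J.2.2) := by
    intro J
    by_cases hJq : ∀ j ∈ J.1, coord φ (xIdx j) q = 0
    · obtain ⟨z, hz, I, hzq, hzI, hinj, hI, hne⟩ :=
        exists_dual_ordLocus hP h hV J.2.2 J.2.1 hq hJq
      have hz' : z.pt ∈ V' := by rwa [hzq]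
      exact ⟨residAt hP z hz' w / residAt hP z hz (normalCocycle hP h hV J.2.2), fun _ =>
        ⟨z, hz', I, hzq, hzI, hinj, hI, (div_mul_cancel₀ _ hne).symm⟩⟩
    · exact ⟨0, fun h => absurd h hJq⟩
  choose c hc using hc
  set D : cocycles P V' i := w - ∑ J, c J • resCocycles P hV' i (normalCocycle hP h hV J.2.2)
    with hD
  have hD0 : cohGerm P V' q hq' i D = 0 := by
    rw [cohGerm_eq_zero_iff_residAt hP]
    rintro z hz rfl
    obtain ⟨I, hI, hzI⟩ :=
      exists_plaque_xIdx h z (hV ▸ hV' hz : z.pt ∈ (φ.source : Set X))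
    have hIinj : Function.Injective I := fun a b hab =>
      plaque_injective hzI (congrArg xIdx hab)
    let J : {J : Finset (Fin n) // J ⊆ K ∧ J.card = i} := ⟨Finset.univ.image I, by
      intro j hj
      obtain ⟨a, -, rfl⟩ := Finset.mem_image.1 hj
      exact hI a, by rw [Finset.card_image_of_injective _ hIinj, Finset.card_univ,
        Fintype.card_fin]⟩
    have hJz : ∀ j ∈ J.1, coord φ (xIdx j) z.pt = 0 := by
      intro j hj
      obtain ⟨a, -, rfl⟩ := Finset.mem_image.1 hj
      exact (hzI.2 a).1
    obtain ⟨z', hz', I', hzz', hzI', hinj', hI', hres⟩ := hc J hJz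
    choose s hs using fun a => Finset.mem_image.1 (hI' a)
    have hsinj : Function.Injective s := fun a b hab => hinj' (by
      rw [← (hs a).2, ← (hs b).2, hab])
    let σ : Equiv.Perm (Fin i) := Equiv.ofBijective s (Finite.injective_iff_bijective.1 hsinj)
    have hσ : (fun a => xIdx (I' a)) = (fun a => xIdx (I a)) ∘ σ := funext fun a =>
      congrArg xIdx (hs a).2.symm
    have e : z' = OrdLocus.perm P σ z := by
      refine plaque_ext hzI' ?_ hzz'
      rw [hσ]
      exact perm_mem_plaque hzI σ
    have h0 : residAt hP z' hz' D = 0 := by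
      rw [hD, map_sub, map_sum, Finset.sum_eq_single J]
      · rw [map_smul, residAt_res, hres, smul_eq_mul, sub_self]
      · intro J' _ hJ'
        obtain ⟨j, hj, hj'⟩ := exists_mem_notMem_of_card_eq J'.2.2 J.2.2 fun h =>
          hJ' (Subtype.ext h)
        rw [map_smul, residAt_res, residAt_normalCocycle_eq_zero hP h hV J'.2.2 (hV' hz')
          (fun a => J.2.1 (hI' a)) hzI' hj fun a ha => hj' (ha ▸ hI' a), smul_zero]
      · exact fun h => absurd (Finset.mem_univ J) h
    subst e
    have h1 := (residAt_perm hP z hz D σ).symm.trans h0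
    exact (mul_eq_zero.1 h1).resolve_left (by simp)
  have h2 : cohGermLin P V' hq' i D = 0 := hD0
  rw [hD, map_sub, map_sum, sub_eq_zero] at h2
  rw [← cohGermLin_apply hq' w, h2]
  refine Submodule.sum_mem _ fun J _ => ?_
  rw [map_smul, cohGermLin_apply, cohGerm_res hV' hq']
  exact Submodule.smul_mem _ _ (Submodule.subset_span ⟨J, rfl⟩)

end Generators

end LogSymp

end

theorem mainTheorem7 {n : ℕ} {X : Type} [TopologicalSpace X] [T2Space X] [ChartedSpace (E n) X]
    [IsManifold 𝓘(ℂ, E n) ω X] (P : Poisson n X) (hP : IsLogSymplectic P) :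
    -- `Θ^•(log D)` and `Ω^•(log D)` are complexes
    (∀ (V : Opens X) (j : ℤ), ∀ w ∈ Theta P V j,
      mdpOn P V j w ∈ Theta P V (j + 1) ∧ mdpOn P V (j + 1) (mdpOn P V j w) = 0) ∧
    (∀ (V : Opens X) (j : ℤ), ∀ w ∈ logForms P V j,
      deRhamOn P V w ∈ logForms P V (j + 1) ∧ deRhamOn P V (deRhamOn P V w) = 0) ∧
    -- the isomorphism of complexes of sheaves given by `ι_{Π^m}` and its inverse
    (∃ π : ∀ (V : Opens X) (j : ℤ), Theta P V j ≃ₗ[ℂ] logForms P V j,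
      (∀ (V : Opens X) (j : ℤ) (m : ℕ) (w : Theta P V j),
        (j = n - m → (π V j w : Forms n X) = (iota P)^[m] (w : Forms n X)) ∧
        (j = n + m → (iota P)^[m] (π V j w : Forms n X) = (w : Forms n X))) ∧
      (∀ (V V' : Opens X) (h : V' ≤ V) (j : ℤ) (w : Theta P V j),
        π V' j (resLog P h _ w) = resLog P h _ (π V j w)) ∧
      (∀ (V : Opens X) (j : ℤ) (w : Theta P V j) (w' : Theta P V (j + 1)),
        (w' : Forms n X) = mdpOn P V j w →
          (π V (j + 1) w' : Forms n X) = deRhamOn P V (π V j w))) ∧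
    -- the cohomology sheaves
    (∀ i : ℕ, Nonempty ((cohSheaf P i).presheaf ≅ nuOrient P i)) ∧
    (IsSimpleNC P → ∀ i : ℕ, Nonempty ((cohSheaf P i).presheaf ≅ nuConst P i)) ∧
    (IsPNormal P → ∀ i : ℕ, n < i → Limits.IsZero (cohSheaf P i)) ∧
    -- local generators at the points of a system of normal coordinates
    (∀ (φ : OpenPartialHomeomorph X (E n)) (K : Finset (Fin n)), IsNormal P φ K →
      ∀ (V : Opens X), (V : Set X) = φ.source → ∀ i : ℕ,
      ∃ g : {J : Finset (Fin n) // J ⊆ K ∧ J.card = i} → cocycles P V i,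
        (∀ J, ((g J : Theta P V i) : Forms n X)
          = restr (V ⊓ symplLocus P) (normalForm φ K J.1)) ∧
        ∀ (q : X) (hq : q ∈ V),
          (∀ J, (∃ j ∈ J.1, coord φ (xIdx j) q ≠ 0) → cohGerm P V q hq i (g J) = 0) ∧
          LinearIndependent ℂ
            (fun J : {J : {J : Finset (Fin n) // J ⊆ K ∧ J.card = i} //
              ∀ j ∈ J.1, coord φ (xIdx j) q = 0} => cohGerm P V q hq i (g J.1)) ∧
          Submodule.span ℂ (Set.range fun J => cohGerm P V q hq i (g J)) = ⊤) := by
  refine ⟨fun V j w hw => ⟨mdpOn_mem hP hw, mdpOn_mdpOn hP hw⟩,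
    fun V j w hw => ⟨deRhamOn_mem hP hw, deRhamOn_deRhamOn hw⟩,
    ⟨piEquiv hP, fun V j m w => ⟨fun hj => piEquiv_of_eq_sub hP hj w,
      fun hj => iota_iterate_piEquiv hP hj w⟩, fun V V' h j w => piEquiv_res hP h j w,
      fun V j w w' h => piEquiv_mdpOn hP w w' h⟩,
    fun i => ?_, fun hD i => ?_, fun hN i hi => isZero_cohSheaf hP hN hi,
    fun φ K h V hV i => ⟨fun J => normalCocycle hP h hV J.2.2, fun J => rfl,
      fun q hq => ⟨fun J hJ => cohGerm_normalCocycle_eq_zero hP h hV J.2.2 hq hJ,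
        linearIndependent_cohGerm hP h hV hq, span_cohGerm_eq_top hP h hV hq⟩⟩⟩
  · obtain ⟨e, -⟩ := exists_cohSheaf_iso hP i
    exact ⟨e⟩
  · obtain ⟨e, -⟩ := exists_cohSheaf_iso hP i
    obtain ⟨e'⟩ := nonempty_iso_nuConst hP hD i
    exact ⟨e ≪≫ e'⟩
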